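/- Let $\alpha,\beta>-1$. Let $P_n^{\alpha,\beta}$ be the classical Jacobi polynomials, let $$\phi_n^{\alpha,\beta}(\theta)=c_n^{\alpha,\beta}\,\Big|\sin\frac\theta2\Big|^{\alpha+1/2}\Big(\cos\frac\theta2\Big)^{\beta+1/2}P_n^{\alpha,\beta}(\cos\theta),\qquad \theta\in(-\pi,\pi),\ n\ge 0,$$ with $c_n^{\alpha,\beta}>0$ chosen so that $\|\phi_n^{\alpha,\beta}\|_{L^2(0,\pi)}=1$, and put $\lambda_n^{\alpha,\beta}=\big(n+\frac{\alpha+\beta+1}2\big)^2$ and $$D_{\alpha,\beta}f=\frac{df}{d\theta}-\frac{2\alpha+1}4\cot\frac\theta2\, f+\frac{2\beta+1}4\tan\frac\theta2\, f .$$ The symmetrized Jacobi functions $$\Phi_{2n}^{\alpha,\beta}=\tfrac1{\sqrt2}\,\phi_n^{\alpha,\beta}\ (n\ge 0),\qquad \Phi_{2n-1}^{\alpha,\beta}=-\tfrac1{\sqrt2}\big(\lambda_n^{\alpha,\beta}-\lambda_0^{\alpha,\beta}\big)^{-1/2}D_{\alpha,\beta}\phi_n^{\alpha,\beta}\ (n\ge1)$$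 form an orthonormal basis of $L^2(-\pi,\pi)$ (Lebesgue measure, complex-valued functions). Let $\mathbb L_{\alpha,\beta}$ be the self-adjoint operator in $L^2(-\pi,\pi)$ with $\mathbb L_{\alpha,\beta}\Phi_n^{\alpha,\beta}=\lambda^{\alpha,\beta}_{\lfloor (n+1)/2\rfloor}\Phi_n^{\alpha,\beta}$. For $\sigma>0$ define on $L^2(-\pi,\pi)$ the Riesz potential (if $\alpha+\beta\neq-1$) and the Bessel potential $$\mathbb L_{\alpha,\beta}^{-\sigma}f=\sum_{n\ge0}\big(\lambda^{\alpha,\beta}_{\lfloor (n+1)/2\rfloor}\big)^{-\sigma}\langle f,\Phi_n^{\alpha,\beta}\rangle\Phi_n^{\alpha,\beta},\qquad (I+\mathbb L_{\alpha,\beta})^{-\sigma}f=\sum_{n\ge0}\big(1+\lambda^{\alpha,\beta}_{\lfloor (n+1)/2\rfloor}\big)^{-\sigma}\langle f,\Phi_n^{\alpha,\beta}\rangle\Phi_n^{\alpha,\beta},$$ with convergence in $L^2(-\pi,\pi)$. Put $p(\alpha,\beta)=\infty$ if $\alpha,\beta\ge-1/2$ and $p(\alpha,\beta)=-1/\min(\alpha+\frac12,\beta+\frac12)$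 otherwise, and let $p'(\alpha,\beta)$ be the conjugate exponent, $\frac1{p(\alpha,\beta)}+\frac1{p'(\alpha,\beta)}=1$. An operator $S$ on $L^2(-\pi,\pi)$ is said to extend to a bounded operator from $L^p(-\pi,\pi)$ to $L^q(-\pi,\pi)$ if some bounded linear operator from $L^p(-\pi,\pi)$ to $L^q(-\pi,\pi)$ coincides with $S$ on $L^p\cap L^2(-\pi,\pi)$. **Proposition.** Let $\alpha,\beta>-1$, $\sigma>0$ and $p'(\alpha,\beta)<p\le\infty$. Let $S$ be $(I+\mathbb L_{\alpha,\beta})^{-\sigma}$ or, provided that $\alpha+\beta\ne-1$, $\mathbb L_{\alpha,\beta}^{-\sigma}$. 1. If $1\le q<p(\alpha,\beta)$, then $S$ extends to a bounded operator from $L^p(-\pi,\pi)$ to $L^q(-\pi,\pi)$ if and only if $$\frac1q\ge\frac1p-2\sigma .$$ 2. $S$ extends to a bounded operator from $L^p(-\pi,\pi)$ to $L^\infty(-\pi,\pi)$ if and only if $$\alpha,\beta\ge-\tfrac12\qquad\text{and}\qquad\frac1p<2\sigma .$$ -/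

import Mathlib

open MeasureTheory Filter Topology Set
open scoped ENNReal ComplexConjugate

namespace SymmJacobi

noncomputable section

/-- The Jacobi polynomial `P_n^{α,β}` in Szegő's normalization,
`P_n^{α,β}(x) = ∑_{k=0}^n C(n+α, n-k) C(n+β, k) ((x-1)/2)^k ((x+1)/2)^{n-k}`,
with generalized binomial coefficients. -/
def jacobiP (α β : ℝ) (n : ℕ) (x : ℝ) : ℝ :=
  ∑ k ∈ Finset.range (n + 1),
    Ring.choose ((n : ℝ) + α) (n - k) * Ring.choose ((n : ℝ) + β) k *
      ((x - 1) / 2) ^ k * ((x + 1) / 2) ^ (n - k)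

/-- The weight `Ψ^{α,β}(θ) = |sin (θ/2)|^{α+1/2} (cos (θ/2))^{β+1/2}`. -/
def psi (α β : ℝ) (θ : ℝ) : ℝ :=
  |Real.sin (θ / 2)| ^ (α + 1 / 2) * (Real.cos (θ / 2)) ^ (β + 1 / 2)

/-- The positive constant `c_n^{α,β}` normalizing the Jacobi function in `L²(0,π)`. -/
def normConst (α β : ℝ) (n : ℕ) : ℝ :=
  (Real.sqrt (∫ θ in Ioo 0 Real.pi, (psi α β θ * jacobiP α β n (Real.cos θ)) ^ 2))⁻¹

/-- The Jacobi function `φ_n^{α,β}`, extended evenly to `(-π,π)`. -/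
def phi (α β : ℝ) (n : ℕ) (θ : ℝ) : ℝ :=
  normConst α β n * psi α β θ * jacobiP α β n (Real.cos θ)

/-- The eigenvalue `λ_n^{α,β} = (n + (α+β+1)/2)²`. -/
def eigenvalue (α β : ℝ) (n : ℕ) : ℝ := ((n : ℝ) + (α + β + 1) / 2) ^ 2

/-- The first-order operator
`D_{α,β} f = f' - (2α+1)/4 cot(θ/2) f + (2β+1)/4 tan(θ/2) f`. -/
def jacobiD (α β : ℝ) (f : ℝ → ℝ) (θ : ℝ) : ℝ :=
  deriv f θ - (2 * α + 1) / 4 * Real.cot (θ / 2) * f θ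
    + (2 * β + 1) / 4 * Real.tan (θ / 2) * f θ

/-- The symmetrized Jacobi system: `Φ_n = φ_{n/2} / √2` for even `n` and
`Φ_n = -(λ_{(n+1)/2} - λ_0)^{-1/2} D φ_{(n+1)/2} / √2` for odd `n`. -/
def Phi (α β : ℝ) (n : ℕ) (θ : ℝ) : ℝ :=
  (Real.sqrt 2)⁻¹ *
    if Even n then phi α β (n / 2) θ
    else -(eigenvalue α β ((n + 1) / 2) - eigenvalue α β 0) ^ (-(1 / 2) : ℝ) *
      jacobiD α β (phi α β ((n + 1) / 2)) θ

/-- Lebesgue measure on `(-π,π)`. -/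
def mu : Measure ℝ := volume.restrict (Ioo (-Real.pi) Real.pi)

/-- The coefficient `⟨f, Φ_n⟩ = ∫_{-π}^{π} f(θ) conj(Φ_n(θ)) dθ`. -/
def coeff (α β : ℝ) (f : ℝ → ℂ) (n : ℕ) : ℂ :=
  ∫ θ, f θ * conj ((Phi α β n θ : ℝ) : ℂ) ∂mu

/-- The eigenvalue `λ_{⟨n⟩}`, `⟨n⟩ = ⌊(n+1)/2⌋`, of the symmetrized Jacobi operator `𝕃_{α,β}`
at `Φ_n`. -/
def symEigenvalue (α β : ℝ) (n : ℕ) : ℝ := eigenvalue α β ((n + 1) / 2)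

/-- `g = m(𝕃) f` in the sense of the spectral decomposition of `𝕃 = 𝕃_{α,β}`: `g ∈ L²(-π,π)` and
`g = ∑_n m(λ_{⟨n⟩}) ⟨f, Φ_n⟩ Φ_n`, the series converging in `L²(-π,π)`. -/
def IsSpectralImage (α β : ℝ) (m : ℝ → ℝ) (f g : ℝ → ℂ) : Prop :=
  MemLp g 2 mu ∧
    Tendsto (fun N : ℕ => eLpNorm (fun θ => g θ - ∑ n ∈ Finset.range N,
      (m (symEigenvalue α β n) : ℂ) * coeff α β f n * (Phi α β n θ : ℂ)) 2 mu)
      atTop (𝓝 0)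

/-- The operator `m(𝕃_{α,β})`, defined initially on `L²(-π,π)`, extends to a bounded operator from
`L^p(-π,π)` to `L^q(-π,π)`: there is a bounded linear operator from `L^p` to `L^q` that agrees with
`m(𝕃_{α,β})` on `L^p ∩ L²`. -/
def ExtendsBounded (α β : ℝ) (m : ℝ → ℝ) (p q : ℝ≥0∞) : Prop :=
  ∃ T : Lp ℂ p mu →ₗ[ℂ] Lp ℂ q mu,
    (∃ C : ℝ, ∀ f : Lp ℂ p mu, ‖T f‖ ≤ C * ‖f‖) ∧
    ∀ f : Lp ℂ p mu, MemLp f 2 mu → IsSpectralImage α β m f (T f)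

/-- The multiplier of the Riesz potential `𝕃^{-σ}`. -/
def rieszSymbol (σ : ℝ) (t : ℝ) : ℝ := t ^ (-σ)

/-- The multiplier of the Bessel potential `(I + 𝕃)^{-σ}`. -/
def besselSymbol (σ : ℝ) (t : ℝ) : ℝ := (1 + t) ^ (-σ)

open Classical in
/-- The critical exponent `p(α,β)`: it is `∞` if `α, β ≥ -1/2`, and
`-1 / min(α+1/2, β+1/2)` otherwise. -/
def critExp (α β : ℝ) : ℝ≥0∞ :=
  if -(1 / 2) ≤ α ∧ -(1 / 2) ≤ β then ∞
  else ENNReal.ofReal (-1 / min (α + 1 / 2) (β + 1 / 2))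

end

end SymmJacobi

namespace SymmJacobi
noncomputable section

/-! ### Power series with coefficient ratio tending to one -/

/-! Both potentials are `(c + 𝕃)^{-σ}`, with `c = 0` (Riesz) or `c = 1` (Bessel), and both are
treated under the sole condition `0 < c + λ_0`. On even functions `𝕃` acts as the Jacobi operator
with parameters `(α, β)` on `(0,π)`. On odd functions it acts as the one with `(α+1, β+1)`, because
`D_{α,β}` annihilates the weight `psi`, so that the odd basis functions are `psi (α+1) (β+1)` times
derivatives of Jacobi polynomials in `x = sin² (θ/2)`. Hence `(c + 𝕃)^{-σ}` is given by two positive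
symmetric kernels on `(0,π)` (`potOp`). Since the `Φ_n` form a Hilbert basis, being the spectral
image amounts to an identity between coefficients, and that identity follows from the action of the
kernels on eigenfunctions.

For `0 < σ < 1` the kernel is an integral of resolvent kernels over the spectral parameter
(Balakrishnan's formula). A resolvent kernel is an explicit Green function: a hypergeometric series
regular at `0`, times one regular at `π`, divided by their Wronskian. All series have positive
coefficients, and this replaces asymptotic analysis. Two facts bound the Green function from above:
its total mass against `psi²` is `1/m` while it decreases away from the diagonal
(`green_mul_integral_le`), and its slope is controlled by the Wronskian (`exists_green_sub_le`).
Integration over the parameter yields the majorant `majKer a δ` in `exists_potKer_le`. There `a =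
sing α β` is the order of the worst end-point singularity of the weight, so that the critical
exponent is `1/a`, and `δ ≤ 2σ`, `δ < 1 - 2a`.

Sufficiency. Write `u = 1/p`, `v = 1/q`, `δ = u - v`. For `a < v < u < 1 - a` the majorant maps
`L^{1/u}` to `L^{1/v}`: it splits into a Riesz kernel (`hls`), Hardy kernels at the end points
(`kerBound_hardy`) and a product kernel (`kerBound_corner`). Larger `σ` come from composition, and
the remaining pairs of exponents from inclusions between Lebesgue spaces. For `q = ∞` and `a = 0`
Hölder's inequality suffices.

Necessity. The potential of the indicator of a `δ`-neighbourhood of `π/2` is at least a multiple of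
`δ^{2σ}` there (`exists_le_integral_potKer_midSet`), and scaling in `δ` forces `1/p - 2σ ≤ 1/q`. At
the end point `q = ∞`, `1/p = 2σ`, a truncated dyadic version of `|θ - π/2|^{-2σ}` shows
unboundedness. If `α` or `β` is below `-1/2`, the potential of a bump dominates a multiple of `psi`,
which is unbounded. -/

theorem summable_mul_pow_of_ratio {c : ℕ → ℝ} (hc : ∀ k, 0 < c k)
    (h : Tendsto (fun k => c (k + 1) / c k) atTop (𝓝 1)) {x : ℝ} (hx : |x| < 1) :
    Summable (fun k => c k * x ^ k) := by
  by_cases hx0 : x = 0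
  · subst hx0
    refine summable_of_ne_finset_zero (s := {0}) fun k hk => ?_
    have : k ≠ 0 := by simpa using hk
    simp [this]
  refine summable_of_ratio_test_tendsto_lt_one (l := |x|) hx
    (Eventually.of_forall fun k => mul_ne_zero (hc k).ne' (pow_ne_zero _ hx0)) ?_
  have h1 : Tendsto (fun k => c (k + 1) / c k * |x|) atTop (𝓝 (1 * |x|)) := h.mul_const _
  rw [one_mul] at h1
  refine h1.congr fun k => ?_
  have := (hc k).ne'
  have h2 : |x| ≠ 0 := abs_ne_zero.mpr hx0
  simp only [Real.norm_eq_abs, abs_mul, abs_pow, abs_of_pos (hc _)]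
  field_simp
  ring

/-- Differentiation preserves positivity of the coefficients and the limit of their ratios, so the
next lemma can be applied to a series and then again to its derivatives. -/
theorem tendsto_ratio_succ {c : ℕ → ℝ} (hc : ∀ k, 0 < c k)
    (h : Tendsto (fun k => c (k + 1) / c k) atTop (𝓝 1)) :
    Tendsto (fun k : ℕ => (((k + 1 : ℕ) : ℝ) + 1) * c (k + 1 + 1) / (((k : ℝ) + 1) * c (k + 1)))
      atTop (𝓝 1) := by
  have h1 := h.comp (tendsto_add_atTop_nat 1)
  have h2 : Tendsto (fun k : ℕ => 1 + 1 / ((k : ℝ) + 1)) atTop (𝓝 (1 + 0)) :=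
    tendsto_const_nhds.add tendsto_one_div_add_atTop_nhds_zero_nat
  have h3 := h2.mul h1
  simp only [add_zero, one_mul] at h3
  refine h3.congr fun k => ?_
  have := (hc (k + 1)).ne'
  have h2 : (k : ℝ) + 1 ≠ 0 := by positivity
  simp only [Function.comp]
  push_cast
  field_simp

theorem hasDerivAt_tsum_mul_pow {c : ℕ → ℝ} (hc : ∀ k, 0 < c k)
    (h : Tendsto (fun k => c (k + 1) / c k) atTop (𝓝 1)) {x : ℝ} (hx : |x| < 1) :
    HasDerivAt (fun x => ∑' k, c k * x ^ k) (∑' k : ℕ, ((k : ℝ) + 1) * c (k + 1) * x ^ k) x := by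
  obtain ⟨r, hxr, hr1⟩ := exists_between hx
  have hr0 : 0 ≤ r := (abs_nonneg x).trans hxr.le
  have hs : Summable (fun k : ℕ => ((k : ℝ) + 1) * c (k + 1) * r ^ k) :=
    summable_mul_pow_of_ratio (c := fun k : ℕ => ((k : ℝ) + 1) * c (k + 1))
      (fun k => mul_pos (by positivity) (hc _)) (tendsto_ratio_succ hc h)
      (by rwa [abs_of_nonneg hr0])
  -- The term `k = 0` has the truncated exponent `0 - 1 = 0`, but its factor `k` vanishes, so the
  -- index may be shifted by one.
  have hs' : Summable (fun k : ℕ => (k : ℝ) * c k * r ^ (k - 1)) := by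
    rw [← summable_nat_add_iff 1]
    simpa using hs
  have key := hasDerivAt_tsum_of_isPreconnected (t := Metric.ball (0 : ℝ) r) hs' Metric.isOpen_ball
    (convex_ball (0 : ℝ) r).isPreconnected
    (g := fun k y => c k * y ^ k) (g' := fun k y => (k : ℝ) * c k * y ^ (k - 1)) (y₀ := 0) (y := x)
    (fun k y _ => by
      have := (hasDerivAt_pow k y).const_mul (c k)
      exact this.congr_deriv (by ring))
    (fun k y hy => by
      have hy' : |y| ≤ r := by simpa using (mem_ball_zero_iff.mp hy).le
      simp only [Real.norm_eq_abs, abs_mul, abs_pow, Nat.abs_cast, abs_of_pos (hc _)]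
      have := (hc k).le
      gcongr)
    (Metric.mem_ball_self (lt_of_le_of_lt (abs_nonneg x) hxr))
    (summable_mul_pow_of_ratio hc h (by simp))
    (mem_ball_zero_iff.mpr hxr)
  refine key.congr_deriv ?_
  have hsx : Summable (fun k : ℕ => (k : ℝ) * c k * x ^ (k - 1)) := by
    rw [← summable_nat_add_iff 1]
    simpa using summable_mul_pow_of_ratio (c := fun k : ℕ => ((k : ℝ) + 1) * c (k + 1))
      (fun k => mul_pos (by positivity) (hc _)) (tendsto_ratio_succ hc h) hx
  rw [hsx.tsum_eq_zero_add]
  simp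

/-! ### The solution of the Jacobi equation that is regular at the origin -/

/-- Coefficients of the solution, regular at `0` and equal to `1` there, of
`x(1-x)F'' + (α+1-(α+β+2)x)F' = mF`. -/
def solCoeff (α β m : ℝ) : ℕ → ℝ
  | 0 => 1
  | k + 1 => solCoeff α β m k * (((k : ℝ) ^ 2 + (α + β + 1) * k + m) / ((k + 1) * (k + 1 + α)))

/-- The hypergeometric series `₂F₁(A, B; α+1; x)` with `A + B = α+β+1` and `A B = m`, where `A`, `B`
need not be real. The two series below are its termwise derivatives. -/
def sol (α β m x : ℝ) : ℝ := ∑' k, solCoeff α β m k * x ^ k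

def solD (α β m x : ℝ) : ℝ := ∑' k : ℕ, ((k : ℝ) + 1) * solCoeff α β m (k + 1) * x ^ k

def solDD (α β m x : ℝ) : ℝ :=
  ∑' k : ℕ, ((k : ℝ) + 1) * ((((k + 1 : ℕ) : ℝ) + 1) * solCoeff α β m (k + 1 + 1)) * x ^ k

section
variable {α β m : ℝ}

theorem solCoeff_num_pos (hα : -1 < α) (hβ : -1 < β) (hm : 0 < m) (k : ℕ) :
    0 < (k : ℝ) ^ 2 + (α + β + 1) * k + m := by
  rcases k with _ | k
  · simpa using hm
  · push_cast
    have : (0 : ℝ) ≤ k := k.cast_nonneg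
    nlinarith [mul_nonneg this this, mul_pos (by linarith : 0 < α + β + 2) (by linarith : (0 : ℝ) < k + 1)]

/-- Positivity of every coefficient for `m > 0` is the source of all later estimates: on `[0,1)` the
solution is at least `1` and increasing, with positive derivative. -/
theorem solCoeff_pos (hα : -1 < α) (hβ : -1 < β) (hm : 0 < m) (k : ℕ) :
    0 < solCoeff α β m k := by
  induction k with
  | zero => simp [solCoeff]
  | succ k ih =>
    have : (0 : ℝ) ≤ k := k.cast_nonneg
    rw [solCoeff]
    exact mul_pos ih (div_pos (solCoeff_num_pos hα hβ hm k) (mul_pos (by linarith) (by linarith)))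

theorem solCoeff_succ_mul (hα : -1 < α) (k : ℕ) :
    ((k : ℝ) + 1) * (k + 1 + α) * solCoeff α β m (k + 1) =
      ((k : ℝ) ^ 2 + (α + β + 1) * k + m) * solCoeff α β m k := by
  have : (0 : ℝ) ≤ k := k.cast_nonneg
  have h1 : (k : ℝ) + 1 ≠ 0 := by linarith
  have h2 : (k : ℝ) + 1 + α ≠ 0 := by linarith
  rw [solCoeff]
  field_simp

theorem solCoeff_ratio (hα : -1 < α) (hβ : -1 < β) (hm : 0 < m) :
    Tendsto (fun k => solCoeff α β m (k + 1) / solCoeff α β m k) atTop (𝓝 1) := by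
  have h0 : Tendsto (fun k : ℕ => 1 / ((k : ℝ) + 1)) atTop (𝓝 0) :=
    tendsto_one_div_add_atTop_nhds_zero_nat
  have h1 : Tendsto (fun k : ℕ => (1 + (α + β - 1) * (1 / ((k : ℝ) + 1)) +
      (m - α - β) * (1 / ((k : ℝ) + 1) * (1 / ((k : ℝ) + 1)))) / (1 + α * (1 / ((k : ℝ) + 1))))
      atTop (𝓝 ((1 + (α + β - 1) * 0 + (m - α - β) * (0 * 0)) / (1 + α * 0))) := by
    refine Tendsto.div ?_ (tendsto_const_nhds.add (h0.const_mul _)) (by simp)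
    exact (tendsto_const_nhds.add (h0.const_mul _)).add ((h0.mul h0).const_mul _)
  simp only [mul_zero, add_zero, div_one] at h1
  refine h1.congr fun k => ?_
  have : (0 : ℝ) ≤ k := k.cast_nonneg
  have h1 : (k : ℝ) + 1 ≠ 0 := by linarith
  have h2 : (k : ℝ) + 1 + α ≠ 0 := by linarith
  have h3 := (solCoeff_pos hα hβ hm k).ne'
  rw [solCoeff]
  field_simp
  ring

theorem summable_sol (hα : -1 < α) (hβ : -1 < β) (hm : 0 < m) {x : ℝ} (hx : |x| < 1) :
    Summable (fun k => solCoeff α β m k * x ^ k) :=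
  summable_mul_pow_of_ratio (solCoeff_pos hα hβ hm) (solCoeff_ratio hα hβ hm) hx

theorem solD_coeff_pos (hα : -1 < α) (hβ : -1 < β) (hm : 0 < m) (k : ℕ) :
    0 < ((k : ℝ) + 1) * solCoeff α β m (k + 1) :=
  mul_pos (by positivity) (solCoeff_pos hα hβ hm _)

theorem solD_ratio (hα : -1 < α) (hβ : -1 < β) (hm : 0 < m) :
    Tendsto (fun k : ℕ => (((k + 1 : ℕ) : ℝ) + 1) * solCoeff α β m (k + 1 + 1) /
      (((k : ℝ) + 1) * solCoeff α β m (k + 1))) atTop (𝓝 1) :=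
  tendsto_ratio_succ (solCoeff_pos hα hβ hm) (solCoeff_ratio hα hβ hm)

theorem summable_solD (hα : -1 < α) (hβ : -1 < β) (hm : 0 < m) {x : ℝ} (hx : |x| < 1) :
    Summable (fun k : ℕ => ((k : ℝ) + 1) * solCoeff α β m (k + 1) * x ^ k) :=
  summable_mul_pow_of_ratio (c := fun k : ℕ => ((k : ℝ) + 1) * solCoeff α β m (k + 1))
    (solD_coeff_pos hα hβ hm) (solD_ratio hα hβ hm) hx

theorem summable_solDD (hα : -1 < α) (hβ : -1 < β) (hm : 0 < m) {x : ℝ} (hx : |x| < 1) :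
    Summable (fun k : ℕ =>
      ((k : ℝ) + 1) * ((((k + 1 : ℕ) : ℝ) + 1) * solCoeff α β m (k + 1 + 1)) * x ^ k) :=
  summable_mul_pow_of_ratio
    (c := fun k : ℕ => ((k : ℝ) + 1) * ((((k + 1 : ℕ) : ℝ) + 1) * solCoeff α β m (k + 1 + 1)))
    (fun k => mul_pos (by positivity) (solD_coeff_pos hα hβ hm _))
    (tendsto_ratio_succ (c := fun k : ℕ => ((k : ℝ) + 1) * solCoeff α β m (k + 1))
      (solD_coeff_pos hα hβ hm) (solD_ratio hα hβ hm)) hx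

theorem hasDerivAt_sol (hα : -1 < α) (hβ : -1 < β) (hm : 0 < m) {x : ℝ} (hx : |x| < 1) :
    HasDerivAt (sol α β m) (solD α β m x) x :=
  hasDerivAt_tsum_mul_pow (solCoeff_pos hα hβ hm) (solCoeff_ratio hα hβ hm) hx

theorem hasDerivAt_solD (hα : -1 < α) (hβ : -1 < β) (hm : 0 < m) {x : ℝ} (hx : |x| < 1) :
    HasDerivAt (solD α β m) (solDD α β m x) x :=
  hasDerivAt_tsum_mul_pow (c := fun k : ℕ => ((k : ℝ) + 1) * solCoeff α β m (k + 1))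
    (solD_coeff_pos hα hβ hm) (solD_ratio hα hβ hm) hx

theorem continuousOn_solDD (hα : -1 < α) (hβ : -1 < β) (hm : 0 < m) :
    ContinuousOn (solDD α β m) {x | |x| < 1} := fun x hx =>
  (hasDerivAt_tsum_mul_pow
    (c := fun k : ℕ => ((k : ℝ) + 1) * ((((k + 1 : ℕ) : ℝ) + 1) * solCoeff α β m (k + 1 + 1)))
    (fun k => mul_pos (by positivity) (solD_coeff_pos hα hβ hm _))
    (tendsto_ratio_succ (c := fun k : ℕ => ((k : ℝ) + 1) * solCoeff α β m (k + 1))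
      (solD_coeff_pos hα hβ hm) (solD_ratio hα hβ hm)) hx).continuousAt.continuousWithinAt

theorem sol_ode (hα : -1 < α) (hβ : -1 < β) (hm : 0 < m) {x : ℝ} (hx : |x| < 1) :
    x * (1 - x) * solDD α β m x + ((α + 1) * (1 - x) - (β + 1) * x) * solD α β m x =
      m * sol α β m x := by
  have h0 := (summable_sol hα hβ hm hx).hasSum
  have h1 := (summable_solD hα hβ hm hx).hasSum
  have h2 := (summable_solDD hα hβ hm hx).hasSum
  -- the series of `x F'`, `x F''` and `x² F''`, indexed by the power of `x`
  have e1 : HasSum (fun k : ℕ => (k : ℝ) * solCoeff α β m k * x ^ k) (x * solD α β m x) := by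
    rw [← hasSum_nat_add_iff' 1]
    have := h1.mul_left x
    simp only [Finset.range_one, Finset.sum_singleton, Nat.cast_zero, zero_mul, sub_zero]
    refine this.congr_fun ?_
    intro k
    push_cast
    ring
  have e2 : HasSum (fun k : ℕ => (k : ℝ) * ((k + 1) * solCoeff α β m (k + 1)) * x ^ k)
      (x * solDD α β m x) := by
    rw [← hasSum_nat_add_iff' 1]
    have := h2.mul_left x
    simp only [Finset.range_one, Finset.sum_singleton, Nat.cast_zero, zero_mul, sub_zero]
    refine this.congr_fun ?_
    intro k
    push_cast
    ring
  have e3 : HasSum (fun k : ℕ => (k : ℝ) * ((k - 1) * solCoeff α β m k) * x ^ k)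
      (x * (x * solDD α β m x)) := by
    rw [← hasSum_nat_add_iff' 1]
    have := e2.mul_left x
    simp only [Finset.range_one, Finset.sum_singleton, Nat.cast_zero, zero_mul, sub_zero]
    refine this.congr_fun ?_
    intro k
    push_cast
    ring
  have key := ((e2.sub e3).add ((h1.mul_left (α + 1)).sub (e1.mul_left (α + β + 2)))).sub
    (h0.mul_left m)
  have hz : (fun k : ℕ => (k : ℝ) * ((k + 1) * solCoeff α β m (k + 1)) * x ^ k -
      (k : ℝ) * ((k - 1) * solCoeff α β m k) * x ^ k +
      ((α + 1) * (((k : ℝ) + 1) * solCoeff α β m (k + 1) * x ^ k) -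
      (α + β + 2) * ((k : ℝ) * solCoeff α β m k * x ^ k)) - m * (solCoeff α β m k * x ^ k)) =
      fun _ => 0 := by
    funext k
    have := solCoeff_succ_mul (β := β) (m := m) hα k
    linear_combination (x ^ k) * this
  rw [hz] at key
  have := key.unique hasSum_zero
  change x * solDD α β m x - x * (x * solDD α β m x) + ((α + 1) * solD α β m x -
    (α + β + 2) * (x * solD α β m x)) - m * sol α β m x = 0 at this
  linear_combination this

theorem one_le_sol (hα : -1 < α) (hβ : -1 < β) (hm : 0 < m) {x : ℝ} (hx0 : 0 ≤ x) (hx : x < 1) :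
    1 ≤ sol α β m x := by
  have := (summable_sol hα hβ hm (x := x) (by rwa [abs_of_nonneg hx0])).le_tsum 0
    fun k _ => mul_nonneg (solCoeff_pos hα hβ hm k).le (pow_nonneg hx0 _)
  simpa [solCoeff, sol] using this

theorem solD_pos (hα : -1 < α) (hβ : -1 < β) (hm : 0 < m) {x : ℝ} (hx0 : 0 ≤ x) (hx : x < 1) :
    0 < solD α β m x := by
  have := (summable_solD hα hβ hm (x := x) (by rwa [abs_of_nonneg hx0])).le_tsum 0
    fun k _ => mul_nonneg (solD_coeff_pos hα hβ hm k).le (pow_nonneg hx0 _)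
  refine lt_of_lt_of_le ?_ this
  have := solD_coeff_pos hα hβ hm 0
  simpa using this

theorem sol_le_sol (hα : -1 < α) (hβ : -1 < β) (hm : 0 < m) {x y : ℝ} (hx0 : 0 ≤ x) (hxy : x ≤ y)
    (hy : y < 1) : sol α β m x ≤ sol α β m y := by
  refine (summable_sol hα hβ hm (by rw [abs_of_nonneg hx0]; linarith)).tsum_le_tsum (fun k => ?_)
    (summable_sol hα hβ hm (by rwa [abs_of_nonneg (hx0.trans hxy)]))
  exact mul_le_mul_of_nonneg_left (pow_le_pow_left₀ hx0 hxy k) (solCoeff_pos hα hβ hm k).le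

theorem continuous_solCoeff (k : ℕ) : Continuous (fun m => solCoeff α β m k) := by
  induction k with
  | zero => simpa [solCoeff] using continuous_const
  | succ k ih => simp only [solCoeff]; fun_prop

/-- Measurability jointly in the spectral parameter and in `x` serves Fubini's theorem in the
integral over the parameter. -/
theorem measurable_sol : Measurable (fun z : ℝ × ℝ => sol α β z.1 z.2) := by
  unfold sol
  refine Measurable.tsum fun k => ?_
  exact ((continuous_solCoeff k).measurable.comp measurable_fst).mul (measurable_snd.pow_const k)

theorem measurable_solD : Measurable (fun z : ℝ × ℝ => solD α β z.1 z.2) := by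
  unfold solD
  refine Measurable.tsum fun k => ?_
  exact (((continuous_solCoeff (k + 1)).measurable.comp measurable_fst).const_mul _).mul
    (measurable_snd.pow_const k)

end

end
end SymmJacobi

namespace SymmJacobi
noncomputable section

/-! ### The weight and the fundamental theorem of calculus for the Jacobi operator -/

/-- The variable `sin² (θ/2)`, in which Jacobi functions are hypergeometric. -/
def hs (θ : ℝ) : ℝ := Real.sin (θ / 2) ^ 2

/-- The coefficient of the flux in the self-adjoint form of the Jacobi equation. -/
def fluxW (α β θ : ℝ) : ℝ := Real.sin (θ / 2) ^ (2 * α + 2) * Real.cos (θ / 2) ^ (2 * β + 2)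

theorem rpow_le_of_comparable {x y c e : ℝ} (hx : 0 < x) (hy : 0 < y) (hc : 1 ≤ c)
    (h1 : y ≤ c * x) (h2 : x ≤ c * y) : x ^ e ≤ c ^ |e| * y ^ e := by
  have hc0 : 0 < c := by linarith
  rcases le_total 0 e with he | he
  · rw [abs_of_nonneg he, ← Real.mul_rpow hc0.le hy.le]
    exact Real.rpow_le_rpow hx.le h2 he
  · rw [abs_of_nonpos he]
    have h3 : (c * x) ^ e ≤ y ^ e := Real.rpow_le_rpow_of_nonpos hy h1 he
    rw [Real.mul_rpow hc0.le hx.le] at h3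
    calc x ^ e = c ^ (-e) * (c ^ e * x ^ e) := by
          rw [← mul_assoc, ← Real.rpow_add hc0]; simp
      _ ≤ _ := by gcongr

theorem sin_half_pos {t : ℝ} (ht : t ∈ Ioo 0 Real.pi) : 0 < Real.sin (t / 2) :=
  Real.sin_pos_of_pos_of_lt_pi (by linarith [ht.1]) (by linarith [ht.1, ht.2])

theorem cos_half_pos {t : ℝ} (ht : t ∈ Ioo (-Real.pi) Real.pi) : 0 < Real.cos (t / 2) :=
  Real.cos_pos_of_mem_Ioo ⟨by linarith [ht.1], by linarith [ht.2]⟩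

theorem cos_half_pos' {t : ℝ} (ht : t ∈ Ioo 0 Real.pi) : 0 < Real.cos (t / 2) :=
  cos_half_pos ⟨by linarith [ht.1, Real.pi_pos], ht.2⟩

theorem hs_pos {t : ℝ} (ht : t ∈ Ioo 0 Real.pi) : 0 < hs t := pow_pos (sin_half_pos ht) 2

theorem one_sub_hs (t : ℝ) : 1 - hs t = Real.cos (t / 2) ^ 2 := by
  have := Real.sin_sq_add_cos_sq (t / 2); unfold hs; linarith

theorem hs_lt_one {t : ℝ} (ht : t ∈ Ioo 0 Real.pi) : hs t < 1 := by
  have := one_sub_hs t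
  have := pow_pos (cos_half_pos' ht) 2
  linarith

theorem hs_nonneg (t : ℝ) : 0 ≤ hs t := sq_nonneg _

theorem hs_le_one (t : ℝ) : hs t ≤ 1 := by
  have := one_sub_hs t
  have := sq_nonneg (Real.cos (t / 2))
  linarith

theorem cos_eq_hs (t : ℝ) : Real.cos t = 1 - 2 * hs t := by
  have h := Real.cos_sq' (t / 2)
  have h2 := Real.cos_sq (t / 2)
  rw [mul_div_cancel₀ t two_ne_zero] at h2
  unfold hs
  linarith

theorem hs_reflect (t : ℝ) : hs (Real.pi - t) = 1 - hs t := by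
  rw [one_sub_hs, hs, sub_div, Real.sin_pi_div_two_sub]

theorem hs_neg (t : ℝ) : hs (-t) = hs t := by
  simp [hs, neg_div]

theorem hs_le_hs {s t : ℝ} (hs0 : 0 ≤ s) (hst : s ≤ t) (ht : t ≤ Real.pi) : hs s ≤ hs t :=
  pow_le_pow_left₀ (Real.sin_nonneg_of_nonneg_of_le_pi (by linarith) (by linarith [Real.pi_pos]))
    (Real.sin_le_sin_of_le_of_le_pi_div_two (by linarith [Real.pi_pos]) (by linarith)
      (by linarith)) 2

theorem continuous_hs : Continuous hs := by unfold hs; fun_prop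

theorem psi_reflect (α β : ℝ) {t : ℝ} (ht : t ∈ Ioo 0 Real.pi) :
    psi α β (Real.pi - t) = psi β α t := by
  unfold psi
  rw [sub_div, Real.sin_pi_div_two_sub, Real.cos_pi_div_two_sub, abs_of_pos (cos_half_pos' ht),
    abs_of_pos (sin_half_pos ht), mul_comm]

theorem psi_neg (α β t : ℝ) : psi α β (-t) = psi α β t := by
  simp [psi, neg_div]

theorem psi_pos (α β : ℝ) {t : ℝ} (ht : t ∈ Ioo 0 Real.pi) : 0 < psi α β t :=
  mul_pos (Real.rpow_pos_of_pos (abs_pos.mpr (sin_half_pos ht).ne') _)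
    (Real.rpow_pos_of_pos (cos_half_pos' ht) _)

theorem psi_sq (α β : ℝ) {t : ℝ} (ht : t ∈ Ioo 0 Real.pi) :
    psi α β t ^ 2 = Real.sin (t / 2) ^ (2 * α + 1) * Real.cos (t / 2) ^ (2 * β + 1) := by
  have h1 := sin_half_pos ht
  have h2 := cos_half_pos' ht
  unfold psi
  rw [abs_of_pos h1, mul_pow, ← Real.rpow_mul_natCast h1.le, ← Real.rpow_mul_natCast h2.le]
  congr 2 <;> push_cast <;> ring

theorem measurable_psi (α β : ℝ) : Measurable (psi α β) := by
  unfold psi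
  fun_prop

theorem psi_add_one (α β : ℝ) {t : ℝ} (ht : t ∈ Ioo 0 Real.pi) :
    psi (α + 1) (β + 1) t = psi α β t * (Real.sin (t / 2) * Real.cos (t / 2)) := by
  have h1 := sin_half_pos ht
  have h2 := cos_half_pos' ht
  unfold psi
  rw [abs_of_pos h1, show α + 1 + 1 / 2 = (α + 1 / 2) + 1 by ring,
    show β + 1 + 1 / 2 = (β + 1 / 2) + 1 by ring, Real.rpow_add_one h1.ne', Real.rpow_add_one h2.ne']
  ring

theorem sin_half_comparable {t : ℝ} (ht : t ∈ Ioo 0 Real.pi) :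
    t ≤ 4 * Real.sin (t / 2) ∧ Real.sin (t / 2) ≤ 4 * t := by
  have h1 := Real.mul_le_sin (x := t / 2) (by linarith [ht.1]) (by linarith [ht.2])
  have h2 := Real.sin_le (x := t / 2) (by linarith [ht.1])
  refine ⟨?_, by linarith [ht.1]⟩
  have h3 : t / 4 ≤ 2 / Real.pi * (t / 2) := by
    rw [show 2 / Real.pi * (t / 2) = t / Real.pi by ring]
    exact div_le_div_of_nonneg_left ht.1.le Real.pi_pos Real.pi_le_four
  linarith

/-- The bound `7π/8` leaves room for an interval of length at most `π/8` to the right of a point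
below `3π/4`. -/
theorem cos_half_comparable {t : ℝ} (ht0 : 0 < t) (ht : t ≤ 7 * Real.pi / 8) :
    1 ≤ 8 * Real.cos (t / 2) ∧ Real.cos (t / 2) ≤ 8 * 1 := by
  have h1 := Real.mul_le_sin (x := Real.pi / 2 - t / 2) (by linarith [Real.pi_pos]) (by linarith)
  rw [Real.sin_pi_div_two_sub] at h1
  have h3 : 2 / Real.pi * (Real.pi / 2 - 7 * Real.pi / 8 / 2) = 1 / 8 := by
    field_simp; norm_num
  have h4 : 2 / Real.pi * (Real.pi / 2 - 7 * Real.pi / 8 / 2) ≤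
      2 / Real.pi * (Real.pi / 2 - t / 2) := by
    have := Real.pi_pos
    gcongr
  refine ⟨by linarith, by linarith [Real.cos_le_one (t / 2)]⟩

/-- Away from `π`, the weight is comparable with a power. -/
theorem exists_psi_sq_comparable (α β : ℝ) : ∃ C : ℝ, 1 ≤ C ∧ ∀ t ∈ Ioc 0 (7 * Real.pi / 8),
    t ^ (2 * α + 1) ≤ C * psi α β t ^ 2 ∧ psi α β t ^ 2 ≤ C * t ^ (2 * α + 1) := by
  refine ⟨4 ^ |2 * α + 1| * 8 ^ |2 * β + 1|, ?_, fun t ht => ?_⟩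
  · exact one_le_mul_of_one_le_of_one_le (Real.one_le_rpow (by norm_num) (abs_nonneg _))
      (Real.one_le_rpow (by norm_num) (abs_nonneg _))
  have htI : t ∈ Ioo 0 Real.pi := ⟨ht.1, by linarith [ht.2, Real.pi_pos]⟩
  obtain ⟨h1, h2⟩ := sin_half_comparable htI
  obtain ⟨h3, h4⟩ := cos_half_comparable ht.1 ht.2
  have p1 := sin_half_pos htI
  have p2 := cos_half_pos' htI
  rw [psi_sq α β htI]
  have a1 := rpow_le_of_comparable (e := 2 * α + 1) ht.1 p1 (by norm_num) h2 h1
  have a2 := rpow_le_of_comparable (e := 2 * α + 1) p1 ht.1 (by norm_num) h1 h2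
  have b1 := rpow_le_of_comparable (e := 2 * β + 1) one_pos p2 (by norm_num) h4 h3
  have b2 := rpow_le_of_comparable (e := 2 * β + 1) p2 one_pos (by norm_num) h3 h4
  rw [Real.one_rpow] at b1 b2
  have q1 := Real.rpow_pos_of_pos p1 (2 * α + 1)
  have q2 := Real.rpow_pos_of_pos p2 (2 * β + 1)
  have q3 := Real.rpow_pos_of_pos ht.1 (2 * α + 1)
  constructor
  · calc t ^ (2 * α + 1) = t ^ (2 * α + 1) * 1 := (mul_one _).symm
      _ ≤ (4 ^ |2 * α + 1| * Real.sin (t / 2) ^ (2 * α + 1)) *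
          (8 ^ |2 * β + 1| * Real.cos (t / 2) ^ (2 * β + 1)) := by gcongr
      _ = _ := by ring
  · calc Real.sin (t / 2) ^ (2 * α + 1) * Real.cos (t / 2) ^ (2 * β + 1)
        ≤ (4 ^ |2 * α + 1| * t ^ (2 * α + 1)) * (8 ^ |2 * β + 1| * 1) := by gcongr
      _ = _ := by ring

theorem integrableOn_psi_sq_left {α : ℝ} (β : ℝ) (hα : -1 < α) :
    IntegrableOn (fun t => psi α β t ^ 2) (Ioc 0 (7 * Real.pi / 8)) := by
  obtain ⟨C, -, hC⟩ := exists_psi_sq_comparable α β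
  have h : IntegrableOn (fun t : ℝ => C * t ^ (2 * α + 1)) (Ioc 0 (7 * Real.pi / 8)) := by
    have := intervalIntegral.intervalIntegrable_rpow' (r := 2 * α + 1) (a := 0)
      (b := 7 * Real.pi / 8) (by linarith)
    rw [intervalIntegrable_iff_integrableOn_Ioc_of_le (by positivity)] at this
    exact this.const_mul C
  refine h.mono' ((measurable_psi α β).pow_const 2).aestronglyMeasurable ?_
  refine (ae_restrict_iff' measurableSet_Ioc).mpr (Eventually.of_forall fun t ht => ?_)
  rw [Real.norm_of_nonneg (sq_nonneg _)]
  exact (hC t ht).2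

/-- Near `0` the integrand is comparable with `t^{2α+1}`, which is integrable since `α > -1`. The
reflection `t ↦ π - t` exchanges `α` and `β` and treats the other end. -/
theorem integrableOn_psi_sq {α β : ℝ} (hα : -1 < α) (hβ : -1 < β) :
    IntegrableOn (fun t => psi α β t ^ 2) (Ioo 0 Real.pi) := by
  have h1 := (integrableOn_psi_sq_left β hα).mono_set
    (show Ioc 0 (Real.pi / 2) ⊆ Ioc 0 (7 * Real.pi / 8) from
      Ioc_subset_Ioc_right (by linarith [Real.pi_pos]))
  have h2 := (integrableOn_psi_sq_left α hβ).mono_set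
    (show Ioo 0 (Real.pi * (5 / 8)) ⊆ Ioc 0 (7 * Real.pi / 8) from
      fun x hx => ⟨hx.1, by linarith [hx.2, Real.pi_pos]⟩)
  have h3 : IntegrableOn (fun t => psi α β t ^ 2) (Ioo (Real.pi * (3 / 8)) Real.pi) := by
    have := (Measure.measurePreserving_sub_left volume Real.pi).integrableOn_comp_preimage
      (f := fun t => psi α β t ^ 2) (s := Ioo (Real.pi * (3 / 8)) Real.pi)
      (MeasurableEquiv.subLeft Real.pi).measurableEmbedding
    rw [← this]
    have hset : (fun x => Real.pi - x) ⁻¹' Ioo (Real.pi * (3 / 8)) Real.pi =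
        Ioo 0 (Real.pi * (5 / 8)) := by
      ext x; simp only [mem_preimage, mem_Ioo]
      constructor <;> rintro ⟨h, h'⟩ <;> constructor <;> linarith
    rw [hset]
    refine h2.congr_fun (fun t ht => ?_) measurableSet_Ioo
    simp only [Function.comp]
    rw [psi_reflect α β ⟨ht.1, by linarith [ht.2, Real.pi_pos]⟩]
  refine (h1.union h3).mono_set fun x hx => ?_
  rcases le_or_gt x (Real.pi / 2) with h | h
  · exact Or.inl ⟨hx.1, h⟩
  · exact Or.inr ⟨by linarith [Real.pi_pos], hx.2⟩

theorem hasDerivAt_hs (t : ℝ) :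
    HasDerivAt hs (Real.sin (t / 2) * Real.cos (t / 2)) t := by
  have h := (((hasDerivAt_id t).div_const 2).sin).pow 2
  refine h.congr_deriv ?_
  simp
  ring

theorem hasDerivAt_fluxW (α β : ℝ) {t : ℝ} (ht : t ∈ Ioo 0 Real.pi) :
    HasDerivAt (fluxW α β)
      (psi α β t ^ 2 * ((α + 1) * (1 - hs t) - (β + 1) * hs t)) t := by
  have p1 := sin_half_pos ht
  have p2 := cos_half_pos' ht
  have h1 := (((hasDerivAt_id t).div_const 2).sin).rpow_const (p := 2 * α + 2) (Or.inl p1.ne')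
  have h2 := (((hasDerivAt_id t).div_const 2).cos).rpow_const (p := 2 * β + 2) (Or.inl p2.ne')
  refine (h1.mul h2).congr_deriv ?_
  simp only [id]
  have e1 : Real.sin (t / 2) ^ (2 * α + 2) = Real.sin (t / 2) ^ (2 * α + 1) * Real.sin (t / 2) := by
    rw [← Real.rpow_add_one p1.ne']; ring_nf
  have e2 : Real.cos (t / 2) ^ (2 * β + 2) = Real.cos (t / 2) ^ (2 * β + 1) * Real.cos (t / 2) := by
    rw [← Real.rpow_add_one p2.ne']; ring_nf
  rw [psi_sq α β ht, one_sub_hs, hs, show 2 * α + 2 - 1 = 2 * α + 1 by ring,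
    show 2 * β + 2 - 1 = 2 * β + 1 by ring, e1, e2]
  generalize Real.sin (t / 2) ^ (2 * α + 1) = A
  generalize Real.cos (t / 2) ^ (2 * β + 1) = B
  ring

theorem fluxW_eq (α β : ℝ) {t : ℝ} (ht : t ∈ Ioo 0 Real.pi) :
    fluxW α β t = psi α β t ^ 2 * (Real.sin (t / 2) * Real.cos (t / 2)) := by
  have p1 := sin_half_pos ht
  have p2 := cos_half_pos' ht
  rw [psi_sq α β ht, fluxW, show 2 * α + 2 = (2 * α + 1) + 1 by ring,
    show 2 * β + 2 = (2 * β + 1) + 1 by ring, Real.rpow_add_one p1.ne', Real.rpow_add_one p2.ne']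
  ring

theorem fluxW_pos (α β : ℝ) {t : ℝ} (ht : t ∈ Ioo 0 Real.pi) : 0 < fluxW α β t :=
  mul_pos (Real.rpow_pos_of_pos (sin_half_pos ht) _) (Real.rpow_pos_of_pos (cos_half_pos' ht) _)

/-- The flux coefficient vanishes at both ends because `2α+2` and `2β+2` are positive; this removes
the boundary terms from the integrations by parts. -/
theorem fluxW_zero {α : ℝ} (β : ℝ) (hα : -1 < α) : fluxW α β 0 = 0 := by
  simp [fluxW, Real.zero_rpow (by linarith : 2 * α + 2 ≠ 0)]

theorem fluxW_pi (α : ℝ) {β : ℝ} (hβ : -1 < β) : fluxW α β Real.pi = 0 := by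
  simp [fluxW, Real.zero_rpow (by linarith : 2 * β + 2 ≠ 0)]

theorem fluxW_reflect (α β t : ℝ) : fluxW α β (Real.pi - t) = fluxW β α t := by
  rw [fluxW, fluxW, sub_div, Real.sin_pi_div_two_sub, Real.cos_pi_div_two_sub, mul_comm]

theorem continuous_fluxW {α β : ℝ} (hα : -1 < α) (hβ : -1 < β) : Continuous (fluxW α β) := by
  unfold fluxW
  refine Continuous.mul ?_ ?_
  · exact (Real.continuous_sin.comp (continuous_id.div_const 2)).rpow_const
      fun x => Or.inr (by linarith)
  · exact (Real.continuous_cos.comp (continuous_id.div_const 2)).rpow_const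
      fun x => Or.inr (by linarith)

/-- The density, in the variable `x = sin² (θ/2)`, of the derivative of `fluxW * q`. -/
def fluxDeriv (α β : ℝ) (q q' : ℝ → ℝ) (x : ℝ) : ℝ :=
  ((α + 1) * (1 - x) - (β + 1) * x) * q x + x * (1 - x) * q' x

theorem integrableOn_psi_sq_mul {α β : ℝ} (hα : -1 < α) (hβ : -1 < β) {φ : ℝ}
    (hφ : φ ∈ Ioc 0 Real.pi) {f : ℝ → ℝ} (hf : ContinuousOn f (Icc 0 (hs φ))) :
    IntegrableOn (fun t => psi α β t ^ 2 * f (hs t)) (Ioo 0 φ) := by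
  have hmaps : MapsTo hs (Icc 0 φ) (Icc 0 (hs φ)) := fun t ht =>
    ⟨hs_nonneg t, hs_le_hs ht.1 ht.2 hφ.2⟩
  have hc : ContinuousOn (fun t => f (hs t)) (Icc 0 φ) :=
    hf.comp continuous_hs.continuousOn hmaps
  obtain ⟨C, hC⟩ := isCompact_Icc.exists_bound_of_continuousOn hc
  have h1 := (integrableOn_psi_sq hα hβ).mono_set (Ioo_subset_Ioo_right hφ.2 : Ioo 0 φ ⊆ Ioo 0 _)
  refine Integrable.mul_bdd (c := C) h1
    ((hc.mono Ioo_subset_Icc_self).aestronglyMeasurable measurableSet_Ioo) ?_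
  exact (ae_restrict_iff' measurableSet_Ioo).mpr
    (Eventually.of_forall fun t ht => hC t (Ioo_subset_Icc_self ht))

/-- Fundamental theorem of calculus for `fluxW * q`: the boundary term at `0` is zero, and only
continuity is needed there, so the possible singularity of `psi²` at `0` is harmless. -/
theorem integral_fluxDeriv {α β : ℝ} (hα : -1 < α) (hβ : -1 < β) {φ : ℝ}
    (hφ : φ ∈ Ioc 0 Real.pi) {q q' : ℝ → ℝ} (hq : ∀ x ∈ Icc 0 (hs φ), HasDerivAt q (q' x) x)
    (hq' : ContinuousOn q' (Icc 0 (hs φ))) :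
    ∫ t in Ioo 0 φ, psi α β t ^ 2 * fluxDeriv α β q q' (hs t) = fluxW α β φ * q (hs φ) := by
  have hqc : ContinuousOn q (Icc 0 (hs φ)) := fun x hx => (hq x hx).continuousAt.continuousWithinAt
  have hmaps : MapsTo hs (Icc 0 φ) (Icc 0 (hs φ)) := fun t ht =>
    ⟨hs_nonneg t, hs_le_hs ht.1 ht.2 hφ.2⟩
  have hint := integrableOn_psi_sq_mul hα hβ hφ (f := fluxDeriv α β q q') (by
    unfold fluxDeriv; fun_prop)
  rw [← integral_Ioc_eq_integral_Ioo, ← intervalIntegral.integral_of_le hφ.1.le,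
    intervalIntegral.integral_eq_sub_of_hasDerivAt_of_le hφ.1.le
      (f := fun t => fluxW α β t * q (hs t))]
  · simp [fluxW_zero β hα]
  · exact (continuous_fluxW hα hβ).continuousOn.mul (hqc.comp continuous_hs.continuousOn hmaps)
  · intro t ht
    have htI : t ∈ Ioo 0 Real.pi := ⟨ht.1, ht.2.trans_le hφ.2⟩
    have h1 := hasDerivAt_fluxW α β htI
    have h2 := (hq (hs t) (hmaps (Ioo_subset_Icc_self ht))).comp t (hasDerivAt_hs t)
    refine (h1.mul h2).congr_deriv ?_
    rw [fluxW_eq α β htI, fluxDeriv]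
    simp only [Function.comp]
    have : hs t * (1 - hs t) = (Real.sin (t / 2) * Real.cos (t / 2)) ^ 2 := by
      rw [one_sub_hs, hs]; ring
    rw [this]
    ring
  · rw [intervalIntegrable_iff_integrableOn_Ioo_of_le hφ.1.le]
    exact hint

end
end SymmJacobi

namespace SymmJacobi
noncomputable section

/-! ### The resolvent kernel of the Jacobi operator -/

/-- The Jacobi operator in the variable `x = sin² (θ/2)`, in terms of the first two derivatives. -/
def jacOp (α β : ℝ) (f' f'' : ℝ → ℝ) (x : ℝ) : ℝ :=
  x * (1 - x) * f'' x + ((α + 1) * (1 - x) - (β + 1) * x) * f' x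

/-- With `F(θ) = sol α β m (hs θ)` and `H(θ) = sol β α m (1 - hs θ)`, this is the conserved quantity
`psi² (F' H - F H')` of the Sturm–Liouville equation; the factor `sin (θ/2) cos (θ/2)` from the
chain rule is absorbed in `fluxW`. -/
def wronskFun (α β m θ : ℝ) : ℝ :=
  fluxW α β θ * (solD α β m (hs θ) * sol β α m (1 - hs θ) +
    sol α β m (hs θ) * solD β α m (1 - hs θ))

def wronsk (α β m : ℝ) : ℝ := wronskFun α β m (Real.pi / 2)

/-- Kernel of the inverse of `m` minus the Jacobi operator, relative to the measure `psi² dθ`: the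
solution regular at `0` is taken at the smaller point, the one regular at `π` at the larger. -/
def green (α β m θ φ : ℝ) : ℝ :=
  sol α β m (hs (min θ φ)) * sol β α m (1 - hs (max θ φ)) / wronsk α β m

/-- The kernel of `(J + m)⁻¹` with respect to Lebesgue measure on `(0,π)`. -/
def resKer (α β m θ φ : ℝ) : ℝ := psi α β θ * psi α β φ * green α β m θ φ

section
variable {α β m : ℝ}

theorem hs_mem {t : ℝ} (ht : t ∈ Ioo 0 Real.pi) : |hs t| < 1 := by
  rw [abs_of_nonneg (hs_nonneg t)]; exact hs_lt_one ht

theorem one_sub_hs_pos {t : ℝ} (ht : t ∈ Ioo 0 Real.pi) : 0 < 1 - hs t := by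
  linarith [hs_lt_one ht]

theorem one_sub_hs_lt {t : ℝ} (ht : t ∈ Ioo 0 Real.pi) : 1 - hs t < 1 := by
  linarith [hs_pos ht]

theorem one_sub_hs_mem {t : ℝ} (ht : t ∈ Ioo 0 Real.pi) : |1 - hs t| < 1 := by
  rw [abs_of_pos (one_sub_hs_pos ht)]; exact one_sub_hs_lt ht

theorem pi_div_two_mem : Real.pi / 2 ∈ Ioo 0 Real.pi :=
  ⟨by linarith [Real.pi_pos], by linarith [Real.pi_pos]⟩

theorem hs_pi_div_two : hs (Real.pi / 2) = 1 / 2 := by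
  have := cos_eq_hs (Real.pi / 2)
  rw [Real.cos_pi_div_two] at this
  linarith

theorem wronskFun_pos (hα : -1 < α) (hβ : -1 < β) (hm : 0 < m) {t : ℝ} (ht : t ∈ Ioo 0 Real.pi) :
    0 < wronskFun α β m t := by
  have h1 := one_le_sol hα hβ hm (hs_nonneg t) (hs_lt_one ht)
  have h2 := one_le_sol hβ hα hm (one_sub_hs_pos ht).le (one_sub_hs_lt ht)
  have h3 := solD_pos hα hβ hm (hs_nonneg t) (hs_lt_one ht)
  have h4 := solD_pos hβ hα hm (one_sub_hs_pos ht).le (one_sub_hs_lt ht)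
  have h5 := fluxW_pos α β ht
  unfold wronskFun
  positivity

/-- Abel's identity. Each solution times the equation of the other gives the same zeroth-order term,
and the difference is the derivative of the flux-weighted Wronskian. -/
theorem hasDerivAt_wronskFun (hα : -1 < α) (hβ : -1 < β) (hm : 0 < m) {t : ℝ}
    (ht : t ∈ Ioo 0 Real.pi) : HasDerivAt (wronskFun α β m) 0 t := by
  have hx := hs_mem ht
  have hy := one_sub_hs_mem ht
  have dh := hasDerivAt_hs t
  have dh' := dh.const_sub 1
  have d1 := (hasDerivAt_solD hα hβ hm hx).comp t dh
  have d2 := (hasDerivAt_sol hα hβ hm hx).comp t dh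
  have d3 := (hasDerivAt_sol hβ hα hm hy).comp t dh'
  have d4 := (hasDerivAt_solD hβ hα hm hy).comp t dh'
  refine ((hasDerivAt_fluxW α β ht).mul ((d1.mul d3).add (d2.mul d4))).congr_deriv ?_
  have o1 := sol_ode hα hβ hm hx
  have o2 := sol_ode hβ hα hm hy
  rw [fluxW_eq α β ht]
  simp only [Function.comp, Pi.mul_apply, Pi.add_apply]
  have e : hs t * (1 - hs t) = (Real.sin (t / 2) * Real.cos (t / 2)) ^ 2 := by
    rw [one_sub_hs, hs]; ring
  rw [sub_sub_cancel] at o2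
  rw [e] at o1
  rw [mul_comm (1 - hs t), e] at o2
  linear_combination psi α β t ^ 2 * (sol β α m (1 - hs t) * o1 - sol α β m (hs t) * o2)

theorem wronskFun_eq (hα : -1 < α) (hβ : -1 < β) (hm : 0 < m) {t : ℝ} (ht : t ∈ Ioo 0 Real.pi) :
    wronskFun α β m t = wronsk α β m :=
  isOpen_Ioo.is_const_of_deriv_eq_zero isPreconnected_Ioo
    (fun _ hs => (hasDerivAt_wronskFun hα hβ hm hs).differentiableAt.differentiableWithinAt)
    (fun _ hs => (hasDerivAt_wronskFun hα hβ hm hs).deriv) ht pi_div_two_mem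

theorem wronsk_pos (hα : -1 < α) (hβ : -1 < β) (hm : 0 < m) : 0 < wronsk α β m :=
  wronskFun_pos hα hβ hm pi_div_two_mem

theorem wronsk_comm : wronsk α β m = wronsk β α m := by
  have : fluxW α β (Real.pi / 2) = fluxW β α (Real.pi / 2) := by
    rw [← fluxW_reflect β α]; congr 1; ring
  rw [wronsk, wronsk, wronskFun, wronskFun, this, hs_pi_div_two]
  norm_num
  left
  ring

theorem green_comm (θ φ : ℝ) : green α β m θ φ = green α β m φ θ := by
  rw [green, green, min_comm, max_comm]

theorem green_reflect (θ φ : ℝ) :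
    green α β m (Real.pi - θ) (Real.pi - φ) = green β α m θ φ := by
  rw [green, green, min_sub_sub_left, max_sub_sub_left, hs_reflect, hs_reflect, sub_sub_cancel,
    wronsk_comm, mul_comm]

theorem resKer_comm (θ φ : ℝ) : resKer α β m θ φ = resKer α β m φ θ := by
  rw [resKer, resKer, green_comm, mul_comm (psi α β θ)]

theorem resKer_reflect {θ φ : ℝ} (hθ : θ ∈ Ioo 0 Real.pi) (hφ : φ ∈ Ioo 0 Real.pi) :
    resKer α β m (Real.pi - θ) (Real.pi - φ) = resKer β α m θ φ := by
  rw [resKer, resKer, green_reflect, psi_reflect α β hθ, psi_reflect α β hφ]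

theorem min_mem_Ioo {θ φ : ℝ} (hθ : θ ∈ Ioo 0 Real.pi) (hφ : φ ∈ Ioo 0 Real.pi) :
    min θ φ ∈ Ioo 0 Real.pi := ⟨lt_min hθ.1 hφ.1, (min_le_left _ _).trans_lt hθ.2⟩

theorem max_mem_Ioo {θ φ : ℝ} (hθ : θ ∈ Ioo 0 Real.pi) (hφ : φ ∈ Ioo 0 Real.pi) :
    max θ φ ∈ Ioo 0 Real.pi := ⟨hθ.1.trans_le (le_max_left _ _), max_lt hθ.2 hφ.2⟩

/-- Both solutions are at least `1`. This crude bound is enough for the global lower bound of the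
potential kernel by a multiple of `psi θ * psi φ`. -/
theorem one_div_wronsk_le_green (hα : -1 < α) (hβ : -1 < β) (hm : 0 < m) {θ φ : ℝ}
    (hθ : θ ∈ Ioo 0 Real.pi) (hφ : φ ∈ Ioo 0 Real.pi) :
    1 / wronsk α β m ≤ green α β m θ φ := by
  have h1 := one_le_sol hα hβ hm (hs_nonneg _) (hs_lt_one (min_mem_Ioo hθ hφ))
  have h2 := one_le_sol hβ hα hm (one_sub_hs_pos (max_mem_Ioo hθ hφ)).le
    (one_sub_hs_lt (max_mem_Ioo hθ hφ))
  have := wronsk_pos hα hβ hm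
  unfold green
  gcongr
  exact one_le_mul_of_one_le_of_one_le h1 h2

theorem green_pos (hα : -1 < α) (hβ : -1 < β) (hm : 0 < m) {θ φ : ℝ}
    (hθ : θ ∈ Ioo 0 Real.pi) (hφ : φ ∈ Ioo 0 Real.pi) : 0 < green α β m θ φ :=
  (one_div_pos.mpr (wronsk_pos hα hβ hm)).trans_le (one_div_wronsk_le_green hα hβ hm hθ hφ)

theorem resKer_pos (hα : -1 < α) (hβ : -1 < β) (hm : 0 < m) {θ φ : ℝ}
    (hθ : θ ∈ Ioo 0 Real.pi) (hφ : φ ∈ Ioo 0 Real.pi) : 0 < resKer α β m θ φ :=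
  mul_pos (mul_pos (psi_pos α β hθ) (psi_pos α β hφ)) (green_pos hα hβ hm hθ hφ)

theorem green_anti (hα : -1 < α) (hβ : -1 < β) (hm : 0 < m) {θ φ φ' : ℝ}
    (hθ : 0 < θ) (h1 : θ ≤ φ) (h2 : φ ≤ φ') (h3 : φ' < Real.pi) :
    green α β m θ φ' ≤ green α β m θ φ := by
  have hφ : φ ∈ Ioo 0 Real.pi := ⟨by linarith, by linarith⟩
  have hφ' : φ' ∈ Ioo 0 Real.pi := ⟨by linarith, by linarith⟩
  have hθ' : θ ∈ Ioo 0 Real.pi := ⟨by linarith, by linarith⟩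
  have := one_le_sol hα hβ hm (hs_nonneg _) (hs_lt_one hθ')
  have := wronsk_pos hα hβ hm
  rw [green, green, min_eq_left h1, max_eq_right h1, min_eq_left (h1.trans h2),
    max_eq_right (h1.trans h2)]
  gcongr
  exact sol_le_sol hβ hα hm (one_sub_hs_pos hφ').le
    (by linarith [hs_le_hs hφ.1.le h2 h3.le]) (one_sub_hs_lt hφ)

/-! ### The resolvent identity -/

/-- Lagrange's identity: with `F = sol α β m`, the derivative of `fluxW * (F' f - F f')` is `psi² F`
times `m f` minus the Jacobi operator applied to `f`, because `F` solves the homogeneous equation.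
Only the boundary term at `φ` survives. -/
theorem integral_sol_left (hα : -1 < α) (hβ : -1 < β) (hm : 0 < m) {f f' f'' : ℝ → ℝ}
    (hf : ∀ x, HasDerivAt f (f' x) x) (hf' : ∀ x, HasDerivAt f' (f'' x) x)
    (hf'' : Continuous f'') {φ : ℝ} (hφ : φ ∈ Ioo 0 Real.pi) :
    IntegrableOn (fun t => psi α β t ^ 2 *
      (sol α β m (hs t) * (m * f (hs t) - jacOp α β f' f'' (hs t)))) (Ioo 0 φ) ∧
    ∫ t in Ioo 0 φ, psi α β t ^ 2 *
      (sol α β m (hs t) * (m * f (hs t) - jacOp α β f' f'' (hs t))) =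
      fluxW α β φ * (solD α β m (hs φ) * f (hs φ) - sol α β m (hs φ) * f' (hs φ)) := by
  have hφ' : φ ∈ Ioc 0 Real.pi := ⟨hφ.1, hφ.2.le⟩
  have hx : ∀ x ∈ Icc 0 (hs φ), |x| < 1 := fun x hx => by
    rw [abs_of_nonneg hx.1]; exact hx.2.trans_lt (hs_lt_one hφ)
  have c0 : ContinuousOn (sol α β m) (Icc 0 (hs φ)) := fun x h =>
    (hasDerivAt_sol hα hβ hm (hx x h)).continuousAt.continuousWithinAt
  have c1 : ContinuousOn (solD α β m) (Icc 0 (hs φ)) := fun x h =>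
    (hasDerivAt_solD hα hβ hm (hx x h)).continuousAt.continuousWithinAt
  have c2 : ContinuousOn (solDD α β m) (Icc 0 (hs φ)) :=
    (continuousOn_solDD hα hβ hm).mono hx
  have cf : Continuous f := continuous_iff_continuousAt.mpr fun x => (hf x).continuousAt
  have cf' : Continuous f' := continuous_iff_continuousAt.mpr fun x => (hf' x).continuousAt
  refine ⟨integrableOn_psi_sq_mul hα hβ hφ' (f := fun x => sol α β m x *
    (m * f x - jacOp α β f' f'' x)) (by unfold jacOp; fun_prop), ?_⟩
  rw [← integral_fluxDeriv hα hβ hφ' (q := fun x => solD α β m x * f x - sol α β m x * f' x)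
    (q' := fun x => solDD α β m x * f x - sol α β m x * f'' x)]
  · refine setIntegral_congr_fun measurableSet_Ioo fun t ht => ?_
    have htI : t ∈ Ioo 0 Real.pi := ⟨ht.1, ht.2.trans hφ.2⟩
    have o1 := sol_ode hα hβ hm (hs_mem htI)
    simp only [fluxDeriv, jacOp]
    linear_combination -(psi α β t ^ 2 * f (hs t)) * o1
  · intro x h
    refine (((hasDerivAt_solD hα hβ hm (hx x h)).mul (hf x)).sub
      ((hasDerivAt_sol hα hβ hm (hx x h)).mul (hf' x))).congr_deriv ?_
    ring
  · fun_prop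

theorem setIntegral_reflect (g : ℝ → ℝ) (φ : ℝ) :
    ∫ t in Ioo φ Real.pi, g t = ∫ t in Ioo 0 (Real.pi - φ), g (Real.pi - t) := by
  have h := (Measure.measurePreserving_sub_left volume Real.pi).setIntegral_preimage_emb
    (MeasurableEquiv.subLeft Real.pi).measurableEmbedding g (Ioo φ Real.pi)
  rw [← h]
  congr 2
  ext x; simp only [mem_preimage, mem_Ioo]
  constructor <;> rintro ⟨h, h'⟩ <;> constructor <;> linarith

theorem integrableOn_reflect_iff (g : ℝ → ℝ) (φ : ℝ) :
    IntegrableOn (fun t => g (Real.pi - t)) (Ioo 0 (Real.pi - φ)) ↔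
      IntegrableOn g (Ioo φ Real.pi) := by
  rw [← (Measure.measurePreserving_sub_left volume Real.pi).integrableOn_comp_preimage
    (MeasurableEquiv.subLeft Real.pi).measurableEmbedding (f := g) (s := Ioo φ Real.pi)]
  have : (fun x => Real.pi - x) ⁻¹' Ioo φ Real.pi = Ioo 0 (Real.pi - φ) := by
    ext x; simp only [mem_preimage, mem_Ioo]
    constructor <;> rintro ⟨h, h'⟩ <;> constructor <;> linarith
  rw [this]
  rfl

theorem integral_sol_right (hα : -1 < α) (hβ : -1 < β) (hm : 0 < m) {f f' f'' : ℝ → ℝ}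
    (hf : ∀ x, HasDerivAt f (f' x) x) (hf' : ∀ x, HasDerivAt f' (f'' x) x)
    (hf'' : Continuous f'') {φ : ℝ} (hφ : φ ∈ Ioo 0 Real.pi) :
    IntegrableOn (fun t => psi α β t ^ 2 *
      (sol β α m (1 - hs t) * (m * f (hs t) - jacOp α β f' f'' (hs t)))) (Ioo φ Real.pi) ∧
    ∫ t in Ioo φ Real.pi, psi α β t ^ 2 *
      (sol β α m (1 - hs t) * (m * f (hs t) - jacOp α β f' f'' (hs t))) =
      fluxW α β φ * (solD β α m (1 - hs φ) * f (hs φ) + sol β α m (1 - hs φ) * f' (hs φ)) := by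
  have hr : Real.pi - φ ∈ Ioo 0 Real.pi := ⟨by linarith [hφ.2], by linarith [hφ.1]⟩
  have key := integral_sol_left hβ hα hm (f := fun x => f (1 - x)) (f' := fun x => -f' (1 - x))
    (f'' := fun x => f'' (1 - x))
    (fun x => by
      have := (hf (1 - x)).comp x ((hasDerivAt_id x).const_sub 1)
      refine this.congr_deriv (by simp))
    (fun x => by
      have := ((hf' (1 - x)).comp x ((hasDerivAt_id x).const_sub 1)).neg
      refine this.congr_deriv (by simp))
    (by fun_prop) hr
  have hcongr : EqOn (fun t => psi β α t ^ 2 * (sol β α m (hs t) * (m * f (1 - hs t) -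
      jacOp β α (fun x => -f' (1 - x)) (fun x => f'' (1 - x)) (hs t))))
      (fun t => (fun t => psi α β t ^ 2 *
      (sol β α m (1 - hs t) * (m * f (hs t) - jacOp α β f' f'' (hs t)))) (Real.pi - t))
      (Ioo 0 (Real.pi - φ)) := by
    intro t ht
    have htI : t ∈ Ioo 0 Real.pi := ⟨ht.1, ht.2.trans hr.2⟩
    simp only [psi_reflect α β htI, hs_reflect, jacOp]
    ring_nf
  refine ⟨?_, ?_⟩
  · rw [← integrableOn_reflect_iff]
    exact key.1.congr_fun hcongr measurableSet_Ioo
  · rw [setIntegral_reflect, ← setIntegral_congr_fun measurableSet_Ioo hcongr, key.2, fluxW_reflect,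
      hs_reflect]
    simp only [sub_sub_cancel]
    ring

/-- The Green function inverts `m - D` on smooth functions of `sin² (θ/2)`. -/
theorem integral_green (hα : -1 < α) (hβ : -1 < β) (hm : 0 < m) {f f' f'' : ℝ → ℝ}
    (hf : ∀ x, HasDerivAt f (f' x) x) (hf' : ∀ x, HasDerivAt f' (f'' x) x)
    (hf'' : Continuous f'') {θ : ℝ} (hθ : θ ∈ Ioo 0 Real.pi) :
    IntegrableOn (fun t => green α β m θ t *
      (psi α β t ^ 2 * (m * f (hs t) - jacOp α β f' f'' (hs t)))) (Ioo 0 Real.pi) ∧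
    ∫ t in Ioo 0 Real.pi, green α β m θ t *
      (psi α β t ^ 2 * (m * f (hs t) - jacOp α β f' f'' (hs t))) = f (hs θ) := by
  obtain ⟨i1, e1⟩ := integral_sol_left hα hβ hm hf hf' hf'' hθ
  obtain ⟨i2, e2⟩ := integral_sol_right hα hβ hm hf hf' hf'' hθ
  have hW := wronsk_pos hα hβ hm
  set h : ℝ → ℝ := fun x => m * f x - jacOp α β f' f'' x with hh
  have c1 : EqOn (fun t => (sol β α m (1 - hs θ) / wronsk α β m) *
      (psi α β t ^ 2 * (sol α β m (hs t) * h (hs t))))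
      (fun t => green α β m θ t * (psi α β t ^ 2 * h (hs t))) (Ioo 0 θ) := by
    intro t ht
    simp only [green, min_eq_right ht.2.le, max_eq_left ht.2.le]
    ring
  have c2 : EqOn (fun t => (sol α β m (hs θ) / wronsk α β m) *
      (psi α β t ^ 2 * (sol β α m (1 - hs t) * h (hs t))))
      (fun t => green α β m θ t * (psi α β t ^ 2 * h (hs t))) (Ioo θ Real.pi) := by
    intro t ht
    simp only [green, min_eq_left ht.1.le, max_eq_right ht.1.le]
    ring
  have j1 : IntegrableOn (fun t => green α β m θ t * (psi α β t ^ 2 * h (hs t))) (Ioo 0 θ) :=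
    IntegrableOn.congr_fun (i1.const_mul _) c1 measurableSet_Ioo
  have j2 : IntegrableOn (fun t => green α β m θ t * (psi α β t ^ 2 * h (hs t)))
      (Ioo θ Real.pi) := IntegrableOn.congr_fun (i2.const_mul _) c2 measurableSet_Ioo
  have j1' : IntegrableOn (fun t => green α β m θ t * (psi α β t ^ 2 * h (hs t))) (Ioc 0 θ) :=
    j1.congr_set_ae Ioo_ae_eq_Ioc.symm
  have hU : Ioo 0 Real.pi = Ioc 0 θ ∪ Ioo θ Real.pi := (Ioc_union_Ioo_eq_Ioo hθ.1.le hθ.2).symm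
  refine ⟨by rw [hU]; exact j1'.union j2, ?_⟩
  rw [hU, setIntegral_union (Set.disjoint_left.mpr fun x hx hx' => not_lt.mpr hx.2 hx'.1)
    measurableSet_Ioo j1' j2, integral_Ioc_eq_integral_Ioo,
    ← setIntegral_congr_fun measurableSet_Ioo c1, ← setIntegral_congr_fun measurableSet_Ioo c2,
    integral_const_mul, integral_const_mul, e1, e2]
  -- In the sum of the two boundary terms at `θ` the contributions of `f'` cancel, and the
  -- coefficient of `f` is exactly the conserved Wronskian.
  have hWθ := wronskFun_eq hα hβ hm hθ
  rw [wronskFun] at hWθ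
  rw [div_mul_eq_mul_div, div_mul_eq_mul_div, ← add_div, div_eq_iff hW.ne', ← hWθ]
  ring

theorem integral_resKer (hα : -1 < α) (hβ : -1 < β) (hm : 0 < m) {f f' f'' : ℝ → ℝ}
    (hf : ∀ x, HasDerivAt f (f' x) x) (hf' : ∀ x, HasDerivAt f' (f'' x) x)
    (hf'' : Continuous f'') {θ : ℝ} (hθ : θ ∈ Ioo 0 Real.pi) :
    IntegrableOn (fun t => resKer α β m θ t *
      (psi α β t * (m * f (hs t) - jacOp α β f' f'' (hs t)))) (Ioo 0 Real.pi) ∧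
    ∫ t in Ioo 0 Real.pi, resKer α β m θ t *
      (psi α β t * (m * f (hs t) - jacOp α β f' f'' (hs t))) = psi α β θ * f (hs θ) := by
  obtain ⟨i, e⟩ := integral_green hα hβ hm hf hf' hf'' hθ
  have hc : (fun t => resKer α β m θ t *
      (psi α β t * (m * f (hs t) - jacOp α β f' f'' (hs t)))) = fun t => psi α β θ *
      (green α β m θ t * (psi α β t ^ 2 * (m * f (hs t) - jacOp α β f' f'' (hs t)))) := by
    funext t
    rw [resKer]
    ring
  rw [hc]
  exact ⟨i.const_mul _, by rw [integral_const_mul, e]⟩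

/-! ### Upper bounds for the Green function -/

/-- The resolvent identity for the constant `1/m` gives `∫ green * psi² = 1/m`. As `green` decreases
to the right of `θ`, its value at `t` is at most its value at any point of `(s,t)`. -/
theorem green_mul_integral_le (hα : -1 < α) (hβ : -1 < β) (hm : 0 < m) {θ s t : ℝ}
    (hθ : 0 < θ) (hs' : θ ≤ s) (ht : t < Real.pi) :
    green α β m θ t * ∫ x in Ioo s t, psi α β x ^ 2 ≤ 1 / m := by
  rcases le_or_gt t s with hts | hts
  · rw [Ioo_eq_empty (not_lt.mpr hts)]; simp [hm.le]
  have hθI : θ ∈ Ioo 0 Real.pi := ⟨hθ, by linarith⟩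
  obtain ⟨i, e⟩ := integral_green (f := fun _ => 1 / m) (f' := fun _ => 0) (f'' := fun _ => 0)
    hα hβ hm (fun x => hasDerivAt_const x _) (fun x => hasDerivAt_const x _) continuous_const hθI
  rw [← e, ← integral_const_mul]
  have hsub : Ioo s t ⊆ Ioo 0 Real.pi := Ioo_subset_Ioo (by linarith) ht.le
  have e1 : ∀ x, green α β m θ x * (psi α β x ^ 2 * (m * (1 / m) -
      jacOp α β (fun _ => 0) (fun _ => 0) (hs x))) = green α β m θ x * psi α β x ^ 2 := fun x => by
    simp [jacOp, hm.ne']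
  simp only [e1] at i ⊢
  calc ∫ x in Ioo s t, green α β m θ t * psi α β x ^ 2
      ≤ ∫ x in Ioo s t, green α β m θ x * psi α β x ^ 2 := by
        refine setIntegral_mono_on (((integrableOn_psi_sq hα hβ).mono_set hsub).const_mul _)
          (i.mono_set hsub) measurableSet_Ioo fun x hx => ?_
        exact mul_le_mul_of_nonneg_right
          (green_anti hα hβ hm hθ (hs'.trans hx.1.le) hx.2.le ht) (sq_nonneg _)
    _ ≤ _ := by
        refine setIntegral_mono_set i ?_ hsub.eventuallyLE
        exact (ae_restrict_iff' measurableSet_Ioo).mpr (Eventually.of_forall fun x hx =>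
          mul_nonneg (green_pos hα hβ hm hθI hx).le (sq_nonneg _))

/-- Mean value theorem for the factor depending on the larger point. At `ξ` the Wronskian identity
has two nonnegative terms, and one of them dominates the resulting slope times `psi²`, since `sol`
increases from `θ` to `ξ`. -/
theorem exists_green_sub_le (hα : -1 < α) (hβ : -1 < β) (hm : 0 < m) {θ φ φ' : ℝ}
    (hθ : 0 < θ) (h1 : θ ≤ φ) (h2 : φ < φ') (h3 : φ' < Real.pi) :
    ∃ ξ ∈ Ioo φ φ', green α β m θ φ - green α β m θ φ' ≤ (φ' - φ) / psi α β ξ ^ 2 := by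
  have hI : ∀ t ∈ Icc φ φ', t ∈ Ioo 0 Real.pi := fun t ht =>
    ⟨by linarith [ht.1], by linarith [ht.2]⟩
  have hd : ∀ t ∈ Icc φ φ', HasDerivAt (fun t => sol β α m (1 - hs t))
      (-(solD β α m (1 - hs t) * (Real.sin (t / 2) * Real.cos (t / 2)))) t := fun t ht => by
    have := (hasDerivAt_sol hβ hα hm (one_sub_hs_mem (hI t ht))).comp t
      ((hasDerivAt_hs t).const_sub 1)
    exact this.congr_deriv (by ring)
  obtain ⟨ξ, hξ, e⟩ := exists_hasDerivAt_eq_slope _ _ h2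
    (fun t ht => (hd t ht).continuousAt.continuousWithinAt)
    (fun t ht => hd t (Ioo_subset_Icc_self ht))
  refine ⟨ξ, hξ, ?_⟩
  have hξI := hI ξ (Ioo_subset_Icc_self hξ)
  have hW := wronsk_pos hα hβ hm
  have p := psi_pos α β hξI
  rw [green, green, min_eq_left h1, max_eq_right h1, min_eq_left (h1.trans h2.le),
    max_eq_right (h1.trans h2.le), ← sub_div, ← mul_sub]
  rw [eq_div_iff (by linarith)] at e
  have e' : sol β α m (1 - hs φ) - sol β α m (1 - hs φ') =
      solD β α m (1 - hs ξ) * (Real.sin (ξ / 2) * Real.cos (ξ / 2)) * (φ' - φ) := by linarith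
  rw [e', div_le_div_iff₀ hW (by positivity)]
  have hWξ := wronskFun_eq hα hβ hm hξI
  rw [wronskFun, fluxW_eq α β hξI] at hWξ
  have k1 := sol_le_sol hα hβ hm (hs_nonneg θ) (hs_le_hs hθ.le (h1.trans hξ.1.le) hξI.2.le)
    (hs_lt_one hξI)
  have k2 := solD_pos hβ hα hm (one_sub_hs_pos hξI).le (one_sub_hs_lt hξI)
  have k3 := solD_pos hα hβ hm (hs_nonneg ξ) (hs_lt_one hξI)
  have k4 := one_le_sol hβ hα hm (one_sub_hs_pos hξI).le (one_sub_hs_lt hξI)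
  have k5 := mul_pos (sin_half_pos hξI) (cos_half_pos' hξI)
  have k6 : 0 < φ' - φ := by linarith
  rw [← hWξ]
  set S := Real.sin (ξ / 2) * Real.cos (ξ / 2)
  have : sol α β m (hs θ) * solD β α m (1 - hs ξ) ≤
      solD α β m (hs ξ) * sol β α m (1 - hs ξ) + sol α β m (hs ξ) * solD β α m (1 - hs ξ) := by
    have := mul_le_mul_of_nonneg_right k1 k2.le
    have := mul_pos k3 (by linarith : 0 < sol β α m (1 - hs ξ))
    linarith
  calc sol α β m (hs θ) * (solD β α m (1 - hs ξ) * S * (φ' - φ)) * psi α β ξ ^ 2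
      = (φ' - φ) * (psi α β ξ ^ 2 * S * (sol α β m (hs θ) * solD β α m (1 - hs ξ))) := by ring
    _ ≤ _ := by gcongr

end

end
end SymmJacobi

namespace SymmJacobi
noncomputable section

/-! ### Pointwise bounds for the resolvent kernel -/

/-- The condition on `a` says that `psi²` is no more singular at `0` than `t^{-2a}`, so passing from
the larger point to the smaller one costs at most `(t/s)^{2a}`. -/
theorem exists_psi_sq_le_of_le {α : ℝ} (β : ℝ) {a : ℝ} (ha : -(2 * α + 1) ≤ 2 * a) :
    ∃ C : ℝ, 1 ≤ C ∧ ∀ s t : ℝ, 0 < s → s ≤ t → t ≤ 7 * Real.pi / 8 →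
      psi α β s ^ 2 ≤ C * (t / s) ^ (2 * a) * psi α β t ^ 2 := by
  obtain ⟨C, hC1, hC⟩ := exists_psi_sq_comparable α β
  refine ⟨C * C, by nlinarith, fun s t hs hst ht => ?_⟩
  have h1 := (hC s ⟨hs, hst.trans ht⟩).2
  have h2 := (hC t ⟨hs.trans_le hst, ht⟩).1
  have ht0 : 0 < t := hs.trans_le hst
  have h3 : s ^ (2 * α + 1) ≤ (t / s) ^ (2 * a) * t ^ (2 * α + 1) := by
    have e : s ^ (2 * α + 1) = (t / s) ^ (-(2 * α + 1)) * t ^ (2 * α + 1) := by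
      rw [Real.div_rpow ht0.le hs.le, Real.rpow_neg ht0.le, Real.rpow_neg hs.le]
      have := (Real.rpow_pos_of_pos ht0 (2 * α + 1)).ne'
      field_simp
    rw [e]
    gcongr
    exact (one_le_div hs).mpr hst
  have hp : 0 ≤ (t / s) ^ (2 * a) := by positivity
  calc psi α β s ^ 2 ≤ C * s ^ (2 * α + 1) := h1
    _ ≤ C * ((t / s) ^ (2 * a) * (C * psi α β t ^ 2)) := by
      refine mul_le_mul_of_nonneg_left (h3.trans ?_) (by linarith)
      exact mul_le_mul_of_nonneg_left h2 hp
    _ = _ := by ring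

theorem exists_psi_sq_le_of_half_le (α β : ℝ) :
    ∃ C : ℝ, 1 ≤ C ∧ ∀ t φ : ℝ, 0 < φ → φ / 2 ≤ t → t ≤ φ → φ ≤ 7 * Real.pi / 8 →
      psi α β φ ^ 2 ≤ C * psi α β t ^ 2 := by
  obtain ⟨C, hC1, hC⟩ := exists_psi_sq_comparable α β
  refine ⟨C * 2 ^ |2 * α + 1| * C, ?_, fun t φ hφ h1 h2 h3 => ?_⟩
  · have := Real.one_le_rpow (x := 2) (by norm_num) (abs_nonneg (2 * α + 1))
    exact one_le_mul_of_one_le_of_one_le (one_le_mul_of_one_le_of_one_le hC1 this) hC1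
  have ht : 0 < t := by linarith
  have k1 := (hC φ ⟨hφ, h3⟩).2
  have k2 := (hC t ⟨ht, h2.trans h3⟩).1
  have k3 := rpow_le_of_comparable (e := 2 * α + 1) (c := 2) hφ ht (by norm_num) (by linarith)
    (by linarith)
  calc psi α β φ ^ 2 ≤ C * φ ^ (2 * α + 1) := k1
    _ ≤ C * (2 ^ |2 * α + 1| * (C * psi α β t ^ 2)) := by
      refine mul_le_mul_of_nonneg_left (k3.trans ?_) (by linarith)
      exact mul_le_mul_of_nonneg_left k2 (by positivity)
    _ = _ := by ring

theorem mul_le_setIntegral_psi_sq {α β : ℝ} (hα : -1 < α) (hβ : -1 < β) {s t c : ℝ}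
    (hs : 0 ≤ s) (hst : s ≤ t) (ht : t ≤ Real.pi) (h : ∀ x ∈ Ioo s t, c ≤ psi α β x ^ 2) :
    (t - s) * c ≤ ∫ x in Ioo s t, psi α β x ^ 2 := by
  have hsub : Ioo s t ⊆ Ioo 0 Real.pi := Ioo_subset_Ioo hs ht
  have := setIntegral_mono_on (f := fun _ => c) (integrableOn_const (by simp))
    ((integrableOn_psi_sq hα hβ).mono_set hsub) measurableSet_Ioo h
  simpa [Measure.real, hst] using this

/-- The weight at the smaller point is controlled by the weight at the larger one. -/
theorem psi_le_of_sq {x y C r a : ℝ} (hy : 0 ≤ y) (hC : 0 ≤ C) (hr : 0 < r)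
    (h : x ^ 2 ≤ C * r ^ (2 * a) * y ^ 2) : x ≤ Real.sqrt C * r ^ a * y := by
  have hra := Real.rpow_nonneg hr.le a
  refine (abs_le_of_sq_le_sq' ?_ (by positivity)).2
  rwa [mul_pow, mul_pow, Real.sq_sqrt hC, ← Real.rpow_mul_natCast hr.le, Nat.cast_two, mul_comm a]

/-- The mass bound is used on the right half of `(θ, φ)`, where `psi²` is at least a multiple of
`psi² φ`; it bounds `green * psi² φ` by a multiple of `1/((φ-θ) m)`. One factor `psi θ` is then
replaced by `psi φ` at the cost `(φ/θ)^a`. -/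
theorem exists_resKer_le_far {α β a : ℝ} (hα : -1 < α) (hβ : -1 < β)
    (ha : -(2 * α + 1) ≤ 2 * a) :
    ∃ C : ℝ, 0 < C ∧ ∀ m θ φ : ℝ, 0 < m → 0 < θ → θ < φ → φ ≤ 7 * Real.pi / 8 →
      resKer α β m θ φ ≤ C * (φ / θ) ^ a / ((φ - θ) * m) := by
  obtain ⟨C1, hC1, h1⟩ := exists_psi_sq_le_of_le β ha
  obtain ⟨C2, hC2, h2⟩ := exists_psi_sq_le_of_half_le α β
  refine ⟨Real.sqrt C1 * (2 * C2), by positivity, fun m θ φ hm hθ hθφ hφ => ?_⟩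
  have hπ := Real.pi_pos
  have hφI : φ ∈ Ioo 0 Real.pi := ⟨by linarith, by linarith⟩
  have hθI : θ ∈ Ioo 0 Real.pi := ⟨by linarith, by linarith⟩
  have hφ0 : 0 < φ := hφI.1
  have pθ := psi_pos α β hθI
  have pφ := psi_pos α β hφI
  have k1 := psi_le_of_sq pφ.le (by linarith) (by positivity : 0 < φ / θ)
    (h1 θ φ hθ hθφ.le hφ)
  have k2 : (φ - (θ + φ) / 2) * (psi α β φ ^ 2 / C2) ≤ ∫ x in Ioo ((θ + φ) / 2) φ, psi α β x ^ 2 :=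
    mul_le_setIntegral_psi_sq hα hβ (by linarith) (by linarith) hφI.2.le fun x hx => by
      rw [div_le_iff₀ (by linarith), mul_comm]
      exact h2 x φ hφI.1 (by linarith [hx.1]) hx.2.le hφ
  have k3 := green_mul_integral_le hα hβ hm hθ (s := (θ + φ) / 2) (by linarith) hφI.2
  have gpos := green_pos hα hβ hm hθI hφI
  have k4 : green α β m θ φ * ((φ - θ) / 2 * (psi α β φ ^ 2 / C2)) ≤ 1 / m := by
    refine le_trans (mul_le_mul_of_nonneg_left (le_of_eq_of_le ?_ k2) gpos.le) k3
    ring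
  have hd : 0 < φ - θ := by linarith
  have k5 : green α β m θ φ * psi α β φ ^ 2 ≤ 2 * C2 / ((φ - θ) * m) := by
    rw [le_div_iff₀ (by positivity)]
    rw [le_div_iff₀ hm] at k4
    have : green α β m θ φ * ((φ - θ) / 2 * (psi α β φ ^ 2 / C2)) * m =
      green α β m θ φ * psi α β φ ^ 2 * ((φ - θ) * m) / (2 * C2) := by field_simp
    rw [this, div_le_one (by positivity)] at k4
    exact k4
  calc resKer α β m θ φ ≤ (Real.sqrt C1 * (φ / θ) ^ a * psi α β φ) * psi α β φ *
        green α β m θ φ := by unfold resKer; gcongr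
    _ = (Real.sqrt C1 * (φ / θ) ^ a) * (green α β m θ φ * psi α β φ ^ 2) := by ring
    _ ≤ (Real.sqrt C1 * (φ / θ) ^ a) * (2 * C2 / ((φ - θ) * m)) := by gcongr
    _ = _ := by ring

/-- The scale `r` is of order `m^{-1/2}`. For `φ - θ ≤ r` the value at `φ` is the value at `φ + r`,
bounded by mass, plus the increment over `(φ, φ+r)`, bounded by the slope. Both are of order `r /
psi² φ`, up to the loss incurred in comparing the weight on `(φ, φ+r)` with its value at `φ`. -/
theorem exists_resKer_le_near {α β a κ : ℝ} (hα : -1 < α) (hβ : -1 < β) (hκ : 0 < κ)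
    (ha0 : 0 ≤ a) (ha : -(2 * α + 1) ≤ 2 * a) :
    ∃ C : ℝ, 0 < C ∧ ∀ m θ φ r : ℝ, κ ≤ m → 0 < θ → θ < φ → φ ≤ 3 * Real.pi / 4 →
      r = Real.pi / 8 * Real.sqrt (κ / m) → φ - θ ≤ r →
      resKer α β m θ φ ≤ C * (φ / θ) ^ a * (r * (r / (φ - θ)) ^ (2 * a)) := by
  obtain ⟨C1, hC1, h1⟩ := exists_psi_sq_le_of_le β ha
  have hπ := Real.pi_pos
  have hC10 : 0 < C1 := by linarith
  set A : ℝ := 64 / (Real.pi ^ 2 * κ) + 1 with hA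
  refine ⟨Real.sqrt C1 * (C1 * 2 ^ (2 * a) * A), by positivity,
    fun m θ φ r hm hθ hθφ hφ hr hdr => ?_⟩
  have hm0 : 0 < m := hκ.trans_le hm
  have hr0 : 0 < r := by rw [hr]; positivity
  have hr1 : r ≤ Real.pi / 8 := by
    rw [hr]
    have : Real.sqrt (κ / m) ≤ 1 := Real.sqrt_le_one.mpr ((div_le_one hm0).mpr hm)
    nlinarith
  -- Since `r²` is a fixed multiple of `1/m`, the mass bound `1/(m r)` is of the same order `r` as
  -- the increment.
  have hmr : 1 / (m * r) = 64 / (Real.pi ^ 2 * κ) * r := by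
    have : r ^ 2 = Real.pi ^ 2 / 64 * (κ / m) := by
      rw [hr, mul_pow, Real.sq_sqrt (by positivity)]; ring
    rw [div_eq_iff (by positivity)]
    calc (1 : ℝ) = 64 / (Real.pi ^ 2 * κ) * m * (Real.pi ^ 2 / 64 * (κ / m)) := by field_simp
      _ = _ := by rw [← this]; ring
  have hφI : φ ∈ Ioo 0 Real.pi := ⟨by linarith, by linarith⟩
  have hθI : θ ∈ Ioo 0 Real.pi := ⟨by linarith, by linarith⟩
  have hφ0 : 0 < φ := hφI.1
  have hφrI : φ + r ∈ Ioo 0 Real.pi := ⟨by linarith, by linarith⟩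
  have pθ := psi_pos α β hθI
  have pφ := psi_pos α β hφI
  have hd : 0 < φ - θ := by linarith
  set B : ℝ := (2 * (r / (φ - θ))) ^ (2 * a) with hB
  have hB0 : 0 < B := by positivity
  -- For `x` in this interval, `x/φ ≤ 1 + r/φ ≤ 2 r/(φ-θ)`, because `φ - θ` is at most both `φ` and
  -- `r`. This produces the factor `B`.
  have k0 : ∀ x ∈ Ioo φ (φ + r), psi α β φ ^ 2 / (C1 * B) ≤ psi α β x ^ 2 := by
    intro x hx
    have := h1 φ x hφI.1 hx.1.le (by linarith [hx.2])
    rw [div_le_iff₀ (by positivity)]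
    refine this.trans ?_
    have hq : x / φ ≤ 2 * (r / (φ - θ)) := by
      have e1 : x / φ ≤ 1 + r / φ := by
        rw [div_le_iff₀ hφI.1, add_mul, div_mul_cancel₀ _ hφI.1.ne']; linarith [hx.2]
      have e2 : r / φ ≤ r / (φ - θ) := div_le_div_of_nonneg_left hr0.le hd (by linarith)
      have e3 : 1 ≤ r / (φ - θ) := (one_le_div hd).mpr hdr
      linarith
    have : (x / φ) ^ (2 * a) ≤ B :=
      Real.rpow_le_rpow (div_nonneg (by linarith [hx.1, hφI.1]) hφI.1.le) hq (by linarith)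
    calc C1 * (x / φ) ^ (2 * a) * psi α β x ^ 2 ≤ C1 * B * psi α β x ^ 2 := by gcongr
      _ = _ := by ring
  have k1 := psi_le_of_sq pφ.le (by linarith) (by positivity : 0 < φ / θ)
    (h1 θ φ hθ hθφ.le (by linarith))
  have k2 : (φ + r - φ) * (psi α β φ ^ 2 / (C1 * B)) ≤ ∫ x in Ioo φ (φ + r), psi α β x ^ 2 :=
    mul_le_setIntegral_psi_sq hα hβ hφI.1.le (by linarith) hφrI.2.le k0
  have k3 := green_mul_integral_le hα hβ hm0 hθ (s := φ) hθφ.le hφrI.2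
  have k3' : green α β m θ (φ + r) ≤ C1 * B / psi α β φ ^ 2 * (1 / (m * r)) := by
    have gpos := green_pos hα hβ hm0 hθI hφrI
    have := (mul_le_mul_of_nonneg_left k2 gpos.le).trans k3
    rw [le_div_iff₀ hm0] at this
    rw [div_mul_div_comm, le_div_iff₀ (by positivity)]
    have e : green α β m θ (φ + r) * ((φ + r - φ) * (psi α β φ ^ 2 / (C1 * B))) * m =
      green α β m θ (φ + r) * (psi α β φ ^ 2 * (m * r)) / (C1 * B) := by field_simp; ring
    rw [e, div_le_one (by positivity)] at this
    linarith
  obtain ⟨ξ, hξ, k4⟩ := exists_green_sub_le hα hβ hm0 hθ hθφ.le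
    (show φ < φ + r by linarith) hφrI.2
  have k5 : (φ + r - φ) / psi α β ξ ^ 2 ≤ C1 * B / psi α β φ ^ 2 * r := by
    rw [add_sub_cancel_left]
    calc r / psi α β ξ ^ 2 ≤ r / (psi α β φ ^ 2 / (C1 * B)) :=
          div_le_div_of_nonneg_left hr0.le (by positivity) (k0 ξ hξ)
      _ = _ := by field_simp
  have k6 : green α β m θ φ ≤ C1 * B / psi α β φ ^ 2 * (A * r) := by
    rw [hmr] at k3'
    calc green α β m θ φ ≤ C1 * B / psi α β φ ^ 2 * (64 / (Real.pi ^ 2 * κ) * r) +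
          C1 * B / psi α β φ ^ 2 * r := by linarith
      _ = _ := by rw [hA]; ring
  have hB' : B = 2 ^ (2 * a) * (r / (φ - θ)) ^ (2 * a) := by
    rw [hB, Real.mul_rpow (by norm_num) (by positivity)]
  have gpos := green_pos hα hβ hm0 hθI hφI
  calc resKer α β m θ φ ≤ (Real.sqrt C1 * (φ / θ) ^ a * psi α β φ) * psi α β φ *
        (C1 * B / psi α β φ ^ 2 * (A * r)) := by unfold resKer; gcongr
    _ = (Real.sqrt C1 * (φ / θ) ^ a) * (C1 * B * (A * r)) := by field_simp
    _ = _ := by rw [hB']; ring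

/-- Two bounds that together control the resolvent kernel, uniformly in the spectral parameter,
away from the right end point. -/
theorem exists_resKer_le {α β a κ : ℝ} (hα : -1 < α) (hβ : -1 < β) (hκ : 0 < κ)
    (ha0 : 0 ≤ a) (ha1 : a < 1 / 2) (ha : -(2 * α + 1) ≤ 2 * a) :
    ∃ C : ℝ, 0 < C ∧ ∀ m θ φ : ℝ, κ ≤ m → 0 < θ → θ < φ → φ ≤ 3 * Real.pi / 4 →
      resKer α β m θ φ ≤ C * ((φ / θ) ^ a * (φ - θ)⁻¹) * m⁻¹ *
        min 1 (((φ - θ) ^ 2 * m) ^ (1 / 2 - a)) := by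
  obtain ⟨C1, hC1, h1⟩ := exists_resKer_le_far hα hβ ha
  obtain ⟨C2, hC2, h2⟩ := exists_resKer_le_near hα hβ hκ ha0 ha
  have hπ := Real.pi_pos
  set b : ℝ := Real.pi ^ 2 / 64 * κ with hb
  have hb0 : 0 < b := by positivity
  set γ : ℝ := 1 / 2 - a with hγ
  have hγ0 : 0 < γ := by rw [hγ]; linarith
  have hbγ : 0 < b ^ (-γ) := by positivity
  -- The three summands serve the bound without decay in `d² m`, the case `d > r` (where `(d/r)^{2γ}
  -- ≥ 1` is inserted for free) and the case `d ≤ r`. The conversion rests on `r² = b/m`.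
  refine ⟨C1 + C1 * b ^ (-γ) + C2 * (b * b ^ (-γ)), by positivity,
    fun m θ φ hm hθ hθφ hφ => ?_⟩
  have hm0 : 0 < m := hκ.trans_le hm
  have hd : 0 < φ - θ := by linarith
  have hq : 0 < (φ / θ) ^ a := Real.rpow_pos_of_pos (div_pos (by linarith) hθ) _
  have far := h1 m θ φ hm0 hθ hθφ (by linarith)
  have far' : resKer α β m θ φ ≤ C1 * ((φ / θ) ^ a * (φ - θ)⁻¹ * m⁻¹) :=
    far.trans_eq (by field_simp)
  set d := φ - θ with hdd
  set q := (φ / θ) ^ a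
  have hbase : 0 < q * d⁻¹ * m⁻¹ := by positivity
  rw [mul_min_of_nonneg _ _ (by positivity)]
  refine le_min ?_ ?_
  · calc _ ≤ C1 * (q * d⁻¹ * m⁻¹) := far'
      _ ≤ (C1 + C1 * b ^ (-γ) + C2 * (b * b ^ (-γ))) * (q * d⁻¹ * m⁻¹) := by
        refine mul_le_mul_of_nonneg_right ?_ hbase.le
        have := mul_pos hC1 hbγ
        have := mul_pos hC2 (mul_pos hb0 hbγ)
        linarith
      _ = _ := by ring
  set r := Real.pi / 8 * Real.sqrt (κ / m) with hr
  have hr0 : 0 < r := by rw [hr]; positivity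
  have hr2 : r ^ 2 = b * m⁻¹ := by
    rw [hr, mul_pow, Real.sq_sqrt (by positivity), hb]; field_simp; norm_num
  have hX : 0 < (d ^ 2 * m) ^ γ := by positivity
  have hbX : b ^ (-γ) * (d ^ 2 * m) ^ γ = (d / r) ^ (2 * γ) := by
    rw [Real.rpow_neg hb0.le, ← Real.inv_rpow hb0.le, ← Real.mul_rpow (by positivity) (by positivity),
      Real.rpow_mul (by positivity), Real.rpow_two, div_pow, hr2]
    congr 1
    field_simp
  rcases le_or_gt d r with hdr | hdr
  · have near := h2 m θ φ r hm hθ hθφ hφ rfl hdr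
    calc _ ≤ C2 * q * (r * (r / d) ^ (2 * a)) := near
      _ = C2 * (b * b ^ (-γ)) * (q * d⁻¹ * m⁻¹ * (d ^ 2 * m) ^ γ) := by
        have e : (r / d) ^ (2 * a) = r / d * (d / r) ^ (2 * γ) := by
          rw [show 2 * γ = 1 - 2 * a by rw [hγ]; ring, Real.rpow_sub (by positivity), Real.rpow_one,
            ← inv_div r d, Real.inv_rpow (by positivity)]
          field_simp
        rw [e, ← hbX]
        have : r * r = b * m⁻¹ := by rw [← hr2]; ring
        calc C2 * q * (r * (r / d * (b ^ (-γ) * (d ^ 2 * m) ^ γ))) =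
            C2 * q * ((r * r) * d⁻¹ * (b ^ (-γ) * (d ^ 2 * m) ^ γ)) := by ring
          _ = _ := by rw [this]; ring
      _ ≤ (C1 + C1 * b ^ (-γ) + C2 * (b * b ^ (-γ))) * (q * d⁻¹ * m⁻¹ * (d ^ 2 * m) ^ γ) := by
        refine mul_le_mul_of_nonneg_right ?_ (by positivity)
        have := mul_pos hC1 hbγ
        linarith
      _ = _ := by ring
  · have h1' : 1 ≤ b ^ (-γ) * (d ^ 2 * m) ^ γ := by
      rw [hbX]
      exact Real.one_le_rpow ((one_le_div hr0).mpr hdr.le) (by linarith)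
    calc _ ≤ C1 * (q * d⁻¹ * m⁻¹) := far'
      _ ≤ C1 * (q * d⁻¹ * m⁻¹) * (b ^ (-γ) * (d ^ 2 * m) ^ γ) :=
        le_mul_of_one_le_right (by positivity) h1'
      _ = C1 * b ^ (-γ) * (q * d⁻¹ * m⁻¹ * (d ^ 2 * m) ^ γ) := by ring
      _ ≤ (C1 + C1 * b ^ (-γ) + C2 * (b * b ^ (-γ))) * (q * d⁻¹ * m⁻¹ * (d ^ 2 * m) ^ γ) := by
        refine mul_le_mul_of_nonneg_right ?_ (by positivity)
        have := mul_pos hC2 (mul_pos hb0 hbγ)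
        linarith
      _ = _ := by ring

/-- When the points lie near opposite ends, the interval `(π/4, 3π/4)` between them carries a fixed
positive mass of `psi²`, so the mass bound alone gives `green ≤ I⁻¹ m⁻¹`. -/
theorem exists_resKer_le_corner {α β : ℝ} (hα : -1 < α) (hβ : -1 < β) :
    ∃ C : ℝ, 0 < C ∧ ∀ m θ φ : ℝ, 0 < m → 0 < θ → θ ≤ Real.pi / 4 → 3 * Real.pi / 4 ≤ φ →
      φ < Real.pi → resKer α β m θ φ ≤ C * (psi α β θ * psi α β φ) * m⁻¹ := by
  have hπ := Real.pi_pos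
  set I : ℝ := ∫ x in Ioo (Real.pi / 4) (3 * Real.pi / 4), psi α β x ^ 2 with hI
  have hsub : Ioo (Real.pi / 4) (3 * Real.pi / 4) ⊆ Ioo 0 Real.pi :=
    Ioo_subset_Ioo (by linarith) (by linarith)
  have hI0 : 0 < I := by
    rw [hI, setIntegral_pos_iff_support_of_nonneg_ae
      (Eventually.of_forall fun x => sq_nonneg _) ((integrableOn_psi_sq hα hβ).mono_set hsub)]
    have : Ioo (Real.pi / 4) (3 * Real.pi / 4) ⊆
        Function.support (fun x => psi α β x ^ 2) ∩ Ioo (Real.pi / 4) (3 * Real.pi / 4) :=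
      fun x hx => ⟨(pow_pos (psi_pos α β (hsub hx)) 2).ne', hx⟩
    refine lt_of_lt_of_le ?_ (measure_mono this)
    rw [Real.volume_Ioo, ENNReal.ofReal_pos]
    linarith
  refine ⟨I⁻¹, by positivity, fun m θ φ hm hθ h1 h2 h3 => ?_⟩
  have hθI : θ ∈ Ioo 0 Real.pi := ⟨hθ, by linarith⟩
  have hφI : φ ∈ Ioo 0 Real.pi := ⟨by linarith, h3⟩
  have k := green_mul_integral_le hα hβ hm hθ h1 h3
  have k2 : I ≤ ∫ x in Ioo (Real.pi / 4) φ, psi α β x ^ 2 :=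
    setIntegral_mono_set ((integrableOn_psi_sq hα hβ).mono_set
      (Ioo_subset_Ioo (by linarith) h3.le)) (Eventually.of_forall fun x => sq_nonneg _)
      (Ioo_subset_Ioo_right h2).eventuallyLE
  have gpos := green_pos hα hβ hm hθI hφI
  have k3 : green α β m θ φ ≤ I⁻¹ * m⁻¹ := by
    have := (mul_le_mul_of_nonneg_left k2 gpos.le).trans k
    rw [← mul_inv, ← one_div, le_div_iff₀ (by positivity), ← mul_assoc]
    rwa [le_div_iff₀ hm] at this
  have := psi_pos α β hθI
  have := psi_pos α β hφI
  calc resKer α β m θ φ ≤ psi α β θ * psi α β φ * (I⁻¹ * m⁻¹) := by unfold resKer; gcongr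
    _ = _ := by ring

end
end SymmJacobi

namespace SymmJacobi
noncomputable section

/-! ### Fractional powers via the resolvent -/

/-- The normalizing constant in Balakrishnan's formula for fractional powers. -/
def potConst (σ : ℝ) : ℝ := ∫ μ in Ioi (0 : ℝ), μ ^ (-σ) * (1 + μ)⁻¹

theorem integrableOn_rpow_mul_inv {σ t : ℝ} (h0 : 0 < σ) (h1 : σ < 1) (ht : 0 < t) :
    IntegrableOn (fun μ : ℝ => μ ^ (-σ) * (t + μ)⁻¹) (Ioi 0) := by
  have hm : Measurable (fun μ : ℝ => μ ^ (-σ) * (t + μ)⁻¹) := by fun_prop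
  have i1 : IntegrableOn (fun μ : ℝ => μ ^ (-σ) * (t + μ)⁻¹) (Ioc 0 1) := by
    have := intervalIntegral.intervalIntegrable_rpow' (r := -σ) (a := 0) (b := 1) (by linarith)
    rw [intervalIntegrable_iff_integrableOn_Ioc_of_le zero_le_one] at this
    refine (this.mul_const t⁻¹).mono' hm.aestronglyMeasurable ?_
    refine (ae_restrict_iff' measurableSet_Ioc).mpr (Eventually.of_forall fun μ hμ => ?_)
    have hμ0 : 0 < μ := hμ.1
    rw [Real.norm_of_nonneg (by positivity)]
    gcongr
    linarith
  have i2 : IntegrableOn (fun μ : ℝ => μ ^ (-σ) * (t + μ)⁻¹) (Ioi 1) := by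
    have := integrableOn_Ioi_rpow_of_lt (a := -σ - 1) (by linarith) one_pos
    refine this.mono' hm.aestronglyMeasurable ?_
    refine (ae_restrict_iff' measurableSet_Ioi).mpr (Eventually.of_forall fun μ hμ => ?_)
    have hμ0 : (0 : ℝ) < μ := one_pos.trans hμ
    rw [Real.norm_of_nonneg (by positivity), Real.rpow_sub_one hμ0.ne', div_eq_mul_inv]
    gcongr
    linarith
  rw [← Ioc_union_Ioi_eq_Ioi zero_le_one]
  exact i1.union i2

theorem potConst_pos {σ : ℝ} (h0 : 0 < σ) (h1 : σ < 1) : 0 < potConst σ := by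
  rw [potConst, setIntegral_pos_iff_support_of_nonneg_ae _ (integrableOn_rpow_mul_inv h0 h1 one_pos)]
  · have : Ioi (0 : ℝ) ⊆ Function.support (fun μ : ℝ => μ ^ (-σ) * (1 + μ)⁻¹) ∩ Ioi 0 := fun μ hμ => by
      have hμ0 : (0 : ℝ) < μ := hμ
      exact ⟨(by positivity : μ ^ (-σ) * (1 + μ)⁻¹ ≠ 0), hμ⟩
    refine lt_of_lt_of_le ?_ (measure_mono this)
    simp
  · refine (ae_restrict_iff' measurableSet_Ioi).mpr (Eventually.of_forall fun μ hμ => ?_)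
    have hμ0 : (0 : ℝ) < μ := hμ
    simp only [Pi.zero_apply]
    positivity

theorem integral_rpow_mul_inv (σ : ℝ) {t : ℝ} (ht : 0 < t) :
    ∫ μ in Ioi (0 : ℝ), μ ^ (-σ) * (t + μ)⁻¹ = potConst σ * t ^ (-σ) := by
  have h := integral_comp_mul_left_Ioi (fun μ : ℝ => μ ^ (-σ) * (t + μ)⁻¹) 0 ht
  rw [mul_zero, smul_eq_mul] at h
  have e : ∫ μ in Ioi (0 : ℝ), (t * μ) ^ (-σ) * (t + t * μ)⁻¹ =
      t ^ (-σ) * t⁻¹ * potConst σ := by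
    rw [potConst, ← integral_const_mul]
    refine setIntegral_congr_fun measurableSet_Ioi fun μ hμ => ?_
    have hμ0 : (0 : ℝ) < μ := hμ
    rw [Real.mul_rpow ht.le hμ0.le, show t + t * μ = t * (1 + μ) by ring, mul_inv]
    ring
  rw [e] at h
  have ht' := ht.ne'
  have h2 := congrArg (t * ·) h
  rw [← mul_assoc t t⁻¹, mul_inv_cancel₀ ht', one_mul] at h2
  rw [← h2]
  field_simp

/-- The kernel of `(J + κ)^{-σ}` for `0 < σ < 1`. -/
def potKer (α β κ σ θ φ : ℝ) : ℝ :=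
  (potConst σ)⁻¹ * ∫ μ in Ioi (0 : ℝ), μ ^ (-σ) * resKer α β (κ + μ) θ φ

theorem measurable_wronsk (α β : ℝ) : Measurable (wronsk α β) := by
  have hc : ∀ c : ℝ, Measurable (fun m : ℝ => (m, c)) := fun c =>
    measurable_id.prodMk measurable_const
  have k1 : ∀ a b c : ℝ, Measurable (fun m => sol a b m c) := fun a b c =>
    (measurable_sol (α := a) (β := b)).comp (hc c)
  have k2 : ∀ a b c : ℝ, Measurable (fun m => solD a b m c) := fun a b c =>
    (measurable_solD (α := a) (β := b)).comp (hc c)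
  unfold wronsk wronskFun
  exact (((k2 _ _ _).mul (k1 _ _ _)).add ((k1 _ _ _).mul (k2 _ _ _))).const_mul _

theorem measurable_resKer (α β : ℝ) {X : Type*} [MeasurableSpace X] {m θ φ : X → ℝ}
    (hm : Measurable m) (hθ : Measurable θ) (hφ : Measurable φ) :
    Measurable (fun x => resKer α β (m x) (θ x) (φ x)) := by
  have m1 : Measurable (fun x => sol α β (m x) (hs (min (θ x) (φ x)))) :=
    measurable_sol.comp (hm.prodMk (continuous_hs.measurable.comp (hθ.min hφ)))
  have m2 : Measurable (fun x => sol β α (m x) (1 - hs (max (θ x) (φ x)))) :=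
    measurable_sol.comp (hm.prodMk
      (measurable_const.sub (continuous_hs.measurable.comp (hθ.max hφ))))
  have m3 : Measurable (fun x => wronsk α β (m x)) := (measurable_wronsk α β).comp hm
  have m4 : Measurable (fun x => psi α β (θ x)) := (measurable_psi α β).comp hθ
  have m5 : Measurable (fun x => psi α β (φ x)) := (measurable_psi α β).comp hφ
  unfold resKer green
  exact (m4.mul m5).mul ((m1.mul m2).div m3)

theorem measurable_rpow_mul_resKer (α β κ σ : ℝ) {X : Type*} [MeasurableSpace X] {μ θ φ : X → ℝ}
    (hμ : Measurable μ) (hθ : Measurable θ) (hφ : Measurable φ) :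
    Measurable (fun x => μ x ^ (-σ) * resKer α β (κ + μ x) (θ x) (φ x)) :=
  (hμ.pow_const _).mul (measurable_resKer α β (hμ.const_add κ) hθ hφ)

theorem measurable_potKer (α β κ σ : ℝ) :
    Measurable (fun z : ℝ × ℝ => potKer α β κ σ z.1 z.2) := by
  unfold potKer
  have h := measurable_rpow_mul_resKer α β κ σ (X := (ℝ × ℝ) × ℝ) (μ := fun z => z.2)
    (θ := fun z => z.1.1) (φ := fun z => z.1.2) measurable_snd measurable_fst.fst measurable_fst.snd
  exact (h.stronglyMeasurable.integral_prod_right'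
    (ν := volume.restrict (Ioi 0))).measurable.const_mul _

theorem potKer_comm (α β κ σ θ φ : ℝ) : potKer α β κ σ θ φ = potKer α β κ σ φ θ := by
  simp only [potKer, resKer_comm]

section
variable {α β κ σ : ℝ}

theorem rpow_mul_resKer_nonneg (hα : -1 < α) (hβ : -1 < β) (hκ : 0 < κ) {θ φ μ : ℝ}
    (hθ : θ ∈ Ioo 0 Real.pi) (hφ : φ ∈ Ioo 0 Real.pi) (hμ : 0 < μ) :
    0 ≤ μ ^ (-σ) * resKer α β (κ + μ) θ φ :=
  mul_nonneg (Real.rpow_nonneg hμ.le _) (resKer_pos hα hβ (by linarith) hθ hφ).le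

theorem potKer_nonneg (hα : -1 < α) (hβ : -1 < β) (hκ : 0 < κ) (h0 : 0 < σ) (h1 : σ < 1) {θ φ : ℝ}
    (hθ : θ ∈ Ioo 0 Real.pi) (hφ : φ ∈ Ioo 0 Real.pi) : 0 ≤ potKer α β κ σ θ φ :=
  mul_nonneg (inv_nonneg.mpr (potConst_pos h0 h1).le)
    (setIntegral_nonneg measurableSet_Ioi fun _ hμ =>
      rpow_mul_resKer_nonneg hα hβ hκ hθ hφ hμ)

end

/-! ### The kernel acting on functions dominated by the weight -/

section
variable {α β κ σ : ℝ}

/-- A constant function of `x` is annihilated by the Jacobi operator, so `psi` is an eigenfunction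
of the resolvent. This makes multiples of `psi` the natural dominating functions. -/
theorem integral_resKer_psi (hα : -1 < α) (hβ : -1 < β) {m : ℝ} (hm : 0 < m) {θ : ℝ}
    (hθ : θ ∈ Ioo 0 Real.pi) :
    IntegrableOn (fun t => resKer α β m θ t * psi α β t) (Ioo 0 Real.pi) ∧
    ∫ t in Ioo 0 Real.pi, resKer α β m θ t * psi α β t = psi α β θ * m⁻¹ := by
  have h := integral_resKer (f := fun _ => m⁻¹) (f' := fun _ => 0) (f'' := fun _ => 0)
    hα hβ hm (fun x => hasDerivAt_const x _) (fun x => hasDerivAt_const x _) continuous_const hθ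
  simpa [jacOp, hm.ne'] using h

/-- After domination by `M * psi`, the inner integral is at most `M psi(θ) μ^{-σ} / (κ+μ)`, which is
integrable in `μ` exactly because `0 < σ < 1`. -/
theorem integrable_prod_resKer (hα : -1 < α) (hβ : -1 < β) (hκ : 0 < κ) (h0 : 0 < σ) (h1 : σ < 1)
    {g : ℝ → ℝ} (hg : Measurable g) {M : ℝ} (hM : ∀ t ∈ Ioo 0 Real.pi, |g t| ≤ M * psi α β t)
    {θ : ℝ} (hθ : θ ∈ Ioo 0 Real.pi) :
    Integrable (fun z : ℝ × ℝ => z.2 ^ (-σ) * resKer α β (κ + z.2) θ z.1 * g z.1)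
      ((volume.restrict (Ioo 0 Real.pi)).prod (volume.restrict (Ioi 0))) := by
  have hmeas : Measurable (fun z : ℝ × ℝ => z.2 ^ (-σ) * resKer α β (κ + z.2) θ z.1 * g z.1) := by
    refine Measurable.mul ?_ (hg.comp measurable_fst)
    exact measurable_rpow_mul_resKer α β κ σ measurable_snd measurable_const measurable_fst
  have hbd : ∀ μ ∈ Ioi (0 : ℝ), ∀ t ∈ Ioo 0 Real.pi, ‖μ ^ (-σ) * resKer α β (κ + μ) θ t * g t‖ ≤
      M * μ ^ (-σ) * (resKer α β (κ + μ) θ t * psi α β t) := fun μ hμ t ht => by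
    have := rpow_mul_resKer_nonneg (σ := σ) hα hβ hκ hθ ht hμ
    rw [norm_mul, Real.norm_of_nonneg this, Real.norm_eq_abs]
    calc _ ≤ μ ^ (-σ) * resKer α β (κ + μ) θ t * (M * psi α β t) :=
          mul_le_mul_of_nonneg_left (hM t ht) this
      _ = _ := by ring
  have hi : ∀ μ ∈ Ioi (0 : ℝ), IntegrableOn
      (fun t => μ ^ (-σ) * resKer α β (κ + μ) θ t * g t) (Ioo 0 Real.pi) := fun μ hμ => by
    have hμ' : (0 : ℝ) < μ := hμ
    refine ((integral_resKer_psi hα hβ (by linarith : 0 < κ + μ) hθ).1.const_mul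
      (M * μ ^ (-σ))).mono' ?_ ?_
    · exact (hmeas.comp measurable_prodMk_right).aestronglyMeasurable
    · exact (ae_restrict_iff' measurableSet_Ioo).mpr (Eventually.of_forall (hbd μ hμ))
  rw [integrable_prod_iff' hmeas.aestronglyMeasurable]
  refine ⟨(ae_restrict_iff' measurableSet_Ioi).mpr (Eventually.of_forall hi), ?_⟩
  refine ((integrableOn_rpow_mul_inv h0 h1 hκ).const_mul (M * psi α β θ)).mono' ?_ ?_
  · exact (hmeas.norm.stronglyMeasurable.integral_prod_left'
      (μ := volume.restrict (Ioo 0 Real.pi))).aestronglyMeasurable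
  · refine (ae_restrict_iff' measurableSet_Ioi).mpr (Eventually.of_forall fun μ hμ => ?_)
    have hμ' : (0 : ℝ) < μ := hμ
    obtain ⟨j, e⟩ := integral_resKer_psi hα hβ (by linarith : 0 < κ + μ) hθ
    rw [Real.norm_of_nonneg (integral_nonneg fun _ => norm_nonneg _)]
    calc ∫ t in Ioo 0 Real.pi, ‖μ ^ (-σ) * resKer α β (κ + μ) θ t * g t‖
        ≤ ∫ t in Ioo 0 Real.pi, M * μ ^ (-σ) * (resKer α β (κ + μ) θ t * psi α β t) :=
          setIntegral_mono_on (hi μ hμ).norm (j.const_mul _) measurableSet_Ioo (hbd μ hμ)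
      _ = _ := by rw [integral_const_mul, e]; ring

theorem integral_potKer_eq (hα : -1 < α) (hβ : -1 < β) (hκ : 0 < κ) (h0 : 0 < σ) (h1 : σ < 1)
    {g : ℝ → ℝ} (hg : Measurable g) {M : ℝ} (hM : ∀ t ∈ Ioo 0 Real.pi, |g t| ≤ M * psi α β t)
    {θ : ℝ} (hθ : θ ∈ Ioo 0 Real.pi) :
    IntegrableOn (fun t => potKer α β κ σ θ t * g t) (Ioo 0 Real.pi) ∧
    IntegrableOn (fun μ => μ ^ (-σ) * ∫ t in Ioo 0 Real.pi, resKer α β (κ + μ) θ t * g t) (Ioi 0) ∧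
    ∫ t in Ioo 0 Real.pi, potKer α β κ σ θ t * g t =
      (potConst σ)⁻¹ * ∫ μ in Ioi (0 : ℝ), μ ^ (-σ) *
        ∫ t in Ioo 0 Real.pi, resKer α β (κ + μ) θ t * g t := by
  have hint := integrable_prod_resKer (κ := κ) (σ := σ) hα hβ hκ h0 h1 hg hM hθ
  have e1 : ∀ t, potKer α β κ σ θ t * g t = (potConst σ)⁻¹ *
      ∫ μ in Ioi (0 : ℝ), μ ^ (-σ) * resKer α β (κ + μ) θ t * g t := fun t => by
    rw [potKer, integral_mul_const, mul_assoc]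
  have e2 : ∀ μ : ℝ, (μ ^ (-σ) * ∫ t in Ioo 0 Real.pi, resKer α β (κ + μ) θ t * g t) =
      ∫ t in Ioo 0 Real.pi, μ ^ (-σ) * resKer α β (κ + μ) θ t * g t := fun μ => by
    rw [← integral_const_mul]; simp only [mul_assoc]
  simp only [e1, e2]
  refine ⟨hint.integral_prod_left.const_mul _, hint.integral_prod_right, ?_⟩
  rw [integral_const_mul, integral_integral_swap hint]

/-- The potential kernel acts on `psi * f`, where `f` is an eigenfunction of the Jacobi operator, as
multiplication by the expected power. -/
theorem integral_potKer_eigen (hα : -1 < α) (hβ : -1 < β) (hκ : 0 < κ) (h0 : 0 < σ) (h1 : σ < 1)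
    {f f' f'' : ℝ → ℝ} (hf : ∀ x, HasDerivAt f (f' x) x) (hf' : ∀ x, HasDerivAt f' (f'' x) x)
    (hf'' : Continuous f'') {η : ℝ} (hη : 0 ≤ η) (heig : ∀ x, jacOp α β f' f'' x = -η * f x)
    {θ : ℝ} (hθ : θ ∈ Ioo 0 Real.pi) :
    IntegrableOn (fun t => potKer α β κ σ θ t * (psi α β t * f (hs t))) (Ioo 0 Real.pi) ∧
    ∫ t in Ioo 0 Real.pi, potKer α β κ σ θ t * (psi α β t * f (hs t)) =
      (κ + η) ^ (-σ) * (psi α β θ * f (hs θ)) := by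
  have cf : Continuous f := continuous_iff_continuousAt.mpr fun x => (hf x).continuousAt
  obtain ⟨M, hM⟩ := (isCompact_Icc (a := (0 : ℝ)) (b := 1)).exists_bound_of_continuousOn
    cf.continuousOn
  have hM' : ∀ t ∈ Ioo 0 Real.pi, |psi α β t * f (hs t)| ≤ M * psi α β t := fun t ht => by
    have := psi_pos α β ht
    rw [abs_mul, abs_of_pos this, mul_comm]
    exact mul_le_mul_of_nonneg_right (hM _ ⟨hs_nonneg t, hs_le_one t⟩) this.le
  obtain ⟨i, -, e⟩ := integral_potKer_eq (κ := κ) (σ := σ) (g := fun t => psi α β t * f (hs t))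
    hα hβ hκ h0 h1 ((measurable_psi α β).mul (cf.comp continuous_hs).measurable) hM' hθ
  refine ⟨i, e.trans ?_⟩
  have e3 : ∀ μ ∈ Ioi (0 : ℝ), μ ^ (-σ) * ∫ t in Ioo 0 Real.pi, resKer α β (κ + μ) θ t *
      (psi α β t * f (hs t)) = (psi α β θ * f (hs θ)) * (μ ^ (-σ) * (κ + η + μ)⁻¹) := by
    intro μ hμ
    have hμ' : (0 : ℝ) < μ := hμ
    have hm : 0 < κ + η + μ := by linarith
    have k := (integral_resKer hα hβ (by linarith : 0 < κ + μ) hf hf' hf'' hθ).2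
    have e4 : ∀ t, resKer α β (κ + μ) θ t * (psi α β t * ((κ + μ) * f (hs t) -
        jacOp α β f' f'' (hs t))) = (κ + η + μ) * (resKer α β (κ + μ) θ t *
        (psi α β t * f (hs t))) := fun t => by rw [heig]; ring
    simp only [e4] at k
    rw [integral_const_mul] at k
    -- The eigenvalue equation turns the resolvent identity into multiplication by `(κ + η + μ)⁻¹`;
    -- Balakrishnan's scalar formula with `t = κ + η` then finishes.
    rw [← k]
    field_simp
  rw [setIntegral_congr_fun measurableSet_Ioi e3, integral_const_mul,
    integral_rpow_mul_inv σ (by linarith : 0 < κ + η)]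
  have := (potConst_pos h0 h1).ne'
  field_simp

end

end
end SymmJacobi

namespace SymmJacobi
noncomputable section

/-! ### Upper bounds for the potential kernel -/

/-- The hypotheses `0 < δ` and `δ < 2γ` give convergence at infinity and at zero, respectively. -/
theorem integrableOn_rpow_mul_min {δ γ : ℝ} (hδ : 0 < δ) (hγ : δ < 2 * γ) :
    IntegrableOn (fun s : ℝ => s ^ (-(δ / 2) - 1) * min 1 (s ^ γ)) (Ioi 0) := by
  have hm : Measurable (fun s : ℝ => s ^ (-(δ / 2) - 1) * min 1 (s ^ γ)) := by fun_prop
  have i1 : IntegrableOn (fun s : ℝ => s ^ (-(δ / 2) - 1) * min 1 (s ^ γ)) (Ioc 0 1) := by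
    have := intervalIntegral.intervalIntegrable_rpow' (r := -(δ / 2) - 1 + γ) (a := 0) (b := 1)
      (by linarith)
    rw [intervalIntegrable_iff_integrableOn_Ioc_of_le zero_le_one] at this
    refine this.mono' hm.aestronglyMeasurable ?_
    refine (ae_restrict_iff' measurableSet_Ioc).mpr (Eventually.of_forall fun s hs => ?_)
    have hs0 : 0 < s := hs.1
    have hmin : 0 ≤ min 1 (s ^ γ) := le_min zero_le_one (by positivity)
    rw [Real.norm_of_nonneg (by positivity), Real.rpow_add hs0]
    gcongr
    exact min_le_right _ _
  have i2 : IntegrableOn (fun s : ℝ => s ^ (-(δ / 2) - 1) * min 1 (s ^ γ)) (Ioi 1) := by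
    refine (integrableOn_Ioi_rpow_of_lt (a := -(δ / 2) - 1) (by linarith) one_pos).mono'
      hm.aestronglyMeasurable ?_
    refine (ae_restrict_iff' measurableSet_Ioi).mpr (Eventually.of_forall fun s hs => ?_)
    have hs0 : (0 : ℝ) < s := one_pos.trans hs
    have hmin : 0 ≤ min 1 (s ^ γ) := le_min zero_le_one (by positivity)
    rw [Real.norm_of_nonneg (by positivity)]
    exact mul_le_of_le_one_right (by positivity) (min_le_left _ _)
  rw [← Ioc_union_Ioi_eq_Ioi zero_le_one]
  exact i1.union i2

theorem integral_rpow_mul_min_scaled {δ γ : ℝ} (hδ : 0 < δ) (hγ : δ < 2 * γ) {d : ℝ}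
    (hd : 0 < d) :
    IntegrableOn (fun μ : ℝ => μ ^ (-(δ / 2) - 1) * min 1 ((d ^ 2 * μ) ^ γ)) (Ioi 0) ∧
    ∫ μ in Ioi (0 : ℝ), μ ^ (-(δ / 2) - 1) * min 1 ((d ^ 2 * μ) ^ γ) =
      d ^ δ * ∫ s in Ioi (0 : ℝ), s ^ (-(δ / 2) - 1) * min 1 (s ^ γ) := by
  set g : ℝ → ℝ := fun s => s ^ (-(δ / 2) - 1) * min 1 (s ^ γ) with hg
  have hd2 : 0 < d ^ 2 := by positivity
  have hc : EqOn (fun μ : ℝ => (d ^ 2) ^ (δ / 2 + 1) * g (d ^ 2 * μ))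
      (fun μ : ℝ => μ ^ (-(δ / 2) - 1) * min 1 ((d ^ 2 * μ) ^ γ)) (Ioi 0) := by
    intro μ hμ
    have hμ' : (0 : ℝ) < μ := hμ
    simp only [hg]
    rw [Real.mul_rpow hd2.le hμ'.le (z := -(δ / 2) - 1), ← mul_assoc, ← mul_assoc,
      ← Real.rpow_add hd2, show δ / 2 + 1 + (-(δ / 2) - 1) = 0 by ring, Real.rpow_zero, one_mul]
  have hi : IntegrableOn (fun μ : ℝ => g (d ^ 2 * μ)) (Ioi 0) := by
    have := (integrableOn_Ioi_comp_mul_left_iff g 0 hd2)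
    rw [mul_zero] at this
    exact this.mpr (integrableOn_rpow_mul_min hδ hγ)
  refine ⟨IntegrableOn.congr_fun (hi.const_mul _) hc measurableSet_Ioi, ?_⟩
  rw [← setIntegral_congr_fun measurableSet_Ioi hc, integral_const_mul,
    integral_comp_mul_left_Ioi g 0 hd2, mul_zero, smul_eq_mul, ← mul_assoc]
  congr 1
  rw [Real.rpow_add_one hd2.ne', mul_assoc, mul_inv_cancel₀ hd2.ne', mul_one, ← Real.rpow_two,
    ← Real.rpow_mul hd.le]
  congr 1; ring

/-- For `μ > 1`, `κ + μ` is comparable with `μ` and `μ^{-σ} ≤ μ^{-δ/2}`, so the scaled integral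
gives `d^δ`. For `μ ≤ 1` the minimum is at most a multiple of `d^{2γ}`, hence of `d^δ` as `d ≤ π`,
and `σ < 1` gives integrability at `0`. -/
theorem exists_integral_rpow_resolvent_le {κ σ δ γ : ℝ} (hκ : 0 < κ) (h1 : σ < 1)
    (hδ : 0 < δ) (hδσ : δ ≤ 2 * σ) (hγ : δ < 2 * γ) :
    ∃ C : ℝ, 0 < C ∧ ∀ d ∈ Ioc 0 Real.pi,
      IntegrableOn (fun μ : ℝ => μ ^ (-σ) * ((κ + μ)⁻¹ * min 1 ((d ^ 2 * (κ + μ)) ^ γ))) (Ioi 0) ∧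
      ∫ μ in Ioi (0 : ℝ), μ ^ (-σ) * ((κ + μ)⁻¹ * min 1 ((d ^ 2 * (κ + μ)) ^ γ)) ≤ C * d ^ δ := by
  have hγ0 : 0 < γ := by linarith
  have hπ := Real.pi_pos
  set A1 : ℝ := κ⁻¹ * (κ + 1) ^ γ * Real.pi ^ (2 * γ - δ) with hA1
  set A2 : ℝ := (κ + 1) ^ γ with hA2
  have hA2' : 1 ≤ A2 := Real.one_le_rpow (by linarith) hγ0.le
  set J1 : ℝ := ∫ μ in Ioi (0 : ℝ), (Ioc (0 : ℝ) 1).indicator (fun μ => μ ^ (-σ)) μ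
  set J2 : ℝ := ∫ s in Ioi (0 : ℝ), s ^ (-(δ / 2) - 1) * min 1 (s ^ γ)
  have hJ1 : 0 ≤ J1 := setIntegral_nonneg measurableSet_Ioi fun μ hμ =>
    indicator_nonneg (fun x hx => Real.rpow_nonneg hx.1.le _) μ
  have hJ2 : 0 ≤ J2 := setIntegral_nonneg measurableSet_Ioi fun μ hμ => by
    have hμ' : (0 : ℝ) < μ := hμ
    have : 0 ≤ min 1 (μ ^ γ) := le_min zero_le_one (by positivity)
    positivity
  have i1 : IntegrableOn ((Ioc (0 : ℝ) 1).indicator (fun μ : ℝ => μ ^ (-σ))) (Ioi 0) := by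
    have := intervalIntegral.intervalIntegrable_rpow' (r := -σ) (a := 0) (b := 1) (by linarith)
    rw [intervalIntegrable_iff_integrableOn_Ioc_of_le zero_le_one] at this
    exact ((integrable_indicator_iff measurableSet_Ioc).mpr this).integrableOn
  refine ⟨A1 * J1 + A2 * J2 + 1, by positivity, fun d hd => ?_⟩
  have hd0 : 0 < d := hd.1
  obtain ⟨i2, e2⟩ := integral_rpow_mul_min_scaled hδ hγ hd0
  have hbd : ∀ μ ∈ Ioi (0 : ℝ), μ ^ (-σ) * ((κ + μ)⁻¹ * min 1 ((d ^ 2 * (κ + μ)) ^ γ)) ≤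
      (A1 * d ^ δ) * (Ioc (0 : ℝ) 1).indicator (fun μ => μ ^ (-σ)) μ +
        A2 * (μ ^ (-(δ / 2) - 1) * min 1 ((d ^ 2 * μ) ^ γ)) := by
    intro μ hμ
    have hμ' : (0 : ℝ) < μ := hμ
    have hmin : 0 ≤ min 1 ((d ^ 2 * μ) ^ γ) := le_min zero_le_one (by positivity)
    have hmin' : 0 ≤ min 1 ((d ^ 2 * (κ + μ)) ^ γ) := le_min zero_le_one (by positivity)
    rcases le_or_gt μ 1 with h | h
    · rw [indicator_of_mem (show μ ∈ Ioc (0 : ℝ) 1 from ⟨hμ', h⟩)]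
      have k : min 1 ((d ^ 2 * (κ + μ)) ^ γ) ≤ (κ + 1) ^ γ * Real.pi ^ (2 * γ - δ) * d ^ δ := by
        calc min 1 ((d ^ 2 * (κ + μ)) ^ γ) ≤ (d ^ 2 * (κ + μ)) ^ γ := min_le_right _ _
          _ ≤ (d ^ 2 * (κ + 1)) ^ γ := by gcongr
          _ = (κ + 1) ^ γ * d ^ (2 * γ - δ) * d ^ δ := by
            rw [Real.mul_rpow (by positivity) (by positivity), mul_assoc, ← Real.rpow_add hd0,
              ← Real.rpow_two, ← Real.rpow_mul hd0.le, mul_comm]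
            congr 2; ring
          _ ≤ _ := by
            gcongr
            exact hd.2
      have : 0 ≤ A2 * (μ ^ (-(δ / 2) - 1) * min 1 ((d ^ 2 * μ) ^ γ)) := by positivity
      calc μ ^ (-σ) * ((κ + μ)⁻¹ * min 1 ((d ^ 2 * (κ + μ)) ^ γ))
          ≤ μ ^ (-σ) * (κ⁻¹ * ((κ + 1) ^ γ * Real.pi ^ (2 * γ - δ) * d ^ δ)) := by
            gcongr
            linarith
        _ = (A1 * d ^ δ) * μ ^ (-σ) := by rw [hA1]; ring
        _ ≤ _ := by linarith
    · rw [indicator_of_notMem (fun h' => not_lt.mpr h'.2 h), mul_zero, zero_add]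
      have k : min 1 ((d ^ 2 * (κ + μ)) ^ γ) ≤ A2 * min 1 ((d ^ 2 * μ) ^ γ) := by
        rw [mul_min_of_nonneg _ _ (by positivity)]
        refine min_le_min (by linarith) ?_
        rw [hA2, ← Real.mul_rpow (by positivity) (by positivity)]
        refine Real.rpow_le_rpow (by positivity) ?_ hγ0.le
        have : κ + μ ≤ (κ + 1) * μ := by nlinarith
        calc d ^ 2 * (κ + μ) ≤ d ^ 2 * ((κ + 1) * μ) := by gcongr
          _ = _ := by ring
      have k2 : μ ^ (-σ) * (κ + μ)⁻¹ ≤ μ ^ (-(δ / 2) - 1) := by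
        rw [Real.rpow_sub_one hμ'.ne', div_eq_mul_inv]
        gcongr
        · exact h.le
        · linarith
        · linarith
      calc μ ^ (-σ) * ((κ + μ)⁻¹ * min 1 ((d ^ 2 * (κ + μ)) ^ γ))
          = μ ^ (-σ) * (κ + μ)⁻¹ * min 1 ((d ^ 2 * (κ + μ)) ^ γ) := by ring
        _ ≤ μ ^ (-(δ / 2) - 1) * (A2 * min 1 ((d ^ 2 * μ) ^ γ)) := by gcongr
        _ = _ := by ring
  have iM := (i1.const_mul (A1 * d ^ δ)).add (i2.const_mul A2)
  have hI : IntegrableOn (fun μ : ℝ => μ ^ (-σ) *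
      ((κ + μ)⁻¹ * min 1 ((d ^ 2 * (κ + μ)) ^ γ))) (Ioi 0) := by
    refine iM.mono' (by fun_prop) ?_
    refine (ae_restrict_iff' measurableSet_Ioi).mpr (Eventually.of_forall fun μ hμ => ?_)
    have hμ' : (0 : ℝ) < μ := hμ
    have hmin' : 0 ≤ min 1 ((d ^ 2 * (κ + μ)) ^ γ) := le_min zero_le_one (by positivity)
    rw [Real.norm_of_nonneg (by positivity)]
    exact hbd μ hμ
  refine ⟨hI, (setIntegral_mono_on hI iM measurableSet_Ioi hbd).trans ?_⟩
  rw [integral_add' (i1.const_mul _) (i2.const_mul _), integral_const_mul, integral_const_mul, e2]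
  have : 0 < d ^ δ := by positivity
  change A1 * d ^ δ * J1 + A2 * (d ^ δ * J2) ≤ _
  nlinarith

section
variable {α β κ σ a δ : ℝ}

/-- The exponent `γ = 1/2 - a` of the resolvent bound is fed into the integral over `μ`; this is the
origin of the restriction `δ < 1 - 2a`. -/
theorem exists_integral_resKer_le_left (hα : -1 < α) (hβ : -1 < β) (hκ : 0 < κ)
    (h1 : σ < 1) (ha0 : 0 ≤ a) (ha : -(2 * α + 1) ≤ 2 * a) (hδ : 0 < δ)
    (hδσ : δ ≤ 2 * σ) (hδa : δ < 1 - 2 * a) :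
    ∃ C : ℝ, 0 < C ∧ ∀ θ φ : ℝ, 0 < θ → θ < φ → φ ≤ 3 * Real.pi / 4 →
      IntegrableOn (fun μ : ℝ => μ ^ (-σ) * resKer α β (κ + μ) θ φ) (Ioi 0) ∧
      ∫ μ in Ioi (0 : ℝ), μ ^ (-σ) * resKer α β (κ + μ) θ φ ≤
        C * ((φ - θ) ^ (δ - 1) * (φ / θ) ^ a) := by
  have hπ := Real.pi_pos
  obtain ⟨C1, hC1, H1⟩ := exists_resKer_le (a := a) hα hβ hκ ha0 (by linarith) ha
  obtain ⟨C2, hC2, H2⟩ := exists_integral_rpow_resolvent_le (γ := 1 / 2 - a) hκ h1 hδ hδσ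
    (by linarith)
  refine ⟨C1 * C2, by positivity, fun θ φ hθ hθφ hφ => ?_⟩
  have hd : 0 < φ - θ := by linarith
  obtain ⟨i, e⟩ := H2 (φ - θ) ⟨hd, by linarith⟩
  have hφI : φ ∈ Ioo 0 Real.pi := ⟨by linarith, by linarith⟩
  have hθI : θ ∈ Ioo 0 Real.pi := ⟨by linarith, by linarith⟩
  have hq : 0 < φ / θ := div_pos hφI.1 hθ
  set B := C1 * ((φ / θ) ^ a * (φ - θ)⁻¹) with hB
  have hB0 : 0 < B := by positivity
  have hbd : ∀ μ ∈ Ioi (0 : ℝ), μ ^ (-σ) * resKer α β (κ + μ) θ φ ≤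
      B * (μ ^ (-σ) * ((κ + μ)⁻¹ * min 1 (((φ - θ) ^ 2 * (κ + μ)) ^ (1 / 2 - a)))) := by
    intro μ hμ
    have hμ' : (0 : ℝ) < μ := hμ
    have := H1 (κ + μ) θ φ (by linarith) hθ hθφ hφ
    calc _ ≤ μ ^ (-σ) * (B * (κ + μ)⁻¹ * min 1 (((φ - θ) ^ 2 * (κ + μ)) ^ (1 / 2 - a))) := by
          gcongr
      _ = _ := by ring
  have hI : IntegrableOn (fun μ : ℝ => μ ^ (-σ) * resKer α β (κ + μ) θ φ) (Ioi 0) := by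
    refine (i.const_mul B).mono' (measurable_rpow_mul_resKer α β κ σ measurable_id
      measurable_const measurable_const).aestronglyMeasurable ?_
    refine (ae_restrict_iff' measurableSet_Ioi).mpr (Eventually.of_forall fun μ hμ => ?_)
    rw [Real.norm_of_nonneg (rpow_mul_resKer_nonneg hα hβ hκ hθI hφI hμ)]
    exact hbd μ hμ
  refine ⟨hI, (setIntegral_mono_on hI (i.const_mul B) measurableSet_Ioi hbd).trans ?_⟩
  rw [integral_const_mul]
  calc B * _ ≤ B * (C2 * (φ - θ) ^ δ) := by gcongr
    _ = _ := by rw [hB, Real.rpow_sub_one hd.ne']; ring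

theorem exists_integral_resKer_le_corner (hα : -1 < α) (hβ : -1 < β) (hκ : 0 < κ)
    (h0 : 0 < σ) (h1 : σ < 1) :
    ∃ C : ℝ, 0 < C ∧ ∀ θ φ : ℝ, 0 < θ → θ ≤ Real.pi / 4 → 3 * Real.pi / 4 ≤ φ → φ < Real.pi →
      IntegrableOn (fun μ : ℝ => μ ^ (-σ) * resKer α β (κ + μ) θ φ) (Ioi 0) ∧
      ∫ μ in Ioi (0 : ℝ), μ ^ (-σ) * resKer α β (κ + μ) θ φ ≤ C * (psi α β θ * psi α β φ) := by
  have hπ := Real.pi_pos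
  obtain ⟨C1, hC1, H1⟩ := exists_resKer_le_corner hα hβ
  have i := integrableOn_rpow_mul_inv h0 h1 hκ
  have e := integral_rpow_mul_inv σ hκ
  have := potConst_pos h0 h1
  refine ⟨C1 * (potConst σ * κ ^ (-σ)), by positivity, fun θ φ hθ h2 h3 h4 => ?_⟩
  have hφI : φ ∈ Ioo 0 Real.pi := ⟨by linarith, by linarith⟩
  have hθI : θ ∈ Ioo 0 Real.pi := ⟨by linarith, by linarith⟩
  set B := C1 * (psi α β θ * psi α β φ) with hB
  have hbd : ∀ μ ∈ Ioi (0 : ℝ), μ ^ (-σ) * resKer α β (κ + μ) θ φ ≤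
      B * (μ ^ (-σ) * (κ + μ)⁻¹) := by
    intro μ hμ
    have hμ' : (0 : ℝ) < μ := hμ
    have := H1 (κ + μ) θ φ (by linarith) hθ h2 h3 h4
    calc _ ≤ μ ^ (-σ) * (B * (κ + μ)⁻¹) := by gcongr
      _ = _ := by ring
  have hI : IntegrableOn (fun μ : ℝ => μ ^ (-σ) * resKer α β (κ + μ) θ φ) (Ioi 0) := by
    refine (i.const_mul B).mono' (measurable_rpow_mul_resKer α β κ σ measurable_id
      measurable_const measurable_const).aestronglyMeasurable ?_
    refine (ae_restrict_iff' measurableSet_Ioi).mpr (Eventually.of_forall fun μ hμ => ?_)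
    rw [Real.norm_of_nonneg (rpow_mul_resKer_nonneg hα hβ hκ hθI hφI hμ)]
    exact hbd μ hμ
  refine ⟨hI, (setIntegral_mono_on hI (i.const_mul B) measurableSet_Ioi hbd).trans_eq ?_⟩
  rw [integral_const_mul, e, hB]
  ring

/-- A power weight with singularities at both end points. -/
def cornerW (a θ : ℝ) : ℝ := (θ * (Real.pi - θ)) ^ (-a)

theorem cornerW_pos (a : ℝ) {θ : ℝ} (hθ : θ ∈ Ioo 0 Real.pi) : 0 < cornerW a θ :=
  Real.rpow_pos_of_pos (mul_pos hθ.1 (by linarith [hθ.2])) _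

/-- A majorant of the potential kernels. -/
def majKer (a δ θ φ : ℝ) : ℝ :=
  |θ - φ| ^ (δ - 1) * ((max θ φ / min θ φ) ^ a +
    ((Real.pi - min θ φ) / (Real.pi - max θ φ)) ^ a) + cornerW a θ * cornerW a φ

theorem majKer_comm (a δ θ φ : ℝ) : majKer a δ θ φ = majKer a δ φ θ := by
  rw [majKer, majKer, abs_sub_comm, max_comm, min_comm, mul_comm (cornerW a θ)]

theorem exists_psi_le_cornerW_left (β : ℝ) (ha0 : 0 ≤ a) (ha : -(2 * α + 1) ≤ 2 * a) :
    ∃ C : ℝ, 0 < C ∧ ∀ θ ∈ Ioc 0 (7 * Real.pi / 8), psi α β θ ≤ C * cornerW a θ := by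
  have hπ := Real.pi_pos
  obtain ⟨C, hC, H⟩ := exists_psi_sq_comparable α β
  set L := 7 * Real.pi / 8 with hL
  have hL0 : 0 < L := by positivity
  refine ⟨Real.sqrt (C * L ^ (2 * α + 1 + 2 * a)) * Real.pi ^ a + 1, by positivity, fun θ hθ => ?_⟩
  have hθI : θ ∈ Ioo 0 Real.pi := ⟨hθ.1, by linarith [hθ.2]⟩
  have hθ0 : 0 < θ := hθ.1
  have hr : 0 < Real.pi - θ := by linarith [hθI.2]
  have k1 : psi α β θ ^ 2 ≤ C * L ^ (2 * α + 1 + 2 * a) * (θ⁻¹) ^ (2 * a) * 1 ^ 2 := by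
    calc psi α β θ ^ 2 ≤ C * θ ^ (2 * α + 1) := (H θ hθ).2
      _ = C * (θ ^ (2 * α + 1 + 2 * a) * (θ⁻¹) ^ (2 * a)) := by
        rw [Real.inv_rpow hθ0.le, ← Real.rpow_neg hθ0.le, ← Real.rpow_add hθ0]; ring_nf
      _ ≤ C * (L ^ (2 * α + 1 + 2 * a) * (θ⁻¹) ^ (2 * a)) := by
        have : θ ^ (2 * α + 1 + 2 * a) ≤ L ^ (2 * α + 1 + 2 * a) :=
          Real.rpow_le_rpow hθ0.le hθ.2 (by linarith)
        gcongr
      _ = _ := by ring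
  have k2 := psi_le_of_sq zero_le_one (by positivity) (by positivity : 0 < θ⁻¹) k1
  have k3 : (θ⁻¹) ^ a ≤ Real.pi ^ a * cornerW a θ := by
    rw [cornerW, Real.rpow_neg (by positivity), ← Real.inv_rpow (by positivity),
      ← Real.mul_rpow (by positivity) (by positivity)]
    refine Real.rpow_le_rpow (by positivity) ?_ ha0
    rw [mul_inv, mul_left_comm]
    refine le_mul_of_one_le_right (by positivity) ?_
    rw [← div_eq_mul_inv, one_le_div hr]
    linarith
  have := cornerW_pos a hθI
  calc psi α β θ ≤ Real.sqrt (C * L ^ (2 * α + 1 + 2 * a)) * (θ⁻¹) ^ a * 1 := k2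
    _ ≤ Real.sqrt (C * L ^ (2 * α + 1 + 2 * a)) * (Real.pi ^ a * cornerW a θ) * 1 := by gcongr
    _ ≤ _ := by nlinarith

theorem cornerW_reflect (a θ : ℝ) : cornerW a (Real.pi - θ) = cornerW a θ := by
  rw [cornerW, cornerW, sub_sub_cancel, mul_comm]

theorem exists_psi_le_cornerW (ha0 : 0 ≤ a) (ha : -(2 * α + 1) ≤ 2 * a)
    (hb : -(2 * β + 1) ≤ 2 * a) :
    ∃ C : ℝ, 0 < C ∧ ∀ θ ∈ Ioo 0 Real.pi, psi α β θ ≤ C * cornerW a θ := by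
  have hπ := Real.pi_pos
  obtain ⟨C1, hC1, H1⟩ := exists_psi_le_cornerW_left β ha0 ha
  obtain ⟨C2, hC2, H2⟩ := exists_psi_le_cornerW_left α ha0 hb
  refine ⟨C1 + C2, by positivity, fun θ hθ => ?_⟩
  have := cornerW_pos a hθ
  rcases le_total θ (Real.pi / 2) with h | h
  · have := H1 θ ⟨hθ.1, by linarith⟩
    nlinarith
  · have h' := H2 (Real.pi - θ) ⟨by linarith [hθ.2], by linarith⟩
    rw [cornerW_reflect, psi_reflect β α hθ] at h'
    nlinarith

/-- Three regions: the larger point at most `3π/4`, the smaller point at least `π/4` (the first case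
after reflection), and points near opposite ends. The diagonal is a null set and is left out, since
the majorant is singular there. -/
theorem exists_integral_resKer_le (hα : -1 < α) (hβ : -1 < β) (hκ : 0 < κ)
    (h1 : σ < 1) (ha0 : 0 ≤ a) (ha : -(2 * α + 1) ≤ 2 * a) (hb : -(2 * β + 1) ≤ 2 * a)
    (hδ : 0 < δ) (hδσ : δ ≤ 2 * σ) (hδa : δ < 1 - 2 * a) :
    ∃ C : ℝ, 0 < C ∧ ∀ θ ∈ Ioo 0 Real.pi, ∀ φ ∈ Ioo 0 Real.pi, θ ≠ φ →
      IntegrableOn (fun μ : ℝ => μ ^ (-σ) * resKer α β (κ + μ) θ φ) (Ioi 0) ∧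
      ∫ μ in Ioi (0 : ℝ), μ ^ (-σ) * resKer α β (κ + μ) θ φ ≤ C * majKer a δ θ φ := by
  have hπ := Real.pi_pos
  obtain ⟨C1, hC1, H1⟩ := exists_integral_resKer_le_left hα hβ hκ h1 ha0 ha hδ hδσ hδa
  obtain ⟨C2, hC2, H2⟩ := exists_integral_resKer_le_left hβ hα hκ h1 ha0 hb hδ hδσ hδa
  obtain ⟨C3, hC3, H3⟩ := exists_integral_resKer_le_corner (σ := σ) hα hβ hκ (by linarith) h1
  obtain ⟨C4, hC4, H4⟩ := exists_psi_le_cornerW (α := α) (β := β) ha0 ha hb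
  refine ⟨C1 + C2 + C3 * (C4 * C4), by positivity, ?_⟩
  have main : ∀ θ ∈ Ioo 0 Real.pi, ∀ φ ∈ Ioo 0 Real.pi, θ < φ →
      IntegrableOn (fun μ : ℝ => μ ^ (-σ) * resKer α β (κ + μ) θ φ) (Ioi 0) ∧
      ∫ μ in Ioi (0 : ℝ), μ ^ (-σ) * resKer α β (κ + μ) θ φ ≤
        (C1 + C2 + C3 * (C4 * C4)) * majKer a δ θ φ := by
    intro θ hθ φ hφ hlt
    have hθ0 := hθ.1
    have hd : 0 < φ - θ := by linarith
    have e : majKer a δ θ φ = (φ - θ) ^ (δ - 1) * (φ / θ) ^ a +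
        (φ - θ) ^ (δ - 1) * ((Real.pi - θ) / (Real.pi - φ)) ^ a + cornerW a θ * cornerW a φ := by
      rw [majKer, abs_sub_comm, abs_of_pos hd, max_eq_right hlt.le, min_eq_left hlt.le, mul_add]
    have p1 : 0 ≤ (φ - θ) ^ (δ - 1) * (φ / θ) ^ a :=
      mul_nonneg (Real.rpow_nonneg hd.le _) (Real.rpow_nonneg (div_nonneg hφ.1.le hθ0.le) _)
    have p2 : 0 ≤ (φ - θ) ^ (δ - 1) * ((Real.pi - θ) / (Real.pi - φ)) ^ a :=
      mul_nonneg (Real.rpow_nonneg hd.le _) (Real.rpow_nonneg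
        (div_nonneg (by linarith [hθ.2]) (by linarith [hφ.2])) _)
    have w1 := cornerW_pos a hθ
    have w2 := cornerW_pos a hφ
    have p3 : 0 ≤ cornerW a θ * cornerW a φ := by positivity
    have q : ∀ (I c x : ℝ), 0 ≤ c → c ≤ C1 + C2 + C3 * (C4 * C4) → 0 ≤ x → x ≤ majKer a δ θ φ →
        I ≤ c * x → I ≤ (C1 + C2 + C3 * (C4 * C4)) * majKer a δ θ φ := fun I c x hc hc' hx hx' h =>
      h.trans (mul_le_mul hc' hx' hx (hc.trans hc'))
    have hC34 : 0 < C3 * (C4 * C4) := by positivity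
    rcases le_or_gt φ (3 * Real.pi / 4) with h | h
    · obtain ⟨i, b⟩ := H1 θ φ hθ0 hlt h
      exact ⟨i, q _ _ _ hC1.le (by linarith) p1 (by rw [e]; linarith) b⟩
    rcases le_or_gt (Real.pi / 4) θ with h' | h'
    · obtain ⟨i, b⟩ := H2 (Real.pi - φ) (Real.pi - θ) (by linarith [hφ.2]) (by linarith)
        (by linarith)
      have er : ∀ μ : ℝ, resKer β α (κ + μ) (Real.pi - φ) (Real.pi - θ) =
          resKer α β (κ + μ) θ φ := fun μ => by rw [resKer_reflect hφ hθ, resKer_comm]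
      simp only [er] at i b
      rw [sub_sub_sub_cancel_left] at b
      exact ⟨i, q _ _ _ hC2.le (by linarith) p2 (by rw [e]; linarith) b⟩
    · obtain ⟨i, b⟩ := H3 θ φ hθ0 h'.le h.le hφ.2
      refine ⟨i, q _ (C3 * (C4 * C4)) _ hC34.le (by linarith) p3 (by rw [e]; linarith) (b.trans ?_)⟩
      have := psi_pos α β hφ
      calc C3 * (psi α β θ * psi α β φ) ≤ C3 * ((C4 * cornerW a θ) * (C4 * cornerW a φ)) := by
            gcongr
            · exact H4 θ hθ
            · exact H4 φ hφ
        _ = _ := by ring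
  intro θ hθ φ hφ hne
  rcases lt_or_gt_of_ne hne with h | h
  · exact main θ hθ φ hφ h
  · have := main φ hφ θ hθ h
    simp only [resKer_comm φ θ, majKer_comm a δ φ θ] at this
    exact this

theorem exists_potKer_le (hα : -1 < α) (hβ : -1 < β) (hκ : 0 < κ)
    (h1 : σ < 1) (ha0 : 0 ≤ a) (ha : -(2 * α + 1) ≤ 2 * a) (hb : -(2 * β + 1) ≤ 2 * a)
    (hδ : 0 < δ) (hδσ : δ ≤ 2 * σ) (hδa : δ < 1 - 2 * a) :
    ∃ C : ℝ, 0 < C ∧ ∀ θ ∈ Ioo 0 Real.pi, ∀ φ ∈ Ioo 0 Real.pi, θ ≠ φ →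
      potKer α β κ σ θ φ ≤ C * majKer a δ θ φ := by
  obtain ⟨C, hC, H⟩ := exists_integral_resKer_le hα hβ hκ h1 ha0 ha hb hδ hδσ hδa
  have := potConst_pos (by linarith : 0 < σ) h1
  refine ⟨(potConst σ)⁻¹ * C, by positivity, fun θ hθ φ hφ hne => ?_⟩
  rw [potKer, mul_assoc]
  have := (H θ hθ φ hφ hne).2
  gcongr

end

end
end SymmJacobi

namespace SymmJacobi
noncomputable section

/-! ### Lower bounds for the potential kernel -/

section
variable {α β κ σ : ℝ}

/-- The pointwise bound of the Green function by `1 / wronsk` is integrated over the spectral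
parameter, so the constant is `∫ μ^{-σ} / wronsk α β (κ+μ)` up to normalization. -/
theorem exists_le_potKer (hα : -1 < α) (hβ : -1 < β) (hκ : 0 < κ) (h0 : 0 < σ) (h1 : σ < 1) :
    ∃ c : ℝ, 0 < c ∧ ∀ θ ∈ Ioo 0 Real.pi, ∀ φ ∈ Ioo 0 Real.pi, θ ≠ φ →
      c * (psi α β θ * psi α β φ) ≤ potKer α β κ σ θ φ := by
  have hπ := Real.pi_pos
  obtain ⟨a, ha0, ha, hb, ha1⟩ : ∃ a : ℝ, 0 ≤ a ∧ -(2 * α + 1) ≤ 2 * a ∧ -(2 * β + 1) ≤ 2 * a ∧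
      a < 1 / 2 := ⟨max 0 (max (-(α + 1 / 2)) (-(β + 1 / 2))), le_max_left _ _,
        by linarith [(le_max_left (-(α + 1 / 2)) (-(β + 1 / 2))).trans (le_max_right 0 _)],
        by linarith [(le_max_right (-(α + 1 / 2)) (-(β + 1 / 2))).trans (le_max_right 0 _)],
        max_lt (by norm_num) (max_lt (by linarith) (by linarith))⟩
  obtain ⟨δ, hδ0, hδ⟩ : ∃ δ : ℝ, 0 < δ ∧ δ < min (2 * σ) (1 - 2 * a) :=
    exists_between (lt_min (by linarith) (by linarith))
  obtain ⟨C, -, H⟩ := exists_integral_resKer_le hα hβ hκ h1 ha0 ha hb hδ0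
    (hδ.le.trans (min_le_left _ _)) (hδ.trans_le (min_le_right _ _))
  have hW : ∀ μ ∈ Ioi (0 : ℝ), 0 < wronsk α β (κ + μ) := fun μ hμ =>
    wronsk_pos hα hβ (add_pos hκ hμ)
  have hle : ∀ θ ∈ Ioo 0 Real.pi, ∀ φ ∈ Ioo 0 Real.pi, ∀ μ ∈ Ioi (0 : ℝ),
      (psi α β θ * psi α β φ) * (μ ^ (-σ) * (wronsk α β (κ + μ))⁻¹) ≤
        μ ^ (-σ) * resKer α β (κ + μ) θ φ := by
    intro θ hθ φ hφ μ hμ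
    have hμ' : (0 : ℝ) < μ := hμ
    have := one_div_wronsk_le_green hα hβ (add_pos hκ hμ') hθ hφ
    rw [one_div] at this
    have := psi_pos α β hθ
    have := psi_pos α β hφ
    calc _ = μ ^ (-σ) * (psi α β θ * psi α β φ * (wronsk α β (κ + μ))⁻¹) := by ring
      _ ≤ _ := by unfold resKer; gcongr
  have hmW : Measurable (fun μ : ℝ => μ ^ (-σ) * (wronsk α β (κ + μ))⁻¹) :=
    (measurable_id.pow_const _).mul ((measurable_wronsk α β).comp (measurable_const_add κ)).inv
  have hpos : ∀ μ ∈ Ioi (0 : ℝ), 0 < μ ^ (-σ) * (wronsk α β (κ + μ))⁻¹ := fun μ hμ =>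
    mul_pos (Real.rpow_pos_of_pos hμ _) (inv_pos.mpr (hW μ hμ))
  -- No asymptotics of the Wronskian are needed: the upper bound at the off-diagonal pair `(π/2,
  -- π/3)` already dominates the integrand.
  have hi : IntegrableOn (fun μ : ℝ => μ ^ (-σ) * (wronsk α β (κ + μ))⁻¹) (Ioi 0) := by
    have h2 : Real.pi / 2 ∈ Ioo 0 Real.pi := pi_div_two_mem
    have h3 : Real.pi / 3 ∈ Ioo 0 Real.pi := ⟨by linarith, by linarith⟩
    have p2 := psi_pos α β h2
    have p3 := psi_pos α β h3
    refine ((H _ h2 _ h3 (by intro h; linarith)).1.const_mul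
      (psi α β (Real.pi / 2) * psi α β (Real.pi / 3))⁻¹).mono' hmW.aestronglyMeasurable ?_
    refine (ae_restrict_iff' measurableSet_Ioi).mpr (Eventually.of_forall fun μ hμ => ?_)
    rw [Real.norm_of_nonneg (hpos μ hμ).le, ← div_eq_inv_mul, le_div_iff₀ (by positivity), mul_comm]
    exact hle _ h2 _ h3 μ hμ
  have hIpos : 0 < ∫ μ in Ioi (0 : ℝ), μ ^ (-σ) * (wronsk α β (κ + μ))⁻¹ := by
    rw [setIntegral_pos_iff_support_of_nonneg_ae
      ((ae_restrict_iff' measurableSet_Ioi).mpr (Eventually.of_forall fun μ hμ => (hpos μ hμ).le)) hi]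
    have : Ioi (0 : ℝ) ⊆ Function.support (fun μ : ℝ => μ ^ (-σ) * (wronsk α β (κ + μ))⁻¹) ∩ Ioi 0 :=
      fun μ hμ => ⟨(hpos μ hμ).ne', hμ⟩
    refine lt_of_lt_of_le ?_ (measure_mono this)
    simp
  have hc := potConst_pos h0 h1
  refine ⟨(potConst σ)⁻¹ * ∫ μ in Ioi (0 : ℝ), μ ^ (-σ) * (wronsk α β (κ + μ))⁻¹, by positivity,
    fun θ hθ φ hφ hne => ?_⟩
  rw [potKer, mul_assoc]
  refine mul_le_mul_of_nonneg_left ?_ (by positivity)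
  rw [mul_comm, ← integral_const_mul]
  exact setIntegral_mono_on (hi.const_mul _) (H θ hθ φ hφ hne).1 measurableSet_Ioi (hle θ hθ φ hφ)

theorem exists_smooth_bump : ∃ (f f' f'' : ℝ → ℝ) (B : ℝ), (∀ x, HasDerivAt f (f' x) x) ∧
    (∀ x, HasDerivAt f' (f'' x) x) ∧ Continuous f'' ∧ (∀ x, |f x| ≤ 1) ∧ (∀ x, |f' x| ≤ B) ∧
    (∀ x, |f'' x| ≤ B) ∧ (∀ x, 1 ≤ |x| → f x = 0 ∧ f' x = 0 ∧ f'' x = 0) ∧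
    ∀ x, |x| ≤ 1 / 2 → f x = 1 := by
  let b : ContDiffBump (0 : ℝ) := ⟨1 / 2, 3 / 4, by norm_num, by norm_num⟩
  have hb : ContDiff ℝ 2 b := b.contDiff
  have hb1 : ContDiff ℝ 1 (deriv b) := hb.deriv' (n := 1) |>.of_le (by norm_num)
  have hb2 : Continuous (deriv (deriv b)) := hb1.continuous_deriv (by norm_num)
  have hc : HasCompactSupport b := b.hasCompactSupport
  have hc1 : HasCompactSupport (deriv b) := hc.deriv
  have hc2 : HasCompactSupport (deriv (deriv b)) := hc1.deriv
  obtain ⟨B1, hB1⟩ := hc1.exists_bound_of_continuous hb1.continuous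
  obtain ⟨B2, hB2⟩ := hc2.exists_bound_of_continuous hb2
  refine ⟨b, deriv b, deriv (deriv b), max B1 B2,
    fun x => ((hb.differentiable (by norm_num)) x).hasDerivAt,
    fun x => ((hb1.differentiable (by norm_num)) x).hasDerivAt, hb2,
    fun x => by rw [abs_of_nonneg b.nonneg]; exact b.le_one,
    fun x => (hB1 x).trans (le_max_left _ _), fun x => (hB2 x).trans (le_max_right _ _),
    fun x hx => ?_, fun x hx => b.one_of_mem_closedBall (by rw [mem_closedBall_zero_iff]; exact hx)⟩
  have hx' : x ∉ tsupport b := by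
    rw [b.tsupport_eq]
    have : (3 / 4 : ℝ) < |x| := by linarith
    simpa [b] using this
  have hx1 : x ∉ tsupport (deriv b) := fun h => hx' (tsupport_deriv_subset h)
  have hx2 : x ∉ tsupport (deriv (deriv b)) := fun h => hx1 (tsupport_deriv_subset h)
  exact ⟨image_eq_zero_of_notMem_tsupport hx', image_eq_zero_of_notMem_tsupport hx1,
    image_eq_zero_of_notMem_tsupport hx2⟩

/-- The set of angles whose `hs` is within `δ` of `1/2`. -/
def midSet (δ : ℝ) : Set ℝ := {θ | |hs θ - 1 / 2| < δ}

theorem measurableSet_midSet (δ : ℝ) : MeasurableSet (midSet δ) :=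
  measurableSet_lt (continuous_hs.measurable.sub_const _).abs measurable_const

/-- A bump `g` of width `δ` around `x = 1/2` serves as test function. For `m ≥ δ^{-2}`, `m g` minus
the Jacobi operator applied to `g` is at most `A m` on the middle set and zero off it. Positivity of
the kernel in the resolvent identity then gives the lower bound. -/
theorem exists_le_integral_resKer_midSet (hα : -1 < α) (hβ : -1 < β) :
    ∃ c : ℝ, 0 < c ∧ ∀ δ m θ : ℝ, 0 < δ → δ ≤ 1 → (δ ^ 2)⁻¹ ≤ m → θ ∈ Ioo 0 Real.pi →
      |hs θ - 1 / 2| ≤ δ / 2 →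
      c * m⁻¹ * psi α β θ ≤ ∫ t in Ioo 0 Real.pi, resKer α β m θ t *
        (psi α β t * (midSet δ).indicator 1 t) := by
  obtain ⟨f, f', f'', B, hf, hf', hf'', b0, b1, b2, hz, hone⟩ := exists_smooth_bump
  have hB : 0 ≤ B := (abs_nonneg _).trans (b1 0)
  set A : ℝ := 1 + B * (1 + (α + 1) + (β + 1)) with hA
  have hA1 : 1 ≤ A := by
    have : 0 ≤ B * (1 + (α + 1) + (β + 1)) := mul_nonneg hB (by linarith)
    linarith
  refine ⟨A⁻¹, by positivity, fun δ m θ hδ hδ1 hm hθ hθδ => ?_⟩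
  have hm0 : 0 < m := lt_of_lt_of_le (by positivity) hm
  have hδm : 1 ≤ m * δ ^ 2 := by
    rwa [inv_le_iff_one_le_mul₀ (by positivity)] at hm
  let g : ℝ → ℝ := fun x => f ((x - 1 / 2) / δ)
  let g' : ℝ → ℝ := fun x => f' ((x - 1 / 2) / δ) / δ
  let g'' : ℝ → ℝ := fun x => f'' ((x - 1 / 2) / δ) / δ ^ 2
  have dl : ∀ x, HasDerivAt (fun x : ℝ => (x - 1 / 2) / δ) (1 / δ) x := fun x =>
    ((hasDerivAt_id x).sub_const _).div_const δ
  have hg : ∀ x, HasDerivAt g (g' x) x := fun x =>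
    ((hf _).comp x (dl x)).congr_deriv (by simp [g', div_eq_mul_inv])
  have hg' : ∀ x, HasDerivAt g' (g'' x) x := fun x =>
    (((hf' _).comp x (dl x)).div_const δ).congr_deriv (by
      simp only [g'']; field_simp)
  have hg'' : Continuous g'' := by simp only [g'']; fun_prop
  obtain ⟨i, e⟩ := integral_resKer hα hβ hm0 hg hg' hg'' hθ
  have e1 : g (hs θ) = 1 := hone _ (by
    rw [abs_div, abs_of_pos hδ, div_le_iff₀ hδ]; linarith)
  rw [e1, mul_one] at e
  have hbd : ∀ t, |m * g (hs t) - jacOp α β g' g'' (hs t)| ≤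
      A * m * (midSet δ).indicator 1 t := by
    intro t
    by_cases ht : t ∈ midSet δ
    · rw [indicator_of_mem ht, Pi.one_apply, mul_one]
      have k0 : 0 ≤ hs t := hs_nonneg t
      have k1 : hs t ≤ 1 := hs_le_one t
      have c0 : |m * g (hs t)| ≤ m := by
        rw [abs_mul, abs_of_pos hm0]; exact mul_le_of_le_one_right hm0.le (b0 _)
      have c2 : |g'' (hs t)| ≤ B * m := by
        simp only [g'']
        rw [abs_div, abs_of_pos (by positivity : 0 < δ ^ 2), div_le_iff₀ (by positivity)]
        have := b2 ((hs t - 1 / 2) / δ)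
        calc _ ≤ B * 1 := by linarith
          _ ≤ B * (m * δ ^ 2) := by gcongr
          _ = _ := by ring
      have c1 : |g' (hs t)| ≤ B * m := by
        simp only [g']
        rw [abs_div, abs_of_pos hδ, div_le_iff₀ hδ]
        have := b1 ((hs t - 1 / 2) / δ)
        calc _ ≤ B * 1 := by linarith
          _ ≤ B * (m * δ ^ 2) := by gcongr
          _ ≤ B * (m * δ) := by gcongr; nlinarith
          _ = _ := by ring
      have hBm : 0 ≤ B * m := by positivity
      have c3 : |hs t * (1 - hs t) * g'' (hs t)| ≤ 1 * (B * m) := by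
        rw [abs_mul]
        refine mul_le_mul ?_ c2 (abs_nonneg _) zero_le_one
        rw [abs_of_nonneg (mul_nonneg k0 (by linarith))]
        nlinarith
      have c4 : |((α + 1) * (1 - hs t) - (β + 1) * hs t) * g' (hs t)| ≤
          ((α + 1) + (β + 1)) * (B * m) := by
        rw [abs_mul]
        refine mul_le_mul ?_ c1 (abs_nonneg _) (by linarith)
        rw [abs_le]
        have : 0 < α + 1 := by linarith
        have : 0 < β + 1 := by linarith
        constructor <;> nlinarith
      have c5 := abs_add_le (hs t * (1 - hs t) * g'' (hs t))
        (((α + 1) * (1 - hs t) - (β + 1) * hs t) * g' (hs t))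
      have c6 := abs_sub (m * g (hs t)) (jacOp α β g' g'' (hs t))
      rw [jacOp] at c6 ⊢
      rw [hA]
      linarith
    · rw [indicator_of_notMem ht, mul_zero]
      have h1 : 1 ≤ |(hs t - 1 / 2) / δ| := by
        rw [abs_div, abs_of_pos hδ, le_div_iff₀ hδ, one_mul]
        exact not_lt.mp ht
      obtain ⟨z0, z1, z2⟩ := hz _ h1
      simp only [g, g', g'', jacOp, z0, z1, z2]
      simp
  have hi2 : IntegrableOn (fun t => resKer α β m θ t * (psi α β t * (midSet δ).indicator 1 t))
      (Ioo 0 Real.pi) := by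
    have := (integral_resKer_psi hα hβ hm0 hθ).1.indicator (measurableSet_midSet δ)
    refine Integrable.congr this (Eventually.of_forall fun t => ?_)
    by_cases ht : t ∈ midSet δ <;> simp [ht]
  have key : psi α β θ ≤ A * m * ∫ t in Ioo 0 Real.pi, resKer α β m θ t *
      (psi α β t * (midSet δ).indicator 1 t) := by
    rw [← e, ← integral_const_mul]
    refine setIntegral_mono_on i (hi2.const_mul _) measurableSet_Ioo fun t ht => ?_
    have r := resKer_pos hα hβ hm0 hθ ht
    have p := psi_pos α β ht
    calc _ ≤ resKer α β m θ t * (psi α β t * (A * m * (midSet δ).indicator 1 t)) := by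
          gcongr
          exact (le_abs_self _).trans (hbd t)
      _ = _ := by ring
  rw [← mul_inv, inv_mul_le_iff₀ (by positivity)]
  exact key

/-- Only `μ > δ^{-2}` is kept, where the resolvent bound applies and `κ + μ ≤ (κ+1) μ`; the
remaining integral of `μ^{-σ-1}` equals `δ^{2σ}/σ`. -/
theorem exists_le_integral_potKer_midSet (hα : -1 < α) (hβ : -1 < β) (hκ : 0 < κ) (h0 : 0 < σ)
    (h1 : σ < 1) :
    ∃ c : ℝ, 0 < c ∧ ∀ δ θ : ℝ, 0 < δ → δ ≤ 1 → θ ∈ Ioo 0 Real.pi → |hs θ - 1 / 2| ≤ δ / 2 →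
      c * δ ^ (2 * σ) * psi α β θ ≤ ∫ t in Ioo 0 Real.pi, potKer α β κ σ θ t *
        (psi α β t * (midSet δ).indicator 1 t) := by
  obtain ⟨c, hc, H⟩ := exists_le_integral_resKer_midSet hα hβ
  have hC := potConst_pos h0 h1
  refine ⟨(potConst σ)⁻¹ * (c * (κ + 1)⁻¹ * σ⁻¹), by positivity, fun δ θ hδ hδ1 hθ hθδ => ?_⟩
  have hind : ∀ t, 0 ≤ (midSet δ).indicator (1 : ℝ → ℝ) t ∧ (midSet δ).indicator (1 : ℝ → ℝ) t ≤ 1 :=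
    fun t => by by_cases ht : t ∈ midSet δ <;> simp [ht]
  obtain ⟨-, i, e⟩ := integral_potKer_eq (κ := κ) (σ := σ) (M := 1)
    (g := fun t => psi α β t * (midSet δ).indicator 1 t) hα hβ hκ h0 h1
    ((measurable_psi α β).mul (measurable_one.indicator (measurableSet_midSet δ)))
    (fun t ht => by
      rw [abs_of_nonneg (mul_nonneg (psi_pos α β ht).le (hind t).1), one_mul]
      exact mul_le_of_le_one_right (psi_pos α β ht).le (hind t).2) hθ
  rw [e, mul_assoc, mul_assoc]
  refine mul_le_mul_of_nonneg_left ?_ (by positivity)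
  have hD : 0 < (δ ^ 2)⁻¹ := by positivity
  have hD1 : 1 ≤ (δ ^ 2)⁻¹ := (one_le_inv₀ (by positivity)).mpr (by nlinarith)
  have pθ := psi_pos α β hθ
  set N := c * (κ + 1)⁻¹ * psi α β θ with hN
  have hN0 : 0 < N := by positivity
  have hp : ∫ μ in Ioi (δ ^ 2)⁻¹, N * μ ^ (-σ - 1) =
      c * (κ + 1)⁻¹ * σ⁻¹ * (δ ^ (2 * σ) * psi α β θ) := by
    rw [integral_const_mul, integral_Ioi_rpow_of_lt (by linarith) hD, sub_add_cancel,
      Real.inv_rpow (by positivity), ← Real.rpow_neg (by positivity), neg_neg, ← Real.rpow_two,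
      ← Real.rpow_mul hδ.le, neg_div_neg_eq, hN]
    ring
  rw [← hp]
  have hpt : ∀ μ ∈ Ioi (0 : ℝ), 0 ≤ μ ^ (-σ) * ∫ t in Ioo 0 Real.pi, resKer α β (κ + μ) θ t *
      (psi α β t * (midSet δ).indicator 1 t) := fun μ hμ =>
    mul_nonneg (Real.rpow_nonneg (le_of_lt hμ) _) (setIntegral_nonneg measurableSet_Ioo fun t ht =>
      mul_nonneg (resKer_pos hα hβ (add_pos hκ hμ) hθ ht).le
        (mul_nonneg (psi_pos α β ht).le (hind t).1))
  calc ∫ μ in Ioi (δ ^ 2)⁻¹, N * μ ^ (-σ - 1)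
      ≤ ∫ μ in Ioi (δ ^ 2)⁻¹, μ ^ (-σ) * ∫ t in Ioo 0 Real.pi, resKer α β (κ + μ) θ t *
          (psi α β t * (midSet δ).indicator 1 t) := by
        refine setIntegral_mono_on ((integrableOn_Ioi_rpow_of_lt (by linarith) hD).const_mul N)
          (i.mono_set (Ioi_subset_Ioi hD.le)) measurableSet_Ioi fun μ hμ => ?_
        have hμ' : (δ ^ 2)⁻¹ < μ := hμ
        have hμ0 : 0 < μ := hD.trans hμ'
        have := H δ (κ + μ) θ hδ hδ1 (by linarith) hθ hθδ
        refine le_trans ?_ (mul_le_mul_of_nonneg_left this (Real.rpow_nonneg hμ0.le _))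
        rw [Real.rpow_sub_one hμ0.ne', hN]
        have k : ((κ + 1) * μ)⁻¹ ≤ (κ + μ)⁻¹ := by
          gcongr
          nlinarith
        calc c * (κ + 1)⁻¹ * psi α β θ * (μ ^ (-σ) / μ) =
            μ ^ (-σ) * (c * ((κ + 1) * μ)⁻¹ * psi α β θ) := by rw [mul_inv]; ring
          _ ≤ _ := by gcongr
    _ ≤ _ := by
        refine setIntegral_mono_set i ?_ (Ioi_subset_Ioi hD.le).eventuallyLE
        exact (ae_restrict_iff' measurableSet_Ioi).mpr (Eventually.of_forall hpt)

end

end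
end SymmJacobi

namespace SymmJacobi
noncomputable section

/-! ### Power integrals in `ℝ≥0∞` -/

theorem lintegral_rpow_Ioc {r A : ℝ} (hr : 0 < r) (hA : 0 ≤ A) :
    ∫⁻ s in Ioc 0 A, ENNReal.ofReal (s ^ (r - 1)) = ENNReal.ofReal (A ^ r / r) := by
  have hi := intervalIntegral.intervalIntegrable_rpow' (r := r - 1) (a := 0) (b := A) (by linarith)
  rw [intervalIntegrable_iff_integrableOn_Ioc_of_le hA] at hi
  rw [← ofReal_integral_eq_lintegral_ofReal hi
    ((ae_restrict_iff' measurableSet_Ioc).mpr (Eventually.of_forall fun s hs =>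
      Real.rpow_nonneg hs.1.le _)), ← intervalIntegral.integral_of_le hA,
    integral_rpow (Or.inl (by linarith)), sub_add_cancel, Real.zero_rpow hr.ne', sub_zero]

theorem lintegral_rpow_Ioo {r A : ℝ} (hr : 0 < r) (hA : 0 ≤ A) :
    ∫⁻ s in Ioo 0 A, ENNReal.ofReal (s ^ (r - 1)) = ENNReal.ofReal (A ^ r / r) := by
  rw [← lintegral_rpow_Ioc hr hA]
  exact setLIntegral_congr Ioo_ae_eq_Ioc

theorem lintegral_rpow_Ioi {e A : ℝ} (he : e < -1) (hA : 0 < A) :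
    ∫⁻ s in Ioi A, ENNReal.ofReal (s ^ e) = ENNReal.ofReal (A ^ (e + 1) / (-(e + 1))) := by
  rw [← ofReal_integral_eq_lintegral_ofReal (integrableOn_Ioi_rpow_of_lt he hA)
    ((ae_restrict_iff' measurableSet_Ioi).mpr (Eventually.of_forall fun s hs =>
      Real.rpow_nonneg (hA.le.trans (le_of_lt hs)) _)), integral_Ioi_rpow_of_lt he hA]
  congr 1
  rw [div_neg, neg_div]

theorem lintegral_layer {r : ℝ} (hr : 0 < r) (A : ℝ≥0∞) :
    ∫⁻ s in Ioi (0 : ℝ), ENNReal.ofReal (s ^ (r - 1)) * {s | ENNReal.ofReal s < A}.indicator 1 s =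
      A ^ r / ENNReal.ofReal r := by
  have hfin : ∀ B : ℝ, 0 ≤ B → ∫⁻ s in Ioi (0 : ℝ), ENNReal.ofReal (s ^ (r - 1)) *
      {s | ENNReal.ofReal s < ENNReal.ofReal B}.indicator 1 s =
      ENNReal.ofReal B ^ r / ENNReal.ofReal r := by
    intro B hB
    rw [ENNReal.ofReal_rpow_of_nonneg hB hr.le, ← ENNReal.ofReal_div_of_pos hr,
      ← lintegral_rpow_Ioo hr hB, ← lintegral_indicator measurableSet_Ioi,
      ← lintegral_indicator measurableSet_Ioo]
    refine lintegral_congr fun s => ?_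
    by_cases h0 : s ∈ Ioi (0 : ℝ)
    · have h0' : (0 : ℝ) < s := h0
      rw [indicator_of_mem h0]
      by_cases h1 : s < B
      · rw [indicator_of_mem (show s ∈ Ioo 0 B from ⟨h0, h1⟩), indicator_of_mem, Pi.one_apply,
          mul_one]
        exact (ENNReal.ofReal_lt_ofReal_iff (h0'.trans h1)).mpr h1
      · rw [indicator_of_notMem (show s ∉ Ioo 0 B from fun h => h1 h.2),
          indicator_of_notMem (show s ∉ {s | ENNReal.ofReal s < ENNReal.ofReal B} from
            fun h => h1 (ENNReal.ofReal_lt_ofReal_iff'.mp h).1), mul_zero]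
    · rw [indicator_of_notMem h0,
        indicator_of_notMem (show s ∉ Ioo 0 B from fun h => h0 h.1)]
  by_cases hA : A = ∞
  · subst hA
    rw [ENNReal.top_rpow_of_pos hr, ENNReal.top_div_of_ne_top ENNReal.ofReal_ne_top]
    -- For an infinite level every finite number is reached: the level `(r x)^{1/r}` produces
    -- exactly the value `x`, and the integrand is monotone in the level.
    refine ENNReal.eq_top_of_forall_nnreal_le fun x => ?_
    have hx : (x : ℝ≥0∞) = ENNReal.ofReal ((r * x) ^ r⁻¹) ^ r / ENNReal.ofReal r := by
      have hrx : 0 ≤ r * x := mul_nonneg hr.le x.2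
      rw [ENNReal.ofReal_rpow_of_nonneg (by positivity) hr.le, ← Real.rpow_mul hrx,
        inv_mul_cancel₀ hr.ne', Real.rpow_one, ← ENNReal.ofReal_div_of_pos hr,
        mul_div_cancel_left₀ _ hr.ne']
      simp
    rw [hx, ← hfin ((r * x) ^ r⁻¹) (Real.rpow_nonneg (mul_nonneg hr.le x.2) _)]
    refine lintegral_mono fun s => ?_
    gcongr
    exact le_top
  · rw [← ENNReal.ofReal_toReal hA]
    exact hfin _ ENNReal.toReal_nonneg

theorem lintegral_comp_abs_le {h : ℝ → ℝ≥0∞} (hh : Measurable h) :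
    ∫⁻ z, h |z| ≤ 2 * ∫⁻ z in Ioi (0 : ℝ), h z := by
  have e0 : ∫⁻ z, h |z| = (∫⁻ z in Iic (0 : ℝ), h |z|) + ∫⁻ z in Ioi (0 : ℝ), h |z| := by
    rw [← compl_Iic]
    exact (lintegral_add_compl (fun z => h |z|) measurableSet_Iic).symm
  have e1 : ∫⁻ z in Ioi (0 : ℝ), h |z| = ∫⁻ z in Ioi (0 : ℝ), h z :=
    setLIntegral_congr_fun measurableSet_Ioi fun z hz => by
      simp only [abs_of_pos (show (0 : ℝ) < z from hz)]
  have e2 : ∫⁻ z in Iic (0 : ℝ), h |z| = ∫⁻ z in Ioi (0 : ℝ), h z := by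
    have := (Measure.measurePreserving_neg (volume : Measure ℝ)).setLIntegral_comp_preimage
      (s := Ici (0 : ℝ)) measurableSet_Ici (f := fun z => h |z|) (hh.comp measurable_id.abs)
    simp only [abs_neg] at this
    have hs : Neg.neg ⁻¹' Ici (0 : ℝ) = Iic 0 := by ext; simp
    rw [hs] at this
    rw [this, ← e1]
    exact setLIntegral_congr Ioi_ae_eq_Ici.symm
  exact le_of_eq ((e0.trans (congrArg₂ (· + ·) e2 e1)).trans (two_mul _).symm)

theorem lintegral_near_le {δ R : ℝ} (hδ : 0 < δ) (hR : 0 < R) (x : ℝ) :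
    ∫⁻ y, {y | |x - y| < R}.indicator (fun y => ENNReal.ofReal (|x - y| ^ (δ - 1))) y ≤
      2 * ENNReal.ofReal (R ^ δ / δ) := by
  set h : ℝ → ℝ≥0∞ := (Iio R).indicator (fun z => ENNReal.ofReal (z ^ (δ - 1))) with hh
  have hm : Measurable h := (by fun_prop : Measurable fun z : ℝ =>
    ENNReal.ofReal (z ^ (δ - 1))).indicator measurableSet_Iio
  have e : ∫⁻ y, {y | |x - y| < R}.indicator (fun y => ENNReal.ofReal (|x - y| ^ (δ - 1))) y =
      ∫⁻ z, h |z| := by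
    rw [← lintegral_sub_left_eq_self (fun z => h |z|) x]
    rfl
  rw [e]
  refine (lintegral_comp_abs_le hm).trans ?_
  gcongr
  rw [hh, lintegral_indicator measurableSet_Iio, Measure.restrict_restrict measurableSet_Iio,
    inter_comm, Ioi_inter_Iio, lintegral_rpow_Ioo hδ hR.le]

theorem lintegral_far_le {e R : ℝ} (he : e < -1) (hR : 0 < R) (x : ℝ) :
    ∫⁻ y, {y | ¬ |x - y| < R}.indicator (fun y => ENNReal.ofReal (|x - y| ^ e)) y ≤
      2 * ENNReal.ofReal (R ^ (e + 1) / (-(e + 1))) := by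
  set h : ℝ → ℝ≥0∞ := (Ici R).indicator (fun z => ENNReal.ofReal (z ^ e)) with hh
  have hm : Measurable h := (by fun_prop : Measurable fun z : ℝ =>
    ENNReal.ofReal (z ^ e)).indicator measurableSet_Ici
  have e1 : ∫⁻ y, {y | ¬ |x - y| < R}.indicator (fun y => ENNReal.ofReal (|x - y| ^ e)) y =
      ∫⁻ z, h |z| := by
    rw [← lintegral_sub_left_eq_self (fun z => h |z|) x]
    refine lintegral_congr fun y => ?_
    simp only [hh, indicator, mem_ofPred_eq, not_lt, mem_Ici]
  rw [e1]
  refine (lintegral_comp_abs_le hm).trans ?_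
  gcongr
  rw [hh, lintegral_indicator measurableSet_Ici, Measure.restrict_restrict measurableSet_Ici,
    inter_eq_left.mpr (show Ici R ⊆ Ioi 0 from fun z hz => lt_of_lt_of_le hR hz), setLIntegral_congr Ioi_ae_eq_Ici.symm,
    lintegral_rpow_Ioi he hR]

/-! ### The Hardy–Littlewood–Sobolev inequality on the line -/

section
variable {u v : ℝ}

/-- Hölder's inequality with the conjugate exponent `1/(1-u)`: the kernel cut off at distance `R`
has norm of order `R^{-v}`. -/
theorem hls_far (hv : 0 < v) (huv : v < u) (hu : u < 1) :
    ∃ C : ℝ≥0∞, C ≠ ∞ ∧ ∀ (f : ℝ → ℝ≥0∞), Measurable f → ∫⁻ y, f y ^ (1 / u) = 1 →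
      ∀ R x : ℝ, 0 < R → ∫⁻ y, {y | ¬ |x - y| < R}.indicator
        (fun y => ENNReal.ofReal (|x - y| ^ (u - v - 1))) y * f y ≤
        C * ENNReal.ofReal (R ^ (-v)) := by
  have hu0 : 0 < u := hv.trans huv
  have hu1 : 0 < 1 - u := by linarith
  set p' : ℝ := 1 / (1 - u) with hp'
  have hp'0 : 0 < p' := by positivity
  have hpq : (1 / u).HolderConjugate p' := by
    rw [Real.holderConjugate_iff]
    refine ⟨(one_lt_div hu0).mpr hu, ?_⟩
    rw [hp', one_div, one_div, inv_inv, inv_inv]; ring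
  have he : (u - v - 1) * p' + 1 = -(v * p') := by
    rw [hp']; field_simp; ring
  have hvp : 0 < v * p' := by positivity
  refine ⟨(2 * ENNReal.ofReal ((v * p')⁻¹)) ^ (1 / p'), by
    refine ENNReal.rpow_ne_top_of_nonneg (by positivity) ?_
    exact ENNReal.mul_ne_top (by simp) ENNReal.ofReal_ne_top, fun f hf hf1 R x hR => ?_⟩
  have hkm0 : Measurable fun y : ℝ => ENNReal.ofReal (|x - y| ^ (u - v - 1)) := by fun_prop
  set k : ℝ → ℝ≥0∞ := {y | ¬ |x - y| < R}.indicator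
    (fun y => ENNReal.ofReal (|x - y| ^ (u - v - 1))) with hk
  have hS : MeasurableSet {y : ℝ | ¬ |x - y| < R} :=
    (measurableSet_lt (by fun_prop) measurable_const :
      MeasurableSet {y : ℝ | |x - y| < R}).compl
  have hkm : Measurable k := Measurable.indicator hkm0 hS
  have h1 := ENNReal.lintegral_mul_le_Lp_mul_Lq volume hpq.symm hkm.aemeasurable hf.aemeasurable
  rw [hf1, ENNReal.one_rpow, mul_one] at h1
  refine h1.trans ?_
  have h2 : ∫⁻ y, k y ^ p' ≤ 2 * ENNReal.ofReal (R ^ (-(v * p')) / (v * p')) := by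
    have h3 := lintegral_far_le (e := (u - v - 1) * p') (by linarith) hR x
    rw [he, neg_neg] at h3
    refine le_trans (le_of_eq (lintegral_congr fun y => ?_)) h3
    by_cases hy : y ∈ {y : ℝ | ¬ |x - y| < R}
    · rw [hk, indicator_of_mem hy, indicator_of_mem hy,
        ENNReal.ofReal_rpow_of_nonneg (by positivity) hp'0.le, ← Real.rpow_mul (abs_nonneg _)]
    · rw [hk, indicator_of_notMem hy, indicator_of_notMem hy, ENNReal.zero_rpow_of_pos hp'0]
  calc (∫⁻ y, k y ^ p') ^ (1 / p')
      ≤ (2 * ENNReal.ofReal (R ^ (-(v * p')) / (v * p'))) ^ (1 / p') := by gcongr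
    _ = (2 * ENNReal.ofReal ((v * p')⁻¹) * ENNReal.ofReal (R ^ (-(v * p')))) ^ (1 / p') := by
        rw [div_eq_mul_inv, ENNReal.ofReal_mul (by positivity)]; ring_nf
    _ = _ := by
        rw [ENNReal.mul_rpow_of_nonneg _ _ (by positivity)]
        congr 1
        rw [ENNReal.ofReal_rpow_of_nonneg (by positivity) (by positivity), ← Real.rpow_mul hR.le]
        congr 2
        field_simp

/-- The Hardy–Littlewood–Sobolev inequality for normalized functions. -/
theorem hls_normalized (hv : 0 < v) (huv : v < u) (hu : u < 1) :
    ∃ C : ℝ≥0∞, C ≠ ∞ ∧ ∀ (f : ℝ → ℝ≥0∞), Measurable f → ∫⁻ y, f y ^ (1 / u) = 1 →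
      ∫⁻ x, (∫⁻ y, ENNReal.ofReal (|x - y| ^ (u - v - 1)) * f y) ^ (1 / v) ≤ C := by
  obtain ⟨C1, hC1, H1⟩ := hls_far hv huv hu
  have hu0 : 0 < u := hv.trans huv
  set δ := u - v with hδ
  have hδ0 : 0 < δ := by linarith
  set C2 : ℝ≥0∞ := 2 * ENNReal.ofReal (1 / δ) with hC2
  have hC2' : C2 ≠ ∞ := ENNReal.mul_ne_top (by simp) ENNReal.ofReal_ne_top
  -- The additional `1` leaves a remainder `s` after `(C1 + C2) s` has been subtracted from `c s`.
  set c : ℝ≥0∞ := C1 + C2 + 1 with hc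
  have hct : c ≠ ∞ := by simp [hc, hC1, hC2']
  have hc0 : c ≠ 0 := by simp [hc]
  have hq0 : 0 < 1 / v := by positivity
  set e : ℝ := 1 / v - u / v with he
  have he0 : 0 < e := by rw [he, ← sub_div]; exact div_pos (by linarith) hv
  refine ⟨c ^ (1 / v) * (ENNReal.ofReal (1 / v) * (C2 / ENNReal.ofReal e)), ?_,
    fun f hf hf1 => ?_⟩
  · refine ENNReal.mul_ne_top (ENNReal.rpow_ne_top_of_nonneg hq0.le hct)
      (ENNReal.mul_ne_top ENNReal.ofReal_ne_top (ENNReal.div_ne_top hC2' ?_))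
    exact (ENNReal.ofReal_pos.mpr he0).ne'
  -- radius and height associated with the level `s`
  let R : ℝ → ℝ := fun s => s ^ (-(1 / v))
  let γ : ℝ → ℝ := fun s => s ^ (u / v)
  let k : ℝ → ℝ → ℝ≥0∞ := fun x y => ENNReal.ofReal (|x - y| ^ (δ - 1))
  let G : ℝ → ℝ → ℝ≥0∞ := fun s x => ∫⁻ y, {y | |x - y| < R s}.indicator (k x) y *
    {y | ENNReal.ofReal (γ s) < f y}.indicator f y
  let F : ℝ → ℝ≥0∞ := fun x => ∫⁻ y, k x y * f y
  have hkm : ∀ x, Measurable (k x) := fun x => by simp only [k]; fun_prop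
  have hnear : ∀ x r, MeasurableSet {y : ℝ | |x - y| < r} := fun x r =>
    measurableSet_lt (by fun_prop) measurable_const
  have hlev : ∀ s, MeasurableSet {y | ENNReal.ofReal (γ s) < f y} := fun s =>
    measurableSet_lt measurable_const hf
  have hRγ : ∀ s, 0 < s → γ s * (R s ^ δ / δ) = s * (1 / δ) := fun s hs => by
    simp only [γ, R]
    rw [← Real.rpow_mul hs.le, ← mul_div_assoc, ← Real.rpow_add hs,
      show u / v + -(1 / v) * δ = 1 by rw [hδ]; field_simp; ring, Real.rpow_one]
    ring
  have hRv : ∀ s, 0 < s → R s ^ (-v) = s := fun s hs => by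
    simp only [R]
    rw [← Real.rpow_mul hs.le, show -(1 / v) * -v = 1 by field_simp, Real.rpow_one]
  -- The kernel is split at radius `R s` and `f` at height `γ s`. These are chosen so that `R^{-v} =
  -- s` and `γ R^δ = s`: the far part and the near part with small `f` are then each `O(s)`, and `G
  -- s x` collects the near part with large `f`.
  have hFG : ∀ s x, 0 < s → F x ≤ (C1 + C2) * ENNReal.ofReal s + G s x := by
    intro s x hs
    have hR : 0 < R s := Real.rpow_pos_of_pos hs _
    have hγ : 0 < γ s := Real.rpow_pos_of_pos hs _
    have b1 := H1 f hf hf1 (R s) x hR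
    rw [hRv s hs] at b1
    have b2 : ∫⁻ y, {y | |x - y| < R s}.indicator (k x) y * ENNReal.ofReal (γ s) ≤
        C2 * ENNReal.ofReal s := by
      rw [lintegral_mul_const _ ((hkm x).indicator (hnear x _))]
      calc _ ≤ 2 * ENNReal.ofReal (R s ^ δ / δ) * ENNReal.ofReal (γ s) := by
            gcongr
            exact lintegral_near_le hδ0 hR x
        _ = 2 * ENNReal.ofReal (γ s * (R s ^ δ / δ)) := by
            rw [ENNReal.ofReal_mul hγ.le]; ring
        _ = _ := by rw [hRγ s hs, ENNReal.ofReal_mul hs.le, hC2]; ring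
    have b3 : F x ≤ ∫⁻ y, ({y | ¬ |x - y| < R s}.indicator (k x) y * f y +
        ({y | |x - y| < R s}.indicator (k x) y * ENNReal.ofReal (γ s) +
        {y | |x - y| < R s}.indicator (k x) y *
          {y | ENNReal.ofReal (γ s) < f y}.indicator f y)) := by
      refine lintegral_mono fun y => ?_
      by_cases h1 : |x - y| < R s
      · rw [indicator_of_notMem (show y ∉ {y | ¬ |x - y| < R s} from fun h => h h1),
          indicator_of_mem (show y ∈ {y | |x - y| < R s} from h1), zero_mul, zero_add, ← mul_add]
        gcongr
        by_cases h2 : ENNReal.ofReal (γ s) < f y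
        · rw [indicator_of_mem (show y ∈ {y | ENNReal.ofReal (γ s) < f y} from h2)]
          exact le_add_self
        · exact (not_lt.mp h2).trans le_self_add
      · rw [indicator_of_mem (show y ∈ {y | ¬ |x - y| < R s} from h1)]
        exact le_self_add
    have m1 : Measurable fun y => {y | ¬ |x - y| < R s}.indicator (k x) y * f y :=
      ((hkm x).indicator (hnear x _).compl).mul hf
    have m2 : Measurable fun y => {y | |x - y| < R s}.indicator (k x) y * ENNReal.ofReal (γ s) :=
      ((hkm x).indicator (hnear x _)).mul_const _
    rw [lintegral_add_left m1, lintegral_add_left m2] at b3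
    calc F x ≤ C1 * ENNReal.ofReal s + (C2 * ENNReal.ofReal s + G s x) :=
          b3.trans (add_le_add b1 (add_le_add b2 le_rfl))
      _ = _ := by ring
  -- Layer-cake formula for `F/c`: whenever `c s ≤ F x`, the decomposition forces `s ≤ G s x`, so
  -- the weight `s^{1/v-1}` may be replaced by `s^{1/v-2} G s x`.
  have hpt : ∀ x, F x ^ (1 / v) ≤ c ^ (1 / v) * (ENNReal.ofReal (1 / v) *
      ∫⁻ s in Ioi (0 : ℝ), ENNReal.ofReal (s ^ (1 / v - 2)) * G s x) := by
    intro x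
    have h1 := lintegral_layer hq0 (F x / c)
    have h2 : F x ^ (1 / v) = c ^ (1 / v) * (ENNReal.ofReal (1 / v) *
        ((F x / c) ^ (1 / v) / ENNReal.ofReal (1 / v))) := by
      rw [ENNReal.mul_div_cancel (ENNReal.ofReal_pos.mpr hq0).ne' ENNReal.ofReal_ne_top,
        ← ENNReal.mul_rpow_of_nonneg _ _ hq0.le, ENNReal.mul_div_cancel hc0 hct]
    rw [h2, ← h1]
    refine mul_le_mul' le_rfl (mul_le_mul' le_rfl ?_)
    refine setLIntegral_mono' measurableSet_Ioi fun s hs => ?_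
    have hs0 : (0 : ℝ) < s := hs
    by_cases hlt : ENNReal.ofReal s < F x / c
    · rw [indicator_of_mem (show s ∈ {s | ENNReal.ofReal s < F x / c} from hlt), Pi.one_apply,
        mul_one]
      have h3 : ENNReal.ofReal s ≤ G s x := by
        have h4 : ENNReal.ofReal s * c ≤ F x := (ENNReal.le_div_iff_mul_le (Or.inl hc0)
          (Or.inl hct)).mp hlt.le
        have h5 := h4.trans (hFG s x hs0)
        rw [hc, mul_add, mul_one, mul_comm _ (C1 + C2)] at h5
        exact (ENNReal.add_le_add_iff_left (ENNReal.mul_ne_top (by simp [hC1, hC2'])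
          ENNReal.ofReal_ne_top)).mp h5
      calc ENNReal.ofReal (s ^ (1 / v - 1)) =
            ENNReal.ofReal (s ^ (1 / v - 2)) * ENNReal.ofReal s := by
            rw [← ENNReal.ofReal_mul (by positivity), ← Real.rpow_add_one hs0.ne']; ring_nf
        _ ≤ _ := by gcongr
    · rw [indicator_of_notMem (show s ∉ {s | ENNReal.ofReal s < F x / c} from hlt), mul_zero]
      exact zero_le
  have hjoint : Measurable (fun z : (ℝ × ℝ) × ℝ => {y | |z.1.2 - y| < R z.1.1}.indicator (k z.1.2) z.2 *
      {y | ENNReal.ofReal (γ z.1.1) < f y}.indicator f z.2) := by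
    refine Measurable.mul ?_ ?_
    · have : Measurable (({z : (ℝ × ℝ) × ℝ | |z.1.2 - z.2| < R z.1.1}).indicator
          (fun z => k z.1.2 z.2)) := by
        refine Measurable.indicator (by simp only [k]; fun_prop) ?_
        exact measurableSet_lt (by fun_prop) (by simp only [R]; fun_prop)
      exact this
    · have : Measurable (({z : (ℝ × ℝ) × ℝ | ENNReal.ofReal (γ z.1.1) < f z.2}).indicator
          (fun z => f z.2)) := by
        refine Measurable.indicator (by fun_prop) ?_
        exact measurableSet_lt (by simp only [γ]; fun_prop) (by fun_prop)
      exact this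
  have hGm : Measurable (fun z : ℝ × ℝ => G z.1 z.2) := hjoint.lintegral_prod_right'
  -- After exchanging the integrals, the near kernel integrates in `x` to a multiple of `R^δ`,
  -- whatever `y` is.
  have hGint : ∀ s, 0 < s → ∫⁻ x, G s x ≤ C2 * ENNReal.ofReal (s ^ (-(1 / v) * δ)) *
      ∫⁻ y, {y | ENNReal.ofReal (γ s) < f y}.indicator f y := by
    intro s hs
    have hR : 0 < R s := Real.rpow_pos_of_pos hs _
    have hj : Measurable (fun z : ℝ × ℝ => {y | |z.1 - y| < R s}.indicator (k z.1) z.2 *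
        {y | ENNReal.ofReal (γ s) < f y}.indicator f z.2) :=
      hjoint.comp (measurable_prodMk_left.comp measurable_fst |>.prodMk measurable_snd)
    simp only [G]
    rw [lintegral_lintegral_swap hj.aemeasurable]
    rw [← lintegral_const_mul _ (hf.indicator (hlev s))]
    refine lintegral_mono fun y => ?_
    have hsw : ∀ x, {y | |x - y| < R s}.indicator (k x) y =
        {x | |y - x| < R s}.indicator (fun x => ENNReal.ofReal (|y - x| ^ (δ - 1))) x := fun x => by
      simp only [indicator, mem_ofPred_eq, k, abs_sub_comm x y]
    simp only [hsw]
    rw [lintegral_mul_const _ ((hkm y).indicator (hnear y _))]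
    gcongr
    refine (lintegral_near_le hδ0 hR y).trans (le_of_eq ?_)
    simp only [R]
    rw [← Real.rpow_mul hs.le, hC2, mul_assoc, ← ENNReal.ofReal_mul (by positivity)]
    congr 2
    ring
  calc ∫⁻ x, F x ^ (1 / v)
      ≤ ∫⁻ x, c ^ (1 / v) * (ENNReal.ofReal (1 / v) *
          ∫⁻ s in Ioi (0 : ℝ), ENNReal.ofReal (s ^ (1 / v - 2)) * G s x) := lintegral_mono hpt
    _ = c ^ (1 / v) * (ENNReal.ofReal (1 / v) *
          ∫⁻ s in Ioi (0 : ℝ), ENNReal.ofReal (s ^ (1 / v - 2)) * ∫⁻ x, G s x) := by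
        have hm2 : Measurable (fun z : ℝ × ℝ => ENNReal.ofReal (z.2 ^ (1 / v - 2)) * G z.2 z.1) :=
          Measurable.mul (by fun_prop) (hGm.comp measurable_swap)
        rw [lintegral_const_mul _ ((hm2.lintegral_prod_right').const_mul _),
          lintegral_const_mul _ hm2.lintegral_prod_right',
          lintegral_lintegral_swap hm2.aemeasurable]
        congr 2
        refine lintegral_congr fun s => ?_
        have hGs : Measurable fun x => G s x := hGm.comp measurable_prodMk_left
        exact lintegral_const_mul (ENNReal.ofReal (s ^ (1 / v - 2))) hGs
    _ ≤ c ^ (1 / v) * (ENNReal.ofReal (1 / v) * ∫⁻ s in Ioi (0 : ℝ), ∫⁻ y,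
          C2 * (ENNReal.ofReal (s ^ (e - 1)) *
            {y | ENNReal.ofReal (γ s) < f y}.indicator f y)) := by
        refine mul_le_mul' le_rfl (mul_le_mul' le_rfl ?_)
        refine setLIntegral_mono' measurableSet_Ioi fun s hs => ?_
        have hs0 : (0 : ℝ) < s := hs
        have hfl : Measurable fun y => {y | ENNReal.ofReal (γ s) < f y}.indicator f y :=
          hf.indicator (hlev s)
        rw [lintegral_const_mul _ (hfl.const_mul _), lintegral_const_mul _ hfl]
        calc _ ≤ ENNReal.ofReal (s ^ (1 / v - 2)) * (C2 * ENNReal.ofReal (s ^ (-(1 / v) * δ)) *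
              ∫⁻ y, {y | ENNReal.ofReal (γ s) < f y}.indicator f y) := by
              gcongr
              exact hGint s hs0
          _ = C2 * ((ENNReal.ofReal (s ^ (1 / v - 2)) * ENNReal.ofReal (s ^ (-(1 / v) * δ))) *
              ∫⁻ y, {y | ENNReal.ofReal (γ s) < f y}.indicator f y) := by ring
          _ = _ := by
              rw [← ENNReal.ofReal_mul (by positivity), ← Real.rpow_add hs0]
              congr 4
              rw [he, hδ]; field_simp; ring
    _ ≤ c ^ (1 / v) * (ENNReal.ofReal (1 / v) * (C2 / ENNReal.ofReal e)) := by
        gcongr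
        have hm3 : Measurable (fun z : ℝ × ℝ => C2 * (ENNReal.ofReal (z.1 ^ (e - 1)) *
            {y | ENNReal.ofReal (γ z.1) < f y}.indicator f z.2)) := by
          have : Measurable (({z : ℝ × ℝ | ENNReal.ofReal (γ z.1) < f z.2}).indicator
              (fun z => f z.2)) := by
            refine Measurable.indicator (by fun_prop) ?_
            exact measurableSet_lt (by simp only [γ]; fun_prop) (by fun_prop)
          exact (Measurable.mul (by fun_prop) this).const_mul _
        rw [lintegral_lintegral_swap hm3.aemeasurable]
        -- For fixed `y` the condition `γ s < f y` reads `s < f y ^ (v/u)`, so the layer-cake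
        -- formula is used backwards; the exponents add up as `(v/u) e + 1 = 1/u`.
        have hin : ∀ y, ∫⁻ s in Ioi (0 : ℝ), C2 * (ENNReal.ofReal (s ^ (e - 1)) *
            {y | ENNReal.ofReal (γ s) < f y}.indicator f y) =
            C2 / ENNReal.ofReal e * f y ^ (1 / u) := by
          intro y
          have h1 := lintegral_layer he0 (f y ^ (v / u))
          have h2 : ∀ s ∈ Ioi (0 : ℝ), C2 * (ENNReal.ofReal (s ^ (e - 1)) *
              {y | ENNReal.ofReal (γ s) < f y}.indicator f y) = C2 * f y *
              (ENNReal.ofReal (s ^ (e - 1)) *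
                {s | ENNReal.ofReal s < f y ^ (v / u)}.indicator 1 s) := by
            intro s hs
            have hs0 : (0 : ℝ) < s := hs
            have hiff : ENNReal.ofReal (γ s) < f y ↔ ENNReal.ofReal s < f y ^ (v / u) := by
              have : f y = (f y ^ (v / u)) ^ (u / v) := by
                rw [← ENNReal.rpow_mul, show v / u * (u / v) = 1 by field_simp, ENNReal.rpow_one]
              conv_lhs => rw [this]
              simp only [γ]
              rw [← ENNReal.ofReal_rpow_of_pos hs0]
              exact ENNReal.rpow_lt_rpow_iff (by positivity)
            by_cases hlt : ENNReal.ofReal (γ s) < f y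
            · rw [indicator_of_mem (show y ∈ {y | ENNReal.ofReal (γ s) < f y} from hlt),
                indicator_of_mem (show s ∈ {s | ENNReal.ofReal s < f y ^ (v / u)} from hiff.mp hlt),
                Pi.one_apply]
              ring
            · rw [indicator_of_notMem (show y ∉ {y | ENNReal.ofReal (γ s) < f y} from hlt),
                indicator_of_notMem (show s ∉ {s | ENNReal.ofReal s < f y ^ (v / u)} from
                  fun h => hlt (hiff.mpr h))]
              simp
          have h4 : Measurable fun s : ℝ => ENNReal.ofReal (s ^ (e - 1)) *
              {s : ℝ | ENNReal.ofReal s < f y ^ (v / u)}.indicator 1 s :=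
            Measurable.mul (by fun_prop) (measurable_one.indicator
              (measurableSet_lt (by fun_prop) measurable_const))
          rw [setLIntegral_congr_fun measurableSet_Ioi h2, lintegral_const_mul _ h4, h1, ← ENNReal.rpow_mul,
            mul_div_assoc', mul_assoc, mul_comm (f y)]
          have h3 : f y ^ (v / u * e) * f y = f y ^ (1 / u) := by
            have hx : 0 < v / u * e := by positivity
            nth_rewrite 2 [← ENNReal.rpow_one (f y)]
            rw [← ENNReal.rpow_add_of_nonneg _ _ hx.le zero_le_one]
            congr 1
            rw [he]; field_simp; ring
          rw [h3, ENNReal.mul_div_right_comm]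
        simp only [hin]
        rw [lintegral_const_mul _ (hf.pow_const _), hf1, mul_one]

/-- The Hardy–Littlewood–Sobolev inequality on the line. -/
theorem hls (hv : 0 < v) (huv : v < u) (hu : u < 1) :
    ∃ C : ℝ≥0∞, C ≠ ∞ ∧ ∀ (f : ℝ → ℝ≥0∞), Measurable f →
      ∫⁻ x, (∫⁻ y, ENNReal.ofReal (|x - y| ^ (u - v - 1)) * f y) ^ (1 / v) ≤
        C * (∫⁻ y, f y ^ (1 / u)) ^ (u / v) := by
  obtain ⟨C, hC, H⟩ := hls_normalized hv huv hu
  have hu0 : 0 < u := hv.trans huv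
  have hkm : ∀ x, Measurable (fun y : ℝ => ENNReal.ofReal (|x - y| ^ (u - v - 1))) :=
    fun x => by fun_prop
  refine ⟨C + 1, by simp [hC], fun f hf => ?_⟩
  set N := ∫⁻ y, f y ^ (1 / u) with hN
  rcases eq_or_ne N 0 with h0 | h0
  · have hf0 : f =ᵐ[volume] 0 := by
      have := (lintegral_eq_zero_iff (hf.pow_const (1 / u))).mp h0
      filter_upwards [this] with y hy
      simpa [ENNReal.rpow_eq_zero_iff, hu0, hu0.not_gt] using hy
    have : ∀ x, ∫⁻ y, ENNReal.ofReal (|x - y| ^ (u - v - 1)) * f y = 0 := fun x => by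
      rw [lintegral_eq_zero_iff (by fun_prop)]
      filter_upwards [hf0] with y hy
      simp [hy]
    simp [this, ENNReal.zero_rpow_of_pos (inv_pos.mpr hv)]
  rcases eq_or_ne N ∞ with ht | ht
  · rw [ht, ENNReal.top_rpow_of_pos (by positivity), ENNReal.mul_top (by simp)]
    exact le_top
  have hNu0 : N ^ u ≠ 0 := by simp [ENNReal.rpow_eq_zero_iff, h0, ht]
  have hNut : N ^ u ≠ ∞ := ENNReal.rpow_ne_top_of_nonneg hu0.le ht
  -- Both sides are homogeneous, so `f` is divided by its `L^{1/u}` norm `N^u`; the norms `0` and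
  -- `∞` have been treated separately.
  have key := H (fun y => (N ^ u)⁻¹ * f y) (hf.const_mul _) (by
    simp only [ENNReal.mul_rpow_of_nonneg _ _ (by positivity : 0 ≤ 1 / u)]
    rw [lintegral_const_mul _ (hf.pow_const _), ← hN, ENNReal.inv_rpow, ← ENNReal.rpow_mul,
      mul_one_div_cancel hu0.ne', ENNReal.rpow_one, ENNReal.inv_mul_cancel h0 ht])
  have e1 : ∀ x, (∫⁻ y, ENNReal.ofReal (|x - y| ^ (u - v - 1)) * f y) ^ (1 / v) =
      N ^ (u / v) * (∫⁻ y, ENNReal.ofReal (|x - y| ^ (u - v - 1)) * ((N ^ u)⁻¹ * f y)) ^ (1 / v) := by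
    intro x
    simp only [mul_left_comm _ ((N ^ u)⁻¹)]
    have hkf : Measurable fun y => ENNReal.ofReal (|x - y| ^ (u - v - 1)) * f y := (hkm x).mul hf
    rw [lintegral_const_mul _ hkf, ENNReal.mul_rpow_of_nonneg _ _ (by positivity),
      ENNReal.inv_rpow, ← ENNReal.rpow_mul, mul_one_div, ← mul_assoc, ENNReal.mul_inv_cancel
        (by simp [ENNReal.rpow_eq_zero_iff, h0, ht])
        (ENNReal.rpow_ne_top_of_nonneg (by positivity) ht), one_mul]
  simp only [e1]
  have hm : Measurable (fun x => (∫⁻ y, ENNReal.ofReal (|x - y| ^ (u - v - 1)) *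
      ((N ^ u)⁻¹ * f y)) ^ (1 / v)) := by
    refine Measurable.pow_const ?_ _
    exact Measurable.lintegral_prod_right' (f := fun z : ℝ × ℝ =>
      ENNReal.ofReal (|z.1 - z.2| ^ (u - v - 1)) * ((N ^ u)⁻¹ * f z.2)) (by fun_prop)
  rw [lintegral_const_mul _ hm, mul_comm]
  gcongr
  exact key.trans le_self_add

end

end
end SymmJacobi

namespace SymmJacobi
noncomputable section

/-! ### `L^p`–`L^q` bounds for positive kernels -/

/-- The integral operator with positive kernel `K` is bounded from `L^{1/u}(ν)` to `L^{1/v}(ν)`. -/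
def KerBound (ν : Measure ℝ) (u v : ℝ) (K : ℝ → ℝ → ℝ≥0∞) : Prop :=
  ∃ C : ℝ≥0∞, C ≠ ∞ ∧ ∀ f : ℝ → ℝ≥0∞, Measurable f →
    ∫⁻ θ, (∫⁻ φ, K θ φ * f φ ∂ν) ^ (1 / v) ∂ν ≤ C * (∫⁻ φ, f φ ^ (1 / u) ∂ν) ^ (u / v)

variable {ν : Measure ℝ} {u v : ℝ} {K L : ℝ → ℝ → ℝ≥0∞}

theorem KerBound.restrict (hu : 0 < u) (h : KerBound ν u v K) {s : Set ℝ} (hs : MeasurableSet s) :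
    KerBound (ν.restrict s) u v K := by
  obtain ⟨C, hC, H⟩ := h
  refine ⟨C, hC, fun f hf => ?_⟩
  have e1 : ∀ θ, ∫⁻ φ in s, K θ φ * f φ ∂ν = ∫⁻ φ, K θ φ * s.indicator f φ ∂ν := fun θ => by
    rw [← lintegral_indicator hs]
    refine lintegral_congr fun φ => ?_
    by_cases h : φ ∈ s <;> simp [h]
  have e2 : ∫⁻ φ in s, f φ ^ (1 / u) ∂ν = ∫⁻ φ, s.indicator f φ ^ (1 / u) ∂ν := by
    rw [← lintegral_indicator hs]
    refine lintegral_congr fun φ => ?_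
    by_cases h : φ ∈ s <;> simp [h, hu]
  simp only [e1]
  rw [e2]
  exact (setLIntegral_le_lintegral _ _).trans (H _ (hf.indicator hs))

/-- Since points are null, kernels need to be compared only off the diagonal and on a set of full
measure. -/
theorem KerBound.mono (hν : ∀ x, ν {x} = 0) (hv : 0 < v) (h : KerBound ν u v L) {s : Set ℝ}
    (hs : ∀ᵐ x ∂ν, x ∈ s) (hKL : ∀ θ ∈ s, ∀ φ ∈ s, θ ≠ φ → K θ φ ≤ L θ φ) : KerBound ν u v K := by
  obtain ⟨C, hC, H⟩ := h
  refine ⟨C, hC, fun f hf => le_trans ?_ (H f hf)⟩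
  refine lintegral_mono_ae ?_
  filter_upwards [hs] with θ hθ
  refine ENNReal.rpow_le_rpow ?_ (by positivity)
  refine lintegral_mono_ae ?_
  have hne : ∀ᵐ φ ∂ν, φ ≠ θ := by
    simpa [ae_iff] using hν θ
  filter_upwards [hs, hne] with φ hφ hne
  gcongr
  exact hKL θ hθ φ hφ hne.symm

theorem KerBound.const_mul (hv : 0 < v) (h : KerBound ν u v K)
    (hK : Measurable (Function.uncurry K)) {c : ℝ≥0∞} (hc : c ≠ ∞) :
    KerBound ν u v (fun θ φ => c * K θ φ) := by
  obtain ⟨C, hC, H⟩ := h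
  refine ⟨c ^ (1 / v) * C, ENNReal.mul_ne_top (ENNReal.rpow_ne_top_of_nonneg (by positivity) hc) hC,
    fun f hf => ?_⟩
  have hm : ∀ θ, Measurable (fun φ => K θ φ * f φ) := fun θ =>
    (hK.comp measurable_prodMk_left).mul hf
  simp only [mul_assoc c]
  simp only [lintegral_const_mul _ (hm _),
    ENNReal.mul_rpow_of_nonneg _ _ (by positivity : 0 ≤ 1 / v)]
  rw [lintegral_const_mul' _ _ (ENNReal.rpow_ne_top_of_nonneg (by positivity) hc), mul_assoc]
  gcongr
  exact H f hf

theorem KerBound.add [SFinite ν] (hv : 0 < v) (hv1 : v ≤ 1) (h : KerBound ν u v K)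
    (h' : KerBound ν u v L) (hK : Measurable (Function.uncurry K)) :
    KerBound ν u v (fun θ φ => K θ φ + L θ φ) := by
  obtain ⟨C, hC, H⟩ := h
  obtain ⟨C', hC', H'⟩ := h'
  refine ⟨2 ^ (1 / v - 1) * (C + C'), ENNReal.mul_ne_top (ENNReal.rpow_ne_top_of_nonneg
    (by rw [sub_nonneg]; exact (one_le_div hv).mpr hv1) (by simp)) (by simp [hC, hC']),
    fun f hf => ?_⟩
  have hm2 : Measurable (fun z : ℝ × ℝ => K z.1 z.2 * f z.2) := hK.mul (hf.comp measurable_snd)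
  have hm : ∀ θ, Measurable (fun φ => K θ φ * f φ) := fun θ => hm2.comp measurable_prodMk_left
  have hmo : Measurable (fun θ => (∫⁻ φ, K θ φ * f φ ∂ν) ^ (1 / v)) :=
    hm2.lintegral_prod_right'.pow_const _
  simp only [add_mul]
  simp only [lintegral_add_left (hm _)]
  calc _ ≤ ∫⁻ θ, 2 ^ (1 / v - 1) * ((∫⁻ φ, K θ φ * f φ ∂ν) ^ (1 / v) +
        (∫⁻ φ, L θ φ * f φ ∂ν) ^ (1 / v)) ∂ν :=
        lintegral_mono fun θ => ENNReal.rpow_add_le_mul_rpow_add_rpow _ _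
          ((one_le_div hv).mpr hv1)
    _ = 2 ^ (1 / v - 1) * (∫⁻ θ, (∫⁻ φ, K θ φ * f φ ∂ν) ^ (1 / v) ∂ν +
        ∫⁻ θ, (∫⁻ φ, L θ φ * f φ ∂ν) ^ (1 / v) ∂ν) := by
        rw [lintegral_const_mul' _ _ (ENNReal.rpow_ne_top_of_nonneg
          (by rw [sub_nonneg]; exact (one_le_div hv).mpr hv1) (by simp)), lintegral_add_left hmo]
    _ ≤ 2 ^ (1 / v - 1) * (C * (∫⁻ φ, f φ ^ (1 / u) ∂ν) ^ (u / v) +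
        C' * (∫⁻ φ, f φ ^ (1 / u) ∂ν) ^ (u / v)) := by
        gcongr
        · exact H f hf
        · exact H' f hf
    _ = _ := by ring

theorem lintegral_Ioo_reflect (h : ℝ → ℝ≥0∞) :
    ∫⁻ θ in Ioo 0 Real.pi, h (Real.pi - θ) = ∫⁻ θ in Ioo 0 Real.pi, h θ := by
  rw [← lintegral_indicator measurableSet_Ioo, ← lintegral_indicator measurableSet_Ioo,
    ← lintegral_sub_left_eq_self _ Real.pi]
  refine lintegral_congr fun x => ?_
  by_cases hx : x ∈ Ioo 0 Real.pi
  · rw [indicator_of_mem hx, indicator_of_mem (show Real.pi - x ∈ Ioo 0 Real.pi from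
      ⟨by linarith [hx.2], by linarith [hx.1]⟩), sub_sub_cancel]
  · rw [indicator_of_notMem hx, indicator_of_notMem (show Real.pi - x ∉ Ioo 0 Real.pi from
      fun h => hx ⟨by linarith [h.2], by linarith [h.1]⟩)]

theorem KerBound.reflect (h : KerBound (volume.restrict (Ioo 0 Real.pi)) u v K) :
    KerBound (volume.restrict (Ioo 0 Real.pi)) u v
      (fun θ φ => K (Real.pi - θ) (Real.pi - φ)) := by
  obtain ⟨C, hC, H⟩ := h
  refine ⟨C, hC, fun f hf => ?_⟩
  have e1 : ∀ θ, ∫⁻ φ in Ioo 0 Real.pi, K (Real.pi - θ) (Real.pi - φ) * f φ =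
      ∫⁻ φ in Ioo 0 Real.pi, K (Real.pi - θ) φ * f (Real.pi - φ) := fun θ => by
    rw [← lintegral_Ioo_reflect (fun φ => K (Real.pi - θ) φ * f (Real.pi - φ))]
    simp
  simp only [e1]
  rw [lintegral_Ioo_reflect (fun θ => (∫⁻ φ in Ioo 0 Real.pi, K θ φ * f (Real.pi - φ)) ^ (1 / v)),
    ← lintegral_Ioo_reflect (fun φ => f φ ^ (1 / u))]
  exact H _ (hf.comp (by fun_prop))

/-! ### Hardy kernels -/

/-- A weighted Schur test with a free exponent `x`. Hölder applied to `φ^{e-x} · φ^x f` on a section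
of `S`, with (h1), bounds the operator by `θ^{-v-x} G(θ)^u`, where `G` integrates `φ^{x/u} f^{1/u}`
over the section. After raising to the power `1/v`, one factor `G` is kept, the power `G^{u/v-1}` is
bounded through (h2) by the norm of `f`, and Fubini with (h3) integrates what remains. -/
theorem kerBound_hardy (hv : 0 < v) (huv : v < u) (hu : u < 1) {S : Set (ℝ × ℝ)}
    (hS : MeasurableSet S) {b e x : ℝ} (hbe : b + e = u - v - 1) {C₁ C₂ : ℝ≥0∞} (hC₁ : C₁ ≠ ∞)
    (hC₂ : C₂ ≠ ∞)
    (h1 : ∀ θ, 0 < θ → ∫⁻ φ in Ioi (0 : ℝ), {φ | (θ, φ) ∈ S}.indicator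
      (fun φ => ENNReal.ofReal (φ ^ ((e - x) / (1 - u)))) φ ≤
        C₁ * ENNReal.ofReal (θ ^ ((e - x) / (1 - u) + 1)))
    (h2 : ∀ θ φ, 0 < θ → 0 < φ → (θ, φ) ∈ S → φ ^ x ≤ θ ^ x)
    (h3 : ∀ φ, 0 < φ → ∫⁻ θ in Ioi (0 : ℝ), {θ | (θ, φ) ∈ S}.indicator
      (fun θ => ENNReal.ofReal (θ ^ (-1 - x / u))) θ ≤ C₂ * ENNReal.ofReal (φ ^ (-(x / u)))) :
    KerBound (volume.restrict (Ioi 0)) u v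
      (fun θ φ => S.indicator (fun z => ENNReal.ofReal (z.1 ^ b * z.2 ^ e)) (θ, φ)) := by
  have hu0 : 0 < u := hv.trans huv
  have hu1 : 0 < 1 - u := by linarith
  have hSθ : ∀ θ, MeasurableSet {φ | (θ, φ) ∈ S} := fun θ => measurable_prodMk_left hS
  have hpq : (1 / (1 - u)).HolderConjugate (1 / u) := by
    rw [Real.holderConjugate_iff]
    refine ⟨(one_lt_div hu1).mpr (by linarith), ?_⟩
    rw [one_div, one_div, inv_inv, inv_inv]; ring
  refine ⟨C₁ ^ ((1 - u) / v) * C₂, ENNReal.mul_ne_top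
    (ENNReal.rpow_ne_top_of_nonneg (by positivity) hC₁) hC₂, fun f hf => ?_⟩
  set N := ∫⁻ φ in Ioi (0 : ℝ), f φ ^ (1 / u) with hN
  let g : ℝ → ℝ → ℝ≥0∞ := fun θ φ => S.indicator (fun z => ENNReal.ofReal (z.2 ^ (x / u)) *
    f z.2 ^ (1 / u)) (θ, φ)
  let G : ℝ → ℝ≥0∞ := fun θ => ∫⁻ φ in Ioi (0 : ℝ), g θ φ
  have hgm : Measurable (fun z : ℝ × ℝ => g z.1 z.2) := by
    refine Measurable.indicator ?_ hS
    fun_prop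
  have hGm : Measurable G := hgm.lintegral_prod_right'
  have hgθ : ∀ θ, Measurable (g θ) := fun θ => hgm.comp measurable_prodMk_left
  have hGN : ∀ θ, 0 < θ → G θ ≤ ENNReal.ofReal (θ ^ (x / u)) * N := by
    intro θ hθ
    rw [hN, ← lintegral_const_mul _ (hf.pow_const _)]
    refine setLIntegral_mono' measurableSet_Ioi fun φ hφ => ?_
    have hφ0 : (0 : ℝ) < φ := hφ
    simp only [g]
    by_cases hs : (θ, φ) ∈ S
    · rw [indicator_of_mem hs]
      refine mul_le_mul' (ENNReal.ofReal_le_ofReal ?_) le_rfl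
      have := Real.rpow_le_rpow (by positivity) (h2 θ φ hθ hφ0 hs) (inv_pos.mpr hu0).le
      rwa [← Real.rpow_mul hφ0.le, ← Real.rpow_mul hθ.le, ← div_eq_mul_inv] at this
    · rw [indicator_of_notMem hs]
      exact bot_le
  have hF : ∀ θ, 0 < θ → ∫⁻ φ in Ioi (0 : ℝ), S.indicator
      (fun z => ENNReal.ofReal (z.1 ^ b * z.2 ^ e)) (θ, φ) * f φ ≤
      ENNReal.ofReal (θ ^ (-v - x)) * C₁ ^ (1 - u) * G θ ^ u := by
    intro θ hθ
    let A : ℝ → ℝ≥0∞ := {φ | (θ, φ) ∈ S}.indicator (fun φ => ENNReal.ofReal (φ ^ (e - x)))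
    let B : ℝ → ℝ≥0∞ := {φ | (θ, φ) ∈ S}.indicator (fun φ => ENNReal.ofReal (φ ^ x) * f φ)
    have hA : Measurable A := Measurable.indicator (by fun_prop) (hSθ θ)
    have hB : Measurable B := Measurable.indicator (by fun_prop) (hSθ θ)
    have q1 : ∫⁻ φ in Ioi (0 : ℝ), S.indicator
        (fun z => ENNReal.ofReal (z.1 ^ b * z.2 ^ e)) (θ, φ) * f φ =
        ENNReal.ofReal (θ ^ b) * ∫⁻ φ in Ioi (0 : ℝ), (A * B) φ := by
      rw [← lintegral_const_mul _ (hA.mul hB)]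
      refine setLIntegral_congr_fun measurableSet_Ioi fun φ hφ => ?_
      have hφ0 : (0 : ℝ) < φ := hφ
      simp only [A, B, Pi.mul_apply]
      by_cases hs : (θ, φ) ∈ S
      · have hs' : φ ∈ {φ | (θ, φ) ∈ S} := hs
        rw [indicator_of_mem hs, indicator_of_mem hs', indicator_of_mem hs', ← mul_assoc,
          ← mul_assoc, mul_assoc (ENNReal.ofReal (θ ^ b)), ← ENNReal.ofReal_mul (by positivity),
          ← ENNReal.ofReal_mul (by positivity), ← Real.rpow_add hφ0, sub_add_cancel]
      · have hs' : φ ∉ {φ | (θ, φ) ∈ S} := hs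
        rw [indicator_of_notMem hs, indicator_of_notMem hs', indicator_of_notMem hs']
        simp
    have q2 := ENNReal.lintegral_mul_le_Lp_mul_Lq (volume.restrict (Ioi (0 : ℝ))) hpq
      hA.aemeasurable hB.aemeasurable
    have q3 : ∫⁻ φ in Ioi (0 : ℝ), A φ ^ (1 / (1 - u)) ≤
        C₁ * ENNReal.ofReal (θ ^ ((e - x) / (1 - u) + 1)) := by
      refine le_trans (le_of_eq ?_) (h1 θ hθ)
      refine setLIntegral_congr_fun measurableSet_Ioi fun φ hφ => ?_
      have hφ0 : (0 : ℝ) < φ := hφ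
      simp only [A]
      by_cases hs' : φ ∈ {φ | (θ, φ) ∈ S}
      · rw [indicator_of_mem hs', indicator_of_mem hs', ENNReal.ofReal_rpow_of_nonneg
          (by positivity) (by positivity), ← Real.rpow_mul hφ0.le, mul_one_div]
      · rw [indicator_of_notMem hs', indicator_of_notMem hs', ENNReal.zero_rpow_of_pos
          (by positivity)]
    have q4 : ∫⁻ φ in Ioi (0 : ℝ), B φ ^ (1 / u) = G θ := by
      refine setLIntegral_congr_fun measurableSet_Ioi fun φ hφ => ?_
      have hφ0 : (0 : ℝ) < φ := hφ
      simp only [B, g]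
      by_cases hs' : φ ∈ {φ | (θ, φ) ∈ S}
      · rw [indicator_of_mem hs', indicator_of_mem (show (θ, φ) ∈ S from hs'),
          ENNReal.mul_rpow_of_nonneg _ _ (by positivity), ENNReal.ofReal_rpow_of_nonneg
          (by positivity) (by positivity), ← Real.rpow_mul hφ0.le, mul_one_div]
      · rw [indicator_of_notMem hs', indicator_of_notMem (show (θ, φ) ∉ S from hs'),
          ENNReal.zero_rpow_of_pos (by positivity)]
    rw [q4] at q2
    simp only [one_div_one_div] at q2
    rw [q1]
    calc _ ≤ ENNReal.ofReal (θ ^ b) * ((C₁ * ENNReal.ofReal (θ ^ ((e - x) / (1 - u) + 1))) ^ (1 - u) *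
          G θ ^ u) := by
          refine mul_le_mul' le_rfl (q2.trans (mul_le_mul' ?_ le_rfl))
          exact ENNReal.rpow_le_rpow q3 hu1.le
      _ = (ENNReal.ofReal (θ ^ b) * ENNReal.ofReal (θ ^ (((e - x) / (1 - u) + 1) * (1 - u)))) *
          C₁ ^ (1 - u) * G θ ^ u := by
          rw [ENNReal.mul_rpow_of_nonneg _ _ hu1.le, ENNReal.ofReal_rpow_of_nonneg (by positivity)
            hu1.le, ← Real.rpow_mul hθ.le]
          ring
      _ = _ := by
          rw [← ENNReal.ofReal_mul (by positivity), ← Real.rpow_add hθ]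
          congr 4
          have : ((e - x) / (1 - u) + 1) * (1 - u) = e - x + (1 - u) := by field_simp
          rw [this]; linarith
  have hFq : ∀ θ, 0 < θ → (∫⁻ φ in Ioi (0 : ℝ), S.indicator
      (fun z => ENNReal.ofReal (z.1 ^ b * z.2 ^ e)) (θ, φ) * f φ) ^ (1 / v) ≤
      C₁ ^ ((1 - u) / v) * N ^ (u / v - 1) * (ENNReal.ofReal (θ ^ (-1 - x / u)) * G θ) := by
    intro θ hθ
    have huv1 : 0 ≤ u / v - 1 := by rw [sub_nonneg]; exact (one_le_div hv).mpr huv.le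
    have p1 : G θ ^ (u / v) ≤ G θ * (ENNReal.ofReal (θ ^ (x / u)) * N) ^ (u / v - 1) := by
      calc G θ ^ (u / v) = G θ ^ (1 + (u / v - 1)) := by ring_nf
        _ = G θ * G θ ^ (u / v - 1) := by
          rw [ENNReal.rpow_add_of_nonneg _ _ zero_le_one huv1, ENNReal.rpow_one]
        _ ≤ _ := mul_le_mul' le_rfl (ENNReal.rpow_le_rpow (hGN θ hθ) huv1)
    calc _ ≤ (ENNReal.ofReal (θ ^ (-v - x)) * C₁ ^ (1 - u) * G θ ^ u) ^ (1 / v) :=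
          ENNReal.rpow_le_rpow (hF θ hθ) (by positivity)
      _ = ENNReal.ofReal (θ ^ ((-v - x) * (1 / v))) * C₁ ^ ((1 - u) / v) * G θ ^ (u / v) := by
          rw [ENNReal.mul_rpow_of_nonneg _ _ (by positivity), ENNReal.mul_rpow_of_nonneg _ _
            (by positivity), ENNReal.ofReal_rpow_of_nonneg (by positivity) (by positivity),
            ← Real.rpow_mul hθ.le, ← ENNReal.rpow_mul, ← ENNReal.rpow_mul, mul_one_div, mul_one_div,
            mul_one_div]
      _ ≤ ENNReal.ofReal (θ ^ ((-v - x) * (1 / v))) * C₁ ^ ((1 - u) / v) *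
          (G θ * (ENNReal.ofReal (θ ^ (x / u)) * N) ^ (u / v - 1)) := mul_le_mul' le_rfl p1
      _ = (ENNReal.ofReal (θ ^ ((-v - x) * (1 / v))) * ENNReal.ofReal (θ ^ (x / u * (u / v - 1)))) *
          (C₁ ^ ((1 - u) / v) * N ^ (u / v - 1) * G θ) := by
          rw [ENNReal.mul_rpow_of_nonneg _ _ huv1, ENNReal.ofReal_rpow_of_nonneg (by positivity)
            huv1, ← Real.rpow_mul hθ.le]
          ring
      _ = ENNReal.ofReal (θ ^ (-1 - x / u)) * (C₁ ^ ((1 - u) / v) * N ^ (u / v - 1) * G θ) := by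
          rw [← ENNReal.ofReal_mul (by positivity), ← Real.rpow_add hθ]
          congr 3
          field_simp; ring
      _ = _ := by ring
  calc _ ≤ ∫⁻ θ in Ioi (0 : ℝ), C₁ ^ ((1 - u) / v) * N ^ (u / v - 1) *
        (ENNReal.ofReal (θ ^ (-1 - x / u)) * G θ) :=
        setLIntegral_mono' measurableSet_Ioi fun θ hθ => hFq θ hθ
    _ = C₁ ^ ((1 - u) / v) * N ^ (u / v - 1) *
        ∫⁻ θ in Ioi (0 : ℝ), (ENNReal.ofReal (θ ^ (-1 - x / u)) * G θ) := by
        have hm : Measurable fun θ : ℝ => ENNReal.ofReal (θ ^ (-1 - x / u)) * G θ :=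
          Measurable.mul (by fun_prop) hGm
        exact lintegral_const_mul _ hm
    _ ≤ C₁ ^ ((1 - u) / v) * N ^ (u / v - 1) * (C₂ * N) := by
        refine mul_le_mul' le_rfl ?_
        have e1 : ∀ θ : ℝ, ENNReal.ofReal (θ ^ (-1 - x / u)) * G θ =
            ∫⁻ φ in Ioi (0 : ℝ), ENNReal.ofReal (θ ^ (-1 - x / u)) * g θ φ := fun θ =>
          (lintegral_const_mul _ (hgθ θ)).symm
        simp only [e1]
        have hm : Measurable fun z : ℝ × ℝ => ENNReal.ofReal (z.1 ^ (-1 - x / u)) * g z.1 z.2 :=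
          Measurable.mul (by fun_prop) hgm
        rw [lintegral_lintegral_swap hm.aemeasurable, hN, ← lintegral_const_mul _ (hf.pow_const _)]
        refine setLIntegral_mono' measurableSet_Ioi fun φ hφ => ?_
        have hφ0 : (0 : ℝ) < φ := hφ
        have e2 : ∀ θ, ENNReal.ofReal (θ ^ (-1 - x / u)) * g θ φ =
            {θ | (θ, φ) ∈ S}.indicator (fun θ => ENNReal.ofReal (θ ^ (-1 - x / u))) θ *
              (ENNReal.ofReal (φ ^ (x / u)) * f φ ^ (1 / u)) := fun θ => by
          simp only [g]
          by_cases hs : (θ, φ) ∈ S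
          · rw [indicator_of_mem hs, indicator_of_mem (show θ ∈ {θ | (θ, φ) ∈ S} from hs)]
          · rw [indicator_of_notMem hs, indicator_of_notMem (show θ ∉ {θ | (θ, φ) ∈ S} from hs)]
            simp
        simp only [e2]
        have hm3 : Measurable ({θ | (θ, φ) ∈ S}.indicator
            (fun θ => ENNReal.ofReal (θ ^ (-1 - x / u)))) :=
          Measurable.indicator (by fun_prop) (measurable_prodMk_right hS)
        rw [lintegral_mul_const _ hm3]
        calc _ ≤ C₂ * ENNReal.ofReal (φ ^ (-(x / u))) *
              (ENNReal.ofReal (φ ^ (x / u)) * f φ ^ (1 / u)) := mul_le_mul' (h3 φ hφ0) le_rfl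
          _ = C₂ * (ENNReal.ofReal (φ ^ (-(x / u))) * ENNReal.ofReal (φ ^ (x / u))) *
              f φ ^ (1 / u) := by ring
          _ = _ := by
            rw [← ENNReal.ofReal_mul (by positivity), ← Real.rpow_add hφ0, neg_add_cancel,
              Real.rpow_zero, ENNReal.ofReal_one, mul_one]
    _ = _ := by
        rw [show u / v = (u / v - 1) + 1 by ring, ENNReal.rpow_add_of_nonneg _ _
          (by rw [sub_nonneg]; exact (one_le_div hv).mpr huv.le) zero_le_one, ENNReal.rpow_one]
        ring_nf

end
end SymmJacobi

namespace SymmJacobi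
noncomputable section

/-! ### Hardy operators, the corner kernel and boundedness of the majorant -/

section
variable {u v a : ℝ}

theorem lintegral_Ioi_indicator_lt {θ : ℝ} (hθ : 0 < θ) (g : ℝ → ℝ≥0∞) :
    ∫⁻ φ in Ioi (0 : ℝ), {φ | θ < φ}.indicator g φ = ∫⁻ φ in Ioi θ, g φ := by
  rw [← lintegral_indicator measurableSet_Ioi, ← lintegral_indicator measurableSet_Ioi]
  refine lintegral_congr fun φ => ?_
  by_cases h : θ < φ
  · rw [indicator_of_mem (show φ ∈ Ioi (0 : ℝ) from hθ.trans h),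
      indicator_of_mem (show φ ∈ {φ | θ < φ} from h), indicator_of_mem (show φ ∈ Ioi θ from h)]
  · rw [indicator_of_notMem (show φ ∉ Ioi θ from h)]
    by_cases h0 : φ ∈ Ioi (0 : ℝ)
    · rw [indicator_of_mem h0, indicator_of_notMem (show φ ∉ {φ | θ < φ} from h)]
    · rw [indicator_of_notMem h0]

theorem lintegral_Ioi_indicator_gt (θ : ℝ) (g : ℝ → ℝ≥0∞) :
    ∫⁻ φ in Ioi (0 : ℝ), {φ | φ < θ}.indicator g φ = ∫⁻ φ in Ioo 0 θ, g φ := by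
  rw [← lintegral_indicator measurableSet_Ioi, ← lintegral_indicator measurableSet_Ioo]
  refine lintegral_congr fun φ => ?_
  by_cases h0 : φ ∈ Ioi (0 : ℝ)
  · rw [indicator_of_mem h0]
    by_cases h : φ < θ
    · rw [indicator_of_mem (show φ ∈ {φ | φ < θ} from h), indicator_of_mem
        (show φ ∈ Ioo 0 θ from ⟨h0, h⟩)]
    · rw [indicator_of_notMem (show φ ∉ {φ | φ < θ} from h), indicator_of_notMem
        (show φ ∉ Ioo 0 θ from fun hh => h hh.2)]
  · rw [indicator_of_notMem h0, indicator_of_notMem (show φ ∉ Ioo 0 θ from fun hh => h0 hh.1)]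

theorem kerBound_hardy_upper (hv : 0 < v) (huv : v < u) (hu : u < 1) (hav : a < v) :
    KerBound (volume.restrict (Ioi 0)) u v (fun θ φ => {z : ℝ × ℝ | z.1 < z.2}.indicator
      (fun z => ENNReal.ofReal (z.1 ^ (-a) * z.2 ^ (u - v - 1 + a))) (θ, φ)) := by
  have hu0 : 0 < u := hv.trans huv
  have hu1 : 0 < 1 - u := by linarith
  -- Convergence at infinity in `φ` requires `a - v < x` and convergence at `0` in `θ` requires `x <
  -- 0`; the midpoint is admissible because `a < v`.
  set x : ℝ := (a - v) / 2 with hx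
  set E : ℝ := (u - v - 1 + a - x) / (1 - u) with hE
  have hE1 : E < -1 := by
    rw [hE, div_lt_iff₀ hu1]; linarith
  have hxu : 0 < -(x / u) := by rw [← neg_div]; exact div_pos (by linarith) hu0
  refine kerBound_hardy hv huv hu (measurableSet_lt measurable_fst measurable_snd) (x := x)
    (by ring) (C₁ := ENNReal.ofReal (1 / (-(E + 1)))) (C₂ := ENNReal.ofReal (1 / (-(x / u))))
    ENNReal.ofReal_ne_top ENNReal.ofReal_ne_top (fun θ hθ => ?_) (fun θ φ hθ hφ h => ?_)
    (fun φ hφ => ?_)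
  · refine le_of_eq ((lintegral_Ioi_indicator_lt hθ _).trans ?_)
    rw [lintegral_rpow_Ioi hE1 hθ, ← ENNReal.ofReal_mul (by
      rw [one_div]; exact inv_nonneg.mpr (by linarith)), mul_comm, mul_one_div]
  · exact Real.rpow_le_rpow_of_nonpos hθ (le_of_lt h) (by linarith)
  · refine le_of_eq ((lintegral_Ioi_indicator_gt φ _).trans ?_)
    rw [show -1 - x / u = -(x / u) - 1 by ring, lintegral_rpow_Ioo hxu hφ.le,
      ← ENNReal.ofReal_mul (by positivity), mul_comm, mul_one_div]

theorem kerBound_hardy_lower (hv : 0 < v) (huv : v < u) (ha0 : 0 ≤ a) (hua : u < 1 - a) :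
    KerBound (volume.restrict (Ioi 0)) u v (fun θ φ => {z : ℝ × ℝ | z.2 < z.1}.indicator
      (fun z => ENNReal.ofReal (z.1 ^ (u - v - 1 + a) * z.2 ^ (-a))) (θ, φ)) := by
  have hu0 : 0 < u := hv.trans huv
  have hu1 : 0 < 1 - u := by linarith
  -- Convergence at `0` in `φ` requires `x < 1 - a - u` and convergence at infinity in `θ` requires
  -- `x > 0`; the midpoint is admissible because `u < 1 - a`.
  set x : ℝ := (1 - a - u) / 2 with hx
  set E : ℝ := (-a - x) / (1 - u) with hE
  have hE1 : 0 < E + 1 := by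
    have : -1 < E := by rw [hE, lt_div_iff₀ hu1]; linarith
    linarith
  have hx0 : 0 < x := by linarith
  have hxu : 0 < x / u := by positivity
  refine kerBound_hardy hv huv (by linarith) (measurableSet_lt measurable_snd measurable_fst)
    (x := x) (by ring) (C₁ := ENNReal.ofReal (1 / (E + 1))) (C₂ := ENNReal.ofReal (1 / (x / u)))
    ENNReal.ofReal_ne_top ENNReal.ofReal_ne_top (fun θ hθ => ?_) (fun θ φ hθ hφ h => ?_)
    (fun φ hφ => ?_)
  · refine le_of_eq ((lintegral_Ioi_indicator_gt θ _).trans ?_)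
    have := lintegral_rpow_Ioo hE1 hθ.le
    rw [add_sub_cancel_right] at this
    rw [this, ← ENNReal.ofReal_mul (by positivity), mul_comm, mul_one_div]
  · exact Real.rpow_le_rpow hφ.le (le_of_lt h) hx0.le
  · refine le_of_eq ((lintegral_Ioi_indicator_lt hφ _).trans ?_)
    rw [lintegral_rpow_Ioi (by linarith) hφ, ← ENNReal.ofReal_mul (by positivity), mul_comm,
      mul_one_div]
    congr 2 <;> ring_nf

theorem restrict_singleton_eq_zero (s : Set ℝ) (x : ℝ) : volume.restrict s {x} = 0 :=
  le_antisymm ((Measure.restrict_apply_le s {x}).trans_eq Real.volume_singleton) bot_le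

/-- The part of the majorant that is singular at the left end point. -/
def leftKer (a δ θ φ : ℝ) : ℝ := |θ - φ| ^ (δ - 1) * (max θ φ / min θ φ) ^ a

/-- If `φ ≤ 2θ` the ratio is bounded and the Riesz kernel remains. Otherwise `φ - θ` is comparable
with `φ` and the kernel is of Hardy type. -/
theorem leftKer_le (ha0 : 0 ≤ a) (ha1 : a ≤ 1) {δ θ φ : ℝ} (hδ0 : 0 ≤ δ) (hδ1 : δ ≤ 1)
    (hθ : 0 < θ) (hφ : θ < φ) :
    leftKer a δ θ φ ≤ 2 * (|θ - φ| ^ (δ - 1) + θ ^ (-a) * φ ^ (δ - 1 + a)) := by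
  have hφ0 : 0 < φ := hθ.trans hφ
  have hd : 0 < φ - θ := sub_pos.mpr hφ
  rw [leftKer, max_eq_right hφ.le, min_eq_left hφ.le, abs_sub_comm, abs_of_pos hd]
  have h2 : ∀ y : ℝ, 0 ≤ y → y ≤ 1 → (2 : ℝ) ^ y ≤ 2 := fun y _ hy => by
    calc (2 : ℝ) ^ y ≤ 2 ^ (1 : ℝ) := Real.rpow_le_rpow_of_exponent_le (by norm_num) hy
      _ = 2 := Real.rpow_one 2
  rw [mul_add]
  by_cases h : φ ≤ 2 * θ
  · have h3 : (φ / θ) ^ a ≤ 2 := (Real.rpow_le_rpow (by positivity)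
      ((div_le_iff₀ hθ).mpr h) ha0).trans (h2 a ha0 ha1)
    calc _ ≤ (φ - θ) ^ (δ - 1) * 2 := by gcongr
      _ ≤ _ := by
        have : 0 ≤ 2 * (θ ^ (-a) * φ ^ (δ - 1 + a)) := by positivity
        linarith
  · have h3 : (φ - θ) ^ (δ - 1) ≤ 2 * φ ^ (δ - 1) := by
      calc (φ - θ) ^ (δ - 1) ≤ (φ / 2) ^ (δ - 1) :=
            Real.rpow_le_rpow_of_nonpos (by positivity) (by linarith) (by linarith)
        _ = 2 ^ (1 - δ) * φ ^ (δ - 1) := by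
            rw [Real.div_rpow hφ0.le (by norm_num), div_eq_mul_inv, ← Real.rpow_neg (by norm_num),
              mul_comm, neg_sub]
        _ ≤ _ := by gcongr; exact h2 _ (by linarith) (by linarith)
    calc _ ≤ 2 * φ ^ (δ - 1) * (φ / θ) ^ a := by gcongr
      _ = 2 * (θ ^ (-a) * φ ^ (δ - 1 + a)) := by
        rw [Real.div_rpow hφ0.le hθ.le, Real.rpow_add hφ0, Real.rpow_neg hθ.le]; ring
      _ ≤ _ := by
        have : 0 ≤ 2 * (φ - θ) ^ (δ - 1) := by positivity
        linarith

theorem leftKer_comm (a δ θ φ : ℝ) : leftKer a δ θ φ = leftKer a δ φ θ := by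
  rw [leftKer, leftKer, abs_sub_comm, max_comm, min_comm]

theorem measurable_leftKer (a δ : ℝ) : Measurable (Function.uncurry (leftKer a δ)) := by
  unfold leftKer Function.uncurry; fun_prop

theorem measurable_majKer (a δ : ℝ) : Measurable (Function.uncurry (majKer a δ)) := by
  unfold majKer cornerW Function.uncurry; fun_prop

theorem majKer_eq (a δ θ φ : ℝ) : majKer a δ θ φ = leftKer a δ θ φ +
    leftKer a δ (Real.pi - θ) (Real.pi - φ) + cornerW a θ * cornerW a φ := by
  rw [majKer, leftKer, leftKer, show Real.pi - θ - (Real.pi - φ) = -(θ - φ) by ring, abs_neg,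
    max_sub_sub_left, min_sub_sub_left]
  ring

theorem kerBound_leftKer (hv : 0 < v) (huv : v < u) (ha0 : 0 ≤ a) (hav : a < v)
    (hua : u < 1 - a) : KerBound (volume.restrict (Ioo 0 Real.pi)) u v
      (fun θ φ => ENNReal.ofReal (leftKer a (u - v) θ φ)) := by
  have hu0 : 0 < u := hv.trans huv
  have hI : (volume.restrict (Ioi (0 : ℝ))).restrict (Ioo 0 Real.pi) =
      volume.restrict (Ioo 0 Real.pi) := by
    rw [Measure.restrict_restrict measurableSet_Ioo, inter_eq_left.mpr Ioo_subset_Ioi_self]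
  have k1 : KerBound volume u v (fun θ φ => ENNReal.ofReal (|θ - φ| ^ (u - v - 1))) :=
    hls hv huv (by linarith)
  have k1' := k1.restrict hu0 (s := Ioo 0 Real.pi) measurableSet_Ioo
  have k2 := (kerBound_hardy_upper hv huv (by linarith) hav).restrict hu0 (s := Ioo 0 Real.pi)
    measurableSet_Ioo
  have k3 := (kerBound_hardy_lower hv huv ha0 hua).restrict hu0 (s := Ioo 0 Real.pi)
    measurableSet_Ioo
  rw [hI] at k2 k3
  have m1 : Measurable (Function.uncurry fun θ φ : ℝ => ENNReal.ofReal (|θ - φ| ^ (u - v - 1))) := by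
    unfold Function.uncurry; fun_prop
  have m2 : Measurable (Function.uncurry fun θ φ : ℝ => {z : ℝ × ℝ | z.1 < z.2}.indicator
      (fun z => ENNReal.ofReal (z.1 ^ (-a) * z.2 ^ (u - v - 1 + a))) (θ, φ)) := by
    exact Measurable.indicator (by fun_prop) (measurableSet_lt measurable_fst measurable_snd)
  have m3 : Measurable (Function.uncurry fun θ φ : ℝ => {z : ℝ × ℝ | z.2 < z.1}.indicator
      (fun z => ENNReal.ofReal (z.1 ^ (u - v - 1 + a) * z.2 ^ (-a))) (θ, φ)) := by
    exact Measurable.indicator (by fun_prop) (measurableSet_lt measurable_snd measurable_fst)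
  have k := ((k1'.add hv (by linarith) (k2.add hv (by linarith) k3 m2) m1).const_mul hv
    (m1.add (m2.add m3)) (c := 2) (by simp))
  refine k.mono (fun x => ?_) hv (ae_restrict_mem measurableSet_Ioo) fun θ hθ φ hφ hne => ?_
  · exact restrict_singleton_eq_zero _ x
  · have hθ0 : 0 < θ := hθ.1
    have hφ0 : 0 < φ := hφ.1
    rcases lt_or_gt_of_ne hne with h | h
    · refine (ENNReal.ofReal_le_ofReal (leftKer_le ha0 (by linarith) (by linarith) (by linarith)
        hθ.1 h)).trans ?_
      rw [ENNReal.ofReal_mul (by norm_num), ENNReal.ofReal_ofNat,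
        ENNReal.ofReal_add (by positivity) (by positivity)]
      refine mul_le_mul' le_rfl (add_le_add le_rfl ?_)
      rw [indicator_of_mem (show (θ, φ) ∈ {z : ℝ × ℝ | z.1 < z.2} from h)]
      exact le_self_add
    · rw [leftKer_comm]
      refine (ENNReal.ofReal_le_ofReal (leftKer_le ha0 (by linarith) (by linarith) (by linarith)
        hφ.1 h)).trans ?_
      rw [ENNReal.ofReal_mul (by norm_num), ENNReal.ofReal_ofNat,
        ENNReal.ofReal_add (by positivity) (by positivity), abs_sub_comm]
      refine mul_le_mul' le_rfl (add_le_add le_rfl ?_)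
      rw [indicator_of_mem (show (θ, φ) ∈ {z : ℝ × ℝ | z.2 < z.1} from h), mul_comm]
      exact le_add_self

theorem lintegral_cornerW_rpow_lt_top {r : ℝ} (hr : 0 < r) (har : a * r < 1) (ha0 : 0 ≤ a) :
    ∫⁻ θ in Ioo 0 Real.pi, ENNReal.ofReal (cornerW a θ) ^ r < ∞ := by
  have hr1 : 0 < 1 - a * r := by linarith
  have hpi := Real.pi_pos
  set c : ℝ := (2 / Real.pi) ^ (a * r) with hc
  have hpt : ∀ θ ∈ Ioo 0 Real.pi, ENNReal.ofReal (cornerW a θ) ^ r ≤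
      ENNReal.ofReal c * (ENNReal.ofReal (θ ^ (1 - a * r - 1)) +
        ENNReal.ofReal ((Real.pi - θ) ^ (1 - a * r - 1))) := by
    intro θ hθ
    have h0 : 0 < θ := hθ.1
    have h1 : 0 < Real.pi - θ := sub_pos.mpr hθ.2
    have har0 : 0 ≤ a * r := by positivity
    have key : ∀ x y : ℝ, 0 < x → Real.pi / 2 ≤ y → (x * y) ^ (-(a * r)) ≤
        c * x ^ (1 - a * r - 1) := by
      intro x y hx hy
      calc (x * y) ^ (-(a * r)) ≤ (x * (Real.pi / 2)) ^ (-(a * r)) :=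
            Real.rpow_le_rpow_of_nonpos (by positivity) (by gcongr) (by linarith)
        _ = _ := by
            rw [Real.mul_rpow hx.le (by positivity), mul_comm, hc,
              Real.rpow_neg (by positivity : 0 ≤ Real.pi / 2), ← Real.inv_rpow (by positivity),
              inv_div]
            ring_nf
    rw [ENNReal.ofReal_rpow_of_nonneg (cornerW_pos a hθ).le hr.le, cornerW,
      ← Real.rpow_mul (by positivity), ← ENNReal.ofReal_add (by positivity) (by positivity),
      ← ENNReal.ofReal_mul (by positivity), neg_mul]
    refine ENNReal.ofReal_le_ofReal ?_
    rw [mul_add]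
    have n1 : 0 ≤ c * θ ^ (1 - a * r - 1) := by positivity
    have n2 : 0 ≤ c * (Real.pi - θ) ^ (1 - a * r - 1) := by positivity
    rcases le_total θ (Real.pi / 2) with h | h
    · linarith [key θ (Real.pi - θ) h0 (by linarith)]
    · have := key (Real.pi - θ) θ h1 h
      rw [mul_comm θ]
      linarith
  refine lt_of_le_of_lt (setLIntegral_mono' measurableSet_Ioo hpt) ?_
  have hm : Measurable fun θ : ℝ => ENNReal.ofReal (θ ^ (1 - a * r - 1)) := by fun_prop
  have hm' : Measurable fun θ : ℝ => ENNReal.ofReal ((Real.pi - θ) ^ (1 - a * r - 1)) := by fun_prop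
  rw [lintegral_const_mul' _ _ ENNReal.ofReal_ne_top, lintegral_add_left hm,
    lintegral_Ioo_reflect (fun θ => ENNReal.ofReal (θ ^ (1 - a * r - 1))),
    lintegral_rpow_Ioo hr1 hpi.le]
  exact ENNReal.mul_lt_top ENNReal.ofReal_lt_top (by simp)

/-- For a product kernel Hölder's inequality suffices: `cornerW a` lies in `L^{1/(1-u)}` because `a
< 1 - u`, and in `L^{1/v}` because `a < v`. -/
theorem kerBound_corner (hv : 0 < v) (huv : v < u) (ha0 : 0 ≤ a) (hav : a < v)
    (hua : u < 1 - a) : KerBound (volume.restrict (Ioo 0 Real.pi)) u v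
      (fun θ φ => ENNReal.ofReal (cornerW a θ * cornerW a φ)) := by
  have hu0 : 0 < u := hv.trans huv
  have hu1 : 0 < 1 - u := by linarith
  have hpq : (1 / (1 - u)).HolderConjugate (1 / u) := by
    rw [Real.holderConjugate_iff]
    refine ⟨(one_lt_div hu1).mpr (by linarith), ?_⟩
    rw [one_div, one_div, inv_inv, inv_inv]; ring
  have i1 := lintegral_cornerW_rpow_lt_top (a := a) (r := 1 / (1 - u)) (by positivity)
    (by rw [mul_one_div, div_lt_one hu1]; linarith) ha0
  have i2 := lintegral_cornerW_rpow_lt_top (a := a) (r := 1 / v) (by positivity)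
    (by rw [mul_one_div, div_lt_one hv]; linarith) ha0
  set A := ∫⁻ θ in Ioo 0 Real.pi, ENNReal.ofReal (cornerW a θ) ^ (1 / (1 - u))
  set B := ∫⁻ θ in Ioo 0 Real.pi, ENNReal.ofReal (cornerW a θ) ^ (1 / v)
  have hm : Measurable fun θ => ENNReal.ofReal (cornerW a θ) := by unfold cornerW; fun_prop
  refine ⟨A ^ ((1 - u) / v) * B, ENNReal.mul_ne_top
    (ENNReal.rpow_ne_top_of_nonneg (by positivity) i1.ne) i2.ne, fun f hf => ?_⟩
  set N := ∫⁻ φ in Ioo 0 Real.pi, f φ ^ (1 / u)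
  have hH : ∫⁻ φ in Ioo 0 Real.pi, ENNReal.ofReal (cornerW a φ) * f φ ≤ A ^ (1 - u) * N ^ u := by
    have := ENNReal.lintegral_mul_le_Lp_mul_Lq (volume.restrict (Ioo 0 Real.pi)) hpq
      hm.aemeasurable hf.aemeasurable
    simp only [one_div_one_div] at this
    exact this
  calc _ ≤ ∫⁻ θ in Ioo 0 Real.pi, ENNReal.ofReal (cornerW a θ) ^ (1 / v) *
        (A ^ (1 - u) * N ^ u) ^ (1 / v) := by
        refine setLIntegral_mono' measurableSet_Ioo fun θ hθ => ?_
        simp only [ENNReal.ofReal_mul (cornerW_pos a hθ).le, mul_assoc]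
        rw [lintegral_const_mul' _ _ ENNReal.ofReal_ne_top, ENNReal.mul_rpow_of_nonneg _ _ (by positivity)]
        gcongr
    _ = B * (A ^ (1 - u) * N ^ u) ^ (1 / v) := lintegral_mul_const _ (hm.pow_const _)
    _ = _ := by
        rw [ENNReal.mul_rpow_of_nonneg _ _ (by positivity), ← ENNReal.rpow_mul, ← ENNReal.rpow_mul,
          mul_one_div, mul_one_div]
        ring

theorem kerBound_majKer (hv : 0 < v) (huv : v < u) (ha0 : 0 ≤ a) (hav : a < v)
    (hua : u < 1 - a) : KerBound (volume.restrict (Ioo 0 Real.pi)) u v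
      (fun θ φ => ENNReal.ofReal (majKer a (u - v) θ φ)) := by
  have k := kerBound_leftKer hv huv ha0 hav hua
  have m1 : Measurable (Function.uncurry fun θ φ => ENNReal.ofReal (leftKer a (u - v) θ φ)) :=
    (measurable_leftKer a (u - v)).ennreal_ofReal
  have m2 : Measurable (Function.uncurry fun θ φ =>
      ENNReal.ofReal (leftKer a (u - v) (Real.pi - θ) (Real.pi - φ))) := by
    unfold leftKer Function.uncurry; fun_prop
  have m3 : Measurable (Function.uncurry fun θ φ => ENNReal.ofReal (leftKer a (u - v) θ φ) +
      ENNReal.ofReal (leftKer a (u - v) (Real.pi - θ) (Real.pi - φ))) := m1.add m2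
  have hv1 : v ≤ 1 := by linarith
  have k1 : KerBound (volume.restrict (Ioo 0 Real.pi)) u v
      (fun θ φ => ENNReal.ofReal (leftKer a (u - v) (Real.pi - θ) (Real.pi - φ))) := k.reflect
  have k2 : KerBound (volume.restrict (Ioo 0 Real.pi)) u v
      (fun θ φ => ENNReal.ofReal (leftKer a (u - v) θ φ) +
        ENNReal.ofReal (leftKer a (u - v) (Real.pi - θ) (Real.pi - φ))) := k.add hv hv1 k1 m1
  have k3 : KerBound (volume.restrict (Ioo 0 Real.pi)) u v
      (fun θ φ => ENNReal.ofReal (leftKer a (u - v) θ φ) +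
        ENNReal.ofReal (leftKer a (u - v) (Real.pi - θ) (Real.pi - φ)) +
        ENNReal.ofReal (cornerW a θ * cornerW a φ)) :=
    k2.add hv hv1 (kerBound_corner hv huv ha0 hav hua) m3
  refine KerBound.mono (fun x => ?_) hv k3 (ae_restrict_mem measurableSet_Ioo)
    fun θ _ φ _ _ => ?_
  · exact restrict_singleton_eq_zero _ x
  · rw [majKer_eq]
    refine ENNReal.ofReal_add_le.trans (add_le_add ENNReal.ofReal_add_le le_rfl)

/-- The kernel bound at the endpoint `L^{1/u} → L^∞` for `a = 0`. -/
theorem exists_lintegral_majKer_zero_le {δ : ℝ} (hu0 : 0 < u) (huδ : u < δ) (hδ : δ < 1) :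
    ∃ C : ℝ≥0∞, C ≠ ∞ ∧ ∀ f : ℝ → ℝ≥0∞, Measurable f → ∀ θ ∈ Ioo 0 Real.pi,
      ∫⁻ φ in Ioo 0 Real.pi, ENNReal.ofReal (majKer 0 δ θ φ) * f φ ≤
        C * (∫⁻ φ in Ioo 0 Real.pi, f φ ^ (1 / u)) ^ u := by
  have hu1 : 0 < 1 - u := by linarith
  have hpq : (1 / (1 - u)).HolderConjugate (1 / u) := by
    rw [Real.holderConjugate_iff]
    refine ⟨(one_lt_div hu1).mpr (by linarith), ?_⟩
    rw [one_div, one_div, inv_inv, inv_inv]; ring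
  set r : ℝ := (δ - 1) * (1 / (1 - u)) + 1 with hr
  have hr0 : 0 < r := by
    have : -1 < (δ - 1) * (1 / (1 - u)) := by rw [mul_one_div, lt_div_iff₀ hu1]; linarith
    linarith
  have hpi := Real.pi_pos
  -- For `a = 0` the majorant is `2 |θ - φ|^{δ-1} + 1`, and the constant `1` is absorbed because `|θ
  -- - φ| ≤ π` and `δ < 1`.
  set c : ℝ := 2 + Real.pi ^ (1 - δ) with hc
  have hc0 : 0 < c := by positivity
  refine ⟨ENNReal.ofReal c * (2 * ENNReal.ofReal (Real.pi ^ r / r)) ^ (1 - u),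
    ENNReal.mul_ne_top ENNReal.ofReal_ne_top (ENNReal.rpow_ne_top_of_nonneg hu1.le
      (ENNReal.mul_ne_top (by simp) ENNReal.ofReal_ne_top)), fun f hf θ hθ => ?_⟩
  have hne : ∀ᵐ φ ∂(volume.restrict (Ioo 0 Real.pi)), φ ≠ θ := by
    rw [ae_iff]
    simp only [ne_eq, not_not]
    exact restrict_singleton_eq_zero (Ioo 0 Real.pi) θ
  have hk : Measurable fun φ : ℝ => ENNReal.ofReal (|θ - φ| ^ (δ - 1)) := by fun_prop
  have h1 := ENNReal.lintegral_mul_le_Lp_mul_Lq (volume.restrict (Ioo 0 Real.pi)) hpq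
    hk.aemeasurable hf.aemeasurable
  simp only [one_div_one_div] at h1
  have h2 : ∫⁻ φ in Ioo 0 Real.pi, ENNReal.ofReal (|θ - φ| ^ (δ - 1)) ^ (1 / (1 - u)) ≤
      2 * ENNReal.ofReal (Real.pi ^ r / r) := by
    refine le_trans ?_ (lintegral_near_le hr0 hpi θ)
    rw [← lintegral_indicator measurableSet_Ioo]
    refine lintegral_mono fun φ => ?_
    by_cases hφ : φ ∈ Ioo 0 Real.pi
    · have hd : |θ - φ| < Real.pi := by
        rw [abs_lt]; constructor <;> linarith [hφ.1, hφ.2, hθ.1, hθ.2]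
      rw [indicator_of_mem hφ, indicator_of_mem (show φ ∈ {y | |θ - y| < Real.pi} from hd),
        ENNReal.ofReal_rpow_of_nonneg (by positivity) (by positivity),
        ← Real.rpow_mul (abs_nonneg _), hr, add_sub_cancel_right]
    · rw [indicator_of_notMem hφ]
      exact bot_le
  calc _ ≤ ∫⁻ φ in Ioo 0 Real.pi, ENNReal.ofReal c * (ENNReal.ofReal (|θ - φ| ^ (δ - 1)) * f φ) := by
        refine lintegral_mono_ae ?_
        filter_upwards [hne, ae_restrict_mem measurableSet_Ioo] with φ hφ hφI
        rw [← mul_assoc, ← ENNReal.ofReal_mul hc0.le]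
        refine mul_le_mul' (ENNReal.ofReal_le_ofReal ?_) le_rfl
        have hd0 : 0 < |θ - φ| := abs_pos.mpr (sub_ne_zero.mpr hφ.symm)
        have hd : |θ - φ| ≤ Real.pi := by
          rw [abs_le]; constructor <;> linarith [hφI.1, hφI.2, hθ.1, hθ.2]
        have h3 : 1 ≤ Real.pi ^ (1 - δ) * |θ - φ| ^ (δ - 1) := by
          have := Real.rpow_le_rpow_of_nonpos hd0 hd (by linarith : δ - 1 ≤ 0)
          calc (1 : ℝ) = Real.pi ^ (1 - δ) * Real.pi ^ (δ - 1) := by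
                rw [← Real.rpow_add hpi]; simp
            _ ≤ _ := by gcongr
        simp only [majKer, cornerW, Real.rpow_zero, neg_zero, mul_one]
        rw [hc, add_mul]
        linarith
    _ = ENNReal.ofReal c * ∫⁻ φ in Ioo 0 Real.pi, ENNReal.ofReal (|θ - φ| ^ (δ - 1)) * f φ :=
        lintegral_const_mul' _ _ ENNReal.ofReal_ne_top
    _ ≤ ENNReal.ofReal c * ((2 * ENNReal.ofReal (Real.pi ^ r / r)) ^ (1 - u) *
          (∫⁻ φ in Ioo 0 Real.pi, f φ ^ (1 / u)) ^ u) := by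
        refine mul_le_mul' le_rfl (h1.trans ?_)
        exact mul_le_mul' (ENNReal.rpow_le_rpow h2 hu1.le) le_rfl
    _ = _ := by ring
end
end
end SymmJacobi

namespace SymmJacobi
noncomputable section

/-! ### Jacobi polynomials in the variable `sin² (θ/2)` -/

open Polynomial in
theorem ringChoose_succ_mul (r : ℝ) (k : ℕ) :
    Ring.choose r (k + 1) * (k + 1) = Ring.choose r k * (r - k) := by
  have h1 := Ring.descPochhammer_eq_factorial_smul_choose r k
  have h2 := Ring.descPochhammer_eq_factorial_smul_choose r (k + 1)
  have h3 : (descPochhammer ℤ (k + 1)).smeval r = (descPochhammer ℤ k).smeval r * (r - k) := by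
    rw [descPochhammer_succ_right, Polynomial.smeval_mul, Polynomial.smeval_sub,
      Polynomial.smeval_X, Polynomial.smeval_natCast]
    simp
  rw [h3, h1, nsmul_eq_mul, nsmul_eq_mul, Nat.factorial_succ] at h2
  have h4 : (k.factorial : ℝ) ≠ 0 := by positivity
  apply mul_left_cancel₀ h4
  push_cast at h2
  linarith

theorem ringChoose_pos {r : ℝ} : ∀ {k : ℕ}, (k : ℝ) - 1 < r → 0 < Ring.choose r k
  | 0, _ => by simp
  | k + 1, h => by
    push_cast at h
    have h1 := ringChoose_pos (r := r) (k := k) (by linarith)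
    have h2 := ringChoose_succ_mul r k
    have h3 : 0 < Ring.choose r k * (r - k) := mul_pos h1 (by linarith)
    rw [← h2] at h3
    exact pos_of_mul_pos_left h3 (by positivity)

open Polynomial in
/-- The Jacobi polynomial as a polynomial in `x = (1 - cos θ) / 2`. -/
def jPoly (α β : ℝ) (n : ℕ) : ℝ[X] :=
  ∑ k ∈ Finset.range (n + 1), C (Ring.choose ((n : ℝ) + α) (n - k) * Ring.choose ((n : ℝ) + β) k) *
    ((-X) ^ k * (1 - X) ^ (n - k))

theorem jacobiP_eq (α β : ℝ) (n : ℕ) (x : ℝ) :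
    jacobiP α β n (1 - 2 * x) = (jPoly α β n).eval x := by
  rw [jacobiP, jPoly, Polynomial.eval_finsetSum]
  refine Finset.sum_congr rfl fun k _ => ?_
  simp only [Polynomial.eval_mul, Polynomial.eval_C, Polynomial.eval_pow, Polynomial.eval_neg,
    Polynomial.eval_X, Polynomial.eval_sub, Polynomial.eval_one]
  rw [show (1 - 2 * x - 1) / 2 = -x by ring, show (1 - 2 * x + 1) / 2 = 1 - x by ring]
  ring

theorem jPoly_eval_zero_pos {α : ℝ} (β : ℝ) (hα : -1 < α) (n : ℕ) :
    0 < (jPoly α β n).eval 0 := by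
  rw [jPoly, Polynomial.eval_finsetSum, Finset.sum_eq_single 0]
  · simpa using ringChoose_pos (r := n + α) (k := n) (by linarith)
  · intro k _ hk
    simp [hk]
  · simp

theorem jPoly_natDegree_le (α β : ℝ) (n : ℕ) : (jPoly α β n).natDegree ≤ n := by
  refine Polynomial.natDegree_sum_le_of_forall_le _ _ fun k hk => ?_
  have hk' : k ≤ n := Nat.lt_succ_iff.mp (Finset.mem_range.mp hk)
  refine (Polynomial.natDegree_C_mul_le _ _).trans (Polynomial.natDegree_mul_le.trans ?_)
  have h1 : ((-Polynomial.X : Polynomial ℝ) ^ k).natDegree ≤ k := by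
    refine Polynomial.natDegree_pow_le.trans ?_
    simp
  have h2 : ((1 - Polynomial.X : Polynomial ℝ) ^ (n - k)).natDegree ≤ n - k := by
    refine Polynomial.natDegree_pow_le.trans ?_
    have : (1 - Polynomial.X : Polynomial ℝ).natDegree ≤ 1 := by
      refine (Polynomial.natDegree_sub_le _ _).trans (by simp)
    nlinarith
  omega

open Polynomial in
/-- The Jacobi operator on polynomials. -/
def jOp (α β : ℝ) (P : ℝ[X]) : ℝ[X] :=
  X * (1 - X) * derivative (derivative P) +
    (C (α + 1) * (1 - X) - C (β + 1) * X) * derivative P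

open Polynomial in
-- After multiplication by `X(1-X)` the logarithmic derivative of `(-X)^k (1-X)^m` becomes the
-- linear polynomial `l`. The result is arranged in three parts so that the outer ones can be
-- shifted in `k` when summed.
theorem jOp_basis (α β : ℝ) (k m : ℕ) :
    X * (1 - X) * jOp α β ((-X) ^ k * (1 - X) ^ m) =
      C ((k : ℝ) * (k + α)) * (1 - X) ^ 2 * ((-X) ^ k * (1 - X) ^ m) -
      C ((2 * k * m + (α + 1) * m + (β + 1) * k)) * (X * (1 - X)) * ((-X) ^ k * (1 - X) ^ m) +
      C ((m : ℝ) * (m + β)) * X ^ 2 * ((-X) ^ k * (1 - X) ^ m) := by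
  have h1 : ∀ j : ℕ, X * derivative ((-X : ℝ[X]) ^ j) = C (j : ℝ) * (-X) ^ j := by
    intro j
    cases j with
    | zero => simp
    | succ j => rw [derivative_pow]; simp; ring
  have h2 : ∀ j : ℕ, (1 - X) * derivative ((1 - X : ℝ[X]) ^ j) = -(C (j : ℝ) * (1 - X) ^ j) := by
    intro j
    cases j with
    | zero => simp
    | succ j => rw [derivative_pow]; simp; ring
  set g : ℝ[X] := (-X) ^ k * (1 - X) ^ m with hg
  set l : ℝ[X] := C (k : ℝ) * (1 - X) - C (m : ℝ) * X with hl
  have h3 : X * (1 - X) * derivative g = l * g := by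
    rw [hg, derivative_mul]
    linear_combination ((1 - X) * (1 - X) ^ m) * h1 k + (X * (-X) ^ k) * h2 m
  have h4 : (1 - 2 * X) * derivative g + X * (1 - X) * derivative (derivative g) =
      -(C (k : ℝ) + C (m : ℝ)) * g + l * derivative g := by
    have := congrArg derivative h3
    simp only [derivative_mul, derivative_X, derivative_sub, derivative_one, hl, derivative_C] at this
    rw [hl]
    linear_combination this
  rw [jOp]
  simp only [C_add, C_mul, C_1, map_ofNat]
  linear_combination (X * (1 - X)) * h4 + (l - (1 - 2 * X) +
    ((C α + 1) * (1 - X) - (C β + 1) * X)) * h3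

open Polynomial in
theorem jOp_sum (α β : ℝ) {ι : Type*} (s : Finset ι) (b : ι → ℝ) (g : ι → ℝ[X]) :
    jOp α β (∑ i ∈ s, C (b i) * g i) = ∑ i ∈ s, C (b i) * jOp α β (g i) := by
  simp only [jOp, derivative_sum, derivative_C_mul, Finset.mul_sum, ← Finset.sum_add_distrib]
  exact Finset.sum_congr rfl fun i _ => by ring

open Polynomial in
-- The coefficients satisfy the two-term recurrence `hrec`, which shifts the index in the parts with
-- `(1-X)²` and with `X²` and turns both into `X(1-X)` times the same basis elements. The scalars
-- then add up to `n (n + α+β+1)`, independently of `k`.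
theorem jOp_jPoly {α β : ℝ} (n : ℕ) :
    jOp α β (jPoly α β n) = C (-((n : ℝ) * (n + (α + β + 1)))) * jPoly α β n := by
  have hX : (X * (1 - X) : ℝ[X]) ≠ 0 := by
    refine mul_ne_zero X_ne_zero fun h => ?_
    have := congrArg (Polynomial.eval 0) h
    simp at this
  apply mul_left_cancel₀ hX
  set b : ℕ → ℝ := fun k => Ring.choose ((n : ℝ) + α) (n - k) * Ring.choose ((n : ℝ) + β) k with hb
  set g : ℕ → ℝ[X] := fun k => (-X) ^ k * (1 - X) ^ (n - k) with hg
  have hJ : jPoly α β n = ∑ k ∈ Finset.range (n + 1), C (b k) * g k := rfl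
  have hrec : ∀ k < n, b (k + 1) * (((k + 1 : ℕ) : ℝ) * ((k + 1 : ℕ) + α)) =
      b k * (((n - k : ℕ) : ℝ) * ((n - k : ℕ) + β)) := by
    intro k hk
    obtain ⟨m, rfl⟩ := Nat.exists_eq_add_of_lt hk
    have e1 := ringChoose_succ_mul (((k + m + 1 : ℕ) : ℝ) + α) m
    have e2 := ringChoose_succ_mul (((k + m + 1 : ℕ) : ℝ) + β) k
    simp only [hb, show k + m + 1 - k = m + 1 by omega, show k + m + 1 - (k + 1) = m by omega]
    push_cast at e1 e2 ⊢
    linear_combination (-Ring.choose ((k : ℝ) + m + 1 + β) k * (m + 1 + β)) * e1 +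
      (Ring.choose ((k : ℝ) + m + 1 + α) m * (k + 1 + α)) * e2
  have s1 : ∑ k ∈ Finset.range (n + 1), C (b k) * (C ((k : ℝ) * (k + α)) * (1 - X) ^ 2 * g k) =
      -(X * (1 - X) * ∑ k ∈ Finset.range (n + 1),
        C (b k) * (C (((n - k : ℕ) : ℝ) * ((n - k : ℕ) + β)) * g k)) := by
    rw [Finset.sum_range_succ', Finset.sum_range_succ, mul_add (X * (1 - X)), Finset.mul_sum, neg_add,
      ← Finset.sum_neg_distrib]
    congr 1
    · refine Finset.sum_congr rfl fun k hk => ?_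
      have hk' := Finset.mem_range.mp hk
      have e := congrArg C (hrec k hk')
      obtain ⟨m, hm⟩ := Nat.exists_eq_add_of_lt hk'
      have e3 : (1 - X) ^ 2 * g (k + 1) = -(X * (1 - X) * g k) := by
        simp only [hg, show n - (k + 1) = m by omega, show n - k = m + 1 by omega]
        ring
      rw [C_mul (a := b (k + 1)), C_mul (a := b k)] at e
      linear_combination (C (b (k + 1)) * C (((k + 1 : ℕ) : ℝ) * ((k + 1 : ℕ) + α))) * e3 -
        (X * (1 - X) * g k) * e
    · simp
  have s2 : ∑ k ∈ Finset.range (n + 1),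
      C (b k) * (C (((n - k : ℕ) : ℝ) * ((n - k : ℕ) + β)) * X ^ 2 * g k) =
      -(X * (1 - X) * ∑ k ∈ Finset.range (n + 1), C (b k) * (C ((k : ℝ) * (k + α)) * g k)) := by
    rw [Finset.sum_range_succ, Finset.sum_range_succ', mul_add (X * (1 - X)), Finset.mul_sum, neg_add,
      ← Finset.sum_neg_distrib]
    congr 1
    · refine Finset.sum_congr rfl fun k hk => ?_
      have hk' := Finset.mem_range.mp hk
      have e := congrArg C (hrec k hk')
      obtain ⟨m, hm⟩ := Nat.exists_eq_add_of_lt hk'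
      have e3 : X ^ 2 * g k = -(X * (1 - X) * g (k + 1)) := by
        simp only [hg, show n - (k + 1) = m by omega, show n - k = m + 1 by omega]
        ring
      rw [C_mul (a := b (k + 1)), C_mul (a := b k)] at e
      linear_combination (C (b k) * C (((n - k : ℕ) : ℝ) * ((n - k : ℕ) + β))) * e3 +
        (X * (1 - X) * g (k + 1)) * e
    · simp
  have s3 : X * (1 - X) * jOp α β (jPoly α β n) =
      ∑ k ∈ Finset.range (n + 1), C (b k) * (C ((k : ℝ) * (k + α)) * (1 - X) ^ 2 * g k) -
      X * (1 - X) * ∑ k ∈ Finset.range (n + 1), C (b k) *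
        (C (2 * k * ((n - k : ℕ) : ℝ) + (α + 1) * ((n - k : ℕ) : ℝ) + (β + 1) * k) * g k) +
      ∑ k ∈ Finset.range (n + 1),
        C (b k) * (C (((n - k : ℕ) : ℝ) * ((n - k : ℕ) + β)) * X ^ 2 * g k) := by
    rw [hJ, jOp_sum, Finset.mul_sum, Finset.mul_sum, ← Finset.sum_sub_distrib,
      ← Finset.sum_add_distrib]
    refine Finset.sum_congr rfl fun k _ => ?_
    linear_combination C (b k) * jOp_basis α β k (n - k)
  rw [s3, s1, s2, hJ, Finset.mul_sum, Finset.mul_sum, Finset.mul_sum, Finset.mul_sum,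
    Finset.mul_sum, ← Finset.sum_neg_distrib, ← Finset.sum_neg_distrib, ← Finset.sum_sub_distrib,
    ← Finset.sum_add_distrib]
  refine Finset.sum_congr rfl fun k hk => ?_
  have hk' : k ≤ n := Nat.lt_succ_iff.mp (Finset.mem_range.mp hk)
  have e : ((n - k : ℕ) : ℝ) * ((n - k : ℕ) + β) + (2 * k * ((n - k : ℕ) : ℝ) +
      (α + 1) * ((n - k : ℕ) : ℝ) + (β + 1) * k) + (k : ℝ) * (k + α) =
      (n : ℝ) * (n + (α + β + 1)) := by
    rw [Nat.cast_sub hk']; ring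
  have e' := congrArg C e
  simp only [C_add (a := _ + _), C_add (a := ((n - k : ℕ) : ℝ) * _), C_neg] at e' ⊢
  linear_combination (-(X * (1 - X) * C (b k) * g k)) * e'

open Polynomial in
theorem coeff_X_mul_derivative (P : ℝ[X]) (j : ℕ) :
    (X * derivative P).coeff j = j * P.coeff j := by
  cases j with
  | zero => simp
  | succ j => rw [coeff_X_mul, coeff_derivative]; push_cast; ring

open Polynomial in
theorem jOp_coeff (α β : ℝ) (P : ℝ[X]) (j : ℕ) :
    (jOp α β P).coeff j = (j + 1) * (j + α + 1) * P.coeff (j + 1) -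
      j * (j + (α + β + 1)) * P.coeff j := by
  have e : jOp α β P = derivative (X * derivative P) - derivative P -
      (X * derivative (X * derivative P) - X * derivative P) + C (α + 1) * derivative P -
      C (α + β + 2) * (X * derivative P) := by
    rw [jOp, show α + β + 2 = (α + 1) + (β + 1) by ring, C_add (a := α + 1) (b := β + 1)]
    simp only [derivative_mul, derivative_X]
    ring
  rw [e]
  simp only [coeff_sub, coeff_add, coeff_C_mul, coeff_X_mul_derivative, coeff_derivative]
  push_cast
  ring

variable {α β : ℝ}

/-- The leading coefficient is not computed: comparison of top coefficients in the eigenvalue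
equation gives `d (d+α+β+1) = n (n+α+β+1)`, which forces `d = n`. -/
theorem jPoly_natDegree (hα : -1 < α) (hβ : -1 < β) (n : ℕ) : (jPoly α β n).natDegree = n := by
  have h0 : jPoly α β n ≠ 0 := fun h => by
    have := jPoly_eval_zero_pos β hα n
    simp [h] at this
  set d := (jPoly α β n).natDegree with hd
  have hdn : d ≤ n := jPoly_natDegree_le α β n
  have h1 := congrArg (fun P => Polynomial.coeff P d) (jOp_jPoly (α := α) (β := β) n)
  simp only [jOp_coeff, Polynomial.coeff_C_mul] at h1
  rw [Polynomial.coeff_eq_zero_of_natDegree_lt (show (jPoly α β n).natDegree < d + 1 by omega)] at h1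
  have h2 : (jPoly α β n).coeff d ≠ 0 := by
    rw [hd, Polynomial.coeff_natDegree]; exact Polynomial.leadingCoeff_ne_zero.mpr h0
  have h3 : ((n : ℝ) - d) * (n + d + (α + β + 1)) = 0 := by
    apply mul_right_cancel₀ h2
    linarith
  rcases mul_eq_zero.mp h3 with h | h
  · have : (n : ℝ) = d := by linarith
    exact_mod_cast this.symm
  · by_contra hne
    have : 1 ≤ n := by omega
    have : (1 : ℝ) ≤ n := by exact_mod_cast this
    have : (0 : ℝ) ≤ d := by positivity
    linarith

theorem span_jPoly (hα : -1 < α) (hβ : -1 < β) :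
    Submodule.span ℝ (Set.range (jPoly α β)) = ⊤ := by
  have h0 : ∀ n, jPoly α β n ≠ 0 := fun n h => by
    have := jPoly_eval_zero_pos β hα n
    simp [h] at this
  let S : Polynomial.Sequence ℝ := ⟨jPoly α β, fun n => by
    rw [Polynomial.degree_eq_natDegree (h0 n), jPoly_natDegree hα hβ]⟩
  exact S.span fun i => (Polynomial.leadingCoeff_ne_zero.mpr (h0 i)).isUnit

theorem span_derivative_jPoly (hα : -1 < α) (hβ : -1 < β) :
    Submodule.span ℝ (Set.range fun n => Polynomial.derivative (jPoly α β (n + 1))) = ⊤ := by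
  have hd : ∀ n, (Polynomial.derivative (jPoly α β (n + 1))).degree = n := fun n => by
    rw [Polynomial.degree_derivative (by rw [jPoly_natDegree hα hβ]; omega),
      jPoly_natDegree hα hβ, Nat.add_sub_cancel]
  let S : Polynomial.Sequence ℝ := ⟨fun n => Polynomial.derivative (jPoly α β (n + 1)), hd⟩
  exact S.span fun i => (Polynomial.leadingCoeff_ne_zero.mpr (S.ne_zero i)).isUnit

open Polynomial in
/-- The differentiated equation: derivatives of Jacobi polynomials are eigenfunctions for the
raised parameters. -/
theorem jOp_derivative_jPoly (n : ℕ) :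
    jOp (α + 1) (β + 1) (derivative (jPoly α β n)) =
      C (-((n : ℝ) * (n + (α + β + 1)) - (α + β + 2))) * derivative (jPoly α β n) := by
  have h := congrArg derivative (jOp_jPoly (α := α) (β := β) n)
  rw [derivative_C_mul, jOp] at h
  rw [jOp]
  simp only [derivative_mul, derivative_X, derivative_sub, derivative_one, derivative_C,
    derivative_add, C_add, C_neg, C_sub, C_mul, C_1, map_ofNat] at h ⊢
  linear_combination h

/-! ### Orthogonality -/

/-- The weighted inner product of polynomials in `sin² (θ/2)`. -/
def wInner (α β : ℝ) (P Q : Polynomial ℝ) : ℝ :=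
  ∫ t in Ioo 0 Real.pi, psi α β t ^ 2 * (P.eval (hs t) * Q.eval (hs t))

theorem integrableOn_wInner (hα : -1 < α) (hβ : -1 < β) (P Q : Polynomial ℝ) :
    IntegrableOn (fun t => psi α β t ^ 2 * (P.eval (hs t) * Q.eval (hs t))) (Ioo 0 Real.pi) :=
  integrableOn_psi_sq_mul hα hβ (f := fun x => P.eval x * Q.eval x) ⟨Real.pi_pos, le_rfl⟩
    (by fun_prop)

theorem wInner_comm (α β : ℝ) (P Q : Polynomial ℝ) : wInner α β P Q = wInner α β Q P := by
  simp only [wInner, mul_comm (P.eval _)]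

theorem wInner_C_mul_left (α β c : ℝ) (P Q : Polynomial ℝ) :
    wInner α β (Polynomial.C c * P) Q = c * wInner α β P Q := by
  rw [wInner, wInner, ← integral_const_mul]
  congr 1; ext t
  simp only [Polynomial.eval_mul, Polynomial.eval_C]
  ring

/-- Integration by parts, the flux vanishing at both ends. The factor `x(1-x) = sin² cos²` of the
half angle raises both parameters of the weight by one, so this identity yields the symmetry of the
operator as well as the inner products of the derivatives. -/
theorem wInner_jOp (hα : -1 < α) (hβ : -1 < β) (P Q : Polynomial ℝ) :
    wInner α β (jOp α β P) Q =
      -wInner (α + 1) (β + 1) (Polynomial.derivative P) (Polynomial.derivative Q) := by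
  have hpi : Real.pi ∈ Ioc 0 Real.pi := ⟨Real.pi_pos, le_rfl⟩
  have h := integral_fluxDeriv hα hβ hpi
    (q := fun x => (Polynomial.derivative P).eval x * Q.eval x)
    (q' := fun x => (Polynomial.derivative (Polynomial.derivative P)).eval x * Q.eval x +
      (Polynomial.derivative P).eval x * (Polynomial.derivative Q).eval x)
    (fun x _ => ((Polynomial.derivative P).hasDerivAt x).mul (Q.hasDerivAt x)) (by fun_prop)
  rw [fluxW_pi α hβ, zero_mul] at h
  have i2 := integrableOn_wInner (α := α + 1) (β := β + 1) (by linarith) (by linarith)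
    (Polynomial.derivative P) (Polynomial.derivative Q)
  rw [← add_eq_zero_iff_eq_neg, wInner, wInner, ← integral_add
    (integrableOn_wInner hα hβ _ _) i2]
  refine Eq.trans ?_ h
  refine setIntegral_congr_fun measurableSet_Ioo fun t ht => ?_
  simp only [fluxDeriv, jOp, psi_add_one α β ht, Polynomial.eval_mul, Polynomial.eval_add,
    Polynomial.eval_sub, Polynomial.eval_C, Polynomial.eval_X, Polynomial.eval_one]
  have e : (Real.sin (t / 2) * Real.cos (t / 2)) ^ 2 = hs t * (1 - hs t) := by
    rw [one_sub_hs, hs, mul_pow]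
  rw [mul_pow, e]
  ring

theorem eigen_ne (hα : -1 < α) (hβ : -1 < β) {n m : ℕ} (h : n ≠ m) :
    (n : ℝ) * (n + (α + β + 1)) ≠ m * (m + (α + β + 1)) := by
  intro he
  have h1 : ((n : ℝ) - m) * (n + m + (α + β + 1)) = 0 := by linarith
  rcases mul_eq_zero.mp h1 with h2 | h2
  · exact h (by exact_mod_cast (by linarith : (n : ℝ) = m))
  · have : 1 ≤ n + m := by omega
    have : (1 : ℝ) ≤ n + m := by exact_mod_cast this
    linarith

theorem wInner_derivative_jPoly (hα : -1 < α) (hβ : -1 < β) (n : ℕ) (Q : Polynomial ℝ) :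
    wInner (α + 1) (β + 1) (Polynomial.derivative (jPoly α β n)) (Polynomial.derivative Q) =
      (n : ℝ) * (n + (α + β + 1)) * wInner α β (jPoly α β n) Q := by
  have := wInner_jOp hα hβ (jPoly α β n) Q
  rw [jOp_jPoly, wInner_C_mul_left] at this
  linarith

theorem wInner_jPoly_of_ne (hα : -1 < α) (hβ : -1 < β) {n m : ℕ} (h : n ≠ m) :
    wInner α β (jPoly α β n) (jPoly α β m) = 0 := by
  have h1 := wInner_derivative_jPoly hα hβ n (jPoly α β m)
  have h2 := wInner_derivative_jPoly hα hβ m (jPoly α β n)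
  rw [wInner_comm, h1, wInner_comm α β (jPoly α β m)] at h2
  by_contra hne
  exact eigen_ne hα hβ h (mul_right_cancel₀ hne h2)

theorem wInner_self_pos (hα : -1 < α) (hβ : -1 < β) (n : ℕ) :
    0 < wInner α β (jPoly α β n) (jPoly α β n) := by
  have hnn : ∀ t ∈ Ioo 0 Real.pi, 0 ≤ psi α β t ^ 2 *
      ((jPoly α β n).eval (hs t) * (jPoly α β n).eval (hs t)) := fun t _ =>
    mul_nonneg (sq_nonneg _) (mul_self_nonneg _)
  have hle : 0 ≤ wInner α β (jPoly α β n) (jPoly α β n) :=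
    setIntegral_nonneg measurableSet_Ioo hnn
  refine lt_of_le_of_ne hle fun h0 => ?_
  have hae := (setIntegral_eq_zero_iff_of_nonneg_ae
    ((ae_restrict_iff' measurableSet_Ioo).mpr (Eventually.of_forall hnn))
    (integrableOn_wInner hα hβ _ _)).mp h0.symm
  have hc : ∀ᶠ t in 𝓝[>] (0 : ℝ), (jPoly α β n).eval (hs t) ≠ 0 := by
    have hcont : Continuous fun t => (jPoly α β n).eval (hs t) :=
      (jPoly α β n).continuous.comp continuous_hs
    have : (jPoly α β n).eval (hs 0) ≠ 0 := by
      simpa [hs] using (jPoly_eval_zero_pos β hα n).ne'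
    exact (hcont.continuousAt.eventually_ne this).filter_mono nhdsWithin_le_nhds
  obtain ⟨ε, hε0, hε⟩ := (mem_nhdsGT_iff_exists_Ioo_subset (a := (0 : ℝ))
    (s := {t | (jPoly α β n).eval (hs t) ≠ 0})).mp hc
  have hε0' : (0 : ℝ) < ε := hε0
  have hsub : volume (Ioo 0 (min ε Real.pi)) = 0 := by
    refine measure_mono_null (fun t ht => ?_) ((ae_restrict_iff' measurableSet_Ioo).mp hae)
    have ht1 : t ∈ Ioo 0 Real.pi := ⟨ht.1, ht.2.trans_le (min_le_right _ _)⟩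
    have ht2 := hε ⟨ht.1, ht.2.trans_le (min_le_left _ _)⟩
    intro hh
    have h3 := hh ht1
    have h4 := psi_pos α β ht1
    simp only [Pi.zero_apply, mul_eq_zero, or_self] at h3
    rcases h3 with h3 | h3
    · exact (pow_pos h4 2).ne' h3
    · exact ht2 h3
  rw [Real.volume_Ioo, ENNReal.ofReal_eq_zero] at hsub
  have := lt_min hε0' Real.pi_pos
  linarith

theorem wInner_derivative_of_ne (hα : -1 < α) (hβ : -1 < β) {n m : ℕ} (h : n ≠ m) :
    wInner (α + 1) (β + 1) (Polynomial.derivative (jPoly α β n))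
      (Polynomial.derivative (jPoly α β m)) = 0 := by
  rw [wInner_derivative_jPoly hα hβ, wInner_jPoly_of_ne hα hβ h, mul_zero]

theorem eigenvalue_sub (α β : ℝ) (n : ℕ) :
    eigenvalue α β n - eigenvalue α β 0 = n * (n + (α + β + 1)) := by
  simp only [eigenvalue, Nat.cast_zero]; ring

end
end SymmJacobi

namespace SymmJacobi
noncomputable section

/-! ### Lebesgue measure on the symmetric interval -/

/-- Lebesgue measure on `(0,π)`. -/
abbrev nu : Measure ℝ := volume.restrict (Ioo 0 Real.pi)

/-- Everything on `(-π,π)` is reduced to a pair of functions on `(0,π)`, namely `f θ` and `f (-θ)`.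
-/
theorem mu_eq : mu = nu + nu.map (MeasurableEquiv.neg ℝ) := by
  have h1 : (nu.map (MeasurableEquiv.neg ℝ)) = volume.restrict (Ioo (-Real.pi) 0) := by
    have h2 := ((Measure.measurePreserving_neg (volume : Measure ℝ)).restrict_preimage
      (s := Ioo (-Real.pi) 0) measurableSet_Ioo).map_eq
    have h3 : Neg.neg ⁻¹' Ioo (-Real.pi) 0 = Ioo 0 Real.pi := by
      ext x; simp [and_comm]
    rw [h3] at h2
    exact h2
  rw [h1, mu, nu, ← Measure.restrict_union (by
    rw [Set.disjoint_left]; intro x hx hx'; exact absurd hx.1 (not_lt.mpr hx'.2.le))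
    measurableSet_Ioo]
  refine Measure.restrict_congr_set ?_
  have : ∀ᵐ x : ℝ, x ≠ 0 := by simp [ae_iff]
  filter_upwards [this] with x hx
  refine propext ⟨fun h => ?_, fun h => ?_⟩
  · rcases lt_or_gt_of_ne hx with h0 | h0
    · exact Or.inr ⟨h.1, h0⟩
    · exact Or.inl ⟨h0, h.2⟩
  · have hpi := Real.pi_pos
    rcases h with h | h
    · exact ⟨by linarith [h.1], h.2⟩
    · exact ⟨h.1, by linarith [h.2]⟩

theorem lintegral_mu (F : ℝ → ℝ≥0∞) :
    ∫⁻ θ, F θ ∂mu = (∫⁻ θ, F θ ∂nu) + ∫⁻ θ, F (-θ) ∂nu := by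
  rw [mu_eq, lintegral_add_measure, lintegral_map_equiv]
  rfl

theorem ae_mu_iff {p : ℝ → Prop} :
    (∀ᵐ θ ∂mu, p θ) ↔ ∀ᵐ θ ∂nu, p θ ∧ p (-θ) := by
  rw [mu_eq, ae_add_measure_iff, eventually_and]
  exact and_congr_right' (MeasurableEquiv.neg ℝ).measurableEmbedding.ae_map_iff

section
variable {E : Type*} [NormedAddCommGroup E]

theorem integrable_mu_iff {F : ℝ → E} :
    Integrable F mu ↔ Integrable F nu ∧ Integrable (fun θ => F (-θ)) nu := by
  rw [mu_eq, integrable_add_measure, integrable_map_equiv]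
  rfl

theorem integral_mu [NormedSpace ℝ E] {F : ℝ → E} (hF : Integrable F mu) :
    ∫ θ, F θ ∂mu = (∫ θ, F θ ∂nu) + ∫ θ, F (-θ) ∂nu := by
  have h := hF
  rw [mu_eq, integrable_add_measure] at h
  rw [mu_eq, integral_add_measure h.1 h.2, integral_map_equiv]
  rfl

theorem aestronglyMeasurable_mu_iff {F : ℝ → E} :
    AEStronglyMeasurable F mu ↔
      AEStronglyMeasurable F nu ∧ AEStronglyMeasurable (fun θ => F (-θ)) nu := by
  rw [mu_eq, aestronglyMeasurable_add_measure_iff,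
    (MeasurableEquiv.neg ℝ).measurableEmbedding.aestronglyMeasurable_map_iff]
  rfl
end

instance : IsFiniteMeasure mu := by unfold mu; infer_instance

theorem ae_nu_mem : ∀ᵐ θ ∂nu, θ ∈ Ioo 0 Real.pi := ae_restrict_mem measurableSet_Ioo

/-! ### Explicit form of the symmetrized Jacobi functions -/

/-- The restriction of `Φ_n` to `(0,π)`. -/
def radial (α β : ℝ) (n : ℕ) (θ : ℝ) : ℝ :=
  (Real.sqrt 2)⁻¹ *
    if Even n then normConst α β (n / 2) * (psi α β θ * (jPoly α β (n / 2)).eval (hs θ))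
    else -(eigenvalue α β ((n + 1) / 2) - eigenvalue α β 0) ^ (-(1 / 2) : ℝ) *
      (normConst α β ((n + 1) / 2) * (psi (α + 1) (β + 1) θ *
        (Polynomial.derivative (jPoly α β ((n + 1) / 2))).eval (hs θ)))

theorem phi_eq (α β : ℝ) (n : ℕ) (θ : ℝ) :
    phi α β n θ = normConst α β n * (psi α β θ * (jPoly α β n).eval (hs θ)) := by
  rw [phi, cos_eq_hs, jacobiP_eq, mul_assoc]

theorem hasDerivAt_psi (α β : ℝ) {θ : ℝ} (hθ : θ ∈ Ioo 0 Real.pi) :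
    HasDerivAt (psi α β) (((2 * α + 1) / 4 * Real.cot (θ / 2) -
      (2 * β + 1) / 4 * Real.tan (θ / 2)) * psi α β θ) θ := by
  have hs0 := sin_half_pos hθ
  have hc0 := cos_half_pos' hθ
  have h1 : HasDerivAt (fun t : ℝ => Real.sin (t / 2)) (Real.cos (θ / 2) * (1 / 2)) θ :=
    ((hasDerivAt_id θ).div_const 2).sin
  have h2 : HasDerivAt (fun t : ℝ => Real.cos (t / 2)) (-Real.sin (θ / 2) * (1 / 2)) θ :=
    ((hasDerivAt_id θ).div_const 2).cos
  have h3 := (h1.rpow_const (p := α + 1 / 2) (Or.inl hs0.ne')).mul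
    (h2.rpow_const (p := β + 1 / 2) (Or.inl hc0.ne'))
  have heq : psi α β =ᶠ[𝓝 θ] fun t => Real.sin (t / 2) ^ (α + 1 / 2) *
      Real.cos (t / 2) ^ (β + 1 / 2) := by
    filter_upwards [isOpen_Ioo.mem_nhds hθ] with t ht
    rw [psi, abs_of_pos (sin_half_pos ht)]
  refine (h3.congr_of_eventuallyEq heq).congr_deriv ?_
  rw [psi, abs_of_pos hs0, Real.rpow_sub_one hs0.ne', Real.rpow_sub_one hc0.ne',
    Real.cot_eq_cos_div_sin, Real.tan_eq_sin_div_cos]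
  field_simp
  ring

/-- The first-order operator annihilates `psi`, so only the derivative of the polynomial survives,
and the chain-rule factor `sin (θ/2) cos (θ/2)` raises both parameters of the weight. -/
theorem jacobiD_phi (α β : ℝ) (n : ℕ) {θ : ℝ} (hθ : θ ∈ Ioo 0 Real.pi) :
    jacobiD α β (phi α β n) θ = normConst α β n * (psi (α + 1) (β + 1) θ *
      (Polynomial.derivative (jPoly α β n)).eval (hs θ)) := by
  have h : HasDerivAt (phi α β n) (normConst α β n * ((((2 * α + 1) / 4 * Real.cot (θ / 2) -
      (2 * β + 1) / 4 * Real.tan (θ / 2)) * psi α β θ) * (jPoly α β n).eval (hs θ) +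
      psi α β θ * ((Polynomial.derivative (jPoly α β n)).eval (hs θ) *
        (Real.sin (θ / 2) * Real.cos (θ / 2))))) θ := by
    have h1 := ((hasDerivAt_psi α β hθ).mul
      (((jPoly α β n).hasDerivAt (hs θ)).comp θ (hasDerivAt_hs θ))).const_mul (normConst α β n)
    refine h1.congr_of_eventuallyEq (Eventually.of_forall fun t => ?_)
    rw [phi_eq]; rfl
  rw [jacobiD, h.deriv, phi_eq, psi_add_one α β hθ]
  ring

theorem phi_neg (α β : ℝ) (n : ℕ) (θ : ℝ) : phi α β n (-θ) = phi α β n θ := by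
  rw [phi_eq, phi_eq, psi_neg, hs_neg]

theorem jacobiD_phi_neg (α β : ℝ) (n : ℕ) (θ : ℝ) :
    jacobiD α β (phi α β n) (-θ) = -jacobiD α β (phi α β n) θ := by
  have h : deriv (phi α β n) (-θ) = -deriv (phi α β n) θ := by
    have := deriv_comp_neg (phi α β n) θ
    rw [show (fun x => phi α β n (-x)) = phi α β n from funext (phi_neg α β n)] at this
    linarith
  rw [jacobiD, jacobiD, h, phi_neg, neg_div, Real.tan_neg, Real.cot_eq_cos_div_sin,
    Real.cot_eq_cos_div_sin, Real.cos_neg, Real.sin_neg]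
  ring

theorem Phi_eq_radial (α β : ℝ) (n : ℕ) {θ : ℝ} (hθ : θ ∈ Ioo 0 Real.pi) :
    Phi α β n θ = radial α β n θ := by
  rw [Phi, radial]
  split_ifs with h
  · rw [phi_eq]
  · rw [jacobiD_phi α β _ hθ]

theorem Phi_neg_eq_radial (α β : ℝ) (n : ℕ) {θ : ℝ} (hθ : θ ∈ Ioo 0 Real.pi) :
    Phi α β n (-θ) = (-1) ^ n * radial α β n θ := by
  rw [← Phi_eq_radial α β n hθ, Phi, Phi]
  split_ifs with h
  · rw [phi_neg, h.neg_one_pow, one_mul]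
  · rw [jacobiD_phi_neg, (Nat.not_even_iff_odd.mp h).neg_one_pow]; ring

variable {α β : ℝ}

theorem memLp_psi_mul_eval (hα : -1 < α) (hβ : -1 < β) (P : Polynomial ℝ) :
    MemLp (fun θ => psi α β θ * P.eval (hs θ)) 2 nu := by
  have hm : Measurable fun θ => psi α β θ * P.eval (hs θ) :=
    (measurable_psi α β).mul (P.continuous.comp continuous_hs).measurable
  rw [memLp_two_iff_integrable_sq hm.aestronglyMeasurable]
  refine (integrableOn_wInner hα hβ P P).congr (Eventually.of_forall fun t => ?_)
  simp only []; ring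

theorem memLp_radial (hα : -1 < α) (hβ : -1 < β) (n : ℕ) : MemLp (radial α β n) 2 nu := by
  unfold radial
  split_ifs
  · exact ((memLp_psi_mul_eval hα hβ _).const_mul _).const_mul _
  · exact (((memLp_psi_mul_eval (by linarith) (by linarith) _).const_mul _).const_mul _).const_mul _

theorem normConst_eq (α β : ℝ) (n : ℕ) :
    normConst α β n = (Real.sqrt (wInner α β (jPoly α β n) (jPoly α β n)))⁻¹ := by
  rw [normConst, wInner]
  congr 3
  ext t
  rw [cos_eq_hs, jacobiP_eq]; ring

theorem normConst_sq (hα : -1 < α) (hβ : -1 < β) (n : ℕ) :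
    normConst α β n ^ 2 * wInner α β (jPoly α β n) (jPoly α β n) = 1 := by
  have h := wInner_self_pos hα hβ n
  rw [normConst_eq, inv_pow, Real.sq_sqrt h.le, inv_mul_cancel₀ h.ne']

theorem normConst_pos (hα : -1 < α) (hβ : -1 < β) (n : ℕ) : 0 < normConst α β n := by
  have h := wInner_self_pos hα hβ n
  rw [normConst_eq]; positivity

theorem eigenvalue_sub_pos (hα : -1 < α) (hβ : -1 < β) {n : ℕ} (hn : n ≠ 0) :
    0 < eigenvalue α β n - eigenvalue α β 0 := by
  rw [eigenvalue_sub]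
  have : (1 : ℝ) ≤ n := by exact_mod_cast Nat.one_le_iff_ne_zero.mpr hn
  have : 0 < (n : ℝ) + (α + β + 1) := by linarith
  positivity

/-- The value `1/2` is the share of `(0,π)` in the unit norm. For odd indices the squared norm of
the derivative is `λ_n - λ_0` times that of the polynomial, which the two powers `-1/2` cancel. -/
theorem integral_radial_mul (hα : -1 < α) (hβ : -1 < β) {n m : ℕ} (h : Even n ↔ Even m) :
    ∫ θ, radial α β n θ * radial α β m θ ∂nu = if n = m then 1 / 2 else 0 := by
  have h2 : (Real.sqrt 2)⁻¹ * (Real.sqrt 2)⁻¹ = 1 / 2 := by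
    rw [← mul_inv, Real.mul_self_sqrt (by norm_num)]; norm_num
  by_cases hn : Even n
  · have hm := h.mp hn
    obtain ⟨k, hk⟩ := hn
    obtain ⟨l, hl⟩ := hm
    have e : ∫ θ, radial α β n θ * radial α β m θ ∂nu = 1 / 2 * (normConst α β k *
        normConst α β l) * wInner α β (jPoly α β k) (jPoly α β l) := by
      rw [wInner, ← integral_const_mul]
      congr 1; ext θ
      simp only [radial, show n / 2 = k by omega, show m / 2 = l by omega, ← h2]
      rw [if_pos ⟨k, hk⟩, if_pos ⟨l, hl⟩]
      ring
    rw [e]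
    split_ifs with hnm
    · have : k = l := by omega
      subst this
      linear_combination (1 / 2) * normConst_sq hα hβ k
    · rw [wInner_jPoly_of_ne hα hβ (by omega), mul_zero]
  · have hm : ¬ Even m := fun hm => hn (h.mpr hm)
    obtain ⟨k, hk⟩ := Nat.not_even_iff_odd.mp hn
    obtain ⟨l, hl⟩ := Nat.not_even_iff_odd.mp hm
    have e : ∫ θ, radial α β n θ * radial α β m θ ∂nu = 1 / 2 *
        ((eigenvalue α β (k + 1) - eigenvalue α β 0) ^ (-(1 / 2) : ℝ) *
        (eigenvalue α β (l + 1) - eigenvalue α β 0) ^ (-(1 / 2) : ℝ)) *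
        (normConst α β (k + 1) * normConst α β (l + 1)) *
        wInner (α + 1) (β + 1) (Polynomial.derivative (jPoly α β (k + 1)))
          (Polynomial.derivative (jPoly α β (l + 1))) := by
      rw [wInner, ← integral_const_mul]
      congr 1; ext θ
      simp only [radial, show (n + 1) / 2 = k + 1 by omega, show (m + 1) / 2 = l + 1 by omega, ← h2]
      rw [if_neg hn, if_neg hm]
      ring
    rw [e]
    split_ifs with hnm
    · have : k = l := by omega
      subst this
      have hp := eigenvalue_sub_pos hα hβ (Nat.succ_ne_zero k)
      rw [wInner_derivative_jPoly hα hβ, ← eigenvalue_sub, ← Real.rpow_add hp,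
        show (-(1 / 2) : ℝ) + -(1 / 2) = -1 by norm_num, Real.rpow_neg_one]
      have e2 := inv_mul_cancel₀ hp.ne'
      linear_combination (1 / 2) * (eigenvalue α β (k + 1) - eigenvalue α β 0)⁻¹ *
        (eigenvalue α β (k + 1) - eigenvalue α β 0) * normConst_sq hα hβ (k + 1) + (1 / 2) * e2
    · rw [wInner_derivative_of_ne hα hβ (by omega), mul_zero]

theorem memLp_Phi (hα : -1 < α) (hβ : -1 < β) (n : ℕ) :
    MemLp (fun θ => (Phi α β n θ : ℂ)) 2 mu := by
  have h0 := memLp_radial hα hβ n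
  have e1 : radial α β n =ᵐ[nu] Phi α β n := by
    filter_upwards [ae_nu_mem] with θ hθ using (Phi_eq_radial α β n hθ).symm
  have e2 : (fun θ => (-1) ^ n * radial α β n θ) =ᵐ[nu] fun θ => Phi α β n (-θ) := by
    filter_upwards [ae_nu_mem] with θ hθ using (Phi_neg_eq_radial α β n hθ).symm
  have h1 : MemLp (Phi α β n) 2 nu := h0.ae_eq e1
  have h2 : MemLp (fun θ => Phi α β n (-θ)) 2 nu := (h0.const_mul _).ae_eq e2
  have h3 : MemLp (Phi α β n) 2 mu := by
    have hm : AEStronglyMeasurable (Phi α β n) mu := aestronglyMeasurable_mu_iff.mpr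
      ⟨h1.1, h2.1⟩
    rw [memLp_two_iff_integrable_sq hm, integrable_mu_iff]
    exact ⟨h1.integrable_sq, h2.integrable_sq⟩
  exact h3.ofReal

theorem integrable_mul_Phi (hα : -1 < α) (hβ : -1 < β) {f : ℝ → ℂ} (hf : MemLp f 2 mu) (n : ℕ) :
    Integrable (fun θ => f θ * (Phi α β n θ : ℂ)) mu :=
  hf.integrable_mul (memLp_Phi hα hβ n)

/-- Even-indexed coefficients see only the even part of `f`, odd-indexed ones only the odd part. -/
theorem coeff_eq (hα : -1 < α) (hβ : -1 < β) {f : ℝ → ℂ} (hf : MemLp f 2 mu) (n : ℕ) :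
    coeff α β f n = ∫ θ, (f θ + (-1) ^ n * f (-θ)) * (radial α β n θ : ℂ) ∂nu := by
  have hi := integrable_mul_Phi hα hβ hf n
  have hi' := integrable_mu_iff.mp hi
  rw [coeff]
  simp only [Complex.conj_ofReal]
  rw [integral_mu hi, ← integral_add hi'.1 hi'.2]
  refine integral_congr_ae ?_
  filter_upwards [ae_nu_mem] with θ hθ
  rw [Phi_eq_radial α β n hθ, Phi_neg_eq_radial α β n hθ]
  push_cast
  ring

theorem coeff_Phi (hα : -1 < α) (hβ : -1 < β) (n m : ℕ) :
    coeff α β (fun θ => (Phi α β m θ : ℂ)) n = if n = m then 1 else 0 := by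
  rw [coeff_eq hα hβ (memLp_Phi hα hβ m)]
  have e : ∀ᵐ θ ∂nu, ((Phi α β m θ : ℂ) + (-1) ^ n * (Phi α β m (-θ) : ℂ)) *
      (radial α β n θ : ℂ) =
      (((1 + (-1) ^ n * (-1) ^ m) * (radial α β n θ * radial α β m θ) : ℝ) : ℂ) := by
    filter_upwards [ae_nu_mem] with θ hθ
    rw [Phi_eq_radial α β m hθ, Phi_neg_eq_radial α β m hθ]
    push_cast
    ring
  rw [integral_congr_ae e, integral_complex_ofReal, integral_const_mul]
  by_cases h : Even n ↔ Even m
  · rw [integral_radial_mul hα hβ h]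
    have : (1 + (-1) ^ n * (-1) ^ m : ℝ) = 2 := by
      rw [← pow_add, (Nat.even_add.mpr h).neg_one_pow]; norm_num
    rw [this]
    split_ifs <;> simp
  · have : (1 + (-1) ^ n * (-1) ^ m : ℝ) = 0 := by
      rw [← pow_add, Odd.neg_one_pow]; · norm_num
      rw [← Nat.not_even_iff_odd, Nat.even_add]; exact h
    rw [this, if_neg (fun hnm => h (by rw [hnm]))]
    simp

end
end SymmJacobi

namespace SymmJacobi
noncomputable section

/-! ### Completeness -/

theorem integrable_mul_comp_hs {G : ℝ → ℂ} (hG : Integrable G nu) {g : ℝ → ℝ}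
    (hg : Continuous g) : Integrable (fun θ => G θ * (g (hs θ) : ℂ)) nu := by
  obtain ⟨C, hC⟩ := (isCompact_Icc (a := (0 : ℝ)) (b := 1)).exists_bound_of_continuousOn
    hg.continuousOn
  refine hG.mul_bdd (c := C) (Complex.continuous_ofReal.comp (hg.comp continuous_hs)).aestronglyMeasurable ?_
  refine Eventually.of_forall fun θ => ?_
  rw [Complex.norm_real]
  exact hC _ ⟨hs_nonneg θ, hs_le_one θ⟩

/-- Weierstrass approximation on `[0,1]` extends the hypothesis to all continuous functions of `hs
θ`. A test function of `θ` is of this kind through `θ = 2 arcsin √(hs θ)`. -/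
theorem ae_eq_zero_of_forall_integral_poly {G : ℝ → ℂ} (hG : Integrable G nu)
    (h : ∀ P : Polynomial ℝ, ∫ θ, G θ * ((P.eval (hs θ) : ℝ) : ℂ) ∂nu = 0) : G =ᵐ[nu] 0 := by
  have h1 : ∀ g : ℝ → ℝ, Continuous g → ∫ θ, G θ * (g (hs θ) : ℂ) ∂nu = 0 := by
    intro g hg
    refine norm_le_zero_iff.mp (le_of_forall_pos_le_add fun ε hε => ?_)
    set N := ∫ θ, ‖G θ‖ ∂nu
    have hN : 0 ≤ N := integral_nonneg fun _ => norm_nonneg _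
    obtain ⟨P, hP⟩ := exists_polynomial_near_of_continuousOn 0 1 g hg.continuousOn (ε / (N + 1))
      (by positivity)
    have e : ∫ θ, G θ * (g (hs θ) : ℂ) ∂nu =
        ∫ θ, G θ * ((g (hs θ) - P.eval (hs θ) : ℝ) : ℂ) ∂nu := by
      have := integral_sub (integrable_mul_comp_hs hG hg)
        (integrable_mul_comp_hs hG (g := fun x => P.eval x) P.continuous)
      rw [h P, sub_zero] at this
      rw [← this]
      congr 1; ext θ; push_cast; ring
    rw [e, zero_add]
    calc _ ≤ ∫ θ, ‖G θ‖ * (ε / (N + 1)) ∂nu := by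
          refine norm_integral_le_of_norm_le (hG.norm.mul_const _) (Eventually.of_forall fun θ => ?_)
          rw [norm_mul, Complex.norm_real]
          gcongr
          rw [norm_sub_rev]
          exact (hP _ ⟨hs_nonneg θ, hs_le_one θ⟩).le
      _ = N * (ε / (N + 1)) := integral_mul_const _ _
      _ ≤ ε := by
        rw [mul_div_assoc', div_le_iff₀ (by positivity)]; nlinarith
  refine ae_eq_zero_of_integral_contDiff_smul_eq_zero hG.locallyIntegrable fun φ hφ _ => ?_
  rw [← h1 (fun x => φ (2 * Real.arcsin (Real.sqrt x))) (by
    have := hφ.continuous; have := Real.continuous_arcsin; fun_prop)]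
  refine setIntegral_congr_fun measurableSet_Ioo fun θ hθ => ?_
  have h0 := sin_half_pos hθ
  rw [hs, Real.sqrt_sq h0.le, Real.arcsin_sin (by linarith [hθ.1, Real.pi_pos])
    (by linarith [hθ.2]), mul_div_cancel₀ _ (two_ne_zero), Complex.real_smul, mul_comm]

theorem integral_poly_eq_zero_of_span {G : ℝ → ℂ} (hG : Integrable G nu) {S : Set (Polynomial ℝ)}
    (hS : Submodule.span ℝ S = ⊤) (h : ∀ P ∈ S, ∫ θ, G θ * ((P.eval (hs θ) : ℝ) : ℂ) ∂nu = 0)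
    (P : Polynomial ℝ) : ∫ θ, G θ * ((P.eval (hs θ) : ℝ) : ℂ) ∂nu = 0 := by
  have hP : P ∈ Submodule.span ℝ S := hS ▸ Submodule.mem_top
  have hi : ∀ P : Polynomial ℝ, Integrable (fun θ => G θ * ((P.eval (hs θ) : ℝ) : ℂ)) nu := fun P =>
    integrable_mul_comp_hs hG P.continuous
  induction hP using Submodule.span_induction with
  | mem P hP => exact h P hP
  | zero => simp
  | add P Q _ _ hP hQ =>
    have := integral_add (hi P) (hi Q)
    rw [hP, hQ, add_zero] at this
    rw [← this]
    congr 1; ext θ; rw [Polynomial.eval_add]; push_cast; ring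
  | smul c P _ hP =>
    have : ∫ θ, G θ * (((c • P).eval (hs θ) : ℝ) : ℂ) ∂nu =
        ∫ θ, (c : ℂ) * (G θ * ((P.eval (hs θ) : ℝ) : ℂ)) ∂nu := by
      congr 1; ext θ; rw [Polynomial.eval_smul, smul_eq_mul]; push_cast; ring
    rw [this, integral_const_mul, hP, mul_zero]

variable {α β : ℝ}

theorem memLp_nu_of_mu {f : ℝ → ℂ} {p : ℝ≥0∞} (hf : MemLp f p mu) : MemLp f p nu := by
  rw [mu_eq] at hf; exact hf.left_of_add_measure

theorem memLp_nu_neg_of_mu {f : ℝ → ℂ} {p : ℝ≥0∞} (hf : MemLp f p mu) :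
    MemLp (fun θ => f (-θ)) p nu := by
  rw [mu_eq] at hf
  exact ((MeasurableEquiv.neg ℝ).measurableEmbedding.memLp_map_measure_iff).mp
    hf.right_of_add_measure

theorem ae_eq_zero_of_span (hα : -1 < α) (hβ : -1 < β) {F : ℝ → ℂ} (hF : MemLp F 2 nu)
    {S : ℕ → Polynomial ℝ} (hS : Submodule.span ℝ (Set.range S) = ⊤)
    (h : ∀ n, ∫ θ, F θ * ((psi α β θ * (S n).eval (hs θ) : ℝ) : ℂ) ∂nu = 0) : F =ᵐ[nu] 0 := by
  have hψ : MemLp (fun θ => (psi α β θ : ℂ)) 2 nu := by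
    have := (memLp_psi_mul_eval hα hβ 1).ofReal (K := ℂ)
    simpa using this
  have hG : Integrable (fun θ => F θ * (psi α β θ : ℂ)) nu := hF.integrable_mul hψ
  have := ae_eq_zero_of_forall_integral_poly hG (integral_poly_eq_zero_of_span hG hS (by
    rintro _ ⟨n, rfl⟩
    rw [← h n]
    congr 1; ext θ; push_cast; ring))
  filter_upwards [this, ae_nu_mem] with θ h1 hθ
  have h2 : (psi α β θ : ℂ) ≠ 0 := by exact_mod_cast (psi_pos α β hθ).ne'
  exact (mul_eq_zero.mp h1).resolve_right h2

/-- The even part is orthogonal to `psi α β` times all polynomials, the odd part to `psi (α+1)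
(β+1)` times all polynomials, since Jacobi polynomials and their derivatives each span. -/
theorem ae_eq_zero_of_coeff_eq_zero (hα : -1 < α) (hβ : -1 < β) {f : ℝ → ℂ} (hf : MemLp f 2 mu)
    (h : ∀ n, coeff α β f n = 0) : f =ᵐ[mu] 0 := by
  have h1 := memLp_nu_of_mu hf
  have h2 := memLp_nu_neg_of_mu hf
  have h20 : (((Real.sqrt 2)⁻¹ : ℝ) : ℂ) ≠ 0 := by
    exact_mod_cast (by positivity : (Real.sqrt 2)⁻¹ ≠ 0)
  have he : (fun θ => f θ + f (-θ)) =ᵐ[nu] 0 := by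
    refine ae_eq_zero_of_span hα hβ (h1.add h2) (span_jPoly hα hβ) fun n => ?_
    have := h (2 * n)
    rw [coeff_eq hα hβ hf] at this
    have hc : (((Real.sqrt 2)⁻¹ : ℝ) : ℂ) * (normConst α β n : ℂ) ≠ 0 :=
      mul_ne_zero h20 (by exact_mod_cast (normConst_pos hα hβ n).ne')
    apply mul_left_cancel₀ hc
    rw [mul_zero, ← this, ← integral_const_mul]
    congr 1; ext θ
    rw [radial, if_pos (even_two_mul n), show 2 * n / 2 = n by omega,
      (even_two_mul n).neg_one_pow]
    push_cast; ring
  have ho : (fun θ => f θ - f (-θ)) =ᵐ[nu] 0 := by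
    refine ae_eq_zero_of_span (α := α + 1) (β := β + 1) (by linarith) (by linarith) (h1.sub h2)
      (span_derivative_jPoly hα hβ) fun n => ?_
    have := h (2 * n + 1)
    rw [coeff_eq hα hβ hf] at this
    have hp := eigenvalue_sub_pos hα hβ (Nat.succ_ne_zero n)
    have hc : (((Real.sqrt 2)⁻¹ : ℝ) : ℂ) *
        ((-(eigenvalue α β (n + 1) - eigenvalue α β 0) ^ (-(1 / 2) : ℝ) : ℝ) : ℂ) *
        (normConst α β (n + 1) : ℂ) ≠ 0 := by
      refine mul_ne_zero (mul_ne_zero h20 ?_) (by exact_mod_cast (normConst_pos hα hβ _).ne')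
      have : (-(eigenvalue α β (n + 1) - eigenvalue α β 0) ^ (-(1 / 2) : ℝ) : ℝ) ≠ 0 :=
        neg_ne_zero.mpr (Real.rpow_pos_of_pos hp _).ne'
      exact_mod_cast this
    apply mul_left_cancel₀ hc
    rw [mul_zero, ← this, ← integral_const_mul]
    congr 1; ext θ
    have hodd : Odd (2 * n + 1) := odd_two_mul_add_one n
    rw [radial, if_neg (Nat.not_even_iff_odd.mpr hodd), show (2 * n + 1 + 1) / 2 = n + 1 by omega,
      hodd.neg_one_pow]
    push_cast; ring
  refine ae_mu_iff.mpr ?_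
  filter_upwards [he, ho] with θ h3 h4
  simp only [Pi.zero_apply] at h3 h4 ⊢
  constructor
  · linear_combination (1 / 2) * h3 + (1 / 2) * h4
  · linear_combination (1 / 2) * h3 - (1 / 2) * h4

/-! ### The spectral decomposition -/

theorem coeff_congr {f g : ℝ → ℂ} (h : f =ᵐ[mu] g) (n : ℕ) : coeff α β f n = coeff α β g n := by
  refine integral_congr_ae ?_
  filter_upwards [h] with θ hθ
  rw [hθ]

theorem coeff_sub (hα : -1 < α) (hβ : -1 < β) {f g : ℝ → ℂ} (hf : MemLp f 2 mu)
    (hg : MemLp g 2 mu) (n : ℕ) :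
    coeff α β (fun θ => f θ - g θ) n = coeff α β f n - coeff α β g n := by
  simp only [coeff, Complex.conj_ofReal]
  rw [← integral_sub (integrable_mul_Phi hα hβ hf n) (integrable_mul_Phi hα hβ hg n)]
  congr 1; ext θ; ring

theorem ae_eq_of_coeff_eq (hα : -1 < α) (hβ : -1 < β) {f g : ℝ → ℂ} (hf : MemLp f 2 mu)
    (hg : MemLp g 2 mu) (h : ∀ n, coeff α β f n = coeff α β g n) : f =ᵐ[mu] g := by
  have := ae_eq_zero_of_coeff_eq_zero hα hβ (hf.sub hg) fun n => by
    rw [← sub_eq_zero.mpr (h n), ← coeff_sub hα hβ hf hg]; rfl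
  filter_upwards [this] with θ hθ
  exact sub_eq_zero.mp hθ

/-- `Φ_n` as an element of `L²(-π,π)`. -/
def PhiLp (hα : -1 < α) (hβ : -1 < β) (n : ℕ) : Lp ℂ 2 mu := (memLp_Phi hα hβ n).toLp _

theorem inner_PhiLp (hα : -1 < α) (hβ : -1 < β) (n : ℕ) (f : Lp ℂ 2 mu) :
    inner ℂ (PhiLp hα hβ n) f = coeff α β f n := by
  rw [L2.inner_def, coeff]
  refine integral_congr_ae ?_
  filter_upwards [(memLp_Phi hα hβ n).coeFn_toLp] with θ hθ
  rw [PhiLp, hθ, RCLike.inner_apply]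

theorem orthonormal_PhiLp (hα : -1 < α) (hβ : -1 < β) : Orthonormal ℂ (PhiLp hα hβ) := by
  rw [orthonormal_iff_ite]
  intro n m
  rw [inner_PhiLp, PhiLp, coeff_congr (memLp_Phi hα hβ m).coeFn_toLp, coeff_Phi hα hβ]

/-- The symmetrized Jacobi functions form a Hilbert basis of `L²(-π,π)`. -/
def basisPhi (hα : -1 < α) (hβ : -1 < β) : HilbertBasis ℕ ℂ (Lp ℂ 2 mu) :=
  HilbertBasis.mkOfOrthogonalEqBot (orthonormal_PhiLp hα hβ) (by
    rw [Submodule.eq_bot_iff]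
    intro f hf
    refine Lp.eq_zero_iff_ae_eq_zero.mpr ?_
    refine ae_eq_zero_of_coeff_eq_zero hα hβ (Lp.memLp f) fun n => ?_
    rw [← inner_PhiLp hα hβ]
    exact (Submodule.mem_orthogonal _ f).mp hf _ (Submodule.subset_span ⟨n, rfl⟩))

/-- Together with its converse `coeff_of_isSpectralImage` this replaces convergence of the spectral
series by an identity between coefficients, the form used in all later arguments. -/
theorem isSpectralImage_of_coeff (hα : -1 < α) (hβ : -1 < β) {m : ℝ → ℝ} {f g : ℝ → ℂ}
    (hg : MemLp g 2 mu)
    (h : ∀ n, coeff α β g n = (m (symEigenvalue α β n) : ℂ) * coeff α β f n) :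
    IsSpectralImage α β m f g := by
  refine ⟨hg, ?_⟩
  set G : Lp ℂ 2 mu := hg.toLp g with hG
  have h1 := ((basisPhi hα hβ).hasSum_repr G).tendsto_sum_nat
  have h2 : ∀ n, (basisPhi hα hβ).repr G n • basisPhi hα hβ n =
      ((m (symEigenvalue α β n) : ℂ) * coeff α β f n) • PhiLp hα hβ n := fun n => by
    rw [HilbertBasis.repr_apply_apply, ← h n, basisPhi, HilbertBasis.coe_mkOfOrthogonalEqBot,
      inner_PhiLp, coeff_congr hg.coeFn_toLp]
  simp only [h2] at h1
  have h3 := (tendsto_iff_norm_sub_tendsto_zero.mp h1)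
  have h4 : ∀ N : ℕ, eLpNorm (fun θ => g θ - ∑ n ∈ Finset.range N,
      (m (symEigenvalue α β n) : ℂ) * coeff α β f n * (Phi α β n θ : ℂ)) 2 mu =
      ENNReal.ofReal ‖∑ n ∈ Finset.range N, ((m (symEigenvalue α β n) : ℂ) * coeff α β f n) •
        PhiLp hα hβ n - G‖ := fun N => by
    rw [norm_sub_rev, Lp.norm_def, ENNReal.ofReal_toReal (Lp.eLpNorm_ne_top _)]
    refine eLpNorm_congr_ae ?_
    have h5 : ∀ᵐ θ ∂mu, ∀ n, (PhiLp hα hβ n : ℝ → ℂ) θ = (Phi α β n θ : ℂ) :=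
      ae_all_iff.mpr fun n => (memLp_Phi hα hβ n).coeFn_toLp
    have h6 : ∀ᵐ θ ∂mu, ∀ n, (((m (symEigenvalue α β n) : ℂ) * coeff α β f n) •
        PhiLp hα hβ n : Lp ℂ 2 mu) θ = ((m (symEigenvalue α β n) : ℂ) * coeff α β f n) *
        (PhiLp hα hβ n : ℝ → ℂ) θ := ae_all_iff.mpr fun n => Lp.coeFn_smul _ _
    filter_upwards [h5, h6, hg.coeFn_toLp, Lp.coeFn_sub G (∑ n ∈ Finset.range N,
      ((m (symEigenvalue α β n) : ℂ) * coeff α β f n) • PhiLp hα hβ n),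
      Lp.coeFn_finsetSum (Finset.range N) (fun n => ((m (symEigenvalue α β n) : ℂ) *
        coeff α β f n) • PhiLp hα hβ n)] with θ a1 a2 a3 a4 a5
    rw [a4, Pi.sub_apply, hG, a3, a5, Finset.sum_apply]
    simp only [a2, a1]
  simp only [h4]
  rw [← ENNReal.ofReal_zero]
  exact ENNReal.tendsto_ofReal h3

theorem coeff_of_isSpectralImage (hα : -1 < α) (hβ : -1 < β) {m : ℝ → ℝ} {f g : ℝ → ℂ}
    (h : IsSpectralImage α β m f g) (n : ℕ) :
    coeff α β g n = (m (symEigenvalue α β n) : ℂ) * coeff α β f n := by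
  obtain ⟨hg, hlim⟩ := h
  set S : ℕ → ℝ → ℂ := fun N θ => ∑ k ∈ Finset.range N,
    (m (symEigenvalue α β k) : ℂ) * coeff α β f k * (Phi α β k θ : ℂ) with hS
  have hSm : ∀ N, MemLp (S N) 2 mu := fun N =>
    memLp_finsetSum _ fun k _ => (memLp_Phi hα hβ k).const_mul _
  have hSc : ∀ N, n < N → coeff α β (S N) n = (m (symEigenvalue α β n) : ℂ) * coeff α β f n := by
    intro N hN
    have e : coeff α β (S N) n = ∑ k ∈ Finset.range N, (m (symEigenvalue α β k) : ℂ) *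
        coeff α β f k * coeff α β (fun θ => (Phi α β k θ : ℂ)) n := by
      simp only [coeff, ← integral_const_mul, Complex.conj_ofReal, hS]
      rw [← integral_finsetSum _ fun k _ => ?_]
      · congr 1; ext θ; rw [Finset.sum_mul]; refine Finset.sum_congr rfl fun k _ => by ring
      · exact (integrable_mul_Phi hα hβ (memLp_Phi hα hβ k) n).const_mul _
    rw [e, Finset.sum_eq_single n]
    · rw [coeff_Phi hα hβ, if_pos rfl, mul_one]
    · intro k _ hk; rw [coeff_Phi hα hβ, if_neg hk.symm, mul_zero]
    · intro hn; exact absurd (Finset.mem_range.mpr hN) hn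
  have hle : ∀ N, n < N → ‖coeff α β g n - (m (symEigenvalue α β n) : ℂ) * coeff α β f n‖ ≤
      ‖PhiLp hα hβ n‖ * (eLpNorm (fun θ => g θ - S N θ) 2 mu).toReal := by
    intro N hN
    rw [← hSc N hN, ← coeff_sub hα hβ hg (hSm N)]
    have hd : MemLp (fun θ => g θ - S N θ) 2 mu := hg.sub (hSm N)
    rw [← coeff_congr hd.coeFn_toLp, ← inner_PhiLp hα hβ, ← Lp.norm_toLp _ hd]
    exact norm_inner_le_norm _ _
  have hlim2 : Tendsto (fun N => ‖PhiLp hα hβ n‖ *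
      (eLpNorm (fun θ => g θ - S N θ) 2 mu).toReal) atTop (𝓝 0) := by
    have := ((ENNReal.tendsto_toReal (by simp)).comp hlim).const_mul ‖PhiLp hα hβ n‖
    simpa using this
  -- Partial sums beyond `n` all have the prescribed `n`-th coefficient, and by Cauchy–Schwarz a
  -- coefficient is continuous in the `L²` norm, so the constant left side is at most a null
  -- sequence.
  have h0 := ge_of_tendsto hlim2 ((eventually_gt_atTop n).mono fun N hN => hle N hN)
  exact sub_eq_zero.mp (norm_le_zero_iff.mp h0)

end
end SymmJacobi

namespace SymmJacobi
noncomputable section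

/-! ### Integral operators on `(0,π)` -/

/-- The integral operator on `(0,π)` with real kernel `K`. -/
def kerOp (K : ℝ → ℝ → ℝ) (F : ℝ → ℂ) (θ : ℝ) : ℂ := ∫ φ, (K θ φ : ℂ) * F φ ∂nu

section
variable {K : ℝ → ℝ → ℝ} {u v : ℝ} {F G : ℝ → ℂ}

theorem aestronglyMeasurable_kernel_mul (hK : Measurable (Function.uncurry K))
    (hF : AEStronglyMeasurable F nu) :
    AEStronglyMeasurable (fun z : ℝ × ℝ => (K z.1 z.2 : ℂ) * F z.2) (nu.prod nu) :=
  (Complex.measurable_ofReal.comp hK).aestronglyMeasurable.mul hF.comp_snd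

theorem aestronglyMeasurable_kerOp (hK : Measurable (Function.uncurry K))
    (hF : AEStronglyMeasurable F nu) : AEStronglyMeasurable (kerOp K F) nu :=
  (aestronglyMeasurable_kernel_mul hK hF).integral_prod_right'

theorem aemeasurable_lintegral_kernel_mul (hK : Measurable (Function.uncurry K))
    (hF : AEStronglyMeasurable F nu) :
    AEMeasurable (fun θ => ∫⁻ φ, ‖(K θ φ : ℂ) * F φ‖ₑ ∂nu) nu :=
  (aestronglyMeasurable_kernel_mul hK hF).enorm.lintegral_prod_right'

theorem enorm_kerOp_le (θ : ℝ) : ‖kerOp K F θ‖ₑ ≤ ∫⁻ φ, ‖(K θ φ : ℂ) * F φ‖ₑ ∂nu :=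
  enorm_integral_le_lintegral_enorm _

theorem KerBound.lintegral_kernel_mul_le
    (hK0 : ∀ θ ∈ Ioo 0 Real.pi, ∀ φ ∈ Ioo 0 Real.pi, 0 ≤ K θ φ)
    (h : KerBound nu u v (fun θ φ => ENNReal.ofReal (K θ φ))) :
    ∃ C : ℝ≥0∞, C ≠ ∞ ∧ ∀ F : ℝ → ℂ, AEStronglyMeasurable F nu →
      ∫⁻ θ, (∫⁻ φ, ‖(K θ φ : ℂ) * F φ‖ₑ ∂nu) ^ (1 / v) ∂nu ≤
        C * (∫⁻ φ, ‖F φ‖ₑ ^ (1 / u) ∂nu) ^ (u / v) := by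
  obtain ⟨C, hC, H⟩ := h
  refine ⟨C, hC, fun F hF => ?_⟩
  have hm := hF.enorm
  have e1 : ∫⁻ φ, ‖F φ‖ₑ ^ (1 / u) ∂nu = ∫⁻ φ, hm.mk _ φ ^ (1 / u) ∂nu := by
    refine lintegral_congr_ae ?_
    filter_upwards [hm.ae_eq_mk] with φ hφ
    rw [hφ]
  have e2 : ∫⁻ θ, (∫⁻ φ, ‖(K θ φ : ℂ) * F φ‖ₑ ∂nu) ^ (1 / v) ∂nu =
      ∫⁻ θ, (∫⁻ φ, ENNReal.ofReal (K θ φ) * hm.mk _ φ ∂nu) ^ (1 / v) ∂nu := by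
    refine lintegral_congr_ae ?_
    filter_upwards [ae_nu_mem] with θ hθ
    congr 1
    refine lintegral_congr_ae ?_
    filter_upwards [hm.ae_eq_mk, ae_nu_mem] with φ hφ hφI
    rw [enorm_mul, hφ, ← ofReal_norm, Complex.norm_real,
      Real.norm_of_nonneg (hK0 θ hθ φ hφI)]
  rw [e1, e2]
  exact H _ hm.measurable_mk

/-- The Lebesgue exponent `1/u`. -/
abbrev expo (u : ℝ) : ℝ≥0∞ := ENNReal.ofReal (1 / u)

theorem eLpNorm_expo {E : Type*} [NormedAddCommGroup E] {ν : Measure ℝ} (hu : 0 < u) (F : ℝ → E) :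
    eLpNorm F (expo u) ν = (∫⁻ φ, ‖F φ‖ₑ ^ (1 / u) ∂ν) ^ u := by
  have h0 : 0 < 1 / u := by positivity
  rw [eLpNorm_eq_lintegral_rpow_enorm_toReal (ENNReal.ofReal_pos.mpr h0).ne' ENNReal.ofReal_ne_top,
    ENNReal.toReal_ofReal h0.le, one_div_one_div]

/-- The bound is kept also for the integral of absolute values, which Fubini's theorem needs for
symmetry, and it yields the almost everywhere integrability behind additivity. -/
theorem KerBound.eLpNorm_le (hu : 0 < u) (hv : 0 < v)
    (hK0 : ∀ θ ∈ Ioo 0 Real.pi, ∀ φ ∈ Ioo 0 Real.pi, 0 ≤ K θ φ)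
    (hK : Measurable (Function.uncurry K))
    (h : KerBound nu u v (fun θ φ => ENNReal.ofReal (K θ φ))) :
    ∃ C : ℝ≥0∞, C ≠ ∞ ∧ ∀ F : ℝ → ℂ, MemLp F (expo u) nu →
      eLpNorm (fun θ => (∫⁻ φ, ‖(K θ φ : ℂ) * F φ‖ₑ ∂nu)) (expo v) nu ≤
        C * eLpNorm F (expo u) nu ∧
      eLpNorm (kerOp K F) (expo v) nu ≤ C * eLpNorm F (expo u) nu ∧
      ∀ᵐ θ ∂nu, Integrable (fun φ => (K θ φ : ℂ) * F φ) nu := by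
  obtain ⟨C, hC, H⟩ := h.lintegral_kernel_mul_le hK0
  have hv0 : 0 < 1 / v := by positivity
  refine ⟨C ^ v, ENNReal.rpow_ne_top_of_nonneg hv.le hC, fun F hF => ?_⟩
  have hH := H F hF.1
  have hb : (∫⁻ θ, (∫⁻ φ, ‖(K θ φ : ℂ) * F φ‖ₑ ∂nu) ^ (1 / v) ∂nu) ^ v ≤
      C ^ v * eLpNorm F (expo u) nu := by
    refine (ENNReal.rpow_le_rpow hH hv.le).trans_eq ?_
    rw [ENNReal.mul_rpow_of_nonneg _ _ hv.le, ← ENNReal.rpow_mul, div_mul_cancel₀ _ hv.ne',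
      eLpNorm_expo hu]
  refine ⟨?_, ?_, ?_⟩
  · rw [eLpNorm_eq_lintegral_rpow_enorm_toReal (ENNReal.ofReal_pos.mpr hv0).ne'
      ENNReal.ofReal_ne_top, ENNReal.toReal_ofReal hv0.le, one_div_one_div]
    simpa only [enorm_eq_self] using hb
  · rw [eLpNorm_expo hv]
    refine le_trans (ENNReal.rpow_le_rpow (lintegral_mono fun θ => ?_) hv.le) hb
    exact ENNReal.rpow_le_rpow (enorm_kerOp_le θ) hv0.le
  · have hm := aemeasurable_lintegral_kernel_mul hK hF.1
    have hfin : ∫⁻ θ, (∫⁻ φ, ‖(K θ φ : ℂ) * F φ‖ₑ ∂nu) ^ (1 / v) ∂nu < ∞ := by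
      refine lt_of_le_of_lt hH (ENNReal.mul_lt_top hC.lt_top
        (ENNReal.rpow_lt_top_of_nonneg (by positivity) ?_))
      have h1 := hF.2
      rw [eLpNorm_expo hu] at h1
      intro htop
      rw [htop, ENNReal.top_rpow_of_pos hu] at h1
      exact lt_irrefl _ h1
    have hm2 := (aestronglyMeasurable_kernel_mul hK hF.1).prodMk_left
    filter_upwards [ae_lt_top' (hm.pow_const _) hfin.ne, hm2] with θ h1 h2
    refine ⟨h2, ?_⟩
    rw [hasFiniteIntegral_iff_enorm]
    exact (ENNReal.rpow_lt_top_iff_of_pos hv0).mp h1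

theorem kerOp_add {θ : ℝ} (hF : Integrable (fun φ => (K θ φ : ℂ) * F φ) nu)
    (hG : Integrable (fun φ => (K θ φ : ℂ) * G φ) nu) :
    kerOp K (fun φ => F φ + G φ) θ = kerOp K F θ + kerOp K G θ := by
  rw [kerOp, kerOp, kerOp, ← integral_add hF hG]
  congr 1; ext φ; ring

theorem kerOp_const_mul (c : ℂ) (F : ℝ → ℂ) (θ : ℝ) :
    kerOp K (fun φ => c * F φ) θ = c * kerOp K F θ := by
  rw [kerOp, kerOp, ← integral_const_mul]
  congr 1; ext φ; ring

theorem kerOp_congr (h : F =ᵐ[nu] G) (θ : ℝ) : kerOp K F θ = kerOp K G θ := by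
  refine integral_congr_ae ?_
  filter_upwards [h] with φ hφ
  rw [hφ]

/-- Symmetry of an operator with symmetric kernel. -/
theorem integral_kerOp_mul (hK : Measurable (Function.uncurry K))
    (hsymm : ∀ θ φ, K θ φ = K φ θ) (hF : AEStronglyMeasurable F nu)
    (h2 : eLpNorm (fun θ => (∫⁻ φ, ‖(K θ φ : ℂ) * F φ‖ₑ ∂nu)) 2 nu < ∞)
    {R : ℝ → ℝ} (hR : MemLp R 2 nu) {lam : ℝ}
    (heig : ∀ θ ∈ Ioo 0 Real.pi, ∫ φ, K θ φ * R φ ∂nu = lam * R θ) :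
    ∫ θ, kerOp K F θ * (R θ : ℂ) ∂nu = lam * ∫ θ, F θ * (R θ : ℂ) ∂nu := by
  have hRc : AEStronglyMeasurable (fun θ => (R θ : ℂ)) nu := hR.ofReal.1
  have hm : AEStronglyMeasurable (fun z : ℝ × ℝ => (K z.1 z.2 : ℂ) * F z.2 * (R z.1 : ℂ))
      (nu.prod nu) := (aestronglyMeasurable_kernel_mul hK hF).mul (hRc.comp_fst (ν := nu))
  have hint : Integrable (fun z : ℝ × ℝ => (K z.1 z.2 : ℂ) * F z.2 * (R z.1 : ℂ))
      (nu.prod nu) := by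
    refine ⟨hm, ?_⟩
    rw [hasFiniteIntegral_iff_enorm, lintegral_prod _ hm.enorm]
    have hml := aemeasurable_lintegral_kernel_mul hK hF
    have e : ∀ θ, ∫⁻ φ, ‖(K θ φ : ℂ) * F φ * (R θ : ℂ)‖ₑ ∂nu =
        (∫⁻ φ, ‖(K θ φ : ℂ) * F φ‖ₑ ∂nu) * ‖R θ‖ₑ := fun θ => by
      simp only [enorm_mul _ (R θ : ℂ)]
      rw [lintegral_mul_const' _ _ enorm_ne_top]
      congr 1
      rw [← ofReal_norm, Complex.norm_real, ofReal_norm]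
    simp only [e]
    have hH := ENNReal.lintegral_mul_le_Lp_mul_Lq nu Real.HolderConjugate.two_two hml hR.1.enorm
    refine lt_of_le_of_lt hH (ENNReal.mul_lt_top ?_ ?_)
    · have := h2
      rw [eLpNorm_eq_lintegral_rpow_enorm_toReal (by simp) (by simp)] at this
      simpa using this
    · have := hR.2
      rw [eLpNorm_eq_lintegral_rpow_enorm_toReal (by simp) (by simp)] at this
      simpa using this
  have e1 : ∫ θ, kerOp K F θ * (R θ : ℂ) ∂nu =
      ∫ θ, ∫ φ, (K θ φ : ℂ) * F φ * (R θ : ℂ) ∂nu ∂nu := by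
    congr 1; ext θ
    rw [kerOp, integral_mul_const]
  rw [e1, integral_integral_swap hint, ← integral_const_mul]
  refine setIntegral_congr_fun measurableSet_Ioo fun φ hφ => ?_
  have e2 : ∀ θ, (K θ φ : ℂ) * F φ * (R θ : ℂ) = F φ * ((K φ θ * R θ : ℝ) : ℂ) := fun θ => by
    rw [hsymm θ φ]; push_cast; ring
  simp only [e2]
  rw [integral_const_mul, integral_complex_ofReal, heig φ hφ]
  push_cast; ring
end

/-! ### The potential operators -/

/-- The kernel on `(0,π)` of `(c + L)^{-σ}`. -/
def symKer (c α β σ θ φ : ℝ) : ℝ := potKer α β (c + eigenvalue α β 0) σ θ φ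

/-- The operator on functions on `(-π,π)` representing `(c + 𝕃)^{-σ}`. -/
def potOp (c α β σ : ℝ) (f : ℝ → ℂ) (θ : ℝ) : ℂ :=
  (1 / 2) * (kerOp (symKer c α β σ) (fun φ => f φ + f (-φ)) |θ| +
    (Real.sign θ : ℂ) * kerOp (symKer c (α + 1) (β + 1) σ) (fun φ => f φ - f (-φ)) |θ|)

variable {c α β σ : ℝ}

theorem measurable_symKer (c α β σ : ℝ) : Measurable (Function.uncurry (symKer c α β σ)) :=
  measurable_potKer α β _ σ

theorem eigenvalue_zero_succ_pos (hα : -1 < α) (hβ : -1 < β) (hc : 0 ≤ c) :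
    0 < c + eigenvalue (α + 1) (β + 1) 0 := by
  have : 0 < (α + 1 + (β + 1) + 1) / 2 := by linarith
  have : 0 < eigenvalue (α + 1) (β + 1) 0 := by
    simp only [eigenvalue, Nat.cast_zero, zero_add]; positivity
  linarith

theorem symKer_nonneg (hα : -1 < α) (hβ : -1 < β) (hκ : 0 < c + eigenvalue α β 0) (h0 : 0 < σ)
    (h1 : σ < 1) : ∀ θ ∈ Ioo 0 Real.pi, ∀ φ ∈ Ioo 0 Real.pi, 0 ≤ symKer c α β σ θ φ :=
  fun _ hθ _ hφ => potKer_nonneg hα hβ hκ h0 h1 hθ hφ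

/-- The two shifts `c + λ_0^{α,β}` and `c + λ_0^{α+1,β+1}` are what make the two operators on
`(0,π)` reproduce the eigenvalues of `𝕃`: for `n = 2k+1`, the eigenvalue `λ_{k+1}` exceeds
`λ_0^{α+1,β+1}` by that of the differentiated equation. -/
theorem integral_symKer_radial (hα : -1 < α) (hβ : -1 < β) (hc : 0 ≤ c)
    (hκ : 0 < c + eigenvalue α β 0) (h0 : 0 < σ) (h1 : σ < 1) (n : ℕ) :
    ∀ θ ∈ Ioo 0 Real.pi,
      ∫ φ, (if Even n then symKer c α β σ θ φ else symKer c (α + 1) (β + 1) σ θ φ) *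
        radial α β n φ ∂nu = (c + symEigenvalue α β n) ^ (-σ) * radial α β n θ := by
  intro θ hθ
  by_cases hn : Even n
  · have hnn : ((n : ℕ) + 1) / 2 = n / 2 := by obtain ⟨k, hk⟩ := hn; omega
    have hη : 0 ≤ ((n / 2 : ℕ) : ℝ) * ((n / 2 : ℕ) + (α + β + 1)) := by
      rw [← eigenvalue_sub]
      rcases Nat.eq_zero_or_pos (n / 2) with h | h
      · rw [h, sub_self]
      · exact (eigenvalue_sub_pos hα hβ h.ne').le
    have := (integral_potKer_eigen hα hβ hκ h0 h1
      (fun x => (jPoly α β (n / 2)).hasDerivAt x) (fun x => Polynomial.hasDerivAt _ x)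
      (Polynomial.continuous _) hη (fun x => by
        have := congrArg (Polynomial.eval x) (jOp_jPoly (α := α) (β := β) (n / 2))
        simp only [jOp, Polynomial.eval_mul, Polynomial.eval_add,
          Polynomial.eval_sub, Polynomial.eval_C, Polynomial.eval_X, Polynomial.eval_one] at this
        rw [jacOp, this]) hθ).2
    have hsum : c + symEigenvalue α β n = c + eigenvalue α β 0 +
        ((n / 2 : ℕ) : ℝ) * ((n / 2 : ℕ) + (α + β + 1)) := by
      rw [symEigenvalue, hnn, ← eigenvalue_sub]; ring
    simp only [radial, if_pos hn]
    rw [hsum]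
    calc _ = ∫ φ in Ioo 0 Real.pi, ((Real.sqrt 2)⁻¹ * normConst α β (n / 2)) *
          (potKer α β (c + eigenvalue α β 0) σ θ φ *
            (psi α β φ * (jPoly α β (n / 2)).eval (hs φ))) := by
          congr 1; ext φ; rw [symKer]; ring
      _ = _ := by rw [integral_const_mul, this]; ring
  · obtain ⟨k, hk⟩ := Nat.not_even_iff_odd.mp hn
    have hnn : (n + 1) / 2 = k + 1 := by omega
    have hk0 : (0 : ℝ) ≤ k := Nat.cast_nonneg k
    have hη : 0 ≤ (((k + 1 : ℕ) : ℝ) * ((k + 1 : ℕ) + (α + β + 1)) - (α + β + 2)) := by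
      push_cast
      nlinarith [mul_nonneg hk0 (by linarith : 0 ≤ (k : ℝ) + α + β + 3)]
    have := (integral_potKer_eigen (α := α + 1) (β := β + 1) (by linarith) (by linarith)
      (eigenvalue_zero_succ_pos hα hβ hc) h0 h1
      (fun x => (Polynomial.derivative (jPoly α β (k + 1))).hasDerivAt x)
      (fun x => Polynomial.hasDerivAt _ x) (Polynomial.continuous _) hη (fun x => by
        have := congrArg (Polynomial.eval x) (jOp_derivative_jPoly (α := α) (β := β) (k + 1))
        simp only [jOp, Polynomial.eval_mul, Polynomial.eval_add,
          Polynomial.eval_sub, Polynomial.eval_C, Polynomial.eval_X, Polynomial.eval_one] at this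
        rw [jacOp, this]) hθ).2
    have hsum : c + symEigenvalue α β n = c + eigenvalue (α + 1) (β + 1) 0 +
        (((k + 1 : ℕ) : ℝ) * ((k + 1 : ℕ) + (α + β + 1)) - (α + β + 2)) := by
      rw [symEigenvalue, hnn]
      simp only [eigenvalue]; push_cast; ring
    simp only [radial, if_neg hn, hnn]
    rw [hsum]
    set B := -(eigenvalue α β (k + 1) - eigenvalue α β 0) ^ (-(1 / 2) : ℝ)
    calc _ = ∫ φ in Ioo 0 Real.pi, ((Real.sqrt 2)⁻¹ * (B * normConst α β (k + 1))) *
          (potKer (α + 1) (β + 1) (c + eigenvalue (α + 1) (β + 1) 0) σ θ φ *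
            (psi (α + 1) (β + 1) φ *
              (Polynomial.derivative (jPoly α β (k + 1))).eval (hs φ))) := by
          congr 1; ext φ; rw [symKer]; ring
      _ = _ := by rw [integral_const_mul, this]; ring

theorem potOp_of_mem (c α β σ : ℝ) (f : ℝ → ℂ) {θ : ℝ} (hθ : θ ∈ Ioo 0 Real.pi) :
    potOp c α β σ f θ = (1 / 2) * (kerOp (symKer c α β σ) (fun φ => f φ + f (-φ)) θ +
      kerOp (symKer c (α + 1) (β + 1) σ) (fun φ => f φ - f (-φ)) θ) := by
  rw [potOp, abs_of_pos hθ.1, Real.sign_of_pos hθ.1]; simp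

theorem potOp_neg_of_mem (c α β σ : ℝ) (f : ℝ → ℂ) {θ : ℝ} (hθ : θ ∈ Ioo 0 Real.pi) :
    potOp c α β σ f (-θ) = (1 / 2) * (kerOp (symKer c α β σ) (fun φ => f φ + f (-φ)) θ -
      kerOp (symKer c (α + 1) (β + 1) σ) (fun φ => f φ - f (-φ)) θ) := by
  rw [potOp, abs_neg, abs_of_pos hθ.1, Real.sign_of_neg (neg_neg_of_pos hθ.1)]
  push_cast; ring

end
end SymmJacobi

namespace SymmJacobi
noncomputable section

/-! ### Mapping properties of the potential operators -/

theorem nu_le_mu : nu ≤ mu := by rw [mu_eq]; exact Measure.le_add_right le_rfl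

theorem eLpNorm_nu_le (F : ℝ → ℂ) (p : ℝ≥0∞) : eLpNorm F p nu ≤ eLpNorm F p mu :=
  eLpNorm_mono_measure _ nu_le_mu

theorem eLpNorm_nu_neg_le (F : ℝ → ℂ) (p : ℝ≥0∞) :
    eLpNorm (fun θ => F (-θ)) p nu ≤ eLpNorm F p mu := by
  have h : eLpNorm F p (nu.map (MeasurableEquiv.neg ℝ)) = eLpNorm (fun θ => F (-θ)) p nu :=
    (MeasurableEquiv.neg ℝ).measurableEmbedding.eLpNorm_map_measure
  rw [← h]
  refine eLpNorm_mono_measure _ ?_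
  rw [mu_eq]
  exact Measure.le_add_left le_rfl

theorem eLpNorm_mu_le {v : ℝ} (hv : 0 < v) (hv1 : v ≤ 1) (F : ℝ → ℂ) :
    eLpNorm F (expo v) mu ≤ eLpNorm F (expo v) nu + eLpNorm (fun θ => F (-θ)) (expo v) nu := by
  rw [eLpNorm_expo hv, eLpNorm_expo hv, eLpNorm_expo hv, lintegral_mu]
  have := ENNReal.rpow_add_le_add_rpow (∫⁻ θ, ‖F θ‖ₑ ^ (1 / v) ∂nu)
    (∫⁻ θ, ‖F (-θ)‖ₑ ^ (1 / v) ∂nu) hv.le hv1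
  exact this

variable {c α β σ a u v : ℝ}

theorem one_le_expo (hv : 0 < v) (hv1 : v ≤ 1) : 1 ≤ expo v := by
  rw [expo, ← ENNReal.ofReal_one]
  exact ENNReal.ofReal_le_ofReal ((one_le_div hv).mpr hv1)

theorem kerBound_symKer (hα : -1 < α) (hβ : -1 < β) (hκ : 0 < c + eigenvalue α β 0)
    (h1 : σ < 1) (ha0 : 0 ≤ a) (ha : -(2 * α + 1) ≤ 2 * a) (hb : -(2 * β + 1) ≤ 2 * a)
    (hav : a < v) (huv : v < u) (hua : u < 1 - a) (hδ : u - v ≤ 2 * σ) :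
    KerBound nu u v (fun θ φ => ENNReal.ofReal (symKer c α β σ θ φ)) := by
  have hv : 0 < v := ha0.trans_lt hav
  obtain ⟨C, hC, H⟩ := exists_potKer_le hα hβ hκ h1 ha0 ha hb (δ := u - v) (by linarith) hδ
    (by linarith)
  have hm : Measurable (Function.uncurry fun θ φ => ENNReal.ofReal (majKer a (u - v) θ φ)) :=
    (measurable_majKer a (u - v)).ennreal_ofReal
  refine KerBound.mono (fun x => restrict_singleton_eq_zero _ x) hv
    ((kerBound_majKer hv huv ha0 hav hua).const_mul hv hm (c := ENNReal.ofReal C)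
      ENNReal.ofReal_ne_top) ae_nu_mem fun θ hθ φ hφ hne => ?_
  rw [← ENNReal.ofReal_mul hC.le]
  exact ENNReal.ofReal_le_ofReal (H θ hθ φ hφ hne)

theorem memLp_even {f : ℝ → ℂ} {p : ℝ≥0∞} (hf : MemLp f p mu) :
    MemLp (fun θ => f θ + f (-θ)) p nu := (memLp_nu_of_mu hf).add (memLp_nu_neg_of_mu hf)

theorem memLp_odd {f : ℝ → ℂ} {p : ℝ≥0∞} (hf : MemLp f p mu) :
    MemLp (fun θ => f θ - f (-θ)) p nu := (memLp_nu_of_mu hf).sub (memLp_nu_neg_of_mu hf)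

theorem aestronglyMeasurable_potOp {f : ℝ → ℂ} (hf : AEStronglyMeasurable f mu) :
    AEStronglyMeasurable (potOp c α β σ f) mu := by
  have h := aestronglyMeasurable_mu_iff.mp hf
  have h1 := aestronglyMeasurable_kerOp (measurable_symKer c α β σ) (h.1.add h.2)
  have h2 := aestronglyMeasurable_kerOp (measurable_symKer c (α + 1) (β + 1) σ) (h.1.sub h.2)
  refine aestronglyMeasurable_mu_iff.mpr ⟨?_, ?_⟩
  · refine ((h1.add h2).const_mul (1 / 2)).congr ?_
    filter_upwards [ae_nu_mem] with θ hθ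
    rw [potOp_of_mem c α β σ f hθ]; rfl
  · refine ((h1.sub h2).const_mul (1 / 2)).congr ?_
    filter_upwards [ae_nu_mem] with θ hθ
    rw [potOp_neg_of_mem c α β σ f hθ]; rfl

theorem norm_half_mul_le (z : ℂ) : ‖(1 / 2 : ℂ) * z‖ ≤ ‖z‖ := by
  rw [norm_mul]
  have : ‖(1 / 2 : ℂ)‖ = 1 / 2 := by simp
  rw [this]
  linarith [norm_nonneg z]

theorem potOp_bound (hα : -1 < α) (hβ : -1 < β) (hc : 0 ≤ c) (hκ : 0 < c + eigenvalue α β 0)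
    (h0 : 0 < σ) (h1 : σ < 1) (ha0 : 0 ≤ a) (ha : -(2 * α + 1) ≤ 2 * a)
    (hb : -(2 * β + 1) ≤ 2 * a) (hav : a < v) (huv : v < u) (hua : u < 1 - a)
    (hδ : u - v ≤ 2 * σ) :
    ∃ C : ℝ≥0∞, C ≠ ∞ ∧ ∀ f : ℝ → ℂ, MemLp f (expo u) mu →
      eLpNorm (potOp c α β σ f) (expo v) mu ≤ C * eLpNorm f (expo u) mu ∧
      (eLpNorm (fun θ => (∫⁻ φ, ‖(symKer c α β σ θ φ : ℂ) * (f φ + f (-φ))‖ₑ ∂nu))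
        (expo v) nu < ∞) ∧
      (eLpNorm (fun θ => (∫⁻ φ, ‖(symKer c (α + 1) (β + 1) σ θ φ : ℂ) * (f φ - f (-φ))‖ₑ ∂nu))
        (expo v) nu < ∞) ∧
      (∀ᵐ θ ∂nu, Integrable (fun φ => (symKer c α β σ θ φ : ℂ) * (f φ + f (-φ))) nu) ∧
      ∀ᵐ θ ∂nu, Integrable (fun φ => (symKer c (α + 1) (β + 1) σ θ φ : ℂ) * (f φ - f (-φ))) nu := by
  have hv : 0 < v := ha0.trans_lt hav
  have hu : 0 < u := hv.trans huv
  have hκ' := eigenvalue_zero_succ_pos hα hβ hc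
  obtain ⟨C₁, hC₁, H₁⟩ := (kerBound_symKer hα hβ hκ h1 ha0 ha hb hav huv hua hδ).eLpNorm_le hu hv
    (symKer_nonneg hα hβ hκ h0 h1) (measurable_symKer _ _ _ _)
  -- The same `a` serves the raised parameters, whose weight is less singular.
  obtain ⟨C₂, hC₂, H₂⟩ := (kerBound_symKer (α := α + 1) (β := β + 1) (by linarith) (by linarith)
    hκ' h1 ha0 (by linarith) (by linarith) hav huv hua hδ).eLpNorm_le hu hv
    (symKer_nonneg (by linarith) (by linarith) hκ' h0 h1) (measurable_symKer _ _ _ _)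
  refine ⟨4 * (C₁ + C₂), ENNReal.mul_ne_top (by simp) (by simp [hC₁, hC₂]), fun f hf => ?_⟩
  have he := memLp_even hf
  have ho := memLp_odd hf
  obtain ⟨b1, b2, b3⟩ := H₁ _ he
  obtain ⟨d1, d2, d3⟩ := H₂ _ ho
  refine ⟨?_, b1.trans_lt (ENNReal.mul_lt_top hC₁.lt_top he.2),
    d1.trans_lt (ENNReal.mul_lt_top hC₂.lt_top ho.2), b3, d3⟩
  have hv1 : v ≤ 1 := by linarith
  set N := eLpNorm f (expo u) mu
  have n1 := eLpNorm_nu_le f (expo u)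
  have n2 := eLpNorm_nu_neg_le f (expo u)
  have m1 := (memLp_nu_of_mu hf).1
  have m2 := (memLp_nu_neg_of_mu hf).1
  have ne : eLpNorm (fun θ => f θ + f (-θ)) (expo u) nu ≤ 2 * N := by
    refine (eLpNorm_add_le m1 m2 (one_le_expo hu (by linarith))).trans ?_
    rw [two_mul]
    exact add_le_add n1 n2
  have no : eLpNorm (fun θ => f θ - f (-θ)) (expo u) nu ≤ 2 * N := by
    refine (eLpNorm_sub_le m1 m2 (one_le_expo hu (by linarith))).trans ?_
    rw [two_mul]
    exact add_le_add n1 n2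
  set A := kerOp (symKer c α β σ) (fun φ => f φ + f (-φ))
  set B := kerOp (symKer c (α + 1) (β + 1) σ) (fun φ => f φ - f (-φ))
  have mA : AEStronglyMeasurable A nu := aestronglyMeasurable_kerOp (measurable_symKer _ _ _ _) he.1
  have mB : AEStronglyMeasurable B nu := aestronglyMeasurable_kerOp (measurable_symKer _ _ _ _) ho.1
  have hAB : eLpNorm A (expo v) nu + eLpNorm B (expo v) nu ≤ 2 * (C₁ + C₂) * N := by
    calc _ ≤ C₁ * (2 * N) + C₂ * (2 * N) := by
          refine add_le_add (b2.trans ?_) (d2.trans ?_)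
          · exact mul_le_mul' le_rfl ne
          · exact mul_le_mul' le_rfl no
      _ = _ := by ring
  have q1 : eLpNorm (potOp c α β σ f) (expo v) nu ≤ 2 * (C₁ + C₂) * N := by
    refine le_trans ?_ ((eLpNorm_add_le mA mB (one_le_expo hv hv1)).trans hAB)
    refine eLpNorm_mono_ae ?_
    filter_upwards [ae_nu_mem] with θ hθ
    rw [potOp_of_mem c α β σ f hθ]
    exact norm_half_mul_le _
  have q2 : eLpNorm (fun θ => potOp c α β σ f (-θ)) (expo v) nu ≤ 2 * (C₁ + C₂) * N := by
    refine le_trans ?_ ((eLpNorm_sub_le mA mB (one_le_expo hv hv1)).trans hAB)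
    refine eLpNorm_mono_ae ?_
    filter_upwards [ae_nu_mem] with θ hθ
    rw [potOp_neg_of_mem c α β σ f hθ]
    exact norm_half_mul_le _
  calc _ ≤ 2 * (C₁ + C₂) * N + 2 * (C₁ + C₂) * N :=
        (eLpNorm_mu_le hv hv1 _).trans (add_le_add q1 q2)
    _ = _ := by ring

theorem potOp_congr {f g : ℝ → ℂ} (h : f =ᵐ[mu] g) : potOp c α β σ f = potOp c α β σ g := by
  have h' := ae_mu_iff.mp h
  ext θ
  rw [potOp, potOp, kerOp_congr (G := fun φ => g φ + g (-φ)), kerOp_congr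
    (K := symKer c (α + 1) (β + 1) σ) (G := fun φ => g φ - g (-φ))]
  · filter_upwards [h'] with φ hφ; rw [hφ.1, hφ.2]
  · filter_upwards [h'] with φ hφ; rw [hφ.1, hφ.2]

/-- The exponent bounding the order of the singularity of the weights at the end points. -/
def sing (α β : ℝ) : ℝ := max 0 (max (-(α + 1 / 2)) (-(β + 1 / 2)))

theorem sing_nonneg (α β : ℝ) : 0 ≤ sing α β := le_max_left _ _

theorem le_sing_left (α β : ℝ) : -(2 * α + 1) ≤ 2 * sing α β := by
  have : -(α + 1 / 2) ≤ sing α β := (le_max_left _ _).trans (le_max_right _ _)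
  linarith

theorem le_sing_right (α β : ℝ) : -(2 * β + 1) ≤ 2 * sing α β := by
  have : -(β + 1 / 2) ≤ sing α β := (le_max_right _ _).trans (le_max_right _ _)
  linarith

theorem sing_lt (hα : -1 < α) (hβ : -1 < β) : sing α β < 1 / 2 :=
  max_lt (by norm_num) (max_lt (by linarith) (by linarith))

theorem expo_half : expo (1 / 2) = 2 := by rw [expo]; norm_num

/-- The symbol `(c + t)^{-σ}`. -/
def potSymbol (c σ t : ℝ) : ℝ := (c + t) ^ (-σ)

/-- The kernel bound requires `v < u` strictly, so `L²` data are regarded as elements of `L^{1/u}`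
with `u` slightly above `1/2`, and the operator returns to `L²`. The coefficients then follow from
symmetry of the kernels and their action on the basis functions. -/
theorem isSpectralImage_potOp (hα : -1 < α) (hβ : -1 < β) (hc : 0 ≤ c)
    (hκ : 0 < c + eigenvalue α β 0) (h0 : 0 < σ) (h1 : σ < 1) {f : ℝ → ℂ} (hf : MemLp f 2 mu) :
    IsSpectralImage α β (potSymbol c σ) f (potOp c α β σ f) := by
  have hs := sing_lt hα hβ
  obtain ⟨u, hu, hu'⟩ : ∃ u, 1 / 2 < u ∧ u < min (1 - sing α β) (1 / 2 + 2 * σ) :=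
    exists_between (lt_min (by linarith) (by linarith))
  obtain ⟨C, hC, H⟩ := potOp_bound hα hβ hc hκ h0 h1 (sing_nonneg α β) (le_sing_left α β)
    (le_sing_right α β) hs hu (hu'.trans_le (min_le_left _ _))
    (by linarith [hu'.trans_le (min_le_right _ _)])
  have hfu : MemLp f (expo u) mu := hf.mono_exponent (by
    rw [← expo_half]
    exact ENNReal.ofReal_le_ofReal (one_div_le_one_div_of_le (by norm_num) hu.le))
  obtain ⟨b1, b2, b3, -, -⟩ := H f hfu
  rw [expo_half] at b1 b2 b3
  have hg : MemLp (potOp c α β σ f) 2 mu := ⟨aestronglyMeasurable_potOp hf.1,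
    b1.trans_lt (ENNReal.mul_lt_top hC.lt_top hfu.2)⟩
  refine isSpectralImage_of_coeff hα hβ hg fun n => ?_
  rw [coeff_eq hα hβ hg, coeff_eq hα hβ hf]
  have he := memLp_even hf
  have ho := memLp_odd hf
  have heig := integral_symKer_radial hα hβ hc hκ h0 h1 n
  have hcomm : ∀ α β θ φ, symKer c α β σ θ φ = symKer c α β σ φ θ := fun _ _ _ _ =>
    potKer_comm _ _ _ _ _ _
  by_cases hn : Even n
  · simp only [if_pos hn] at heig
    have := integral_kerOp_mul (measurable_symKer c α β σ) (hcomm α β) he.1 b2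
      (memLp_radial hα hβ n) heig
    simp only [hn.neg_one_pow, one_mul]
    rw [potSymbol, ← this]
    refine setIntegral_congr_fun measurableSet_Ioo fun θ hθ => ?_
    rw [potOp_of_mem _ _ _ _ _ hθ, potOp_neg_of_mem _ _ _ _ _ hθ]
    ring
  · simp only [if_neg hn] at heig
    have := integral_kerOp_mul (measurable_symKer c (α + 1) (β + 1) σ) (hcomm _ _) ho.1 b3
      (memLp_radial hα hβ n) heig
    simp only [(Nat.not_even_iff_odd.mp hn).neg_one_pow, neg_one_mul, ← sub_eq_add_neg]
    rw [potSymbol, ← this]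
    refine setIntegral_congr_fun measurableSet_Ioo fun θ hθ => ?_
    rw [potOp_of_mem _ _ _ _ _ hθ, potOp_neg_of_mem _ _ _ _ _ hθ]
    ring

theorem potOp_add {f g : ℝ → ℂ}
    (hf1 : ∀ᵐ θ ∂nu, Integrable (fun φ => (symKer c α β σ θ φ : ℂ) * (f φ + f (-φ))) nu)
    (hf2 : ∀ᵐ θ ∂nu, Integrable (fun φ => (symKer c (α + 1) (β + 1) σ θ φ : ℂ) *
      (f φ - f (-φ))) nu)
    (hg1 : ∀ᵐ θ ∂nu, Integrable (fun φ => (symKer c α β σ θ φ : ℂ) * (g φ + g (-φ))) nu)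
    (hg2 : ∀ᵐ θ ∂nu, Integrable (fun φ => (symKer c (α + 1) (β + 1) σ θ φ : ℂ) *
      (g φ - g (-φ))) nu) :
    potOp c α β σ (fun θ => f θ + g θ) =ᵐ[mu] fun θ => potOp c α β σ f θ + potOp c α β σ g θ := by
  refine ae_mu_iff.mpr ?_
  filter_upwards [hf1, hf2, hg1, hg2, ae_nu_mem] with θ i1 i2 j1 j2 hθ
  have e1 : kerOp (symKer c α β σ) (fun φ => f φ + g φ + (f (-φ) + g (-φ))) θ =
      kerOp (symKer c α β σ) (fun φ => f φ + f (-φ)) θ +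
      kerOp (symKer c α β σ) (fun φ => g φ + g (-φ)) θ := by
    rw [← kerOp_add i1 j1]; congr 1; ext φ; ring
  have e2 : kerOp (symKer c (α + 1) (β + 1) σ) (fun φ => f φ + g φ - (f (-φ) + g (-φ))) θ =
      kerOp (symKer c (α + 1) (β + 1) σ) (fun φ => f φ - f (-φ)) θ +
      kerOp (symKer c (α + 1) (β + 1) σ) (fun φ => g φ - g (-φ)) θ := by
    rw [← kerOp_add i2 j2]; congr 1; ext φ; ring
  constructor
  · rw [potOp_of_mem _ _ _ _ _ hθ, potOp_of_mem _ _ _ _ _ hθ, potOp_of_mem _ _ _ _ _ hθ, e1, e2]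
    ring
  · rw [potOp_neg_of_mem _ _ _ _ _ hθ, potOp_neg_of_mem _ _ _ _ _ hθ,
      potOp_neg_of_mem _ _ _ _ _ hθ, e1, e2]
    ring

theorem potOp_const_mul (b : ℂ) (f : ℝ → ℂ) :
    potOp c α β σ (fun θ => b * f θ) = fun θ => b * potOp c α β σ f θ := by
  ext θ
  simp only [potOp, ← mul_add, ← mul_sub, kerOp_const_mul]
  ring

end
end SymmJacobi

namespace SymmJacobi
noncomputable section

/-! ### Bounded extensions: general facts -/

variable {c α β σ a u v : ℝ} {m m₁ m₂ : ℝ → ℝ} {p q r : ℝ≥0∞}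

theorem isSpectralImage_congr {f f' g g' : ℝ → ℂ} (hα : -1 < α) (hβ : -1 < β)
    (hff' : f =ᵐ[mu] f') (hgg' : g =ᵐ[mu] g') (h : IsSpectralImage α β m f g) :
    IsSpectralImage α β m f' g' := by
  refine isSpectralImage_of_coeff hα hβ (h.1.ae_eq hgg') fun n => ?_
  rw [← coeff_congr hff', ← coeff_congr hgg']
  exact coeff_of_isSpectralImage hα hβ h n

theorem extendsBounded_of_op (hα : -1 < α) (hβ : -1 < β) {S : (ℝ → ℂ) → ℝ → ℂ} {C : ℝ≥0∞}
    (hC : C ≠ ∞)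
    (hm : ∀ f, AEStronglyMeasurable f mu → AEStronglyMeasurable (S f) mu)
    (hb : ∀ f, MemLp f p mu → eLpNorm (S f) q mu ≤ C * eLpNorm f p mu)
    (hadd : ∀ f g, MemLp f p mu → MemLp g p mu → S (fun θ => f θ + g θ) =ᵐ[mu] fun θ => S f θ + S g θ)
    (hsmul : ∀ (b : ℂ) f, S (fun θ => b * f θ) = fun θ => b * S f θ)
    (hcongr : ∀ f g, f =ᵐ[mu] g → S f = S g)
    (hspec : ∀ f, MemLp f 2 mu → IsSpectralImage α β m f (S f)) :
    ExtendsBounded α β m p q := by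
  have hmem : ∀ f, MemLp f p mu → MemLp (S f) q mu := fun f hf =>
    ⟨hm f hf.1, (hb f hf).trans_lt (ENNReal.mul_lt_top hC.lt_top hf.2)⟩
  let T : Lp ℂ p mu →ₗ[ℂ] Lp ℂ q mu :=
    { toFun := fun f => (hmem f (Lp.memLp f)).toLp
      map_add' := fun f g => by
        refine Lp.ext ?_
        have h1 : S (f + g : Lp ℂ p mu) = S (fun θ => f θ + g θ) := hcongr _ _ (Lp.coeFn_add f g)
        filter_upwards [(hmem _ (Lp.memLp (f + g))).coeFn_toLp, (hmem _ (Lp.memLp f)).coeFn_toLp,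
          (hmem _ (Lp.memLp g)).coeFn_toLp, hadd f g (Lp.memLp f) (Lp.memLp g),
          Lp.coeFn_add ((hmem f (Lp.memLp f)).toLp) ((hmem g (Lp.memLp g)).toLp)]
          with θ a1 a2 a3 a4 a5
        rw [a1, a5, Pi.add_apply, a2, a3, h1, a4]
      map_smul' := fun b f => by
        refine Lp.ext ?_
        have h1 : S (b • f : Lp ℂ p mu) = S (fun θ => b * f θ) := hcongr _ _ (Lp.coeFn_smul b f)
        filter_upwards [(hmem _ (Lp.memLp (b • f))).coeFn_toLp, (hmem _ (Lp.memLp f)).coeFn_toLp,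
          Lp.coeFn_smul b ((hmem f (Lp.memLp f)).toLp)] with θ a1 a2 a5
        rw [a1, RingHom.id_apply, a5, Pi.smul_apply, a2, h1, hsmul, smul_eq_mul] }
  have hT : ∀ f : Lp ℂ p mu, T f =ᵐ[mu] S f := fun f => (hmem f (Lp.memLp f)).coeFn_toLp
  refine ⟨T, ⟨C.toReal, fun f => ?_⟩, fun f hf => ?_⟩
  · rw [Lp.norm_def, Lp.norm_def, eLpNorm_congr_ae (hT f), ← ENNReal.toReal_mul]
    exact ENNReal.toReal_mono (ENNReal.mul_ne_top hC (Lp.eLpNorm_ne_top f)) (hb f (Lp.memLp f))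
  · exact isSpectralImage_congr hα hβ EventuallyEq.rfl (hT f).symm (hspec f hf)

theorem ExtendsBounded.congr (hα : -1 < α) (hβ : -1 < β)
    (h : ∀ n, m₁ (symEigenvalue α β n) = m₂ (symEigenvalue α β n))
    (h1 : ExtendsBounded α β m₁ p q) : ExtendsBounded α β m₂ p q := by
  obtain ⟨T, hb, hT⟩ := h1
  refine ⟨T, hb, fun f hf => isSpectralImage_of_coeff hα hβ (hT f hf).1 fun n => ?_⟩
  rw [coeff_of_isSpectralImage hα hβ (hT f hf) n, h]

theorem ExtendsBounded.comp (hα : -1 < α) (hβ : -1 < β) (h1 : ExtendsBounded α β m₁ r q)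
    (h2 : ExtendsBounded α β m₂ p r) : ExtendsBounded α β (fun t => m₁ t * m₂ t) p q := by
  obtain ⟨T₁, ⟨C₁, hb₁⟩, hT₁⟩ := h1
  obtain ⟨T₂, ⟨C₂, hb₂⟩, hT₂⟩ := h2
  refine ⟨T₁ ∘ₗ T₂, ⟨|C₁| * |C₂|, fun f => ?_⟩, fun f hf => ?_⟩
  · calc ‖T₁ (T₂ f)‖ ≤ C₁ * ‖T₂ f‖ := hb₁ _
      _ ≤ |C₁| * ‖T₂ f‖ := mul_le_mul_of_nonneg_right (le_abs_self _) ENNReal.toReal_nonneg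
      _ ≤ |C₁| * (|C₂| * ‖f‖) := mul_le_mul_of_nonneg_left ((hb₂ f).trans
          (mul_le_mul_of_nonneg_right (le_abs_self _) ENNReal.toReal_nonneg)) (abs_nonneg _)
      _ = _ := by ring
  · have a2 := hT₂ f hf
    have a1 := hT₁ (T₂ f) a2.1
    refine isSpectralImage_of_coeff hα hβ a1.1 fun n => ?_
    rw [LinearMap.comp_apply, coeff_of_isSpectralImage hα hβ a1, coeff_of_isSpectralImage hα hβ a2]
    push_cast; ring

/-- The inclusion of `L^q` in `L^p` for `p ≤ q`. -/
theorem exists_inclusion (hpq : p ≤ q) :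
    ∃ J : Lp ℂ q mu →ₗ[ℂ] Lp ℂ p mu, (∃ C : ℝ, 0 ≤ C ∧ ∀ f, ‖J f‖ ≤ C * ‖f‖) ∧
      ∀ f, J f =ᵐ[mu] f := by
  have hmem : ∀ f : Lp ℂ q mu, MemLp f p mu := fun f => (Lp.memLp f).mono_exponent hpq
  let J : Lp ℂ q mu →ₗ[ℂ] Lp ℂ p mu :=
    { toFun := fun f => (hmem f).toLp
      map_add' := fun f g => by
        refine Lp.ext ?_
        filter_upwards [(hmem (f + g)).coeFn_toLp, (hmem f).coeFn_toLp, (hmem g).coeFn_toLp,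
          Lp.coeFn_add f g, Lp.coeFn_add ((hmem f).toLp) ((hmem g).toLp)] with θ a1 a2 a3 a4 a5
        rw [a1, a5, Pi.add_apply, a2, a3, a4, Pi.add_apply]
      map_smul' := fun b f => by
        refine Lp.ext ?_
        filter_upwards [(hmem (b • f)).coeFn_toLp, (hmem f).coeFn_toLp,
          Lp.coeFn_smul b f, Lp.coeFn_smul b ((hmem f).toLp)] with θ a1 a2 a4 a5
        rw [a1, RingHom.id_apply, a5, Pi.smul_apply, a2, a4, Pi.smul_apply] }
  have hJ : ∀ f, J f =ᵐ[mu] f := fun f => (hmem f).coeFn_toLp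
  rcases eq_or_ne p 0 with rfl | hp0
  · refine ⟨J, ⟨0, le_rfl, fun f => ?_⟩, hJ⟩
    rw [Lp.norm_def, eLpNorm_exponent_zero]; simp
  set K : ℝ≥0∞ := mu univ ^ (1 / p.toReal - 1 / q.toReal) with hK
  have hμ0 : mu univ ≠ 0 := by
    rw [mu, Measure.restrict_apply_univ, Real.volume_Ioo]
    simp [Real.pi_pos]
  have hKt : K ≠ ∞ := ENNReal.rpow_ne_top_of_ne_zero hμ0 (measure_ne_top mu _)
  refine ⟨J, ⟨K.toReal, ENNReal.toReal_nonneg, fun f => ?_⟩, hJ⟩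
  rw [Lp.norm_def, Lp.norm_def, eLpNorm_congr_ae (hJ f), ← ENNReal.toReal_mul, mul_comm K]
  exact ENNReal.toReal_mono (ENNReal.mul_ne_top (Lp.eLpNorm_ne_top f) hKt)
    (eLpNorm_le_eLpNorm_mul_rpow_measure_univ hpq (Lp.memLp f).1)

/-- On the finite measure `mu` the extension is composed with bounded inclusions on both sides. -/
theorem ExtendsBounded.mono (hα : -1 < α) (hβ : -1 < β) {p' q' : ℝ≥0∞}
    (h : ExtendsBounded α β m p q) (hp : p ≤ p') (hq : q' ≤ q) : ExtendsBounded α β m p' q' := by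
  obtain ⟨T, ⟨C, hb⟩, hT⟩ := h
  obtain ⟨J, ⟨A, hA, hJb⟩, hJ⟩ := exists_inclusion hp
  obtain ⟨I, ⟨B, hB, hIb⟩, hI⟩ := exists_inclusion hq
  refine ⟨I ∘ₗ T ∘ₗ J, ⟨B * (|C| * A), fun f => ?_⟩, fun f hf => ?_⟩
  · calc ‖I (T (J f))‖ ≤ B * ‖T (J f)‖ := hIb _
      _ ≤ B * (|C| * (A * ‖f‖)) := by
        refine mul_le_mul_of_nonneg_left ?_ hB
        refine (hb _).trans ((mul_le_mul_of_nonneg_right (le_abs_self _)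
          ENNReal.toReal_nonneg).trans ?_)
        exact mul_le_mul_of_nonneg_left (hJb f) (abs_nonneg _)
      _ = _ := by ring
  · exact isSpectralImage_congr hα hβ (hJ f) (hI (T (J f))).symm (hT (J f) (hf.ae_eq (hJ f).symm))

/-! ### Sufficiency -/

theorem add_symEigenvalue_pos (hα : -1 < α) (hβ : -1 < β) (hκ : 0 < c + eigenvalue α β 0) (n : ℕ) :
    0 < c + symEigenvalue α β n := by
  rw [symEigenvalue]
  rcases Nat.eq_zero_or_pos ((n + 1) / 2) with h | h
  · rwa [h]
  · linarith [eigenvalue_sub_pos hα hβ h.ne']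

theorem ExtendsBounded.potSymbol_comp (hα : -1 < α) (hβ : -1 < β)
    (hκ : 0 < c + eigenvalue α β 0) {σ₁ σ₂ : ℝ} (h1 : ExtendsBounded α β (potSymbol c σ₁) r q)
    (h2 : ExtendsBounded α β (potSymbol c σ₂) p r) :
    ExtendsBounded α β (potSymbol c (σ₁ + σ₂)) p q := by
  refine (h1.comp hα hβ h2).congr hα hβ fun n => ?_
  rw [potSymbol, potSymbol, potSymbol, ← Real.rpow_add (add_symEigenvalue_pos hα hβ hκ n)]
  congr 1; ring

theorem extendsBounded_potSymbol_lt_one (hα : -1 < α) (hβ : -1 < β) (hc : 0 ≤ c)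
    (hκ : 0 < c + eigenvalue α β 0) (h0 : 0 < σ) (h1 : σ < 1) (hav : sing α β < v) (huv : v < u)
    (hua : u < 1 - sing α β) (hδ : u - v ≤ 2 * σ) :
    ExtendsBounded α β (potSymbol c σ) (expo u) (expo v) := by
  obtain ⟨C, hC, H⟩ := potOp_bound hα hβ hc hκ h0 h1 (sing_nonneg α β) (le_sing_left α β)
    (le_sing_right α β) hav huv hua hδ
  exact extendsBounded_of_op hα hβ (S := potOp c α β σ) hC (fun f hf => aestronglyMeasurable_potOp hf)
    (fun f hf => (H f hf).1)
    (fun f g hf hg => potOp_add (H f hf).2.2.2.1 (H f hf).2.2.2.2 (H g hg).2.2.2.1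
      (H g hg).2.2.2.2)
    (fun b f => potOp_const_mul b f) (fun f g h => potOp_congr h)
    (fun f hf => isSpectralImage_potOp hα hβ hc hκ h0 h1 hf)

theorem extendsBounded_potSymbol_nsmul (hα : -1 < α) (hβ : -1 < β) (hc : 0 ≤ c)
    (hκ : 0 < c + eigenvalue α β 0) (h0 : 0 < σ) (h1 : σ < 1) (k : ℕ) :
    ∀ u v : ℝ, sing α β < v → v < u → u < 1 - sing α β → u - v ≤ 2 * ((k + 1) * σ) →
      ExtendsBounded α β (potSymbol c ((k + 1) * σ)) (expo u) (expo v) := by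
  induction k with
  | zero =>
    intro u v hav huv hua hδ
    rw [Nat.cast_zero, zero_add, one_mul] at hδ ⊢
    exact extendsBounded_potSymbol_lt_one hα hβ hc hκ h0 h1 hav huv hua hδ
  | succ k ih =>
    intro u v hav huv hua hδ
    push_cast at hδ ⊢
    -- Equal steps: each application of the potential of order `σ` accounts for `(u-v)/(k+2) ≤ 2σ`,
    -- and the intermediate exponents stay between `v` and `u`.
    set w : ℝ := u - (u - v) / (k + 2) with hw
    have hk : (0 : ℝ) < k + 2 := by positivity
    have e1 : (u - v) / (k + 2) ≤ 2 * σ := by rw [div_le_iff₀ hk]; linarith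
    have e2 : 0 < (u - v) / (k + 2) := div_pos (by linarith) hk
    have e3 : w - v = (u - v) / (k + 2) * (k + 1) := by rw [hw]; field_simp; ring
    have e4 : 0 < w - v := by rw [e3]; positivity
    have A := ih w v hav (by linarith) (by linarith) (by
      rw [e3]
      calc _ ≤ 2 * σ * (k + 1) := by gcongr
        _ = _ := by ring)
    have B := extendsBounded_potSymbol_lt_one hα hβ hc hκ h0 h1 (u := u) (v := w) (by linarith)
      (by linarith) hua (by linarith)
    have := A.potSymbol_comp hα hβ hκ B
    rwa [show (k + 1) * σ + σ = (k + 1 + 1) * σ by ring] at this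

theorem extendsBounded_potSymbol_of_lt (hα : -1 < α) (hβ : -1 < β) (hc : 0 ≤ c)
    (hκ : 0 < c + eigenvalue α β 0) (h0 : 0 < σ) (hav : sing α β < v) (huv : v < u)
    (hua : u < 1 - sing α β) (hδ : u - v ≤ 2 * σ) :
    ExtendsBounded α β (potSymbol c σ) (expo u) (expo v) := by
  -- With `k > σ` the order `σ/(k+1)` is below `1`, where the kernel is available.
  obtain ⟨k, hk⟩ := exists_nat_gt σ
  have hk0 : (0 : ℝ) < k + 1 := by positivity
  have e : (k + 1) * (σ / (k + 1)) = σ := mul_div_cancel₀ _ hk0.ne'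
  have := extendsBounded_potSymbol_nsmul hα hβ hc hκ (σ := σ / (k + 1)) (by positivity)
    (by rw [div_lt_one hk0]; linarith) k u v hav huv hua (by rw [e]; exact hδ)
  rwa [e] at this

theorem expo_le_iff_inv {p : ℝ≥0∞} (hp0 : p ≠ 0) (hu : 0 < u) :
    expo u ≤ p ↔ (p⁻¹).toReal ≤ u := by
  rw [expo, one_div, ENNReal.ofReal_inv_of_pos hu, ENNReal.inv_le_iff_inv_le,
    ENNReal.le_ofReal_iff_toReal_le (ENNReal.inv_ne_top.mpr hp0) hu.le]

theorem le_expo_iff_inv {q : ℝ≥0∞} (hq0 : q ≠ 0) (hv : 0 < v) :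
    q ≤ expo v ↔ v ≤ (q⁻¹).toReal := by
  rw [expo, one_div, ENNReal.ofReal_inv_of_pos hv, ENNReal.le_inv_iff_le_inv,
    ENNReal.ofReal_le_iff_le_toReal (ENNReal.inv_ne_top.mpr hq0)]

theorem extendsBounded_potSymbol (hα : -1 < α) (hβ : -1 < β) (hc : 0 ≤ c)
    (hκ : 0 < c + eigenvalue α β 0) (h0 : 0 < σ) (hp0 : p ≠ 0) (hq0 : q ≠ 0)
    (hp : (p⁻¹).toReal < 1 - sing α β) (hq : sing α β < (q⁻¹).toReal)
    (h : (p⁻¹).toReal - 2 * σ ≤ (q⁻¹).toReal) :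
    ExtendsBounded α β (potSymbol c σ) p q := by
  have ha := sing_lt hα hβ
  have ha0 := sing_nonneg α β
  -- The pair `(1/p, 1/q)` is used itself if `1/q < 1/p`. Otherwise a slightly stronger admissible
  -- pair `v < u` with `u - v ≤ 2σ` is found, and the inclusions do the rest.
  obtain ⟨u, v, h1, h2, h3, h4, h5, h6⟩ : ∃ u v : ℝ, sing α β < v ∧ v < u ∧ u < 1 - sing α β ∧
      u - v ≤ 2 * σ ∧ (p⁻¹).toReal ≤ u ∧ v ≤ (q⁻¹).toReal := by
    set a := sing α β
    set x := (p⁻¹).toReal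
    set y := (q⁻¹).toReal
    rcases lt_or_ge y x with hyx | hyx
    · exact ⟨x, y, hq, hyx, hp, by linarith, le_rfl, le_rfl⟩
    · have hm : max x a < 1 - a := max_lt hp (by linarith)
      rcases lt_or_ge y (1 - a) with hy | hy
      · obtain ⟨u, hu1, hu2⟩ := exists_between (lt_min hy (by linarith : y < y + 2 * σ))
        have := hu2.trans_le (min_le_left _ _)
        have := hu2.trans_le (min_le_right _ _)
        exact ⟨u, y, hq, hu1, by linarith, by linarith, by linarith, le_rfl⟩
      · obtain ⟨u, hu1, hu2⟩ := exists_between hm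
        have hu3 := (le_max_left x a).trans_lt hu1
        have hu4 := (le_max_right x a).trans_lt hu1
        obtain ⟨v, hv1, hv2⟩ := exists_between (max_lt hu4 (by linarith : u - 2 * σ < u))
        have := (le_max_left a (u - 2 * σ)).trans_lt hv1
        have := (le_max_right a (u - 2 * σ)).trans_lt hv1
        exact ⟨u, v, by linarith, hv2, hu2, by linarith, hu3.le, by linarith⟩
  exact (extendsBounded_potSymbol_of_lt hα hβ hc hκ h0 h1 h2 h3 h4).mono hα hβ
    ((expo_le_iff_inv hp0 (by linarith)).mpr h5) ((le_expo_iff_inv hq0 (by linarith)).mpr h6)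

end
end SymmJacobi

namespace SymmJacobi
noncomputable section

/-! ### Sufficiency at `L^∞` -/

variable {c α β σ a u v : ℝ} {p q r : ℝ≥0∞}

theorem exists_enorm_kerOp_le {K : ℝ → ℝ → ℝ} {C δ : ℝ} (hC : 0 ≤ C) (hu : 0 < u) (huδ : u < δ)
    (hδ : δ < 1)
    (hK0 : ∀ θ ∈ Ioo 0 Real.pi, ∀ φ ∈ Ioo 0 Real.pi, 0 ≤ K θ φ)
    (hK : ∀ θ ∈ Ioo 0 Real.pi, ∀ φ ∈ Ioo 0 Real.pi, θ ≠ φ → K θ φ ≤ C * majKer 0 δ θ φ) :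
    ∃ C' : ℝ≥0∞, C' ≠ ∞ ∧ ∀ F : ℝ → ℂ, MemLp F (expo u) nu → ∀ θ ∈ Ioo 0 Real.pi,
      ‖kerOp K F θ‖ₑ ≤ C' * eLpNorm F (expo u) nu := by
  obtain ⟨C₀, hC₀, H⟩ := exists_lintegral_majKer_zero_le hu huδ hδ
  refine ⟨ENNReal.ofReal C * C₀, ENNReal.mul_ne_top ENNReal.ofReal_ne_top hC₀,
    fun F hF θ hθ => ?_⟩
  have hm := hF.1.enorm
  have hne : ∀ᵐ φ ∂nu, φ ≠ θ := by
    rw [ae_iff]; simp only [ne_eq, not_not]; exact restrict_singleton_eq_zero _ θ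
  have e1 : eLpNorm F (expo u) nu = (∫⁻ φ, hm.mk _ φ ^ (1 / u) ∂nu) ^ u := by
    rw [eLpNorm_expo hu]
    congr 1
    refine lintegral_congr_ae ?_
    filter_upwards [hm.ae_eq_mk] with φ hφ
    rw [hφ]
  calc ‖kerOp K F θ‖ₑ ≤ ∫⁻ φ, ‖(K θ φ : ℂ) * F φ‖ₑ ∂nu := enorm_kerOp_le θ
    _ ≤ ∫⁻ φ, ENNReal.ofReal C * (ENNReal.ofReal (majKer 0 δ θ φ) * hm.mk _ φ) ∂nu := by
        refine lintegral_mono_ae ?_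
        filter_upwards [hm.ae_eq_mk, ae_nu_mem, hne] with φ hφ hφI hφθ
        rw [enorm_mul, hφ, ← ofReal_norm, Complex.norm_real,
          Real.norm_of_nonneg (hK0 θ hθ φ hφI), ← mul_assoc, ← ENNReal.ofReal_mul hC]
        exact mul_le_mul' (ENNReal.ofReal_le_ofReal (hK θ hθ φ hφI hφθ.symm)) le_rfl
    _ = ENNReal.ofReal C * ∫⁻ φ, ENNReal.ofReal (majKer 0 δ θ φ) * hm.mk _ φ ∂nu :=
        lintegral_const_mul' _ _ ENNReal.ofReal_ne_top
    _ ≤ ENNReal.ofReal C * (C₀ * (∫⁻ φ, hm.mk _ φ ^ (1 / u) ∂nu) ^ u) :=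
        mul_le_mul' le_rfl (H _ hm.measurable_mk θ hθ)
    _ = _ := by rw [e1, mul_assoc]

theorem extendsBounded_potSymbol_top_small (hα : -1 < α) (hβ : -1 < β) (hc : 0 ≤ c)
    (hκ : 0 < c + eigenvalue α β 0) (hs : sing α β = 0) (hu : 0 < u) (huσ : u < 2 * σ)
    (hσ : 2 * σ < 1) : ExtendsBounded α β (potSymbol c σ) (expo u) ∞ := by
  have h0 : 0 < σ := by linarith
  have h1 : σ < 1 := by linarith
  have hκ' := eigenvalue_zero_succ_pos hα hβ hc
  have ha := le_sing_left α β
  have hb := le_sing_right α β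
  rw [hs] at ha hb
  -- The value `v = u/2` is of no importance: this bound only supplies the integrability behind
  -- additivity.
  obtain ⟨_, _, H⟩ := potOp_bound (v := u / 2) hα hβ hc hκ h0 h1 le_rfl ha hb (by linarith)
    (by linarith) (by linarith : u < 1 - 0) (by linarith)
  obtain ⟨A, hA, HA⟩ := exists_potKer_le hα hβ hκ h1 le_rfl ha hb (δ := 2 * σ) (by linarith) le_rfl
    (by linarith)
  obtain ⟨B, hB, HB⟩ := exists_potKer_le (α := α + 1) (β := β + 1) (by linarith) (by linarith) hκ' h1
    le_rfl (by linarith) (by linarith) (δ := 2 * σ) (by linarith) le_rfl (by linarith)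
  obtain ⟨A', hA', HA'⟩ := exists_enorm_kerOp_le hA.le hu huσ hσ (symKer_nonneg hα hβ hκ h0 h1) HA
  obtain ⟨B', hB', HB'⟩ := exists_enorm_kerOp_le hB.le hu huσ hσ
    (symKer_nonneg (by linarith) (by linarith) hκ' h0 h1) HB
  refine extendsBounded_of_op hα hβ (S := potOp c α β σ) (C := 2 * (A' + B'))
    (ENNReal.mul_ne_top (by simp) (by simp [hA', hB'])) (fun f hf => aestronglyMeasurable_potOp hf)
    (fun f hf => ?_)
    (fun f g hf hg => potOp_add (H f hf).2.2.2.1 (H f hf).2.2.2.2 (H g hg).2.2.2.1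
      (H g hg).2.2.2.2)
    (fun b f => potOp_const_mul b f) (fun f g h => potOp_congr h)
    (fun f hf => isSpectralImage_potOp hα hβ hc hκ h0 h1 hf)
  set N := eLpNorm f (expo u) mu
  have n1 := eLpNorm_nu_le f (expo u)
  have n2 := eLpNorm_nu_neg_le f (expo u)
  have m1 := (memLp_nu_of_mu hf).1
  have m2 := (memLp_nu_neg_of_mu hf).1
  have ne : eLpNorm (fun θ => f θ + f (-θ)) (expo u) nu ≤ 2 * N := by
    refine (eLpNorm_add_le m1 m2 (one_le_expo hu (by linarith))).trans ?_
    rw [two_mul]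
    exact add_le_add n1 n2
  have no : eLpNorm (fun θ => f θ - f (-θ)) (expo u) nu ≤ 2 * N := by
    refine (eLpNorm_sub_le m1 m2 (one_le_expo hu (by linarith))).trans ?_
    rw [two_mul]
    exact add_le_add n1 n2
  have hhalf : ∀ z : ℂ, ‖(1 / 2 : ℂ) * z‖ₑ ≤ ‖z‖ₑ := fun z =>
    enorm_le_iff_norm_le.mpr (norm_half_mul_le z)
  rw [eLpNorm_exponent_top]
  refine essSup_le_of_ae_le _ (ae_mu_iff.mpr ?_)
  filter_upwards [ae_nu_mem] with θ hθ
  have a1 := (HA' _ (memLp_even hf) θ hθ).trans (mul_le_mul' le_rfl ne)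
  have a2 := (HB' _ (memLp_odd hf) θ hθ).trans (mul_le_mul' le_rfl no)
  have e : A' * (2 * N) + B' * (2 * N) = 2 * (A' + B') * N := by ring
  constructor
  · rw [potOp_of_mem c α β σ f hθ, ← e]
    exact (hhalf _).trans ((enorm_add_le _ _).trans (add_le_add a1 a2))
  · rw [potOp_neg_of_mem c α β σ f hθ, ← e]
    exact (hhalf _).trans (enorm_sub_le.trans (add_le_add a1 a2))

theorem toReal_inv_expo (hu : 0 < u) : ((expo u)⁻¹).toReal = u := by
  rw [expo, one_div, ENNReal.ofReal_inv_of_pos hu, inv_inv, ENNReal.toReal_ofReal hu.le]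

theorem extendsBounded_potSymbol_top (hα : -1 < α) (hβ : -1 < β) (hc : 0 ≤ c)
    (hκ : 0 < c + eigenvalue α β 0) (hs : sing α β = 0) (h0 : 0 < σ) (hp0 : p ≠ 0)
    (hp : (p⁻¹).toReal < 1) (h : (p⁻¹).toReal < 2 * σ) :
    ExtendsBounded α β (potSymbol c σ) p ∞ := by
  set x := (p⁻¹).toReal with hx
  obtain ⟨τ, hτ0, hτ⟩ : ∃ τ, 0 < τ ∧ τ < min σ (1 / 2) :=
    exists_between (lt_min h0 (by norm_num))
  have hτ1 := hτ.trans_le (min_le_left _ _)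
  have hτ2 := hτ.trans_le (min_le_right _ _)
  -- Factorization through `L^{1/w}`: the order `σ - τ` maps `L^p` to `L^{1/w}`, and the order `τ <
  -- 1/2` maps `L^{1/w}` to `L^∞`. Such a `w` exists because `1/p < 2σ`.
  obtain ⟨w, hw0, hw⟩ : ∃ w, max 0 (x - 2 * (σ - τ)) < w ∧ w < 2 * τ :=
    exists_between (max_lt (by linarith) (by linarith))
  have hw1 := (le_max_left _ _).trans_lt hw0
  have hw2 := (le_max_right _ _).trans_lt hw0
  have A := extendsBounded_potSymbol_top_small hα hβ hc hκ hs hw1 hw (by linarith)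
  have hexp : expo w ≠ 0 := by
    rw [expo]; exact (ENNReal.ofReal_pos.mpr (by positivity)).ne'
  have B := extendsBounded_potSymbol hα hβ hc hκ (σ := σ - τ) (by linarith) hp0 hexp
    (by rw [hs, sub_zero]; exact hp) (by rw [hs, toReal_inv_expo hw1]; exact hw1)
    (by rw [toReal_inv_expo hw1]; exact hw2.le)
  have := A.potSymbol_comp hα hβ hκ B
  rwa [add_sub_cancel] at this

/-! ### The critical exponent -/

/-- The inverse in `ℝ≥0∞` sends `0` to `∞`, so both cases of the definition are covered by one
formula. -/
theorem critExp_eq (α β : ℝ) : critExp α β = (ENNReal.ofReal (sing α β))⁻¹ := by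
  rw [critExp]
  split_ifs with h
  · have : sing α β = 0 := by
      rw [sing, max_eq_left]
      exact max_le (by linarith [h.1]) (by linarith [h.2])
    rw [this]; simp
  · have hmin : min (α + 1 / 2) (β + 1 / 2) < 0 := by
      by_contra hcon
      rw [not_lt, le_min_iff] at hcon
      exact h ⟨by linarith [hcon.1], by linarith [hcon.2]⟩
    have : sing α β = -min (α + 1 / 2) (β + 1 / 2) := by
      rw [sing, max_neg_neg, max_eq_right (by linarith)]
    rw [this, ← ENNReal.ofReal_inv_of_pos (by linarith)]
    congr 1
    rw [inv_neg, neg_div, one_div]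

theorem sing_eq_zero_iff : sing α β = 0 ↔ -(1 / 2) ≤ α ∧ -(1 / 2) ≤ β := by
  constructor
  · intro h
    have h1 := le_sing_left α β
    have h2 := le_sing_right α β
    rw [h] at h1 h2
    exact ⟨by linarith, by linarith⟩
  · rintro ⟨h1, h2⟩
    rw [sing, max_eq_left]
    exact max_le (by linarith) (by linarith)

theorem sing_lt_of_lt_critExp (hq0 : q ≠ 0) (hq : q < critExp α β) :
    sing α β < (q⁻¹).toReal := by
  rw [critExp_eq, ENNReal.lt_inv_iff_lt_inv] at hq
  exact (ENNReal.ofReal_lt_iff_lt_toReal (sing_nonneg α β) (ENNReal.inv_ne_top.mpr hq0)).mp hq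

theorem lt_one_sub_sing (hα : -1 < α) (hβ : -1 < β) (hp : (critExp α β).conjExponent < p) :
    p ≠ 0 ∧ (p⁻¹).toReal < 1 - sing α β := by
  have hs := sing_lt hα hβ
  have h1 : 1 ≤ critExp α β := by
    rw [critExp_eq, ENNReal.one_le_inv]
    rw [← ENNReal.ofReal_one]
    exact ENNReal.ofReal_le_ofReal (by linarith)
  have hconj := ENNReal.HolderConjugate.conjExponent h1
  have h2 : (critExp α β)⁻¹ + (critExp α β).conjExponent⁻¹ = 1 := hconj.inv_add_inv_eq_one
  have hp0 : p ≠ 0 := (bot_le.trans_lt hp).ne'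
  refine ⟨hp0, ?_⟩
  have h3 : p⁻¹ < (critExp α β).conjExponent⁻¹ := ENNReal.inv_lt_inv.mpr hp
  have h4 : (critExp α β).conjExponent⁻¹ = ENNReal.ofReal (1 - sing α β) := by
    rw [critExp_eq, inv_inv] at h2
    rw [ENNReal.ofReal_sub _ (sing_nonneg α β), ENNReal.ofReal_one, ← h2, critExp_eq,
      ENNReal.add_sub_cancel_left ENNReal.ofReal_ne_top]
  rw [h4] at h3
  exact (ENNReal.lt_ofReal_iff_toReal_lt (ENNReal.inv_ne_top.mpr hp0)).mp h3

end
end SymmJacobi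

namespace SymmJacobi
noncomputable section

/-! ### Necessity -/

variable {c α β σ a u v : ℝ} {m : ℝ → ℝ} {p q r : ℝ≥0∞}

/-- By uniqueness of coefficients the extension agrees with any explicit spectral image. Passing to
the even part leaves only the kernel with parameters `(α, β)` on `(0,π)`. -/
theorem ExtendsBounded.exists_eLpNorm_even_le (hα : -1 < α) (hβ : -1 < β) (hq : 1 ≤ q)
    (h : ExtendsBounded α β m p q) :
    ∃ C : ℝ≥0∞, C ≠ ∞ ∧ ∀ f g : ℝ → ℂ, MemLp f 2 mu → MemLp f p mu → IsSpectralImage α β m f g →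
      eLpNorm (fun θ => g θ + g (-θ)) q nu ≤ C * eLpNorm f p mu := by
  obtain ⟨T, ⟨K, hK⟩, hT⟩ := h
  refine ⟨2 * ENNReal.ofReal K, ENNReal.mul_ne_top (by simp) ENNReal.ofReal_ne_top,
    fun f g hf2 hf hg => ?_⟩
  have hff := hf.coeFn_toLp
  have hS := isSpectralImage_congr hα hβ hff EventuallyEq.rfl
    (hT (hf.toLp f) (hf2.ae_eq hff.symm))
  have hTg : T (hf.toLp f) =ᵐ[mu] g := ae_eq_of_coeff_eq hα hβ hS.1 hg.1 fun n => by
    rw [coeff_of_isSpectralImage hα hβ hS, coeff_of_isSpectralImage hα hβ hg]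
  have hgq : MemLp g q mu := (Lp.memLp _).ae_eq hTg
  have hb : eLpNorm g q mu ≤ ENNReal.ofReal K * eLpNorm f p mu := by
    have := ENNReal.ofReal_le_ofReal (hK (hf.toLp f))
    rw [Lp.norm_def, Lp.norm_def, ENNReal.ofReal_mul' ENNReal.toReal_nonneg,
      ENNReal.ofReal_toReal (Lp.eLpNorm_ne_top _), ENNReal.ofReal_toReal (Lp.eLpNorm_ne_top _),
      eLpNorm_congr_ae hTg, eLpNorm_congr_ae hff] at this
    exact this
  calc _ ≤ eLpNorm g q nu + eLpNorm (fun θ => g (-θ)) q nu :=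
        eLpNorm_add_le (memLp_nu_of_mu hgq).1 (memLp_nu_neg_of_mu hgq).1 hq
    _ ≤ eLpNorm g q mu + eLpNorm g q mu := add_le_add (eLpNorm_nu_le _ _) (eLpNorm_nu_neg_le _ _)
    _ ≤ _ := by rw [← two_mul, mul_assoc]; exact mul_le_mul' le_rfl hb

theorem potOp_add_neg (f : ℝ → ℂ) {θ : ℝ} (hθ : θ ∈ Ioo 0 Real.pi) :
    potOp c α β σ f θ + potOp c α β σ f (-θ) =
      kerOp (symKer c α β σ) (fun φ => f φ + f (-φ)) θ := by
  rw [potOp_of_mem _ _ _ _ _ hθ, potOp_neg_of_mem _ _ _ _ _ hθ]; ring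

theorem kerOp_ofReal {K : ℝ → ℝ → ℝ} (s : ℝ → ℝ) (θ : ℝ) :
    kerOp K (fun φ => (s φ : ℂ)) θ = ((∫ φ, K θ φ * s φ ∂nu : ℝ) : ℂ) := by
  rw [kerOp, ← integral_complex_ofReal]
  congr 1; ext φ; push_cast; rfl

theorem half_le_of_quarter_le_sq {x : ℝ} (hx : 0 < x) (h : 1 / 4 ≤ x ^ 2) : 1 / 2 ≤ x := by
  nlinarith

theorem rpow_mem_of_half_le {x : ℝ} (h : 1 / 2 ≤ x) (h1 : x ≤ 1) (e : ℝ) :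
    (2 : ℝ) ^ (-|e|) ≤ x ^ e ∧ x ^ e ≤ 2 ^ |e| := by
  have hx : 0 < x := by linarith
  have h2 : (2 : ℝ) ^ (-|e|) = (1 / 2 : ℝ) ^ |e| := by
    rw [Real.rpow_neg (by norm_num), one_div, Real.inv_rpow (by norm_num)]
  have h3 : (2 : ℝ) ^ |e| = (1 / 2 : ℝ) ^ (-|e|) := by
    rw [one_div, Real.inv_rpow (by norm_num), Real.rpow_neg (by norm_num), inv_inv]
  constructor
  · rw [h2]
    exact (Real.rpow_le_rpow (by norm_num) h (abs_nonneg e)).trans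
      (Real.rpow_le_rpow_of_exponent_ge hx h1 (le_abs_self e))
  · rw [h3]
    exact (Real.rpow_le_rpow_of_exponent_ge hx h1 (neg_abs_le e)).trans
      (Real.rpow_le_rpow_of_nonpos (by norm_num) h (neg_nonpos.mpr (abs_nonneg e)))

theorem exists_psi_mem_of_mid (α β : ℝ) : ∃ A B : ℝ, 0 < A ∧ 0 < B ∧ ∀ θ ∈ Ioo 0 Real.pi,
    |hs θ - 1 / 2| ≤ 1 / 4 → A ≤ psi α β θ ∧ psi α β θ ≤ B := by
  refine ⟨(2 : ℝ) ^ (-|α + 1 / 2|) * 2 ^ (-|β + 1 / 2|), (2 : ℝ) ^ |α + 1 / 2| * 2 ^ |β + 1 / 2|,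
    by positivity, by positivity, fun θ hθ h => ?_⟩
  rw [abs_le] at h
  have e : hs θ = Real.sin (θ / 2) ^ 2 := rfl
  have e' := one_sub_hs θ
  have s1 := sin_half_pos hθ
  have c1 := cos_half_pos' hθ
  obtain ⟨a1, a2⟩ := rpow_mem_of_half_le (half_le_of_quarter_le_sq s1 (by linarith))
    (Real.sin_le_one _) (α + 1 / 2)
  obtain ⟨b1, b2⟩ := rpow_mem_of_half_le (half_le_of_quarter_le_sq c1 (by linarith))
    (Real.cos_le_one _) (β + 1 / 2)
  rw [psi, abs_of_pos s1]
  constructor <;> gcongr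

theorem midSet_mono {δ ε : ℝ} (h : δ ≤ ε) : midSet δ ⊆ midSet ε :=
  fun _ hθ => lt_of_lt_of_le hθ h

theorem neg_mem_midSet_iff {δ θ : ℝ} : -θ ∈ midSet δ ↔ θ ∈ midSet δ := by
  simp only [midSet, Set.mem_ofPred_eq, hs_neg]

theorem indicator_midSet_neg (δ θ : ℝ) :
    (midSet δ).indicator (1 : ℝ → ℝ) (-θ) = (midSet δ).indicator 1 θ := by
  by_cases h : θ ∈ midSet δ
  · rw [indicator_of_mem h, indicator_of_mem (neg_mem_midSet_iff.mpr h)]; rfl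
  · rw [indicator_of_notMem h, indicator_of_notMem fun h' => h (neg_mem_midSet_iff.mp h')]

/-- Shows that the middle sets are comparable with intervals around `π/2`, hence have measure of
order `δ`. -/
theorem abs_hs_sub_half (θ : ℝ) : |hs θ - 1 / 2| = |Real.sin (Real.pi / 2 - θ)| / 2 := by
  rw [Real.sin_pi_div_two_sub, cos_eq_hs, ← abs_two (α := ℝ), ← abs_div, abs_two, ← abs_neg]
  congr 1; ring

theorem mu_midSet_le {δ : ℝ} : mu (midSet δ) ≤ ENNReal.ofReal (4 * Real.pi * δ) := by
  rcases le_or_gt δ 0 with h | h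
  · have : midSet δ = ∅ := by
      ext θ
      simp only [midSet, Set.mem_ofPred_eq, mem_empty_iff_false, iff_false, not_lt]
      exact h.trans (abs_nonneg _)
    simp [this]
  have hπ := Real.pi_pos
  have h1 : nu (midSet δ) ≤ ENNReal.ofReal (2 * Real.pi * δ) := by
    rw [Measure.restrict_apply (measurableSet_midSet δ)]
    have : midSet δ ∩ Ioo 0 Real.pi ⊆ Ioo (Real.pi / 2 - Real.pi * δ) (Real.pi / 2 + Real.pi * δ) := by
      rintro θ ⟨h1, h2⟩
      have h1' : |hs θ - 1 / 2| < δ := h1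
      rw [abs_hs_sub_half] at h1'
      have h3 : |Real.pi / 2 - θ| ≤ Real.pi / 2 := by
        rw [abs_le]; constructor <;> linarith [h2.1, h2.2]
      have h4 := Real.mul_abs_le_abs_sin h3
      have h5 : |Real.pi / 2 - θ| < Real.pi * δ := by
        have : 2 / Real.pi * |Real.pi / 2 - θ| < 2 * δ := by linarith
        rw [div_mul_eq_mul_div, div_lt_iff₀ hπ] at this
        linarith
      rw [abs_lt] at h5
      constructor <;> linarith [h5.1, h5.2]
    refine (measure_mono this).trans ?_
    rw [Real.volume_Ioo]
    exact ENNReal.ofReal_le_ofReal (by linarith)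
  have h2 : (nu.map (MeasurableEquiv.neg ℝ)) (midSet δ) = nu (midSet δ) := by
    rw [MeasurableEquiv.map_apply]
    congr 1
    ext θ
    exact neg_mem_midSet_iff
  rw [mu_eq, Measure.add_apply, h2]
  refine (add_le_add h1 h1).trans_eq ?_
  rw [← ENNReal.ofReal_add (by positivity) (by positivity)]
  congr 1; ring

theorem le_nu_midSet {δ : ℝ} (h1 : δ ≤ 1) :
    ENNReal.ofReal δ ≤ nu {θ | |hs θ - 1 / 2| ≤ δ / 2} := by
  have hπ := Real.pi_gt_three
  have hm : MeasurableSet {θ | |hs θ - 1 / 2| ≤ δ / 2} :=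
    measurableSet_le (continuous_hs.measurable.sub_const _).abs measurable_const
  rw [Measure.restrict_apply hm]
  have : Ioo (Real.pi / 2 - δ) (Real.pi / 2) ⊆ {θ | |hs θ - 1 / 2| ≤ δ / 2} ∩ Ioo 0 Real.pi := by
    rintro θ ⟨h2, h3⟩
    refine ⟨?_, by linarith, by linarith⟩
    rw [Set.mem_ofPred_eq, abs_hs_sub_half]
    have := Real.abs_sin_le_abs (x := Real.pi / 2 - θ)
    rw [abs_of_pos (by linarith : 0 < Real.pi / 2 - θ)] at this
    linarith
  refine le_trans ?_ (measure_mono this)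
  rw [Real.volume_Ioo]
  exact ENNReal.ofReal_le_ofReal (by linarith)

/-- The product of the weight and `s`, as a complex-valued function. -/
def midFun (α β : ℝ) (s : ℝ → ℝ) (θ : ℝ) : ℂ := ((psi α β θ * s θ : ℝ) : ℂ)

section
variable {s : ℝ → ℝ} {M : ℝ}

theorem exists_norm_midFun_le (α β : ℝ) : ∃ B : ℝ, 0 < B ∧ ∀ s : ℝ → ℝ, (∀ θ, s (-θ) = s θ) →
    (∀ θ, 0 ≤ s θ) → (∀ θ, θ ∉ midSet (1 / 4) → s θ = 0) →
    ∀ᵐ θ ∂mu, ‖midFun α β s θ‖ ≤ B * s θ := by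
  obtain ⟨A, B, hA, hB, H⟩ := exists_psi_mem_of_mid α β
  refine ⟨B, hB, fun s hse hs0 hsm => ?_⟩
  have key : ∀ θ ∈ Ioo 0 Real.pi, ‖midFun α β s θ‖ ≤ B * s θ := by
    intro θ hθ
    have p := psi_pos α β hθ
    rw [midFun, Complex.norm_real, Real.norm_of_nonneg (mul_nonneg p.le (hs0 θ))]
    by_cases hm : θ ∈ midSet (1 / 4)
    · exact mul_le_mul_of_nonneg_right (H θ hθ (le_of_lt hm)).2 (hs0 θ)
    · rw [hsm θ hm]; simp
  rw [ae_mu_iff]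
  filter_upwards [ae_nu_mem] with θ hθ
  refine ⟨key θ hθ, ?_⟩
  have := key θ hθ
  rw [midFun] at this ⊢
  rwa [psi_neg, hse]

theorem memLp_midFun (p : ℝ≥0∞) (hsmeas : Measurable s) (hse : ∀ θ, s (-θ) = s θ)
    (hs0 : ∀ θ, 0 ≤ s θ) (hsM : ∀ θ, s θ ≤ M) (hsm : ∀ θ, θ ∉ midSet (1 / 4) → s θ = 0) :
    MemLp (midFun α β s) p mu := by
  obtain ⟨B, hB, H⟩ := exists_norm_midFun_le α β
  refine MemLp.of_bound ?_ (B * M) ?_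
  · exact (Complex.measurable_ofReal.comp
      ((measurable_psi α β).mul hsmeas)).aestronglyMeasurable
  · filter_upwards [H s hse hs0 hsm] with θ hθ
    exact hθ.trans (mul_le_mul_of_nonneg_left (hsM θ) hB.le)

theorem potOp_midFun_add_neg (hse : ∀ θ, s (-θ) = s θ) {θ : ℝ} (hθ : θ ∈ Ioo 0 Real.pi) :
    potOp c α β σ (midFun α β s) θ + potOp c α β σ (midFun α β s) (-θ) =
      ((2 * ∫ φ, symKer c α β σ θ φ * (psi α β φ * s φ) ∂nu : ℝ) : ℂ) := by
  rw [potOp_add_neg _ hθ]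
  have : (fun φ => midFun α β s φ + midFun α β s (-φ)) = fun φ =>
      (2 : ℂ) * ((psi α β φ * s φ : ℝ) : ℂ) := by
    ext φ
    rw [midFun, midFun, psi_neg, hse]; ring
  rw [this, kerOp_const_mul, kerOp_ofReal]
  push_cast; rfl

end

/-- Test functions `psi * s` supported where `psi` lies between positive constants: the weight
disappears from the norm on the right. -/
theorem ExtendsBounded.exists_integral_symKer_le (hα : -1 < α) (hβ : -1 < β) (hc : 0 ≤ c)
    (hκ : 0 < c + eigenvalue α β 0) (h0 : 0 < σ) (h1 : σ < 1) (hq : 1 ≤ q)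
    (h : ExtendsBounded α β (potSymbol c σ) p q) :
    ∃ C : ℝ≥0∞, C ≠ ∞ ∧ ∀ (s : ℝ → ℝ) (M : ℝ), Measurable s → (∀ θ, s (-θ) = s θ) →
      (∀ θ, 0 ≤ s θ) → (∀ θ, s θ ≤ M) → (∀ θ, θ ∉ midSet (1 / 4) → s θ = 0) →
      eLpNorm (fun θ => ∫ φ, symKer c α β σ θ φ * (psi α β φ * s φ) ∂nu) q nu ≤
        C * eLpNorm s p mu := by
  obtain ⟨C, hC, H⟩ := h.exists_eLpNorm_even_le hα hβ hq
  obtain ⟨B, hB, hBs⟩ := exists_norm_midFun_le α β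
  refine ⟨C * ENNReal.ofReal B, ENNReal.mul_ne_top hC ENNReal.ofReal_ne_top,
    fun s M hsmeas hse hs0 hsM hsm => ?_⟩
  have h2 := memLp_midFun (α := α) (β := β) 2 hsmeas hse hs0 hsM hsm
  have hp := memLp_midFun (α := α) (β := β) p hsmeas hse hs0 hsM hsm
  have e := H _ _ h2 hp (isSpectralImage_potOp hα hβ hc hκ h0 h1 h2)
  have e1 : eLpNorm (midFun α β s) p mu ≤ ENNReal.ofReal B * eLpNorm s p mu := by
    refine eLpNorm_le_mul_eLpNorm_of_ae_le_mul ?_ p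
    filter_upwards [hBs s hse hs0 hsm] with θ hθ
    rwa [Real.norm_of_nonneg (hs0 θ)]
  rw [mul_assoc]
  refine le_trans (eLpNorm_mono_ae ?_) (e.trans (mul_le_mul' le_rfl e1))
  filter_upwards [ae_nu_mem] with θ hθ
  rw [potOp_midFun_add_neg hse hθ, Complex.norm_real, Real.norm_eq_abs, Real.norm_eq_abs, abs_mul,
    abs_two]
  linarith [abs_nonneg (∫ φ, symKer c α β σ θ φ * (psi α β φ * s φ) ∂nu)]

/-- Testing on the middle set of width `δ` gives `δ^{2σ + 1/q} ≤ C δ^{1/p}`, and `δ → 0` compares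
the exponents. The case `q = ∞` is included with `1/q = 0`. -/
theorem ExtendsBounded.toReal_inv_le (hα : -1 < α) (hβ : -1 < β) (hc : 0 ≤ c)
    (hκ : 0 < c + eigenvalue α β 0) (h0 : 0 < σ) (hp : (p⁻¹).toReal < 1) (hq : 1 ≤ q)
    (h : ExtendsBounded α β (potSymbol c σ) p q) :
    (p⁻¹).toReal - 2 * σ ≤ (q⁻¹).toReal := by
  -- For `σ ≥ 1/2` the left side is negative, as `1/p < 1`; this leaves orders below `1`, where the
  -- kernel is available.
  rcases le_or_gt (1 / 2) σ with hσ | hσ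
  · have : 0 ≤ (q⁻¹).toReal := ENNReal.toReal_nonneg
    linarith
  have h1 : σ < 1 := by linarith
  obtain ⟨C, hC, H⟩ := h.exists_integral_symKer_le hα hβ hc hκ h0 h1 hq
  obtain ⟨b, hb, L⟩ := exists_le_integral_potKer_midSet hα hβ hκ h0 h1
  obtain ⟨A, B, hA, hB, hAB⟩ := exists_psi_mem_of_mid α β
  set x := (p⁻¹).toReal with hx
  set y := (q⁻¹).toReal with hy
  have hx0 : 0 ≤ x := ENNReal.toReal_nonneg
  have hy0 : 0 ≤ y := ENNReal.toReal_nonneg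
  have hpx : 1 / p.toReal = x := by rw [hx, ENNReal.toReal_inv, one_div]
  have hqy : 1 / q.toReal = y := by rw [hy, ENNReal.toReal_inv, one_div]
  have key : ∀ δ : ℝ, 0 < δ → δ ≤ 1 / 4 →
      b * δ ^ (2 * σ) * A * δ ^ y ≤ C.toReal * (4 * Real.pi) ^ x * δ ^ x := by
    intro δ hδ hδ1
    have hE : MeasurableSet {θ | |hs θ - 1 / 2| ≤ δ / 2} :=
      measurableSet_le (continuous_hs.measurable.sub_const _).abs measurable_const
    have h2 := H ((midSet δ).indicator 1) 1 (measurable_one.indicator (measurableSet_midSet δ))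
      (indicator_midSet_neg δ)
      (fun θ => indicator_nonneg (fun _ _ => zero_le_one) θ)
      (fun θ => indicator_le_self' (fun _ _ => zero_le_one) θ)
      (fun θ hθ => indicator_of_notMem (fun hm => hθ (midSet_mono hδ1 hm)) _)
    have h3 : eLpNorm ((midSet δ).indicator (1 : ℝ → ℝ)) p mu ≤
        ENNReal.ofReal ((4 * Real.pi * δ) ^ x) := by
      refine (eLpNorm_indicator_const_le (1 : ℝ) p).trans ?_
      rw [hpx, enorm_one, one_mul, ← ENNReal.ofReal_rpow_of_nonneg (by positivity) hx0]
      exact ENNReal.rpow_le_rpow mu_midSet_le hx0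
    have hlow : ENNReal.ofReal δ ≤ nu {θ | |hs θ - 1 / 2| ≤ δ / 2} := le_nu_midSet (by linarith)
    have hne : nu {θ | |hs θ - 1 / 2| ≤ δ / 2} ≠ 0 :=
      ((ENNReal.ofReal_pos.mpr hδ).trans_le hlow).ne'
    have h4 : ENNReal.ofReal (b * δ ^ (2 * σ) * A * δ ^ y) ≤
        eLpNorm (fun θ => ∫ φ, symKer c α β σ θ φ * (psi α β φ * (midSet δ).indicator 1 φ) ∂nu)
          q nu := by
      calc _ ≤ ‖b * δ ^ (2 * σ) * A‖ₑ * nu {θ | |hs θ - 1 / 2| ≤ δ / 2} ^ (1 / q.toReal) := by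
            rw [ENNReal.ofReal_mul (by positivity), ← ENNReal.ofReal_rpow_of_nonneg hδ.le hy0,
              Real.enorm_of_nonneg (by positivity), hqy]
            exact mul_le_mul' le_rfl (ENNReal.rpow_le_rpow hlow hy0)
        _ = eLpNorm ({θ | |hs θ - 1 / 2| ≤ δ / 2}.indicator fun _ => b * δ ^ (2 * σ) * A) q nu :=
            (eLpNorm_indicator_const' hE hne (by positivity)).symm
        _ ≤ _ := by
            refine eLpNorm_mono_ae ?_
            filter_upwards [ae_nu_mem] with θ hθ
            by_cases hm : |hs θ - 1 / 2| ≤ δ / 2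
            · rw [indicator_of_mem (by exact hm), Real.norm_of_nonneg (by positivity)]
              refine le_trans ?_ ((L δ θ hδ (by linarith) hθ hm).trans (le_abs_self _))
              exact mul_le_mul_of_nonneg_left (hAB θ hθ (by linarith)).1 (by positivity)
            · rw [indicator_of_notMem (by exact hm), norm_zero]; exact norm_nonneg _
    have h5 := h4.trans (h2.trans (mul_le_mul' le_rfl h3))
    rw [← ENNReal.ofReal_toReal hC, ← ENNReal.ofReal_mul ENNReal.toReal_nonneg,
      ENNReal.ofReal_le_ofReal_iff (by positivity), Real.mul_rpow (by positivity) hδ.le,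
      ← mul_assoc] at h5
    exact h5
  by_contra hcon
  push Not at hcon
  have hpos : 0 < x - (2 * σ + y) := by linarith
  have hlim : Tendsto (fun δ : ℝ => C.toReal * (4 * Real.pi) ^ x * δ ^ (x - (2 * σ + y)))
      (𝓝[>] 0) (𝓝 0) := by
    have := ((Real.continuousAt_rpow_const 0 (x - (2 * σ + y)) (Or.inr hpos.le)).tendsto.const_mul
      (C.toReal * (4 * Real.pi) ^ x)).mono_left (nhdsWithin_le_nhds (s := Ioi 0))
    rwa [Real.zero_rpow hpos.ne', mul_zero] at this
  have hev : ∀ᶠ δ in 𝓝[>] (0 : ℝ), b * A ≤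
      C.toReal * (4 * Real.pi) ^ x * δ ^ (x - (2 * σ + y)) := by
    filter_upwards [Ioc_mem_nhdsGT (by norm_num : (0 : ℝ) < 1 / 4)] with δ hδ
    have hk := key δ hδ.1 hδ.2
    have hd : 0 < δ ^ (2 * σ + y) := Real.rpow_pos_of_pos hδ.1 _
    have e1 : δ ^ x = δ ^ (x - (2 * σ + y)) * δ ^ (2 * σ + y) := by
      rw [← Real.rpow_add hδ.1]; congr 1; ring
    have e2 : δ ^ (2 * σ + y) = δ ^ (2 * σ) * δ ^ y := Real.rpow_add hδ.1 _ _
    refine le_of_mul_le_mul_right ?_ hd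
    calc _ = b * δ ^ (2 * σ) * A * δ ^ y := by rw [e2]; ring
      _ ≤ _ := hk
      _ = _ := by rw [e1]; ring
  have := ge_of_tendsto hlim hev
  have : 0 < b * A := by positivity
  linarith

end
end SymmJacobi

namespace SymmJacobi
noncomputable section

/-! ### Failure of the end-point estimate into `L^∞` at `1/p = 2σ` -/

variable {c α β σ a u v : ℝ} {m : ℝ → ℝ} {p q : ℝ≥0∞}

/-- A geometrically growing sum is comparable with its last nonzero term: if `e N = 1`, the entire
sum is at most `r^N · r/(r-1)`, whose power is matched by the `N`-th term on the right alone. -/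
theorem rpow_sum_geom_mul_le {r P : ℝ} (hr : 1 < r) (hP : 0 < P) {e : ℕ → ℝ}
    (he : ∀ j, e j = 0 ∨ e j = 1) (N : ℕ) :
    (∑ j ∈ Finset.range N, r ^ j * e j) ^ P ≤
      (r / (r - 1)) ^ P * ∑ j ∈ Finset.range N, (r ^ P) ^ j * e j := by
  have hr0 : 0 < r := by linarith
  have hr1 : 0 < r - 1 := by linarith
  have he0 : ∀ j, 0 ≤ e j := fun j => by rcases he j with h | h <;> simp [h]
  have he1 : ∀ j, e j ≤ 1 := fun j => by rcases he j with h | h <;> simp [h]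
  have hP0 : 0 < r ^ P := Real.rpow_pos_of_pos hr0 _
  induction N with
  | zero => simp [Real.zero_rpow hP.ne']
  | succ N ih =>
    rcases he N with h | h
    · rw [Finset.sum_range_succ, Finset.sum_range_succ, h]; simpa using ih
    · have h1 : ∑ j ∈ Finset.range (N + 1), r ^ j * e j ≤ r ^ N * (r / (r - 1)) := by
        calc _ ≤ ∑ j ∈ Finset.range (N + 1), r ^ j := Finset.sum_le_sum fun j _ =>
              mul_le_of_le_one_right (by positivity) (he1 j)
          _ = (r ^ (N + 1) - 1) / (r - 1) := geom_sum_eq hr.ne' _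
          _ ≤ r ^ (N + 1) / (r - 1) := by gcongr; linarith
          _ = _ := by rw [pow_succ]; ring
      have h2 : (r ^ N * (r / (r - 1))) ^ P = (r / (r - 1)) ^ P * (r ^ P) ^ N := by
        rw [Real.mul_rpow (by positivity) (by positivity), mul_comm, ← Real.rpow_natCast,
          ← Real.rpow_mul hr0.le, mul_comm (N : ℝ), Real.rpow_mul hr0.le, Real.rpow_natCast]
      refine (Real.rpow_le_rpow (Finset.sum_nonneg fun j _ => mul_nonneg (by positivity) (he0 j))
        h1 hP.le).trans ?_
      rw [h2]
      refine mul_le_mul_of_nonneg_left ?_ (by positivity)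
      rw [Finset.sum_range_succ, h, mul_one]
      have : 0 ≤ ∑ j ∈ Finset.range N, (r ^ P) ^ j * e j :=
        Finset.sum_nonneg fun j _ => mul_nonneg (by positivity) (he0 j)
      linarith

/-- A truncated dyadic sum approximating `|θ - π/2|^{-u}`. -/
def dyadicFun (u : ℝ) (N : ℕ) (θ : ℝ) : ℝ :=
  ∑ j ∈ Finset.range N, ((2 : ℝ) ^ u) ^ j * (midSet (1 / 4 * (1 / 2) ^ j)).indicator 1 θ

theorem measurable_dyadicFun (u : ℝ) (N : ℕ) : Measurable (dyadicFun u N) :=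
  Finset.measurable_fun_sum _ fun _ _ =>
    (measurable_one.indicator (measurableSet_midSet _)).const_mul _

theorem indicator_one_eq_zero_or {A : Set ℝ} (θ : ℝ) :
    A.indicator (1 : ℝ → ℝ) θ = 0 ∨ A.indicator (1 : ℝ → ℝ) θ = 1 := by
  by_cases h : θ ∈ A <;> simp [h]

theorem dyadicFun_nonneg (u : ℝ) (N : ℕ) (θ : ℝ) : 0 ≤ dyadicFun u N θ :=
  Finset.sum_nonneg fun j _ => mul_nonneg (by positivity)
    (indicator_nonneg (fun _ _ => zero_le_one) θ)

/-- The integrated power receives about `2^j · 2^{-j}` from the `j`-th layer, so `N` layers give `N`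
in all and the norm grows like `N^u`. -/
theorem eLpNorm_dyadicFun_le (hu : 0 < u) : ∃ K : ℝ, 0 < K ∧ ∀ N : ℕ,
    eLpNorm (dyadicFun u N) (expo u) mu ≤ ENNReal.ofReal ((K * N) ^ u) := by
  have hr : 1 < (2 : ℝ) ^ u := Real.one_lt_rpow one_lt_two hu
  have hr1 : 0 < (2 : ℝ) ^ u - 1 := by linarith
  have hP : 0 < 1 / u := by positivity
  have hrP : ((2 : ℝ) ^ u) ^ (1 / u) = 2 := by
    rw [← Real.rpow_mul zero_le_two, mul_one_div_cancel hu.ne', Real.rpow_one]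
  set k := ((2 : ℝ) ^ u / (2 ^ u - 1)) ^ (1 / u) with hk
  have hk0 : 0 < k := by positivity
  refine ⟨k * Real.pi, by positivity, fun N => ?_⟩
  rw [eLpNorm_expo hu, ← ENNReal.ofReal_rpow_of_nonneg (by positivity) hu.le]
  refine ENNReal.rpow_le_rpow ?_ hu.le
  have hind : ∀ j : ℕ, Measurable fun θ => ENNReal.ofReal (k * 2 ^ j) *
      (midSet (1 / 4 * (1 / 2) ^ j)).indicator (1 : ℝ → ℝ≥0∞) θ := fun j =>
    (measurable_one.indicator (measurableSet_midSet _)).const_mul _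
  calc ∫⁻ θ, ‖dyadicFun u N θ‖ₑ ^ (1 / u) ∂mu
      ≤ ∫⁻ θ, ∑ j ∈ Finset.range N, ENNReal.ofReal (k * 2 ^ j) *
          (midSet (1 / 4 * (1 / 2) ^ j)).indicator (1 : ℝ → ℝ≥0∞) θ ∂mu := by
        refine lintegral_mono fun θ => ?_
        have h1 := rpow_sum_geom_mul_le hr hP
          (e := fun j : ℕ => (midSet (1 / 4 * (1 / 2) ^ j)).indicator (1 : ℝ → ℝ) θ)
          (fun j => indicator_one_eq_zero_or θ) N
        rw [hrP, ← hk, Finset.mul_sum] at h1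
        simp only []
        rw [Real.enorm_of_nonneg (dyadicFun_nonneg u N θ),
          ENNReal.ofReal_rpow_of_nonneg (dyadicFun_nonneg u N θ) hP.le]
        refine (ENNReal.ofReal_le_ofReal h1).trans_eq ?_
        rw [ENNReal.ofReal_sum_of_nonneg fun j _ => mul_nonneg hk0.le (mul_nonneg (by positivity)
          (indicator_nonneg (f := (1 : ℝ → ℝ)) (fun _ _ => zero_le_one) θ))]
        refine Finset.sum_congr rfl fun j _ => ?_
        rw [← mul_assoc, ENNReal.ofReal_mul (by positivity)]
        congr 1
        by_cases h : θ ∈ midSet (1 / 4 * (1 / 2) ^ j)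
        · rw [indicator_of_mem h, indicator_of_mem h]; simp
        · rw [indicator_of_notMem h, indicator_of_notMem h]; simp
    _ = ∑ j ∈ Finset.range N, ENNReal.ofReal (k * 2 ^ j) * mu (midSet (1 / 4 * (1 / 2) ^ j)) := by
        rw [lintegral_finsetSum _ fun j _ => hind j]
        refine Finset.sum_congr rfl fun j _ => ?_
        rw [lintegral_const_mul' _ _ ENNReal.ofReal_ne_top, lintegral_indicator_one
          (measurableSet_midSet _)]
    _ ≤ ∑ _j ∈ Finset.range N, ENNReal.ofReal (k * Real.pi) := by
        refine Finset.sum_le_sum fun j _ => (mul_le_mul' le_rfl mu_midSet_le).trans_eq ?_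
        rw [← ENNReal.ofReal_mul (by positivity)]
        congr 1
        have : (2 : ℝ) ^ j * (1 / 2) ^ j = 1 := by rw [← mul_pow]; norm_num
        calc _ = k * Real.pi * ((2 : ℝ) ^ j * (1 / 2) ^ j) := by ring
          _ = _ := by rw [this, mul_one]
    _ = _ := by
        rw [Finset.sum_const, Finset.card_range, nsmul_eq_mul, ← ENNReal.ofReal_natCast,
          ← ENNReal.ofReal_mul (by positivity), mul_comm]

/-- With height exponent `2σ`, the layer of width `2^{-j}/4` has a potential bounded below by the
same constant for every `j < N`, near `π/2`. -/
theorem exists_mul_le_integral_dyadicFun (hα : -1 < α) (hβ : -1 < β)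
    (hκ : 0 < c + eigenvalue α β 0) (h0 : 0 < σ) (h1 : σ < 1) :
    ∃ b : ℝ, 0 < b ∧ ∀ N : ℕ, ∀ θ ∈ Ioo 0 Real.pi, |hs θ - 1 / 2| ≤ 1 / 4 * (1 / 2) ^ N / 2 →
      b * N ≤ ∫ φ, symKer c α β σ θ φ * (psi α β φ * dyadicFun (2 * σ) N φ) ∂nu := by
  obtain ⟨b, hb, L⟩ := exists_le_integral_potKer_midSet hα hβ hκ h0 h1
  obtain ⟨A, B, hA, hB, hAB⟩ := exists_psi_mem_of_mid α β
  refine ⟨b * (1 / 4) ^ (2 * σ) * A, by positivity, fun N θ hθ hm => ?_⟩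
  have hint : ∀ j : ℕ, Integrable (fun φ => symKer c α β σ θ φ *
      (psi α β φ * (midSet (1 / 4 * (1 / 2) ^ j)).indicator 1 φ)) nu := fun j =>
    (integral_potKer_eq (M := 1)
      (g := fun φ => psi α β φ * (midSet (1 / 4 * (1 / 2) ^ j)).indicator 1 φ) hα hβ hκ h0 h1
      ((measurable_psi α β).mul (measurable_one.indicator (measurableSet_midSet _)))
      (fun t ht => by
        have := psi_pos α β ht
        rcases indicator_one_eq_zero_or (A := midSet (1 / 4 * (1 / 2) ^ j)) t with h | h <;>
          simp only [h]
        · simpa using this.le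
        · rw [mul_one, one_mul, abs_of_pos this]) hθ).1
  have e : ∀ φ, symKer c α β σ θ φ * (psi α β φ * dyadicFun (2 * σ) N φ) =
      ∑ j ∈ Finset.range N, ((2 : ℝ) ^ (2 * σ)) ^ j * (symKer c α β σ θ φ *
        (psi α β φ * (midSet (1 / 4 * (1 / 2) ^ j)).indicator 1 φ)) := fun φ => by
    rw [dyadicFun, Finset.mul_sum, Finset.mul_sum]
    exact Finset.sum_congr rfl fun j _ => by ring
  simp only [e]
  rw [integral_finsetSum _ fun j _ => (hint j).const_mul _]
  calc _ = ∑ _j ∈ Finset.range N, b * (1 / 4) ^ (2 * σ) * A := by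
        rw [Finset.sum_const, Finset.card_range, nsmul_eq_mul, mul_comm]
    _ ≤ _ := by
        refine Finset.sum_le_sum fun j hj => ?_
        have hjN : (1 / 2 : ℝ) ^ N ≤ (1 / 2) ^ j :=
          pow_le_pow_of_le_one (by norm_num) (by norm_num) (Finset.mem_range.mp hj).le
        have hj1 : (1 / 2 : ℝ) ^ j ≤ 1 := pow_le_one₀ (by norm_num) (by norm_num)
        have hj0 : (0 : ℝ) < (1 / 2) ^ j := by positivity
        have l := L (1 / 4 * (1 / 2) ^ j) θ (by positivity) (by linarith) hθ (by linarith)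
        rw [integral_const_mul]
        have hp : ((2 : ℝ) ^ (2 * σ)) ^ j * ((1 / 2) ^ j) ^ (2 * σ) = 1 := by
          rw [Real.rpow_pow_comm zero_le_two, ← Real.mul_rpow (by positivity) (by positivity),
            ← mul_pow]
          norm_num
        calc b * (1 / 4) ^ (2 * σ) * A
            = ((2 : ℝ) ^ (2 * σ)) ^ j * ((1 / 2) ^ j) ^ (2 * σ) * (b * (1 / 4) ^ (2 * σ) * A) := by
              rw [hp, one_mul]
          _ = ((2 : ℝ) ^ (2 * σ)) ^ j * (b * (1 / 4 * (1 / 2) ^ j) ^ (2 * σ) * A) := by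
              rw [Real.mul_rpow (by norm_num) hj0.le]; ring
          _ ≤ ((2 : ℝ) ^ (2 * σ)) ^ j * (b * (1 / 4 * (1 / 2) ^ j) ^ (2 * σ) * psi α β θ) := by
              gcongr
              exact (hAB θ hθ (by linarith)).1
          _ ≤ _ := mul_le_mul_of_nonneg_left l (by positivity)

/-- Boundedness would give `b N ≤ C (K N)^{2σ}` for all `N`, which is impossible since `2σ = 1/p <
1`. -/
theorem ExtendsBounded.toReal_inv_ne (hα : -1 < α) (hβ : -1 < β) (hc : 0 ≤ c)
    (hκ : 0 < c + eigenvalue α β 0) (h0 : 0 < σ) (hp : (p⁻¹).toReal < 1)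
    (h : ExtendsBounded α β (potSymbol c σ) p ∞) : (p⁻¹).toReal ≠ 2 * σ := by
  intro hpσ
  have h1 : σ < 1 := by linarith
  have hu : 0 < 2 * σ := by linarith
  have hpe : p = expo (2 * σ) := by
    have : p⁻¹ ≠ ∞ := fun ht => by rw [ht, ENNReal.toReal_top] at hpσ; linarith
    rw [← inv_inv p, ← ENNReal.ofReal_toReal this, hpσ, expo, one_div,
      ENNReal.ofReal_inv_of_pos hu]
  rw [hpe] at h
  obtain ⟨C, hC, H⟩ := h.exists_integral_symKer_le hα hβ hc hκ h0 h1 le_top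
  obtain ⟨K, hK, hKN⟩ := eLpNorm_dyadicFun_le hu
  obtain ⟨b, hb, L⟩ := exists_mul_le_integral_dyadicFun hα hβ hκ h0 h1
  have key : ∀ N : ℕ, b * N ≤ C.toReal * (K * N) ^ (2 * σ) := by
    intro N
    have h2 := (H (dyadicFun (2 * σ) N) (∑ j ∈ Finset.range N, ((2 : ℝ) ^ (2 * σ)) ^ j)
      (measurable_dyadicFun _ _)
      (fun θ => by simp only [dyadicFun, indicator_midSet_neg])
      (dyadicFun_nonneg _ _)
      (fun θ => Finset.sum_le_sum fun j _ => mul_le_of_le_one_right (by positivity)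
        (indicator_le_self' (fun _ _ => zero_le_one) θ))
      (fun θ hθ => Finset.sum_eq_zero fun j _ => by
        rw [indicator_of_notMem fun hm => hθ (midSet_mono (mul_le_of_le_one_right (by norm_num)
          (pow_le_one₀ (by norm_num) (by norm_num))) hm), mul_zero])).trans
      (mul_le_mul' le_rfl (hKN N))
    set δ : ℝ := 1 / 4 * (1 / 2) ^ N with hδ
    have hδ0 : 0 < δ := by positivity
    have hδ1 : δ ≤ 1 := by
      have : (1 / 2 : ℝ) ^ N ≤ 1 := pow_le_one₀ (by norm_num) (by norm_num)
      rw [hδ]; linarith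
    have hE : MeasurableSet {θ | |hs θ - 1 / 2| ≤ δ / 2} :=
      measurableSet_le (continuous_hs.measurable.sub_const _).abs measurable_const
    have hne : nu {θ | |hs θ - 1 / 2| ≤ δ / 2} ≠ 0 :=
      ((ENNReal.ofReal_pos.mpr hδ0).trans_le (le_nu_midSet hδ1)).ne'
    have h4 : ENNReal.ofReal (b * N) ≤ eLpNorm (fun θ => ∫ φ, symKer c α β σ θ φ *
        (psi α β φ * dyadicFun (2 * σ) N φ) ∂nu) ∞ nu := by
      calc _ = eLpNorm ({θ | |hs θ - 1 / 2| ≤ δ / 2}.indicator fun _ => b * N) ∞ nu := by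
            rw [eLpNorm_indicator_const' hE hne (by simp), Real.enorm_of_nonneg (by positivity)]
            simp
        _ ≤ _ := by
            refine eLpNorm_mono_ae ?_
            filter_upwards [ae_nu_mem] with θ hθ
            by_cases hm : |hs θ - 1 / 2| ≤ δ / 2
            · rw [indicator_of_mem (by exact hm), Real.norm_of_nonneg (by positivity)]
              exact (L N θ hθ hm).trans (le_abs_self _)
            · rw [indicator_of_notMem (by exact hm), norm_zero]; exact norm_nonneg _
    have h5 := h4.trans h2
    rwa [← ENNReal.ofReal_toReal hC, ← ENNReal.ofReal_mul ENNReal.toReal_nonneg,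
      ENNReal.ofReal_le_ofReal_iff (by positivity)] at h5
  have hlim : Tendsto (fun N : ℕ => (N : ℝ) ^ (1 - 2 * σ)) atTop atTop :=
    (tendsto_rpow_atTop (by linarith)).comp tendsto_natCast_atTop_atTop
  obtain ⟨N, hN, hN1⟩ := ((hlim.eventually_gt_atTop (C.toReal * K ^ (2 * σ) / b)).and
    (eventually_gt_atTop 0)).exists
  have hN0 : (0 : ℝ) < N := by exact_mod_cast hN1
  have hk := key N
  rw [Real.mul_rpow hK.le hN0.le] at hk
  rw [div_lt_iff₀ hb, Real.rpow_sub hN0, Real.rpow_one, div_mul_eq_mul_div,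
    lt_div_iff₀ (by positivity)] at hN
  linarith

end
end SymmJacobi

namespace SymmJacobi
noncomputable section

/-! ### Necessity of `α, β ≥ -1/2` for `L^∞` bounds, and the final equivalences -/

variable {c α β σ τ : ℝ} {p q : ℝ≥0∞}

theorem ae_integrable_symKer (hα : -1 < α) (hβ : -1 < β) (hc : 0 ≤ c)
    (hκ : 0 < c + eigenvalue α β 0) (h0 : 0 < σ) (h1 : σ < 1) {f : ℝ → ℂ} (hf : MemLp f 2 mu) :
    ∀ᵐ θ ∂nu, Integrable (fun φ => (symKer c α β σ θ φ : ℂ) * (f φ + f (-φ))) nu := by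
  have hs := sing_lt hα hβ
  obtain ⟨v, hv, hv'⟩ : ∃ v, max (sing α β) (1 / 2 - 2 * σ) < v ∧ v < 1 / 2 :=
    exists_between (max_lt hs (by linarith))
  obtain ⟨C, hC, H⟩ := potOp_bound hα hβ hc hκ h0 h1 (sing_nonneg α β) (le_sing_left α β)
    (le_sing_right α β) ((le_max_left _ _).trans_lt hv) hv' (by linarith)
    (by linarith [(le_max_right _ _).trans_lt hv])
  rw [expo_half] at H
  exact (H f hf).2.2.2.1

theorem integral_psi_midSet_pos (hα : -1 < α) (hβ : -1 < β) :
    Integrable (fun φ => psi α β φ * (psi α β φ * (midSet (1 / 4)).indicator 1 φ)) nu ∧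
    0 < ∫ φ, psi α β φ * (psi α β φ * (midSet (1 / 4)).indicator 1 φ) ∂nu := by
  have hi : Integrable (fun φ => psi α β φ * (psi α β φ * (midSet (1 / 4)).indicator 1 φ)) nu := by
    refine ((integrableOn_psi_sq hα hβ).indicator (measurableSet_midSet (1 / 4))).congr
      (Eventually.of_forall fun φ => ?_)
    by_cases h : φ ∈ midSet (1 / 4)
    · simp only [indicator_of_mem h, Pi.one_apply]; ring
    · simp only [indicator_of_notMem h, mul_zero]
  refine ⟨hi, ?_⟩
  rw [integral_pos_iff_support_of_nonneg_ae ?_ hi]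
  · refine ((ENNReal.ofReal_pos.mpr (by norm_num : (0 : ℝ) < 1 / 4)).trans_le
      (le_nu_midSet (by norm_num))).trans_le (measure_mono_ae ?_)
    filter_upwards [ae_nu_mem] with φ hφ hm
    have hm' : |hs φ - 1 / 2| ≤ 1 / 4 / 2 := hm
    have h : φ ∈ midSet (1 / 4) := by
      change |hs φ - 1 / 2| < 1 / 4
      linarith
    have := psi_pos α β hφ
    change psi α β φ * (psi α β φ * (midSet (1 / 4)).indicator 1 φ) ≠ 0
    rw [indicator_of_mem h, Pi.one_apply]
    positivity
  · filter_upwards [ae_nu_mem] with φ hφ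
    have := psi_pos α β hφ
    exact mul_nonneg this.le (mul_nonneg this.le (indicator_nonneg (fun _ _ => zero_le_one) φ))

/-- The potential operators improve a lower bound near `π/2` to a global one. -/
theorem exists_mul_psi_le_potOp (hα : -1 < α) (hβ : -1 < β) (hc : 0 ≤ c)
    (hκ : 0 < c + eigenvalue α β 0) (h0 : 0 < σ) (h1 : σ < 1) {g : ℝ → ℂ} (hg : MemLp g 2 mu)
    {b : ℝ} (hb : 0 < b) (h : ∀ᵐ θ ∂nu, ∃ r : ℝ, g θ + g (-θ) = r ∧
      b * (psi α β θ * (midSet (1 / 4)).indicator 1 θ) ≤ r) :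
    ∃ b' : ℝ, 0 < b' ∧ ∀ᵐ θ ∂nu, ∃ r : ℝ,
      potOp c α β σ g θ + potOp c α β σ g (-θ) = r ∧ b' * psi α β θ ≤ r := by
  obtain ⟨A, hA, HA⟩ := exists_le_potKer hα hβ hκ h0 h1
  obtain ⟨hi, hpos⟩ := integral_psi_midSet_pos hα hβ
  set I := ∫ φ, psi α β φ * (psi α β φ * (midSet (1 / 4)).indicator 1 φ) ∂nu
  refine ⟨b * A * I, by positivity, ?_⟩
  filter_upwards [ae_integrable_symKer hα hβ hc hκ h0 h1 hg, ae_nu_mem] with θ hint hθ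
  have hne : ∀ᵐ φ ∂nu, φ ≠ θ := by
    rw [ae_iff]; simp only [ne_eq, not_not]; exact restrict_singleton_eq_zero _ θ
  refine ⟨∫ φ, symKer c α β σ θ φ * (g φ + g (-φ)).re ∂nu, ?_, ?_⟩
  · rw [potOp_add_neg _ hθ, ← kerOp_ofReal]
    refine kerOp_congr ?_ θ
    filter_upwards [h] with φ hφ
    obtain ⟨r, hr, -⟩ := hφ
    rw [hr, Complex.ofReal_re]
  · have hre : Integrable (fun φ => symKer c α β σ θ φ * (g φ + g (-φ)).re) nu := by
      refine hint.re.congr (Eventually.of_forall fun φ => ?_)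
      exact Complex.re_ofReal_mul _ _
    have e : b * A * I * psi α β θ = ∫ φ, b * A * psi α β θ *
        (psi α β φ * (psi α β φ * (midSet (1 / 4)).indicator 1 φ)) ∂nu := by
      rw [integral_const_mul]; ring
    rw [e]
    refine integral_mono_ae (hi.const_mul _) hre ?_
    filter_upwards [h, ae_nu_mem, hne] with φ hφ hφI hφθ
    obtain ⟨r, hr, hr2⟩ := hφ
    have p1 := psi_pos α β hθ
    have p2 := psi_pos α β hφI
    have hk : A * (psi α β θ * psi α β φ) ≤ symKer c α β σ θ φ := HA θ hθ φ hφI hφθ.symm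
    have hn : 0 ≤ b * (psi α β φ * (midSet (1 / 4)).indicator 1 φ) :=
      mul_nonneg hb.le (mul_nonneg p2.le (indicator_nonneg (fun _ _ => zero_le_one) φ))
    rw [hr, Complex.ofReal_re]
    calc _ = A * (psi α β θ * psi α β φ) * (b * (psi α β φ * (midSet (1 / 4)).indicator 1 φ)) := by
          ring
      _ ≤ _ := mul_le_mul hk hr2 hn (le_trans (by positivity) hk)

theorem IsSpectralImage.potOp_right (hα : -1 < α) (hβ : -1 < β) (hc : 0 ≤ c)
    (hκ : 0 < c + eigenvalue α β 0) (h0 : 0 < τ) (h1 : τ < 1) {f g : ℝ → ℂ}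
    (h : IsSpectralImage α β (potSymbol c σ) f g) :
    IsSpectralImage α β (potSymbol c (σ + τ)) f (potOp c α β τ g) := by
  have hS := isSpectralImage_potOp hα hβ hc hκ h0 h1 h.1
  refine isSpectralImage_of_coeff hα hβ hS.1 fun n => ?_
  rw [coeff_of_isSpectralImage hα hβ hS, coeff_of_isSpectralImage hα hβ h, ← mul_assoc,
    ← Complex.ofReal_mul, potSymbol, potSymbol, potSymbol, neg_add_rev,
    Real.rpow_add (add_symEigenvalue_pos hα hβ hκ n)]

/-- The lower bound of the kernel by `psi θ * psi φ` survives iteration, so it reaches orders beyond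
the range `0 < τ < 1` of the kernel. -/
theorem exists_isSpectralImage_ge (hα : -1 < α) (hβ : -1 < β) (hc : 0 ≤ c)
    (hκ : 0 < c + eigenvalue α β 0) (h0 : 0 < τ) (h1 : τ < 1) {f : ℝ → ℂ} (hf : MemLp f 2 mu)
    {b : ℝ} (hb : 0 < b) (h : ∀ᵐ θ ∂nu, ∃ r : ℝ, f θ + f (-θ) = r ∧
      b * (psi α β θ * (midSet (1 / 4)).indicator 1 θ) ≤ r) (n : ℕ) :
    ∃ g, IsSpectralImage α β (potSymbol c ((n + 1 : ℕ) * τ)) f g ∧ ∃ b' : ℝ, 0 < b' ∧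
      ∀ᵐ θ ∂nu, ∃ r : ℝ, g θ + g (-θ) = r ∧ b' * psi α β θ ≤ r := by
  induction n with
  | zero =>
    refine ⟨potOp c α β τ f, ?_, exists_mul_psi_le_potOp hα hβ hc hκ h0 h1 hf hb h⟩
    simpa using isSpectralImage_potOp hα hβ hc hκ h0 h1 hf
  | succ n ih =>
    obtain ⟨g, hg, b', hb', H⟩ := ih
    refine ⟨potOp c α β τ g, ?_, exists_mul_psi_le_potOp hα hβ hc hκ h0 h1 hg.1 hb' ?_⟩
    · have := hg.potOp_right hα hβ hc hκ h0 h1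
      convert this using 2
      push_cast; ring
    · filter_upwards [H, ae_nu_mem] with θ hθ hθI
      obtain ⟨r, hr, hr2⟩ := hθ
      refine ⟨r, hr, le_trans (mul_le_mul_of_nonneg_left ?_ hb'.le) hr2⟩
      have := psi_pos α β hθI
      rcases indicator_one_eq_zero_or (A := midSet (1 / 4)) θ with e | e <;> rw [e]
      · simpa using this.le
      · rw [mul_one]

theorem tendsto_psi_zero {α : ℝ} (β : ℝ) (hα : α < -(1 / 2)) :
    Tendsto (psi α β) (𝓝[>] 0) atTop := by
  have h1 : Tendsto (fun θ : ℝ => |Real.sin (θ / 2)|) (𝓝[>] 0) (𝓝[>] 0) := by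
    refine tendsto_nhdsWithin_iff.mpr ⟨?_, ?_⟩
    · have : Continuous fun θ : ℝ => |Real.sin (θ / 2)| := by fun_prop
      simpa using (this.tendsto 0).mono_left (nhdsWithin_le_nhds (s := Ioi 0))
    · filter_upwards [Ioo_mem_nhdsGT Real.pi_pos] with θ hθ
      exact abs_pos.mpr (sin_half_pos hθ).ne'
  have h2 : Tendsto (fun θ : ℝ => Real.cos (θ / 2) ^ (β + 1 / 2)) (𝓝[>] 0) (𝓝 1) := by
    have : ContinuousAt (fun θ : ℝ => Real.cos (θ / 2) ^ (β + 1 / 2)) 0 :=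
      ContinuousAt.rpow_const (by fun_prop) (Or.inl (by simp))
    simpa using this.tendsto.mono_left (nhdsWithin_le_nhds (s := Ioi 0))
  exact ((tendsto_rpow_neg_nhdsGT_zero (by linarith)).comp h1).atTop_mul_pos one_pos h2

theorem not_ae_psi_le {M : ℝ} (h : α < -(1 / 2) ∨ β < -(1 / 2)) : ¬ ∀ᵐ θ ∂nu, psi α β θ ≤ M := by
  intro hM
  have key : ∀ x y : ℝ, 0 ≤ x → x < y → y ≤ Real.pi → ∃ θ ∈ Ioo x y, psi α β θ ≤ M := by
    intro x y hx hxy hy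
    have hsub : Ioo x y ⊆ Ioo 0 Real.pi := Ioo_subset_Ioo hx hy
    have h1 := ae_mono (Measure.restrict_mono_set volume hsub) hM
    have h2 := (ae_restrict_iff' measurableSet_Ioo).mp h1
    by_contra hcon
    push Not at hcon
    have : volume (Ioo x y) = 0 := by
      refine measure_mono_null (fun θ hθ => ?_) (ae_iff.mp h2)
      exact fun h => (hcon θ hθ).not_ge (h hθ)
    rw [Real.volume_Ioo, ENNReal.ofReal_eq_zero] at this
    linarith
  rcases h with h | h
  · obtain ⟨ε, hε, H⟩ := mem_nhdsGT_iff_exists_Ioo_subset.mp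
      ((tendsto_psi_zero β h).eventually_gt_atTop M)
    have hε' : (0 : ℝ) < ε := hε
    obtain ⟨θ, hθ, h1⟩ := key 0 (min ε Real.pi) le_rfl (lt_min hε' Real.pi_pos) (min_le_right _ _)
    have : M < psi α β θ := H ⟨hθ.1, hθ.2.trans_le (min_le_left _ _)⟩
    linarith
  · obtain ⟨ε, hε, H⟩ := mem_nhdsGT_iff_exists_Ioo_subset.mp
      ((tendsto_psi_zero α h).eventually_gt_atTop M)
    have hε' : (0 : ℝ) < ε := hε
    have h2 := lt_min hε' Real.pi_pos
    obtain ⟨θ, hθ, h1⟩ := key (Real.pi - min ε Real.pi) Real.pi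
      (by linarith [min_le_right ε Real.pi]) (by linarith) le_rfl
    have h3 : M < psi β α (Real.pi - θ) :=
      H ⟨by linarith [hθ.2], by linarith [hθ.1, min_le_left ε Real.pi]⟩
    have h4 : Real.pi - θ ∈ Ioo 0 Real.pi :=
      ⟨by linarith [hθ.2], by linarith [hθ.1, min_le_right ε Real.pi]⟩
    have h5 := psi_reflect α β h4
    rw [sub_sub_cancel] at h5
    linarith

/-- The potential of a bump at `π/2` has an even part dominating a multiple of `psi`. If it is
essentially bounded then so is `psi`, which blows up at `0` or `π` when a parameter is below `-1/2`.
The order is divided by `⌊σ⌋₊ + 1 > σ` to fall below `1`. -/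
theorem ExtendsBounded.neg_half_le (hα : -1 < α) (hβ : -1 < β) (hc : 0 ≤ c)
    (hκ : 0 < c + eigenvalue α β 0) (h0 : 0 < σ) (h : ExtendsBounded α β (potSymbol c σ) p ∞) :
    -(1 / 2) ≤ α ∧ -(1 / 2) ≤ β := by
  obtain ⟨C, hC, H⟩ := h.exists_eLpNorm_even_le hα hβ le_top
  have hn : (0 : ℝ) < (⌊σ⌋₊ + 1 : ℕ) := by positivity
  have hτ1 : σ / (⌊σ⌋₊ + 1 : ℕ) < 1 := by
    rw [div_lt_one hn]; push_cast; exact Nat.lt_floor_add_one σ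
  set s : ℝ → ℝ := (midSet (1 / 4)).indicator 1 with hsdef
  have hmem := fun r : ℝ≥0∞ => memLp_midFun (α := α) (β := β) (s := s) (M := 1) r
    (measurable_one.indicator (measurableSet_midSet _)) (indicator_midSet_neg _)
    (fun θ => indicator_nonneg (fun _ _ => zero_le_one) θ)
    (fun θ => indicator_le_self' (fun _ _ => zero_le_one) θ)
    (fun θ hθ => indicator_of_notMem hθ _)
  obtain ⟨g, hg, b, hb, hbg⟩ := exists_isSpectralImage_ge hα hβ hc hκ (div_pos h0 hn) hτ1 (hmem 2)
    two_pos (Eventually.of_forall fun θ => ⟨2 * (psi α β θ * s θ), by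
      rw [midFun, midFun, psi_neg, hsdef, indicator_midSet_neg]; push_cast; ring, le_rfl⟩) ⌊σ⌋₊
  rw [mul_div_cancel₀ _ hn.ne'] at hg
  have hfin := (H _ g (hmem 2) (hmem p) hg).trans_lt (ENNReal.mul_lt_top hC.lt_top (hmem p).2)
  rw [eLpNorm_exponent_top] at hfin
  by_contra hcon
  refine not_ae_psi_le (α := α) (β := β)
    (M := (eLpNormEssSup (fun θ => g θ + g (-θ)) nu).toReal / b) ?_ ?_
  · by_contra hc2
    push Not at hc2
    exact hcon hc2
  · filter_upwards [hbg, ae_le_eLpNormEssSup (μ := nu) (f := fun θ => g θ + g (-θ))] with θ h1 h2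
    obtain ⟨r, hr, hr2⟩ := h1
    rw [le_div_iff₀ hb]
    rw [hr, ← ofReal_norm, Complex.norm_real, Real.norm_eq_abs,
      ENNReal.ofReal_le_iff_le_toReal hfin.ne] at h2
    linarith [le_abs_self r]

theorem extendsBounded_potSymbol_iff (hα : -1 < α) (hβ : -1 < β) (hc : 0 ≤ c)
    (hκ : 0 < c + eigenvalue α β 0) (h0 : 0 < σ) (hp : (critExp α β).conjExponent < p)
    (hq : 1 ≤ q) (hq' : q < critExp α β) :
    ExtendsBounded α β (potSymbol c σ) p q ↔ (p⁻¹).toReal - 2 * σ ≤ (q⁻¹).toReal := by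
  obtain ⟨hp0, hp1⟩ := lt_one_sub_sing hα hβ hp
  have hq0 : q ≠ 0 := (zero_lt_one.trans_le hq).ne'
  exact ⟨fun h => h.toReal_inv_le hα hβ hc hκ h0 (by linarith [sing_nonneg α β]) hq,
    fun h => extendsBounded_potSymbol hα hβ hc hκ h0 hp0 hq0 hp1 (sing_lt_of_lt_critExp hq0 hq') h⟩

theorem extendsBounded_potSymbol_top_iff (hα : -1 < α) (hβ : -1 < β) (hc : 0 ≤ c)
    (hκ : 0 < c + eigenvalue α β 0) (h0 : 0 < σ) (hp : (critExp α β).conjExponent < p) :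
    ExtendsBounded α β (potSymbol c σ) p ∞ ↔
      (-(1 / 2) ≤ α ∧ -(1 / 2) ≤ β) ∧ (p⁻¹).toReal < 2 * σ := by
  obtain ⟨hp0, hp1⟩ := lt_one_sub_sing hα hβ hp
  have hp2 : (p⁻¹).toReal < 1 := by linarith [sing_nonneg α β]
  refine ⟨fun h => ⟨h.neg_half_le hα hβ hc hκ h0, ?_⟩, fun h =>
    extendsBounded_potSymbol_top hα hβ hc hκ (sing_eq_zero_iff.mpr h.1) h0 hp0 hp2 h.2⟩
  have h1 := h.toReal_inv_le hα hβ hc hκ h0 hp2 le_top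
  rw [ENNReal.inv_top, ENNReal.toReal_zero] at h1
  exact lt_of_le_of_ne (by linarith) (h.toReal_inv_ne hα hβ hc hκ h0 hp2)

theorem rieszSymbol_eq (σ : ℝ) : rieszSymbol σ = potSymbol 0 σ := by
  ext t; rw [rieszSymbol, potSymbol, zero_add]

theorem besselSymbol_eq (σ : ℝ) : besselSymbol σ = potSymbol 1 σ := rfl

theorem eigenvalue_zero_pos (h : α + β ≠ -1) : 0 < (0 : ℝ) + eigenvalue α β 0 := by
  have : (α + β + 1) / 2 ≠ 0 := fun h' => h (by linarith)
  rw [eigenvalue, Nat.cast_zero, zero_add, zero_add]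
  positivity

theorem one_add_eigenvalue_pos (α β : ℝ) (n : ℕ) : 0 < 1 + eigenvalue α β n := by
  rw [eigenvalue]; positivity

end
end SymmJacobi

theorem proposition2p1 (α β σ : ℝ) (hα : -1 < α) (hβ : -1 < β) (hσ : 0 < σ)
    (p : ℝ≥0∞) (hp : (SymmJacobi.critExp α β).conjExponent < p) :
    (∀ q : ℝ≥0∞, 1 ≤ q → q < SymmJacobi.critExp α β →
      (α + β ≠ -1 →
        (SymmJacobi.ExtendsBounded α β (SymmJacobi.rieszSymbol σ) p q ↔
          (p⁻¹).toReal - 2 * σ ≤ (q⁻¹).toReal)) ∧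
      (SymmJacobi.ExtendsBounded α β (SymmJacobi.besselSymbol σ) p q ↔
        (p⁻¹).toReal - 2 * σ ≤ (q⁻¹).toReal)) ∧
    (α + β ≠ -1 →
      (SymmJacobi.ExtendsBounded α β (SymmJacobi.rieszSymbol σ) p ∞ ↔
        (-(1 / 2) ≤ α ∧ -(1 / 2) ≤ β) ∧ (p⁻¹).toReal < 2 * σ)) ∧
    (SymmJacobi.ExtendsBounded α β (SymmJacobi.besselSymbol σ) p ∞ ↔
      (-(1 / 2) ≤ α ∧ -(1 / 2) ≤ β) ∧ (p⁻¹).toReal < 2 * σ) := by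
  rw [SymmJacobi.rieszSymbol_eq, SymmJacobi.besselSymbol_eq]
  exact ⟨fun q hq hq' => ⟨fun h => SymmJacobi.extendsBounded_potSymbol_iff hα hβ le_rfl
      (SymmJacobi.eigenvalue_zero_pos h) hσ hp hq hq',
      SymmJacobi.extendsBounded_potSymbol_iff hα hβ zero_le_one
        (SymmJacobi.one_add_eigenvalue_pos α β 0) hσ hp hq hq'⟩,
    fun h => SymmJacobi.extendsBounded_potSymbol_top_iff hα hβ le_rfl
      (SymmJacobi.eigenvalue_zero_pos h) hσ hp,
    SymmJacobi.extendsBounded_potSymbol_top_iff hα hβ zero_le_one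
      (SymmJacobi.one_add_eigenvalue_pos α β 0) hσ hp⟩
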